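/- Let $\lambda<0$, let $S$ be a smooth 3-manifold with boundary $\Sigma=\partial S$, $M=\,]-t_0,t_0[\,\times S$, $\mathcal J=\,]-t_0,t_0[\,\times\partial S$, and identify $S$ with $\{0\}\times S$ and $\Sigma$ with $S\cap\mathcal J$. Consider an AdS-type solution on $M$: a smooth Lorentz metric $g$ of signature $(-,+,+,+)$ and a smooth defining function $\Omega$ of $\mathcal J$ on $M$ (both smooth up to $\mathcal J$) such that $\hat g=\Omega^{-2}g$ satisfies $Ric[\hat g]=\lambda\hat g$ away from $\mathcal J$, the tensor $W^{\mu}{}_{\nu\lambda\rho}=\Omega^{-1}C^{\mu}{}_{\nu\lambda\rho}$ ($C$ the conformal Weyl tensor) extends smoothly to $M$, $S$ is space-like and its normals are tangent to $\mathcal J$ on $\Sigma$. For an orthonormal frame $e_0,\dots,e_3$ put $l=(e_0+e_3)/\sqrt2$, $n=(e_0-e_3)/\sqrt2$, $m=(e_1+ie_2)/\sqrt2$ and let $\psi_0=W(l,m,l,m)$, $\psi_1=W(l,n,l,m)$, $\psi_2=W(l,m,\bar m,n)$, $\psi_3=W(l,n,\bar m,n)$, $\psi_4=W(n,\bar m,n,\bar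 m)$ be the components of the rescaled Weyl spinor $\psi_{ABCD}$. The frame is adapted to $\mathcal J$ if on $\mathcal J$ the vector $e_0$ is future directed and tangent to $\mathcal J$ and $e_3$ is normal to $\mathcal J$ and inward pointing. The solution satisfies the reflecting boundary condition if the Cotton tensor $B_{ab}[k]=\epsilon_a{}^{cd}D_cL_{db}$ of the metric $k$ induced by $g$ on $\mathcal J$ vanishes on $\mathcal J$ (that is, $k$ is conformally flat). (1) If the reflecting boundary condition holds, then $\psi_4=\bar\psi_0$, $\psi_3=\bar\psi_1$ and $\psi_2=\bar\psi_2$ on $\Sigma$, in every frame adapted to $\mathcal J$. (2) Suppose the solution is given in an adapted conformal Gauss gauge: the curves $x=\mathrm{const}$ with parameter $\tau$ (the coordinate on $]-t_0,t_0[$) start orthogonally to $S$ at $\tau=0$ and are, together with a smooth 1-form $b$, conformal geodesics, i.e. with $\dot x=\partial_\tau$, $$\nabla_{\dot x}\dot x=-2\langle b,\dot x\rangle\dot x+g(\dot x,\dot x)b^\sharp,\qquad \nabla_{\dot x}b=\langle b,\dot x\rangle b-\tfrac12|b|^2g(\dot x,\cdot)+L(\dot x,\cdot)$$ ($L$ the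 Schouten tensor of $g$), where $g(\dot x,\dot x)=-1$ and $\partial_\tau\Omega=0$ on $S$; and $e_0=\dot x,e_1,e_2,e_3$ is a smooth local orthonormal frame, adapted to $\mathcal J$, with $\nabla_{\dot x}e_k=-\langle b,e_k\rangle\dot x-\langle b,\dot x\rangle e_k+g(e_k,\dot x)b^\sharp$. Let $(S,\Omega,h_{ab},\chi_{ab})$ be the induced hyperboloidal Cauchy data. Then $W$, and hence $\psi_{ABCD}$, is on $S$ the smooth extension of the field calculated by the Gauss and Codazzi equations from the Cauchy data $\hat h_{ab}=\Omega^{-2}h_{ab}$, $\hat\chi_{ab}=\Omega^{-1}\chi_{ab}$ of $Ric[\hat g]=\lambda\hat g$. Moreover there is a sequence $P_0,P_1,P_2,\dots$ of universal differential polynomials, depending at most on $\lambda$, in $\psi,\bar\psi$ and the components of $h_{ab},\chi_{ab},\Omega$, of the initial values on $S$ of the frame $e_1,e_2,e_3$ and of the tangential part of $b$, in local coordinates $(x^1,x^2,x^3)$ of $S$ with $S=\{x^1\ge0\}$, such that for every such solution and every $k$ $$\partial_\tau^k(\psi_4-\bar\psi_0)=P_k[\text{data}]\quad\text{on }\Sigma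 .$$ Here $P_k$ has the form $$P_k=(e_3^{1})^k\big((-1)^k\partial_{1}^k\psi_4-\partial_{1}^k\bar\psi_0\big)+Q_k,$$ where $e_3^{1}>0$ on $\Sigma$ is the $x^1$-component of $e_3$ and $Q_k$ contains only derivatives of order at most $k$ of the data, and only those derivatives of $\psi,\bar\psi$ with fewer than $k$ differentiations with respect to $x^1$. If the reflecting boundary condition holds, then for all $k=0,1,2,\dots$ $$\partial_\tau^k(\psi_4-\bar\psi_0)=0\quad\text{and}\quad P_k[\text{data}]=0\quad\text{on }\Sigma ,$$ so the data satisfy an infinite sequence of differential conditions on $\Sigma$ which involve derivatives of $\psi_{ABCD}$ of all orders. -/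

import Mathlib

open scoped Manifold ContDiff Topology

noncomputable section

namespace AdS

/-! ## Tensor calculus in coordinates

Tensor fields on a set `D` of coordinate values are given by their components.  Derivatives are
taken within `D`, so that boundary points of half-space charts are included. -/

/-- The partial derivative `∂_μ f` within `D`. -/
def pd {n : ℕ} {V : Type*} [NormedAddCommGroup V] [NormedSpace ℝ V] (D : Set (Fin n → ℝ))
    (μ : Fin n) (f : (Fin n → ℝ) → V) : (Fin n → ℝ) → V :=
  fun x => fderivWithin ℝ f D x (Pi.single μ 1)

section Curvature

variable {n : ℕ} (D : Set (Fin n → ℝ)) (g : (Fin n → ℝ) → Matrix (Fin n) (Fin n) ℝ)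

/-- Christoffel symbols `Γ^i_{jk}` of the metric `g`. -/
def christoffel (i j k : Fin n) : (Fin n → ℝ) → ℝ := fun x =>
  (1 / 2) * ∑ l, (g x)⁻¹ i l *
    (pd D j (fun y => g y l k) x + pd D k (fun y => g y l j) x - pd D l (fun y => g y j k) x)

/-- The curvature tensor `R^i_{jkl}`, with
`R^i_{jkl} = ∂_k Γ^i_{lj} - ∂_l Γ^i_{kj} + Γ^i_{km} Γ^m_{lj} - Γ^i_{lm} Γ^m_{kj}`. -/
def riemann (i j k l : Fin n) : (Fin n → ℝ) → ℝ := fun x =>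
  pd D k (christoffel D g i l j) x - pd D l (christoffel D g i k j) x
    + ∑ m, (christoffel D g i k m x * christoffel D g m l j x
      - christoffel D g i l m x * christoffel D g m k j x)

/-- The curvature tensor with all indices lowered, `R_{ijkl} = g_{im} R^m_{jkl}`. -/
def riemannLow (i j k l : Fin n) : (Fin n → ℝ) → ℝ := fun x =>
  ∑ m, g x i m * riemann D g m j k l x

/-- The Ricci tensor `R_{jl} = R^i_{jil}`. -/
def ricci (j l : Fin n) : (Fin n → ℝ) → ℝ := fun x => ∑ i, riemann D g i j i l x

/-- The Ricci scalar. -/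
def scalarCurv : (Fin n → ℝ) → ℝ := fun x => ∑ i, ∑ j, (g x)⁻¹ i j * ricci D g i j x

/-- The Schouten tensor `L_{jk} = (R_{jk} - R g_{jk} / (2 (n - 1))) / (n - 2)`. -/
def schouten (j k : Fin n) : (Fin n → ℝ) → ℝ := fun x =>
  (1 / ((n : ℝ) - 2)) * (ricci D g j k x - scalarCurv D g x / (2 * ((n : ℝ) - 1)) * g x j k)

/-- The conformal Weyl tensor `C_{ijkl}`, all indices lowered with `g`. -/
def weyl (i j k l : Fin n) : (Fin n → ℝ) → ℝ := fun x =>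
  riemannLow D g i j k l x
    - (g x i k * schouten D g j l x - g x i l * schouten D g j k x
      + g x j l * schouten D g i k x - g x j k * schouten D g i l x)

/-- The covariant derivative `∇_c T_{ab}` of a covariant 2-tensor. -/
def covDeriv (T : Fin n → Fin n → (Fin n → ℝ) → ℝ) (c a b : Fin n) : (Fin n → ℝ) → ℝ := fun x =>
  pd D c (T a b) x
    - ∑ m, (christoffel D g m c a x * T m b x + christoffel D g m c b x * T a m x)

end Curvature

/-- The permutation symbol on three indices, `ε_{012} = 1`. -/
def permSymbol (a b c : Fin 3) : ℝ :=
  (((b : ℕ) : ℝ) - ((a : ℕ) : ℝ)) * (((c : ℕ) : ℝ) - ((a : ℕ) : ℝ))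
    * (((c : ℕ) : ℝ) - ((b : ℕ) : ℝ)) / 2

/-- The Cotton tensor `B_{ab} = ε_a^{cd} D_c L_{db}` of a three-dimensional metric `k`. -/
def cotton (D : Set (Fin 3 → ℝ)) (k : (Fin 3 → ℝ) → Matrix (Fin 3) (Fin 3) ℝ) (a b : Fin 3) :
    (Fin 3 → ℝ) → ℝ := fun y =>
  ∑ a', ∑ c, ∑ d, k y a a' * (permSymbol a' c d / Real.sqrt |(k y).det|)
    * covDeriv D k (schouten D k) c d b y

/-! ## Null frames and the components of the rescaled Weyl spinor -/

/-- The Minkowski metric `diag(-1, 1, 1, 1)`. -/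
def minkowski (i j : Fin 4) : ℝ := if i = j then (if i = 0 then -1 else 1) else 0

/-- Contraction of a real covariant 4-tensor with four complex vectors. -/
def contract (T : Fin 4 → Fin 4 → Fin 4 → Fin 4 → ℝ) (u v w z : Fin 4 → ℂ) : ℂ :=
  ∑ i, ∑ j, ∑ k, ∑ l, (T i j k l : ℂ) * u i * v j * w k * z l

/-- `l = (e₀ + e₃) / √2`. -/
def nullL (E : Fin 4 → Fin 4 → ℝ) : Fin 4 → ℂ := fun μ =>
  ((E 0 μ : ℂ) + (E 3 μ : ℂ)) / (Real.sqrt 2 : ℂ)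

/-- `n = (e₀ - e₃) / √2`. -/
def nullN (E : Fin 4 → Fin 4 → ℝ) : Fin 4 → ℂ := fun μ =>
  ((E 0 μ : ℂ) - (E 3 μ : ℂ)) / (Real.sqrt 2 : ℂ)

/-- `m = (e₁ + i e₂) / √2`. -/
def nullM (E : Fin 4 → Fin 4 → ℝ) : Fin 4 → ℂ := fun μ =>
  ((E 1 μ : ℂ) + Complex.I * (E 2 μ : ℂ)) / (Real.sqrt 2 : ℂ)

/-- `m̄ = (e₁ - i e₂) / √2`. -/
def nullMbar (E : Fin 4 → Fin 4 → ℝ) : Fin 4 → ℂ := fun μ =>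
  ((E 1 μ : ℂ) - Complex.I * (E 2 μ : ℂ)) / (Real.sqrt 2 : ℂ)

/-- The components `ψ₀, …, ψ₄` of the symmetric spinor `ψ_{ABCD}` that corresponds to the Weyl
candidate `T`, in the null frame built from the orthonormal frame `E`. -/
def spinor (T : Fin 4 → Fin 4 → Fin 4 → Fin 4 → ℝ) (E : Fin 4 → Fin 4 → ℝ) : Fin 5 → ℂ :=
  ![contract T (nullL E) (nullM E) (nullL E) (nullM E),
    contract T (nullL E) (nullN E) (nullL E) (nullM E),
    contract T (nullL E) (nullM E) (nullMbar E) (nullN E),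
    contract T (nullL E) (nullN E) (nullMbar E) (nullN E),
    contract T (nullN E) (nullMbar E) (nullN E) (nullMbar E)]

/-! ## Space-times `]-t₀, t₀[ × S` in charts of `S` -/

/-- The coordinates `(τ, x)` of a point (or the components of a vector): `τ` comes first, then the
three coordinates of a half-space chart; the coordinate with index `1` is the half-space coordinate,
which is `≥ 0` and vanishes exactly on the boundary. -/
def spat (z : Fin 4 → ℝ) : EuclideanSpace ℝ (Fin 3) := WithLp.toLp 2 (fun i => z i.succ)

/-- Inclusion of the coordinates `(τ, x², x³)` of the boundary hypersurface `𝒥 = {x¹ = 0}`. -/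
def bdry (y : Fin 3 → ℝ) : Fin 4 → ℝ := Fin.insertNth (α := fun _ => ℝ) 1 0 y

/-- Inclusion of the coordinates of `S` as the hypersurface `τ = 0`. -/
def slice (x : Fin 3 → ℝ) : Fin 4 → ℝ := Fin.cons (α := fun _ => ℝ) 0 x

/-- The tangent space of `ℝ × S` at a point `(t, p)`. -/
abbrev TangentST {S : Type*} [TopologicalSpace S] [ChartedSpace (EuclideanHalfSpace 3) S]
    (p : S) : Type := ℝ × TangentSpace (𝓡∂ 3) p

section Charts

variable {S : Type*} [TopologicalSpace S] [ChartedSpace (EuclideanHalfSpace 3) S]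
  (c : OpenPartialHomeomorph S (EuclideanHalfSpace 3))

/-- The point of `S` with the given chart coordinates. -/
def chartPt (z : Fin 4 → ℝ) : S := (c.extend (𝓡∂ 3)).symm (spat z)

/-- The tangent vector at `(z 0, chartPt c z)` with components `v` in the coordinates `(τ, x)`. -/
def chartVec (z : Fin 4 → ℝ) (v : Fin 4 → ℝ) : TangentST (chartPt c z) :=
  (v 0, mfderivWithin 𝓘(ℝ, EuclideanSpace ℝ (Fin 3)) (𝓡∂ 3) (c.extend (𝓡∂ 3)).symm
    (Set.range (𝓡∂ 3)) (spat z) (spat v))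

/-- The coordinate range of `]-t₀, t₀[ × (domain of c)`. -/
def chartDom (t₀ : ℝ) : Set (Fin 4 → ℝ) :=
  {z | z 0 ∈ Set.Ioo (-t₀) t₀ ∧ spat z ∈ (c.extend (𝓡∂ 3)).target}

end Charts

/-- Charts of the smooth structure of `S`. -/
def IsChart {S : Type*} [TopologicalSpace S] [ChartedSpace (EuclideanHalfSpace 3) S]
    (c : OpenPartialHomeomorph S (EuclideanHalfSpace 3)) : Prop :=
  c ∈ IsManifold.maximalAtlas (𝓡∂ 3) ∞ S

/-- The fields of a conformally extended space-time on `]-t₀, t₀[ × S`: the conformal metric `g`,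
the conformal factor `Ω` and the rescaled Weyl tensor `W` (all indices lowered with `g`). -/
structure ConformalFields (S : Type*) [TopologicalSpace S]
    [ChartedSpace (EuclideanHalfSpace 3) S] where
  /-- half the length of the time interval -/
  t₀ : ℝ
  /-- the conformal factor -/
  Ω : ℝ → S → ℝ
  /-- the conformal metric -/
  g : ∀ (_t : ℝ) (p : S), TangentST p →ₗ[ℝ] TangentST p →ₗ[ℝ] ℝ
  /-- the rescaled conformal Weyl tensor -/
  W : ∀ (_t : ℝ) (p : S),
    TangentST p →ₗ[ℝ] TangentST p →ₗ[ℝ] TangentST p →ₗ[ℝ] TangentST p →ₗ[ℝ] ℝ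

namespace ConformalFields

variable {S : Type*} [TopologicalSpace S] [ChartedSpace (EuclideanHalfSpace 3) S]
  (A : ConformalFields S) (c : OpenPartialHomeomorph S (EuclideanHalfSpace 3))

/-- The coordinate range of the chart `]-t₀, t₀[ × c`. -/
def dom : Set (Fin 4 → ℝ) := chartDom c A.t₀

/-- `Ω` in coordinates. -/
def om (z : Fin 4 → ℝ) : ℝ := A.Ω (z 0) (chartPt c z)

/-- The components `g_{μν}`. -/
def met (z : Fin 4 → ℝ) : Matrix (Fin 4) (Fin 4) ℝ := Matrix.of fun μ ν =>
  A.g (z 0) (chartPt c z) (chartVec c z (Pi.single μ 1)) (chartVec c z (Pi.single ν 1))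

/-- The components `W_{μνλρ}`. -/
def rwe (z : Fin 4 → ℝ) (μ ν l r : Fin 4) : ℝ :=
  A.W (z 0) (chartPt c z) (chartVec c z (Pi.single μ 1)) (chartVec c z (Pi.single ν 1))
    (chartVec c z (Pi.single l 1)) (chartVec c z (Pi.single r 1))

/-- The coordinate range of the boundary `𝒥` in the chart `]-t₀, t₀[ × c`. -/
def bdryDom : Set (Fin 3 → ℝ) := {y | bdry y ∈ A.dom c}

/-- The metric `k` induced on `𝒥`, in the coordinates `(τ, x², x³)`. -/
def bdryMet (y : Fin 3 → ℝ) : Matrix (Fin 3) (Fin 3) ℝ := Matrix.of fun a b =>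
  A.met c (bdry y) (Fin.succAbove 1 a) (Fin.succAbove 1 b)

/-- The reflecting boundary condition: the Cotton tensor `B_{ab}[k]` of the metric induced on `𝒥`
vanishes on `𝒥`. -/
def Reflecting : Prop := ∀ c, IsChart c → ∀ y ∈ A.bdryDom c, ∀ a b,
  cotton (A.bdryDom c) (A.bdryMet c) a b y = 0

end ConformalFields

/-- A smooth conformal extension `(g, Ω)`, with rescaled Weyl tensor `W`, on `]-t₀, t₀[ × S` of an
AdS-type solution `ĝ = Ω⁻² g` of `Ric[ĝ] = lam ĝ`. -/
structure IsAdSType {S : Type*} [TopologicalSpace S] [ChartedSpace (EuclideanHalfSpace 3) S]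
    (lam : ℝ) (A : ConformalFields S) : Prop where
  t₀_pos : 0 < A.t₀
  smooth_om : ∀ c, IsChart c → ContDiffOn ℝ ∞ (A.om c) (A.dom c)
  smooth_met : ∀ c, IsChart c → ∀ μ ν, ContDiffOn ℝ ∞ (fun z => A.met c z μ ν) (A.dom c)
  smooth_rwe : ∀ c, IsChart c → ∀ μ ν l r,
    ContDiffOn ℝ ∞ (fun z => A.rwe c z μ ν l r) (A.dom c)
  /-- `g` is a Lorentz metric of signature `(-, +, +, +)`. -/
  symm : ∀ t ∈ Set.Ioo (-A.t₀) A.t₀, ∀ p u v, A.g t p u v = A.g t p v u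
  lorentz : ∀ t ∈ Set.Ioo (-A.t₀) A.t₀, ∀ p, ∃ E : Module.Basis (Fin 4) ℝ (TangentST p),
    ∀ i j, A.g t p (E i) (E j) = minkowski i j
  /-- `Ω` is a defining function of the boundary `𝒥 = ]-t₀, t₀[ × ∂S`. -/
  om_pos : ∀ c, IsChart c → ∀ z ∈ A.dom c, z 1 ≠ 0 → 0 < A.om c z
  om_zero : ∀ c, IsChart c → ∀ z ∈ A.dom c, z 1 = 0 → A.om c z = 0
  om_deriv : ∀ c, IsChart c → ∀ z ∈ A.dom c, z 1 = 0 → pd (A.dom c) 1 (A.om c) z ≠ 0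
  /-- `Ric[ĝ] = lam ĝ` in the interior. -/
  einstein : ∀ c, IsChart c → ∀ z ∈ A.dom c, z 1 ≠ 0 → ∀ μ ν,
    ricci (A.dom c) (fun w => (A.om c w ^ 2)⁻¹ • A.met c w) μ ν z
      = lam * ((A.om c z ^ 2)⁻¹ * A.met c z μ ν)
  /-- `W` is the smooth extension of `Ω⁻¹ C`. -/
  rescaled_weyl : ∀ c, IsChart c → ∀ z ∈ A.dom c, ∀ μ ν l r,
    A.om c z * A.rwe c z μ ν l r = weyl (A.dom c) (A.met c) μ ν l r z
  /-- The slice `S = {τ = 0}` is space-like. -/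
  spacelike : ∀ p (v : TangentSpace (𝓡∂ 3) p), v ≠ 0 → 0 < A.g 0 p (0, v) (0, v)
  /-- The normals to `S` are tangent to `𝒥` on `Σ = S ∩ 𝒥`. -/
  normal_tangent : ∀ c, IsChart c → ∀ z ∈ A.dom c, z 0 = 0 → z 1 = 0 → ∀ v : Fin 4 → ℝ,
    (∀ ν, ν ≠ 0 → ∑ μ, A.met c z μ ν * v μ = 0) → v 1 = 0

/-- The frame `E` (components in the chart) at the point `z` of `𝒥` is orthonormal, with `e₀ ∝ l + n`
future directed and (being orthogonal to `e₃`) tangent to `𝒥`, and `e₃ ∝ l - n` normal to `𝒥` and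
inward pointing. -/
structure IsBoundaryFrame {S : Type*} [TopologicalSpace S]
    [ChartedSpace (EuclideanHalfSpace 3) S] (A : ConformalFields S)
    (c : OpenPartialHomeomorph S (EuclideanHalfSpace 3)) (z : Fin 4 → ℝ)
    (E : Fin 4 → Fin 4 → ℝ) : Prop where
  orthonormal : ∀ i j, ∑ μ, ∑ ν, A.met c z μ ν * E i μ * E j ν = minkowski i j
  future : 0 < E 0 0
  normal : ∀ ν, ν ≠ 1 → ∑ μ, A.met c z μ ν * E 3 μ = 0
  inward : 0 < E 3 1

/-! ## The adapted conformal Gauss gauge -/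

/-- A 1-form field on `]-t₀, t₀[ × S`. -/
abbrev OneForm (S : Type*) [TopologicalSpace S] [ChartedSpace (EuclideanHalfSpace 3) S] :=
  ∀ (_t : ℝ) (p : S), TangentST p →ₗ[ℝ] ℝ

/-- The components of a 1-form in a chart. -/
def OneForm.comp {S : Type*} [TopologicalSpace S] [ChartedSpace (EuclideanHalfSpace 3) S]
    (b : OneForm S) (c : OpenPartialHomeomorph S (EuclideanHalfSpace 3)) (z : Fin 4 → ℝ)
    (μ : Fin 4) : ℝ := b (z 0) (chartPt c z) (chartVec c z (Pi.single μ 1))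

/-- `|b|²` with respect to the metric matrix `G`. -/
def normSq (G : Matrix (Fin 4) (Fin 4) ℝ) (b : Fin 4 → ℝ) : ℝ := ∑ μ, ∑ ν, G⁻¹ μ ν * b μ * b ν

/-- The propagation law `∇_ẋ X = - ⟨b, X⟩ ẋ - ⟨b, ẋ⟩ X + g(X, ẋ) b^♯` along the curves with tangent
`ẋ = ∂_τ`; for `X = ẋ` this is the first conformal geodesic equation. -/
def IsPropagated {S : Type*} [TopologicalSpace S] [ChartedSpace (EuclideanHalfSpace 3) S]
    (A : ConformalFields S) (b : OneForm S) (c : OpenPartialHomeomorph S (EuclideanHalfSpace 3))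
    (X : (Fin 4 → ℝ) → Fin 4 → ℝ) : Prop :=
  ∀ z ∈ A.dom c, ∀ μ,
    pd (A.dom c) 0 (fun w => X w μ) z + ∑ ν, christoffel (A.dom c) (A.met c) μ 0 ν z * X z ν
      = - (∑ ν, b.comp c z ν * X z ν) * (Pi.single 0 1 : Fin 4 → ℝ) μ
        - b.comp c z 0 * X z μ
        + (∑ ν, A.met c z 0 ν * X z ν) * ∑ ν, (A.met c z)⁻¹ μ ν * b.comp c z ν

/-- The adapted conformal Gauss gauge: the curves `x = const` with parameter `τ`, together with
the 1-form `b`, are conformal geodesics that start orthogonally to `S`; the conformal factor is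
chosen so that `ẋ` is a `g`-unit vector, and so that its normal derivative vanishes on `S`, which
means that the second fundamental forms of `S` are related by `χ = Ω χ̂`. -/
structure IsConformalGauss {S : Type*} [TopologicalSpace S]
    [ChartedSpace (EuclideanHalfSpace 3) S] (A : ConformalFields S) (b : OneForm S) : Prop where
  smooth : ∀ c, IsChart c → ∀ μ, ContDiffOn ℝ ∞ (fun z => b.comp c z μ) (A.dom c)
  unit : ∀ c, IsChart c → ∀ z ∈ A.dom c, A.met c z 0 0 = -1
  orthogonal : ∀ c, IsChart c → ∀ z ∈ A.dom c, z 0 = 0 → ∀ μ, μ ≠ 0 → A.met c z 0 μ = 0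
  geodesic : ∀ c, IsChart c → IsPropagated A b c (fun _ => Pi.single 0 1)
  /-- `∇_ẋ b = ⟨b, ẋ⟩ b - |b|² g(ẋ, ·) / 2 + L(ẋ, ·)` -/
  one_form : ∀ c, IsChart c → ∀ z ∈ A.dom c, ∀ ν,
    pd (A.dom c) 0 (fun w => b.comp c w ν) z
        - ∑ σ, christoffel (A.dom c) (A.met c) σ 0 ν z * b.comp c z σ
      = b.comp c z 0 * b.comp c z ν - (1 / 2) * normSq (A.met c z) (b.comp c z) * A.met c z 0 ν
        + schouten (A.dom c) (A.met c) 0 ν z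
  om_slice : ∀ c, IsChart c → ∀ z ∈ A.dom c, z 0 = 0 → pd (A.dom c) 0 (A.om c) z = 0

/-- A smooth frame field over the chart `c` that belongs to the adapted conformal Gauss gauge:
`e₀ = ẋ = ∂_τ`, the frame is orthonormal, is propagated along the conformal geodesics, and is adapted
to `𝒥` at the points of `𝒥`. -/
structure IsGaugeFrame {S : Type*} [TopologicalSpace S] [ChartedSpace (EuclideanHalfSpace 3) S]
    (A : ConformalFields S) (b : OneForm S) (c : OpenPartialHomeomorph S (EuclideanHalfSpace 3))
    (F : (Fin 4 → ℝ) → Fin 4 → Fin 4 → ℝ) : Prop where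
  smooth : ∀ i μ, ContDiffOn ℝ ∞ (fun z => F z i μ) (A.dom c)
  time : ∀ z ∈ A.dom c, F z 0 = Pi.single 0 1
  orthonormal : ∀ z ∈ A.dom c, ∀ i j,
    ∑ μ, ∑ ν, A.met c z μ ν * F z i μ * F z j ν = minkowski i j
  propagated : ∀ i, IsPropagated A b c (fun z => F z i)
  adapted : ∀ z ∈ A.dom c, z 1 = 0 → IsBoundaryFrame A c z (F z)

/-! ## Cauchy data on `S` -/

/-- The components, in a chart of `S`, of hyperboloidal Cauchy data: the metric `h`, the second
fundamental form `chi`, the conformal factor `om`, the rescaled Weyl tensor `W` on `S`; and of the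
initial data for the gauge: the spatial part `b` of the 1-form and an orthonormal frame
`e₁, e₂, e₃` of `h`. -/
structure LocalData where
  dom : Set (Fin 3 → ℝ)
  h : (Fin 3 → ℝ) → Matrix (Fin 3) (Fin 3) ℝ
  chi : Fin 3 → Fin 3 → (Fin 3 → ℝ) → ℝ
  om : (Fin 3 → ℝ) → ℝ
  W : (Fin 3 → ℝ) → Fin 4 → Fin 4 → Fin 4 → Fin 4 → ℝ
  b : Fin 3 → (Fin 3 → ℝ) → ℝ
  e : Fin 3 → Fin 3 → (Fin 3 → ℝ) → ℝ

namespace LocalData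

variable (d : LocalData)

/-- The frame of the space-time at points of `S`: the unit normal `∂_τ` and `e₁, e₂, e₃`. -/
def frame (x : Fin 3 → ℝ) : Fin 4 → Fin 4 → ℝ :=
  Fin.cons (α := fun _ => Fin 4 → ℝ) (Pi.single 0 1) fun a =>
    Fin.cons (α := fun _ => ℝ) 0 fun α => d.e a α x

/-- The components of the rescaled Weyl spinor on `S`. -/
def psi (B : Fin 5) (x : Fin 3 → ℝ) : ℂ := spinor (d.W x) (d.frame x) B

/-- The physical metric `ĥ = Ω⁻² h`. -/
def hPhys (x : Fin 3 → ℝ) : Matrix (Fin 3) (Fin 3) ℝ := (d.om x ^ 2)⁻¹ • d.h x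

/-- The physical second fundamental form `χ̂ = Ω⁻¹ χ`. -/
def chiPhys (α β : Fin 3) (x : Fin 3 → ℝ) : ℝ := (d.om x)⁻¹ * d.chi α β x

/-- The tangential components `Ĉ_{αβγδ}` (lowered with `ĥ`) of the Weyl tensor of a solution of
`Ric[ĝ] = lam ĝ`, calculated from its Cauchy data by the Gauss equation. -/
def weylPhys (lam : ℝ) (α β γ δ : Fin 3) (x : Fin 3 → ℝ) : ℝ :=
  riemannLow d.dom d.hPhys α β γ δ x
    + d.chiPhys α γ x * d.chiPhys β δ x - d.chiPhys α δ x * d.chiPhys β γ x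
    - lam / 3 * (d.hPhys x α γ * d.hPhys x β δ - d.hPhys x α δ * d.hPhys x β γ)

/-- In the interior of `S` the tensor `W = Ω⁻¹ C` is the one that is calculated by the Gauss and
Codazzi equations from the Cauchy data `ĥ = Ω⁻² h`, `χ̂ = Ω⁻¹ χ` of `Ric[ĝ] = lam ĝ` (so on all of `S`
it is the smooth extension of that tensor).  The index `0` refers to the `g`-unit normal of `S`;
the remaining components follow from the symmetries of the Weyl tensor. -/
structure IsRescaledWeyl (lam : ℝ) : Prop where
  tangential : ∀ x ∈ d.dom, x 0 ≠ 0 → ∀ α β γ δ : Fin 3,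
    d.W x α.succ β.succ γ.succ δ.succ = d.om x * d.weylPhys lam α β γ δ x
  electric : ∀ x ∈ d.dom, x 0 ≠ 0 → ∀ β δ : Fin 3,
    d.W x 0 β.succ 0 δ.succ
      = (d.om x)⁻¹ * ∑ α, ∑ γ, (d.hPhys x)⁻¹ α γ * d.weylPhys lam α β γ δ x
  magnetic : ∀ x ∈ d.dom, x 0 ≠ 0 → ∀ β γ δ : Fin 3,
    d.W x 0 β.succ γ.succ δ.succ
      = covDeriv d.dom d.hPhys d.chiPhys δ γ β x - covDeriv d.dom d.hPhys d.chiPhys γ δ β x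

end LocalData

/-- The data induced on `S = {τ = 0}`, in the chart `c` of `S` and with the frame field `F`.  The
second fundamental form is `χ_{αβ} = g(∇_α ∂_τ, ∂_β)`, where `∂_τ` is the unit normal. -/
def ConformalFields.data {S : Type*} [TopologicalSpace S] [ChartedSpace (EuclideanHalfSpace 3) S]
    (A : ConformalFields S) (b : OneForm S) (c : OpenPartialHomeomorph S (EuclideanHalfSpace 3))
    (F : (Fin 4 → ℝ) → Fin 4 → Fin 4 → ℝ) : LocalData where
  dom := {x | slice x ∈ A.dom c}
  h := fun x => Matrix.of fun α β => A.met c (slice x) α.succ β.succ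
  chi := fun α β x =>
    ∑ μ, A.met c (slice x) β.succ μ * christoffel (A.dom c) (A.met c) μ α.succ 0 (slice x)
  om := fun x => A.om c (slice x)
  W := fun x => A.rwe c (slice x)
  b := fun α x => b.comp c (slice x) α.succ
  e := fun a α x => F (slice x) a.succ α.succ

/-- The components of the rescaled Weyl spinor on the space-time, in the frame field `F`. -/
def ConformalFields.psi {S : Type*} [TopologicalSpace S] [ChartedSpace (EuclideanHalfSpace 3) S]
    (A : ConformalFields S) (c : OpenPartialHomeomorph S (EuclideanHalfSpace 3))
    (F : (Fin 4 → ℝ) → Fin 4 → Fin 4 → ℝ) (B : Fin 5) (z : Fin 4 → ℝ) : ℂ :=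
  spinor (A.rwe c z) (F z) B

/-! ## Differential expressions in the data -/

/-- The component functions of the data other than those of the Weyl spinor. -/
inductive GeoField where
  | h (α β : Fin 3)
  | chi (α β : Fin 3)
  | om
  | b (α : Fin 3)
  | e (a α : Fin 3)

/-- The variables of differential polynomials in the data: the partial derivatives of multi-order
`q` of the component functions.  Here `q 0` is the number of derivatives in the direction of the
half-space coordinate, that is, transverse to `Σ`. -/
inductive JetVar where
  | geo (f : GeoField) (q : Fin 3 → ℕ)
  | psi (B : Fin 5) (q : Fin 3 → ℕ)
  | psiBar (B : Fin 5) (q : Fin 3 → ℕ)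

/-- The derivative of multi-order `q` within `D`. -/
def multiDeriv (D : Set (Fin 3 → ℝ)) (q : Fin 3 → ℕ) (f : (Fin 3 → ℝ) → ℂ) : (Fin 3 → ℝ) → ℂ :=
  (pd D 0)^[q 0] ((pd D 1)^[q 1] ((pd D 2)^[q 2] f))

/-- The component function named by `f`. -/
def LocalData.geo (d : LocalData) : GeoField → (Fin 3 → ℝ) → ℝ
  | .h α β => fun x => d.h x α β
  | .chi α β => d.chi α β
  | .om => d.om
  | .b α => d.b α
  | .e a α => d.e a α

/-- The value at `x` of the variable `v` on the data `d`. -/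
def LocalData.jet (d : LocalData) (x : Fin 3 → ℝ) : JetVar → ℂ
  | .geo f q => multiDeriv d.dom q (fun y => (d.geo f y : ℂ)) x
  | .psi B q => multiDeriv d.dom q (d.psi B) x
  | .psiBar B q => multiDeriv d.dom q (fun y => (starRingEnd ℂ) (d.psi B y)) x

/-- The differential expression given by the polynomial `P`, at the point `x`. -/
def LocalData.eval (d : LocalData) (P : MvPolynomial JetVar ℂ) (x : Fin 3 → ℝ) : ℂ :=
  MvPolynomial.eval (d.jet x) P

/-- The variables allowed in the lower order terms of the condition of order `k`: derivatives of
order at most `k`, and for `ψ` with less than `k` of them transverse to `Σ`. -/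
def JetVar.IsLower (k : ℕ) : JetVar → Prop
  | .geo _ q => ∑ i, q i ≤ k
  | .psi _ q => ∑ i, q i ≤ k ∧ q 0 < k
  | .psiBar _ q => ∑ i, q i ≤ k ∧ q 0 < k

/-- The leading part `ν^k ((-1)^k ∂₀^k ψ₄ - ∂₀^k ψ̄₀)`, where `∂₀` is the derivative transverse to `Σ`
and `ν` the (positive) transverse component of `e₃`. -/
def principalPart (k : ℕ) : MvPolynomial JetVar ℂ :=
  MvPolynomial.X (.geo (.e 2 0) 0) ^ k *
    (MvPolynomial.C ((-1) ^ k) * MvPolynomial.X (.psi 4 (Pi.single 0 k))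
      - MvPolynomial.X (.psiBar 0 (Pi.single 0 k)))

/-- `P` is a differential polynomial that involves derivatives of `ψ` of order `k` and none of
higher order, with the above leading part. -/
def IsConditionOfOrder (k : ℕ) (P : MvPolynomial JetVar ℂ) : Prop :=
  ∀ v ∈ (P - principalPart k).vars, v.IsLower k

end AdS

end

open scoped Manifold ContDiff Topology

namespace AdS

/-! ## Calculus of partial derivatives within a domain -/

/-! All analysis is done in charts: `IsSolution`, `IsGauss` and `GaugeSol` are the coordinate forms
of the hypotheses.

Boundary algebra. In terms of `g` and `Ω` the equation `Ric[ĝ] = λ ĝ` becomes the conformal field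
equations for the Hessian of `Ω`, the scalar `s = fs`, the Schouten tensor `L` and `W` (`hess_eq`,
`om_mul_fs`, `pd_fs`, `cotton_eq`, `div_W`). Each is found in the interior and reaches `𝒥` by
continuity (`hess_om`, `cancel_om`). Where `Ω = 0` they say that `|dΩ|² = -λ/3 > 0` and that the
Hessian of `Ω` is pure trace, so `𝒥` is time-like and umbilic. The Gauss equation then expresses the
Schouten tensor of `k` by the restriction of `L` and by `s² k`. Differentiating this relation, and
using the Cotton equation of `g`, identifies the Cotton tensor of `k` with the part of `W` that has
one normal and three tangential indices. If that part vanishes (`W_boundary`), then `W` at `𝒥` is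
invariant under the reflection `e₃ ↦ -e₃`, which exchanges `l` and `n`; in spinor components this is
`ψ₄ = ψ̄₀`, `ψ₃ = ψ̄₁`, `ψ₂ = ψ̄₂` (`spinor_reflecting`).

Cauchy data. The Weyl tensor is conformally covariant, so `W` on `S` follows from the Gauss and
Codazzi equations of `ĝ`. The gauge condition `∂_τ Ω = 0` makes `χ` the component `Γ̂⁰` of the
connection of `ĝ` (`isRescaledWeyl`).

Universal polynomials. In the conformal Gauss gauge every field (frame, `g`, `b`, `Ω`, `Γ`, `L`,
`s`, `W`) obeys an evolution equation in `τ`, and its value on `S` is a polynomial in the data. A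
simultaneous induction (`FieldsCl.all`) shows that all `τ`-derivatives on `S` are universal
polynomials, with a count of the derivatives that they need. The count is sharp enough because `L(ẋ,
ẋ) = |b|²/2` and because the other components `L(ẋ, ·)` involve only one derivative of the data.

Leading terms. The Bianchi equation `div W = 0` in the frame gives `∂_τ w_{0bcd} = Σ e_a(w_{abcd})`
up to lower order. The real and imaginary parts of `ψ₄` and `ψ̄₀` are combinations of the `w_{0bcd}`
that are multiplied by `ε = ∓1` when the leading index `0` is replaced by `3`. So each satisfies a
transport equation along `e₀ - ε e₃`, up to `e₁`- and `e₂`-derivatives. On `Σ` the vectors `e₁, e₂`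
have no transverse component, hence `∂_τ^k` equals `ε^k (e₃¹)^k ∂₁^k` up to terms with fewer
transverse derivatives of `ψ` (`transport`, `weylComb_transport`, `exists_conditions`).

Vanishing. Under the reflecting condition `ψ₄ - ψ̄₀` vanishes on all of `𝒥`, and `∂_τ` is tangent to
`𝒥`; so all its `τ`-derivatives vanish on `Σ`. -/

/-- A set on which derivatives within the set are unique and symmetric. -/
structure IsRegularDomain {n : ℕ} (D : Set (Fin n → ℝ)) : Prop where
  unique : UniqueDiffOn ℝ D
  dense : D ⊆ closure (interior D)

section Pd

variable {n : ℕ} {D : Set (Fin n → ℝ)} {V : Type*} [NormedAddCommGroup V] [NormedSpace ℝ V]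

theorem pd_congr {f g : (Fin n → ℝ) → V} (h : Set.EqOn f g D) (μ : Fin n) :
    Set.EqOn (pd D μ f) (pd D μ g) D := fun x hx => by
  simp only [pd]
  rw [fderivWithin_congr h (h hx)]

theorem pd_inter {f : (Fin n → ℝ) → V} {U : Set (Fin n → ℝ)} (hU : IsOpen U) {x : Fin n → ℝ}
    (hx : x ∈ U) (μ : Fin n) : pd (D ∩ U) μ f x = pd D μ f x := by
  simp only [pd]
  rw [fderivWithin_inter (hU.mem_nhds hx)]

theorem ContDiffOn.pd {f : (Fin n → ℝ) → V} (hD : IsRegularDomain D) (hf : ContDiffOn ℝ ∞ f D)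
    (μ : Fin n) : ContDiffOn ℝ ∞ (AdS.pd D μ f) D :=
  (hf.fderivWithin hD.unique (m := ∞) (by simp)).clm_apply contDiffOn_const

theorem diffAt {f : (Fin n → ℝ) → V} (hf : ContDiffOn ℝ ∞ f D) {x : Fin n → ℝ} (hx : x ∈ D) :
    DifferentiableWithinAt ℝ f D x :=
  (hf x hx).differentiableWithinAt (by simp)

theorem pd_add (hD : IsRegularDomain D) {f g : (Fin n → ℝ) → V} (hf : ContDiffOn ℝ ∞ f D)
    (hg : ContDiffOn ℝ ∞ g D) {x : Fin n → ℝ} (hx : x ∈ D) (μ : Fin n) :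
    pd D μ (fun y => f y + g y) x = pd D μ f x + pd D μ g x := by
  simp only [pd]
  rw [fderivWithin_fun_add (hD.unique x hx) (diffAt hf hx) (diffAt hg hx)]
  rfl

theorem pd_sub (hD : IsRegularDomain D) {f g : (Fin n → ℝ) → V} (hf : ContDiffOn ℝ ∞ f D)
    (hg : ContDiffOn ℝ ∞ g D) {x : Fin n → ℝ} (hx : x ∈ D) (μ : Fin n) :
    pd D μ (fun y => f y - g y) x = pd D μ f x - pd D μ g x := by
  simp only [pd]
  rw [fderivWithin_fun_sub (hD.unique x hx) (diffAt hf hx) (diffAt hg hx)]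
  rfl

theorem pd_neg (hD : IsRegularDomain D) {f : (Fin n → ℝ) → V} {x : Fin n → ℝ} (hx : x ∈ D)
    (μ : Fin n) : pd D μ (fun y => - f y) x = - pd D μ f x := by
  simp only [pd]
  rw [fderivWithin_fun_neg (hD.unique x hx)]
  rfl

theorem pd_const (c : V) (x : Fin n → ℝ) (μ : Fin n) : pd D μ (fun _ => c) x = 0 := by
  simp [pd]

theorem pd_sum (hD : IsRegularDomain D) {ι : Type*} (s : Finset ι) {f : ι → (Fin n → ℝ) → V}
    (hf : ∀ i, ContDiffOn ℝ ∞ (f i) D) {x : Fin n → ℝ} (hx : x ∈ D) (μ : Fin n) :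
    pd D μ (fun y => ∑ i ∈ s, f i y) x = ∑ i ∈ s, pd D μ (f i) x := by
  simp only [pd]
  rw [fderivWithin_fun_sum (hD.unique x hx) (fun i _ => diffAt (hf i) hx)]
  simp

theorem pd_mul {A : Type*} [NormedCommRing A] [NormedAlgebra ℝ A] (hD : IsRegularDomain D)
    {f g : (Fin n → ℝ) → A} (hf : ContDiffOn ℝ ∞ f D) (hg : ContDiffOn ℝ ∞ g D)
    {x : Fin n → ℝ} (hx : x ∈ D) (μ : Fin n) :
    pd D μ (fun y => f y * g y) x = pd D μ f x * g x + f x * pd D μ g x := by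
  simp only [pd]
  rw [fderivWithin_fun_mul (hD.unique x hx) (diffAt hf hx) (diffAt hg hx)]
  simp [mul_comm, add_comm]

theorem pd_const_mul {A : Type*} [NormedCommRing A] [NormedAlgebra ℝ A] (hD : IsRegularDomain D)
    (c : A) {f : (Fin n → ℝ) → A} (hf : ContDiffOn ℝ ∞ f D) {x : Fin n → ℝ} (hx : x ∈ D)
    (μ : Fin n) : pd D μ (fun y => c * f y) x = c * pd D μ f x := by
  rw [pd_mul hD contDiffOn_const hf hx, pd_const]
  ring

theorem pd_clm {W : Type*} [NormedAddCommGroup W] [NormedSpace ℝ W] (hD : IsRegularDomain D)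
    (T : V →L[ℝ] W) {f : (Fin n → ℝ) → V} (hf : ContDiffOn ℝ ∞ f D) {x : Fin n → ℝ} (hx : x ∈ D)
    (μ : Fin n) : pd D μ (fun y => T (f y)) x = T (pd D μ f x) := by
  have h := T.hasFDerivAt.comp_hasFDerivWithinAt x (diffAt hf hx).hasFDerivWithinAt
  have h' : fderivWithin ℝ (fun y => T (f y)) D x = T.comp (fderivWithin ℝ f D x) :=
    h.fderivWithin (hD.unique x hx)
  simp only [pd, h']
  rfl

theorem two_le_infty : minSmoothness ℝ 2 ≤ (∞ : WithTop ℕ∞) := by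
  rw [minSmoothness_of_isRCLikeNormedField]
  exact WithTop.coe_le_coe.2 (le_top : (2 : ℕ∞) ≤ ⊤)

/-- Every point of `D` is a limit of interior points, so the symmetry of second derivatives persists
at the boundary. This is the purpose of `IsRegularDomain.dense`. -/
theorem pd_comm (hD : IsRegularDomain D) {f : (Fin n → ℝ) → V} (hf : ContDiffOn ℝ ∞ f D)
    {x : Fin n → ℝ} (hx : x ∈ D) (μ ν : Fin n) :
    pd D μ (pd D ν f) x = pd D ν (pd D μ f) x := by
  have hs : IsSymmSndFDerivWithinAt ℝ f D x :=
    (hf x hx).isSymmSndFDerivWithinAt two_le_infty hD.unique (hD.dense hx) hx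
  have hd : DifferentiableWithinAt ℝ (fderivWithin ℝ f D) D x :=
    diffAt (hf.fderivWithin hD.unique (m := ∞) (by simp)) hx
  have key : ∀ a b : Fin n, pd D a (pd D b f) x
      = fderivWithin ℝ (fderivWithin ℝ f D) D x (Pi.single a 1) (Pi.single b 1) := by
    intro a b
    have := fderivWithin_clm_apply (hD.unique x hx) hd
      (differentiableWithinAt_const (c := (Pi.single b 1 : Fin n → ℝ)))
    change fderivWithin ℝ (fun y => (fderivWithin ℝ f D y) (Pi.single b 1)) D x _ = _
    rw [this]
    simp
  rw [key, key, hs]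

theorem pd_zero_of_eqOn {f : (Fin n → ℝ) → V}
    (h : ∀ x ∈ D, f x = 0) {x : Fin n → ℝ} (hx : x ∈ D) (μ : Fin n) : pd D μ f x = 0 := by
  rw [pd_congr (g := fun _ => (0 : V)) h μ hx, pd_const]

end Pd

/-! ### Coordinate hyperplanes and half-spaces -/

section Hyperplane

variable {n : ℕ} (N : Fin (n + 1)) {D : Set (Fin (n + 1) → ℝ)}

/-- The inclusion of the hyperplane on which the coordinate with index `N` vanishes. -/
def hyp (y : Fin n → ℝ) : Fin (n + 1) → ℝ := Fin.insertNth (α := fun _ => ℝ) N 0 y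

/-- The linear map `hyp`. -/
def hypL : (Fin n → ℝ) →ₗ[ℝ] (Fin (n + 1) → ℝ) where
  toFun := hyp N
  map_add' x y := by
    ext i
    refine Fin.succAboveCases N ?_ (fun j => ?_) i <;> simp [hyp]
  map_smul' c y := by
    ext i
    refine Fin.succAboveCases N ?_ (fun j => ?_) i <;> simp [hyp]

@[simp] theorem hyp_self (y : Fin n → ℝ) : hyp N y N = 0 := by simp [hyp]

@[simp] theorem hyp_succAbove (y : Fin n → ℝ) (a : Fin n) : hyp N y (N.succAbove a) = y a := by
  simp [hyp]

theorem hyp_single (a : Fin n) : hyp N (Pi.single a 1) = Pi.single (N.succAbove a) 1 := by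
  ext i
  refine Fin.succAboveCases N ?_ (fun j => ?_) i
  · simp [(Fin.succAbove_ne N a).symm]
  · simp [Pi.single_apply]

theorem contDiff_hyp : ContDiff ℝ ∞ (hyp N) :=
  (LinearMap.toContinuousLinearMap (hypL N)).contDiff

variable {V : Type*} [NormedAddCommGroup V] [NormedSpace ℝ V]

theorem pd_hyp {f : (Fin (n + 1) → ℝ) → V} (hf : ContDiffOn ℝ ∞ f D)
    (hE : IsRegularDomain (hyp N ⁻¹' D)) {y : Fin n → ℝ} (hy : hyp N y ∈ D) (a : Fin n) :
    pd (hyp N ⁻¹' D) a (fun w => f (hyp N w)) y = pd D (N.succAbove a) f (hyp N y) := by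
  have h := (diffAt hf hy).hasFDerivWithinAt.comp y
    ((LinearMap.toContinuousLinearMap (hypL N)).hasFDerivWithinAt (s := hyp N ⁻¹' D))
    (fun _ h => h)
  have h' := h.fderivWithin (hE.unique y hy)
  simp only [pd]
  change fderivWithin ℝ (f ∘ _) _ _ _ = _
  rw [h', ContinuousLinearMap.comp_apply]
  congr 1
  exact hyp_single N a

theorem ContDiffOn.comp_hyp {f : (Fin (n + 1) → ℝ) → V} (hf : ContDiffOn ℝ ∞ f D) :
    ContDiffOn ℝ ∞ (fun y => f (hyp N y)) (hyp N ⁻¹' D) :=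
  hf.comp (contDiff_hyp N).contDiffOn fun _ h => h

end Hyperplane

section HalfSpace

variable {n : ℕ} {D : Set (Fin n → ℝ)} {i : Fin n}

/-- `D` is a relatively open subset of the half-space on which the coordinate `i` is `≥ 0`. -/
def IsHalfDomain (D : Set (Fin n → ℝ)) (i : Fin n) : Prop :=
  ∃ U : Set (Fin n → ℝ), IsOpen U ∧ D = U ∩ {z | 0 ≤ z i}

theorem isOpen_pos (i : Fin n) : IsOpen {z : Fin n → ℝ | 0 < z i} :=
  isOpen_lt continuous_const (continuous_apply i)

theorem closure_pos (i : Fin n) : closure {z : Fin n → ℝ | 0 < z i} = {z | 0 ≤ z i} := by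
  have h := (isOpenMap_eval (X := fun _ : Fin n => ℝ) i).preimage_closure_eq_closure_preimage
    (continuous_apply i) (Set.Ioi 0)
  rw [closure_Ioi] at h
  exact h.symm

theorem IsHalfDomain.nonneg (h : IsHalfDomain D i) {z : Fin n → ℝ} (hz : z ∈ D) : 0 ≤ z i := by
  obtain ⟨U, -, rfl⟩ := h
  exact hz.2

theorem IsHalfDomain.subset_closure (h : IsHalfDomain D i) : D ⊆ closure (D ∩ {z | 0 < z i}) := by
  obtain ⟨U, hU, rfl⟩ := h
  intro z hz
  have h1 : z ∈ U ∩ closure {z : Fin n → ℝ | 0 < z i} := ⟨hz.1, by rw [closure_pos]; exact hz.2⟩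
  have h2 : U ∩ {z | 0 < z i} ⊆ U ∩ {z | 0 ≤ z i} ∩ {z | 0 < z i} :=
    fun w hw => ⟨⟨hw.1, le_of_lt (show 0 < w i from hw.2)⟩, hw.2⟩
  exact closure_mono h2 (hU.inter_closure h1)

theorem IsHalfDomain.isOpen_inter (h : IsHalfDomain D i) : IsOpen (D ∩ {z | 0 < z i}) := by
  obtain ⟨U, hU, rfl⟩ := h
  have : U ∩ {z : Fin n → ℝ | 0 ≤ z i} ∩ {z | 0 < z i} = U ∩ {z | 0 < z i} := by
    ext w
    exact ⟨fun hw => ⟨hw.1.1, hw.2⟩, fun hw => ⟨⟨hw.1, le_of_lt (show 0 < w i from hw.2)⟩, hw.2⟩⟩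
  rw [this]
  exact hU.inter (isOpen_pos i)

theorem isRegularDomain_of_isOpen (h : IsOpen D) : IsRegularDomain D :=
  ⟨h.uniqueDiffOn, by rw [h.interior_eq]; exact subset_closure⟩

theorem IsHalfDomain.regular (h : IsHalfDomain D i) : IsRegularDomain D := by
  refine ⟨?_, h.subset_closure.trans (closure_mono ?_)⟩
  · obtain ⟨U, hU, rfl⟩ := h
    rw [Set.inter_comm]
    refine UniqueDiffOn.inter (uniqueDiffOn_convex ?_ ?_) hU
    · exact convex_halfSpace_ge (IsLinearMap.mk (fun _ _ => rfl) fun _ _ => rfl) 0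
    · refine ⟨fun _ => 1, ?_⟩
      refine interior_maximal (t := {z : Fin n → ℝ | 0 < z i})
        (fun w (hw : 0 < w i) => le_of_lt hw) (isOpen_pos i) ?_
      exact zero_lt_one (α := ℝ)
  · exact interior_maximal Set.inter_subset_left h.isOpen_inter

/-- The open part `0 < z i` is dense in a half-space domain, so an identity between continuous
functions that is known off the boundary holds on it as well. Equations obtained by dividing by `Ω`
reach `𝒥` in this way. -/
theorem IsHalfDomain.eqOn {V : Type*} [TopologicalSpace V] [T2Space V] (h : IsHalfDomain D i)
    {f g : (Fin n → ℝ) → V} (hf : ContinuousOn f D) (hg : ContinuousOn g D)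
    (hfg : ∀ z ∈ D, z i ≠ 0 → f z = g z) {z : Fin n → ℝ} (hz : z ∈ D) : f z = g z :=
  Set.EqOn.of_subset_closure (s := D ∩ {z | 0 < z i}) (fun w hw => hfg w hw.1 (ne_of_gt hw.2))
    hf hg Set.inter_subset_left h.subset_closure hz

end HalfSpace

end AdS

namespace AdS

/-! ## Pseudo-Riemannian geometry in coordinates -/

/-- `g` is a smooth pseudo-Riemannian metric on the regular domain `D`. -/
structure IsMetric {n : ℕ} (D : Set (Fin n → ℝ)) (g : (Fin n → ℝ) → Matrix (Fin n) (Fin n) ℝ) :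
    Prop where
  dom : IsRegularDomain D
  smooth : ∀ i j, ContDiffOn ℝ ∞ (fun x => g x i j) D
  symm : ∀ x ∈ D, ∀ i j, g x i j = g x j i
  det : ∀ x ∈ D, (g x).det ≠ 0

theorem contDiffOn_det {n : WithTop ℕ∞} {E : Type*} [NormedAddCommGroup E] [NormedSpace ℝ E] {D : Set E}
    {ι : Type*} [Fintype ι] [DecidableEq ι] {g : E → Matrix ι ι ℝ}
    (h : ∀ i j, ContDiffOn ℝ n (fun x => g x i j) D) : ContDiffOn ℝ n (fun x => (g x).det) D := by
  simp only [Matrix.det_apply]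
  refine ContDiffOn.sum fun σ _ => ?_
  simp only [Units.smul_def, zsmul_eq_mul]
  exact contDiffOn_const.mul (contDiffOn_prod fun i _ => h _ _)

/-- The Christoffel symbols of the first kind. -/
noncomputable def chrL {n : ℕ} (D : Set (Fin n → ℝ)) (g : (Fin n → ℝ) → Matrix (Fin n) (Fin n) ℝ)
    (l j k : Fin n) : (Fin n → ℝ) → ℝ := fun x =>
  (1 / 2) * (pd D j (fun y => g y l k) x + pd D k (fun y => g y l j) x
    - pd D l (fun y => g y j k) x)

/-- The bilinear form with matrix `H`. -/
def bil {n : ℕ} (H : Matrix (Fin n) (Fin n) ℝ) (v w : Fin n → ℝ) : ℝ :=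
  ∑ i, ∑ j, H i j * v i * w j

section Bil

variable {n : ℕ} (H : Matrix (Fin n) (Fin n) ℝ)

theorem bil_add_left (u v w : Fin n → ℝ) : bil H (u + v) w = bil H u w + bil H v w := by
  simp only [bil, ← Finset.sum_add_distrib, Pi.add_apply]
  exact Finset.sum_congr rfl fun i _ => Finset.sum_congr rfl fun j _ => by ring

theorem bil_smul_left (c : ℝ) (v w : Fin n → ℝ) : bil H (c • v) w = c * bil H v w := by
  simp only [bil, Finset.mul_sum, Pi.smul_apply, smul_eq_mul]
  exact Finset.sum_congr rfl fun i _ => Finset.sum_congr rfl fun j _ => by ring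

theorem bil_add_right (u v w : Fin n → ℝ) : bil H u (v + w) = bil H u v + bil H u w := by
  simp only [bil, ← Finset.sum_add_distrib, Pi.add_apply]
  exact Finset.sum_congr rfl fun i _ => Finset.sum_congr rfl fun j _ => by ring

theorem bil_smul_right (c : ℝ) (v w : Fin n → ℝ) : bil H v (c • w) = c * bil H v w := by
  simp only [bil, Finset.mul_sum, Pi.smul_apply, smul_eq_mul]
  exact Finset.sum_congr rfl fun i _ => Finset.sum_congr rfl fun j _ => by ring

theorem bil_sub_left (u v w : Fin n → ℝ) : bil H (u - v) w = bil H u w - bil H v w := by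
  simp only [bil, ← Finset.sum_sub_distrib, Pi.sub_apply]
  exact Finset.sum_congr rfl fun i _ => Finset.sum_congr rfl fun j _ => by ring

theorem bil_sub_right (u v w : Fin n → ℝ) : bil H u (v - w) = bil H u v - bil H u w := by
  simp only [bil, ← Finset.sum_sub_distrib, Pi.sub_apply]
  exact Finset.sum_congr rfl fun i _ => Finset.sum_congr rfl fun j _ => by ring

theorem bil_comm {H : Matrix (Fin n) (Fin n) ℝ} (hH : ∀ i j, H i j = H j i) (v w : Fin n → ℝ) :
    bil H v w = bil H w v := by
  simp only [bil]
  rw [Finset.sum_comm]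
  exact Finset.sum_congr rfl fun i _ => Finset.sum_congr rfl fun j _ => by rw [hH]; ring

theorem bil_eq_left (v w : Fin n → ℝ) : bil H v w = ∑ j, (∑ i, H i j * v i) * w j := by
  simp only [bil]
  rw [Finset.sum_comm]
  simp only [Finset.sum_mul]

end Bil

namespace IsMetric

variable {n : ℕ} {D : Set (Fin n → ℝ)} {g : (Fin n → ℝ) → Matrix (Fin n) (Fin n) ℝ}
  {x : Fin n → ℝ}

theorem inv_smooth (M : IsMetric D g) (i j : Fin n) :
    ContDiffOn ℝ ∞ (fun x => (g x)⁻¹ i j) D := by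
  -- Cramer's rule: each entry of the inverse is a quotient of determinants.
  have h : ∀ x, (g x)⁻¹ i j = ((g x).det)⁻¹ * ((g x).updateRow j (Pi.single i 1)).det := by
    intro x
    rw [Matrix.inv_def, Matrix.smul_apply, Matrix.adjugate_apply, Ring.inverse_eq_inv', smul_eq_mul]
  simp only [h]
  refine ((contDiffOn_det M.smooth).inv M.det).mul (contDiffOn_det fun a b => ?_)
  by_cases ha : a = j
  · subst ha
    simpa using contDiffOn_const
  · simpa [Matrix.updateRow_ne ha] using M.smooth a b

theorem isUnit_det (M : IsMetric D g) (hx : x ∈ D) : IsUnit (g x).det := (M.det x hx).isUnit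

theorem mul_inv (M : IsMetric D g) (hx : x ∈ D) (i j : Fin n) :
    ∑ m, g x i m * (g x)⁻¹ m j = if i = j then 1 else 0 := by
  rw [← Matrix.mul_apply, Matrix.mul_nonsing_inv _ (M.isUnit_det hx), Matrix.one_apply]

theorem inv_mul (M : IsMetric D g) (hx : x ∈ D) (i j : Fin n) :
    ∑ m, (g x)⁻¹ i m * g x m j = if i = j then 1 else 0 := by
  rw [← Matrix.mul_apply, Matrix.nonsing_inv_mul _ (M.isUnit_det hx), Matrix.one_apply]

theorem lower_raise (M : IsMetric D g) (hx : x ∈ D) (v : Fin n → ℝ) (i : Fin n) :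
    ∑ m, g x i m * ∑ l, (g x)⁻¹ m l * v l = v i := by
  have h : (g x).mulVec ((g x)⁻¹.mulVec v) = v := by
    rw [Matrix.mulVec_mulVec, Matrix.mul_nonsing_inv _ (M.isUnit_det hx), Matrix.one_mulVec]
  exact congrFun h i

theorem raise_lower (M : IsMetric D g) (hx : x ∈ D) (v : Fin n → ℝ) (i : Fin n) :
    ∑ m, (g x)⁻¹ i m * ∑ l, g x m l * v l = v i := by
  have h : (g x)⁻¹.mulVec ((g x).mulVec v) = v := by
    rw [Matrix.mulVec_mulVec, Matrix.nonsing_inv_mul _ (M.isUnit_det hx), Matrix.one_mulVec]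
  exact congrFun h i

theorem inv_symm (M : IsMetric D g) (hx : x ∈ D) (i j : Fin n) : (g x)⁻¹ i j = (g x)⁻¹ j i := by
  have h : (g x).transpose = g x := by
    ext a b
    exact M.symm x hx b a
  conv_lhs => rw [← h, ← Matrix.transpose_nonsing_inv]
  rfl

theorem pd_symm (M : IsMetric D g) (hx : x ∈ D) (k i j : Fin n) :
    pd D k (fun y => g y i j) x = pd D k (fun y => g y j i) x :=
  pd_congr (fun y hy => M.symm y hy i j) k hx

theorem chrL_smooth (M : IsMetric D g) (l j k : Fin n) : ContDiffOn ℝ ∞ (chrL D g l j k) D :=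
  contDiffOn_const.mul (((ContDiffOn.pd M.dom (M.smooth _ _) _).add
    (ContDiffOn.pd M.dom (M.smooth _ _) _)).sub (ContDiffOn.pd M.dom (M.smooth _ _) _))

theorem chrL_symm (M : IsMetric D g) (hx : x ∈ D) (l j k : Fin n) :
    chrL D g l j k x = chrL D g l k j x := by
  simp only [chrL]
  rw [M.pd_symm hx l j k]
  ring

theorem christoffel_eq (l j k : Fin n) :
    christoffel D g l j k = fun x => ∑ m, (g x)⁻¹ l m * chrL D g m j k x := by
  ext x
  simp only [christoffel, chrL, Finset.mul_sum]
  exact Finset.sum_congr rfl fun i _ => by ring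

theorem christoffel_smooth (M : IsMetric D g) (l j k : Fin n) :
    ContDiffOn ℝ ∞ (christoffel D g l j k) D := by
  rw [christoffel_eq]
  exact ContDiffOn.sum fun m _ => (M.inv_smooth _ _).mul (M.chrL_smooth _ _ _)

theorem christoffel_symm (M : IsMetric D g) (hx : x ∈ D) (l j k : Fin n) :
    christoffel D g l j k x = christoffel D g l k j x := by
  simp only [christoffel_eq]
  exact Finset.sum_congr rfl fun m _ => by rw [M.chrL_symm hx]

theorem lower_christoffel (M : IsMetric D g) (hx : x ∈ D) (i j k : Fin n) :
    ∑ m, g x i m * christoffel D g m j k x = chrL D g i j k x := by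
  simp only [christoffel_eq]
  exact M.lower_raise hx (fun m => chrL D g m j k x) i

/-- The metric is parallel. -/
theorem pd_metric (M : IsMetric D g) (hx : x ∈ D) (k i j : Fin n) :
    pd D k (fun y => g y i j) x = chrL D g i k j x + chrL D g j k i x := by
  simp only [chrL]
  rw [M.pd_symm hx k j i, M.pd_symm hx j k i, M.pd_symm hx i k j]
  ring

theorem lower_pd_christoffel (M : IsMetric D g) (hx : x ∈ D) (i j k l : Fin n) :
    ∑ m, g x i m * pd D k (christoffel D g m l j) x
      = pd D k (chrL D g i l j) x
        - ∑ m, (chrL D g i k m x + chrL D g m k i x) * christoffel D g m l j x := by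
  have h : pd D k (chrL D g i l j) x
      = pd D k (fun y => ∑ m, g y i m * christoffel D g m l j y) x :=
    pd_congr (fun y hy => (M.lower_christoffel hy i l j).symm) k hx
  rw [h, pd_sum M.dom _ (fun m => (M.smooth _ _).mul (M.christoffel_smooth _ _ _)) hx,
    ← Finset.sum_sub_distrib]
  refine Finset.sum_congr rfl fun m _ => ?_
  rw [pd_mul M.dom (M.smooth _ _) (M.christoffel_smooth _ _ _) hx, M.pd_metric hx]
  ring

/-- Lowering an index commutes with `∂_k` up to `∂_k g`, which metricity turns into symbols of the
first kind. One of the two resulting quadratic terms cancels the `ΓΓ` term of the curvature. -/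
theorem riemannLow_eq_aux (M : IsMetric D g) (hx : x ∈ D) (i j k l : Fin n) :
    riemannLow D g i j k l x = pd D k (chrL D g i l j) x - pd D l (chrL D g i k j) x
      - ∑ m, chrL D g m k i x * christoffel D g m l j x
      + ∑ m, chrL D g m l i x * christoffel D g m k j x := by
  have h1 := M.lower_pd_christoffel hx i j k l
  have h2 := M.lower_pd_christoffel hx i j l k
  have h3 : ∀ k l : Fin n, ∑ m, g x i m * ∑ p, christoffel D g m k p x * christoffel D g p l j x
      = ∑ p, chrL D g i k p x * christoffel D g p l j x := by
    intro k l
    simp only [Finset.mul_sum]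
    rw [Finset.sum_comm]
    refine Finset.sum_congr rfl fun p _ => ?_
    rw [← M.lower_christoffel hx, Finset.sum_mul]
    exact Finset.sum_congr rfl fun _ _ => by ring
  simp only [add_mul, Finset.sum_add_distrib] at h1 h2
  simp only [riemannLow, riemann, mul_add, mul_sub, Finset.sum_add_distrib,
    Finset.sum_sub_distrib, h3, h1, h2]
  ring

/-- The vector of the Christoffel symbols of the first kind with given differentiation indices. -/
noncomputable def chrV (D : Set (Fin n → ℝ)) (g : (Fin n → ℝ) → Matrix (Fin n) (Fin n) ℝ)
    (j k : Fin n) (x : Fin n → ℝ) : Fin n → ℝ := fun m => chrL D g m j k x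

theorem bil_chrV_left (M : IsMetric D g) (hx : x ∈ D) (j k : Fin n) (v : Fin n → ℝ) :
    bil (g x)⁻¹ (chrV D g j k x) v = ∑ m, christoffel D g m j k x * v m := by
  rw [bil_eq_left]
  simp only [christoffel_eq, chrV]
  refine Finset.sum_congr rfl fun m _ => ?_
  congr 1
  exact Finset.sum_congr rfl fun i _ => by rw [M.inv_symm hx]

theorem pd_chrL (M : IsMetric D g) (hx : x ∈ D) (m l j k : Fin n) :
    pd D m (chrL D g l j k) x = (1 / 2) * (pd D m (pd D j (fun y => g y l k)) x
      + pd D m (pd D k (fun y => g y l j)) x - pd D m (pd D l (fun y => g y j k)) x) := by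
  have s := fun a i j => ContDiffOn.pd M.dom (M.smooth i j) a
  unfold chrL
  rw [pd_const_mul M.dom _ (((s _ _ _).add (s _ _ _)).sub (s _ _ _)) hx,
    pd_sub M.dom ((s _ _ _).add (s _ _ _)) (s _ _ _) hx, pd_add M.dom (s _ _ _) (s _ _ _) hx]

/-- The curvature tensor in terms of second derivatives and Christoffel symbols of the first
kind. -/
theorem riemannLow_eq (M : IsMetric D g) (hx : x ∈ D) (i j k l : Fin n) :
    riemannLow D g i j k l x = (1 / 2) * (pd D j (pd D k (fun y => g y i l)) x
        + pd D i (pd D l (fun y => g y j k)) x - pd D i (pd D k (fun y => g y j l)) x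
        - pd D j (pd D l (fun y => g y i k)) x)
      + bil (g x)⁻¹ (chrV D g i l x) (chrV D g j k x)
      - bil (g x)⁻¹ (chrV D g i k x) (chrV D g j l x) := by
  have e : ∀ k l : Fin n, ∑ m, chrL D g m k i x * christoffel D g m l j x
      = bil (g x)⁻¹ (chrV D g i k x) (chrV D g j l x) := by
    intro k l
    rw [bil_comm (M.inv_symm hx), M.bil_chrV_left hx]
    refine Finset.sum_congr rfl fun m _ => ?_
    rw [M.christoffel_symm hx, M.chrL_symm hx, mul_comm]
    rfl
  have sy : ∀ a b c d : Fin n, pd D a (pd D b (fun y => g y c d)) x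
      = pd D a (pd D b (fun y => g y d c)) x := fun a b c d =>
    pd_congr (fun y hy => M.pd_symm hy b c d) a hx
  rw [M.riemannLow_eq_aux hx, e, e, M.pd_chrL hx, M.pd_chrL hx,
    pd_comm M.dom (M.smooth i j) hx l k, pd_comm M.dom (M.smooth i l) hx k j,
    pd_comm M.dom (M.smooth l j) hx k i, pd_comm M.dom (M.smooth i k) hx l j,
    pd_comm M.dom (M.smooth k j) hx l i, sy i k l j, sy i l k j]
  ring

theorem riemannLow_antisymm_right (M : IsMetric D g) (hx : x ∈ D) (i j k l : Fin n) :
    riemannLow D g i j k l x = - riemannLow D g i j l k x := by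
  rw [M.riemannLow_eq hx, M.riemannLow_eq hx]
  ring

theorem riemannLow_antisymm_left (M : IsMetric D g) (hx : x ∈ D) (i j k l : Fin n) :
    riemannLow D g i j k l x = - riemannLow D g j i k l x := by
  rw [M.riemannLow_eq hx, M.riemannLow_eq hx, bil_comm (M.inv_symm hx) (chrV D g i l x),
    bil_comm (M.inv_symm hx) (chrV D g i k x)]
  ring

theorem riemannLow_pair (M : IsMetric D g) (hx : x ∈ D) (i j k l : Fin n) :
    riemannLow D g i j k l x = riemannLow D g k l i j x := by
  have cv : ∀ a b : Fin n, chrV D g a b x = chrV D g b a x := fun a b =>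
    funext fun m => M.chrL_symm hx m a b
  have sy : ∀ a b c d : Fin n, pd D a (pd D b (fun y => g y c d)) x
      = pd D b (pd D a (fun y => g y d c)) x := fun a b c d => by
    rw [pd_comm M.dom (M.smooth c d) hx]
    exact pd_congr (fun y hy => M.pd_symm hy a c d) b hx
  rw [M.riemannLow_eq hx, M.riemannLow_eq hx, cv k j, cv l i, cv k i, cv l j,
    sy l i k j, sy k j l i, sy k i l j, sy l j k i, bil_comm (M.inv_symm hx) (chrV D g j k x)]
  ring

theorem riemannLow_cyclic (M : IsMetric D g) (hx : x ∈ D) (i j k l : Fin n) :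
    riemannLow D g i j k l x + riemannLow D g i k l j x + riemannLow D g i l j k x = 0 := by
  have cv : ∀ a b : Fin n, chrV D g a b x = chrV D g b a x := fun a b =>
    funext fun m => M.chrL_symm hx m a b
  have sy : ∀ a b c d : Fin n, pd D a (pd D b (fun y => g y c d)) x
      = pd D a (pd D b (fun y => g y d c)) x := fun a b c d =>
    pd_congr (fun y hy => M.pd_symm hy b c d) a hx
  rw [M.riemannLow_eq hx, M.riemannLow_eq hx, M.riemannLow_eq hx, cv k j, cv l j, cv l k,
    pd_comm M.dom (M.smooth i l) hx k j, pd_comm M.dom (M.smooth i k) hx l j,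
    pd_comm M.dom (M.smooth i j) hx l k, sy i j k l, sy i l k j, sy i k l j]
  ring

/-- Raising the first index of the curvature tensor. -/
theorem riemann_eq (M : IsMetric D g) (hx : x ∈ D) (i j k l : Fin n) :
    riemann D g i j k l x = ∑ m, (g x)⁻¹ i m * riemannLow D g m j k l x := by
  simp only [riemannLow]
  exact (M.raise_lower hx (fun m => riemann D g m j k l x) i).symm

theorem ricci_eq (M : IsMetric D g) (hx : x ∈ D) (j l : Fin n) :
    ricci D g j l x = ∑ i, ∑ m, (g x)⁻¹ i m * riemannLow D g m j i l x := by
  simp only [ricci, M.riemann_eq hx]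

theorem ricci_symm (M : IsMetric D g) (hx : x ∈ D) (j l : Fin n) :
    ricci D g j l x = ricci D g l j x := by
  rw [M.ricci_eq hx, M.ricci_eq hx, Finset.sum_comm]
  refine Finset.sum_congr rfl fun i _ => Finset.sum_congr rfl fun m _ => ?_
  rw [M.inv_symm hx, M.riemannLow_pair hx]

theorem schouten_symm (M : IsMetric D g) (hx : x ∈ D) (j l : Fin n) :
    schouten D g j l x = schouten D g l j x := by
  simp only [schouten]
  rw [M.ricci_symm hx, M.symm x hx j l]

theorem riemann_smooth (M : IsMetric D g) (i j k l : Fin n) :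
    ContDiffOn ℝ ∞ (riemann D g i j k l) D := by
  have c := M.christoffel_smooth
  exact ((ContDiffOn.pd M.dom (c _ _ _) _).sub (ContDiffOn.pd M.dom (c _ _ _) _)).add
      (ContDiffOn.sum fun p _ => ((c _ _ _).mul (c _ _ _)).sub ((c _ _ _).mul (c _ _ _)))

theorem ricci_smooth (M : IsMetric D g) (j l : Fin n) : ContDiffOn ℝ ∞ (ricci D g j l) D :=
  ContDiffOn.sum fun _ _ => M.riemann_smooth _ _ _ _

theorem schouten_smooth (M : IsMetric D g) (j l : Fin n) :
    ContDiffOn ℝ ∞ (schouten D g j l) D := by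
  refine contDiffOn_const.mul ((M.ricci_smooth _ _).sub (ContDiffOn.mul ?_ (M.smooth _ _)))
  simp only [scalarCurv, div_eq_mul_inv]
  exact (ContDiffOn.sum fun i _ => ContDiffOn.sum fun j _ =>
    (M.inv_smooth i j).mul (M.ricci_smooth i j)).mul contDiffOn_const

end IsMetric
end AdS

/-! ### Tensor identities: traces, Bianchi and Ricci identities, conformal change. -/

namespace AdS

/-- The Kulkarni–Nomizu product of two symmetric matrices. -/
def kn {n : ℕ} (g P : Fin n → Fin n → ℝ) (i j k l : Fin n) : ℝ :=
  g i k * P j l - g i l * P j k + g j l * P i k - g j k * P i l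

/-- The covariant derivative `∇_m T_{ijkl}` of a covariant 4-tensor. -/
noncomputable def covDeriv4 {n : ℕ} (D : Set (Fin n → ℝ))
    (g : (Fin n → ℝ) → Matrix (Fin n) (Fin n) ℝ)
    (T : Fin n → Fin n → Fin n → Fin n → (Fin n → ℝ) → ℝ) (m i j k l : Fin n) (x : Fin n → ℝ) :
    ℝ :=
  pd D m (T i j k l) x
    - ∑ p, (christoffel D g p m i x * T p j k l x + christoffel D g p m j x * T i p k l x
      + christoffel D g p m k x * T i j p l x + christoffel D g p m l x * T i j k p x)

/-- The covariant derivative `∇_m R^i_{jkl}` of the curvature tensor. -/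
noncomputable def covRiemann {n : ℕ} (D : Set (Fin n → ℝ))
    (g : (Fin n → ℝ) → Matrix (Fin n) (Fin n) ℝ) (m i j k l : Fin n) (x : Fin n → ℝ) : ℝ :=
  pd D m (riemann D g i j k l) x
    + ∑ p, christoffel D g i m p x * riemann D g p j k l x
    - ∑ p, christoffel D g p m j x * riemann D g i p k l x
    - ∑ p, christoffel D g p m k x * riemann D g i j p l x
    - ∑ p, christoffel D g p m l x * riemann D g i j k p x

/-- The Hessian `∇_j ∇_k f`. -/
noncomputable def hess {n : ℕ} (D : Set (Fin n → ℝ))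
    (g : (Fin n → ℝ) → Matrix (Fin n) (Fin n) ℝ) (f : (Fin n → ℝ) → ℝ) (j k : Fin n) :
    (Fin n → ℝ) → ℝ := fun x =>
  pd D j (pd D k f) x - ∑ m, christoffel D g m j k x * pd D m f x

namespace IsMetric

variable {n : ℕ} {D : Set (Fin n → ℝ)} {g : (Fin n → ℝ) → Matrix (Fin n) (Fin n) ℝ}
  {x : Fin n → ℝ}

/-! ### Traces -/

theorem trace_metric (M : IsMetric D g) (hx : x ∈ D) : ∑ i, ∑ m, (g x)⁻¹ i m * g x m i = n := by
  simp only [M.inv_mul hx]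
  simp

theorem contract_left (M : IsMetric D g) (hx : x ∈ D) (k : Fin n) (v : Fin n → ℝ) :
    ∑ i, ∑ m, (g x)⁻¹ i m * (g x m k * v i) = v k := by
  have : ∀ i, ∑ m, (g x)⁻¹ i m * (g x m k * v i) = (if i = k then 1 else 0) * v i := by
    intro i
    rw [← M.inv_mul hx i k, Finset.sum_mul]
    exact Finset.sum_congr rfl fun m _ => by ring
  simp [this]

theorem contract_right (M : IsMetric D g) (hx : x ∈ D) (k : Fin n) (v : Fin n → ℝ) :
    ∑ i, ∑ m, (g x)⁻¹ i m * (g x k i * v m) = v k := by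
  rw [Finset.sum_comm, ← M.contract_left hx k v]
  refine Finset.sum_congr rfl fun i _ => Finset.sum_congr rfl fun m _ => ?_
  rw [M.inv_symm hx, M.symm x hx k m]

theorem trace_kn (M : IsMetric D g) (hx : x ∈ D) (P : Fin n → Fin n → ℝ)
    (j l : Fin n) :
    ∑ i, ∑ m, (g x)⁻¹ i m * kn (g x) P m j i l
      = ((n : ℝ) - 2) * P j l + g x j l * ∑ i, ∑ m, (g x)⁻¹ i m * P m i := by
  have h1 : ∑ i, ∑ m, (g x)⁻¹ i m * (g x m i * P j l) = n * P j l := by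
    rw [← M.trace_metric hx, Finset.sum_mul]
    refine Finset.sum_congr rfl fun i _ => ?_
    rw [Finset.sum_mul]
    exact Finset.sum_congr rfl fun m _ => by ring
  have h2 := M.contract_left hx l (fun i => P j i)
  have h3 : ∑ i, ∑ m, (g x)⁻¹ i m * (g x j l * P m i)
      = g x j l * ∑ i, ∑ m, (g x)⁻¹ i m * P m i := by
    simp only [Finset.mul_sum]
    exact Finset.sum_congr rfl fun i _ => Finset.sum_congr rfl fun m _ => by ring
  have h4 := M.contract_right hx j (fun m => P m l)
  simp only [kn, mul_add, mul_sub, Finset.sum_add_distrib, Finset.sum_sub_distrib, h1, h2, h3, h4]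
  ring

/-- The trace of the Schouten tensor. -/
theorem trace_schouten (M : IsMetric D g) (hx : x ∈ D) (h2 : (n : ℝ) - 2 ≠ 0)
    (h1 : (n : ℝ) - 1 ≠ 0) :
    ∑ i, ∑ m, (g x)⁻¹ i m * schouten D g m i x = scalarCurv D g x / (2 * ((n : ℝ) - 1)) := by
  have ht := M.trace_metric hx
  have hr : ∑ i, ∑ m, (g x)⁻¹ i m * ricci D g m i x = scalarCurv D g x := by
    simp only [scalarCurv]
    exact Finset.sum_congr rfl fun i _ => Finset.sum_congr rfl fun m _ => by rw [M.ricci_symm hx]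
  have : ∑ i, ∑ m, (g x)⁻¹ i m * schouten D g m i x
      = (1 / ((n : ℝ) - 2)) * (∑ i, ∑ m, (g x)⁻¹ i m * ricci D g m i x
        - scalarCurv D g x / (2 * ((n : ℝ) - 1)) * ∑ i, ∑ m, (g x)⁻¹ i m * g x m i) := by
    simp only [Finset.mul_sum, ← Finset.sum_sub_distrib, schouten]
    exact Finset.sum_congr rfl fun i _ => Finset.sum_congr rfl fun m _ => by ring
  rw [this, hr, ht]
  field_simp
  ring

theorem ricci_eq_schouten (M : IsMetric D g) (hx : x ∈ D) (h2 : (n : ℝ) - 2 ≠ 0)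
    (h1 : (n : ℝ) - 1 ≠ 0) (j l : Fin n) :
    ricci D g j l x = ((n : ℝ) - 2) * schouten D g j l x
      + g x j l * ∑ i, ∑ m, (g x)⁻¹ i m * schouten D g m i x := by
  rw [M.trace_schouten hx h2 h1]
  simp only [schouten]
  field_simp
  ring

theorem weyl_eq (i j k l : Fin n) : weyl D g i j k l x
    = riemannLow D g i j k l x - kn (g x) (fun a b => schouten D g a b x) i j k l := by
  simp only [weyl, kn]

theorem trace_weyl (M : IsMetric D g) (hx : x ∈ D) (h2 : (n : ℝ) - 2 ≠ 0)
    (h1 : (n : ℝ) - 1 ≠ 0) (j l : Fin n) :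
    ∑ i, ∑ m, (g x)⁻¹ i m * weyl D g m j i l x = 0 := by
  simp only [weyl_eq, mul_sub, Finset.sum_sub_distrib]
  rw [M.trace_kn hx, ← M.ricci_eq hx, M.ricci_eq_schouten hx h2 h1]
  ring

/-- The trace-free part of the curvature determines the Schouten tensor. -/
theorem schouten_of_riemannLow (M : IsMetric D g) (hx : x ∈ D) (h2 : (n : ℝ) - 2 ≠ 0)
    (h1 : (n : ℝ) - 1 ≠ 0) (P : Fin n → Fin n → ℝ)
    (T : Fin n → Fin n → Fin n → Fin n → ℝ)
    (hT : ∀ j l, ∑ i, ∑ m, (g x)⁻¹ i m * T m j i l = 0)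
    (hR : ∀ i j k l, riemannLow D g i j k l x = T i j k l + kn (g x) P i j k l) (j l : Fin n) :
    schouten D g j l x = P j l := by
  -- One contraction gives the Ricci tensor in terms of `P`, a second one the scalar curvature. The
  -- definition of the Schouten tensor is the inverse of `P ↦ (n - 2) P + (tr P) g`.
  have hric : ∀ j l, ricci D g j l x
      = ((n : ℝ) - 2) * P j l + g x j l * ∑ i, ∑ m, (g x)⁻¹ i m * P m i := by
    intro j l
    simp only [M.ricci_eq hx, hR, mul_add, Finset.sum_add_distrib]
    rw [hT, M.trace_kn hx, zero_add]
  have hs : scalarCurv D g x = 2 * ((n : ℝ) - 1) * ∑ i, ∑ m, (g x)⁻¹ i m * P m i := by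
    have e : scalarCurv D g x = ((n : ℝ) - 2) * (∑ i, ∑ m, (g x)⁻¹ i m * P m i)
        + (∑ i, ∑ m, (g x)⁻¹ i m * g x m i) * ∑ i, ∑ m, (g x)⁻¹ i m * P m i := by
      simp only [scalarCurv]
      rw [Finset.mul_sum, Finset.sum_mul, ← Finset.sum_add_distrib]
      have : ∀ i j, ricci D g i j x = ricci D g j i x := M.ricci_symm hx
      refine Finset.sum_congr rfl fun i _ => ?_
      rw [Finset.mul_sum, Finset.sum_mul, ← Finset.sum_add_distrib]
      refine Finset.sum_congr rfl fun j _ => ?_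
      rw [this i j, hric]
      ring
    rw [e, M.trace_metric hx]
    ring
  simp only [schouten, hs, hric]
  field_simp
  ring

/-! ### The Bianchi identity -/

/-- With the connection written as matrices `A k`, the curvature is `F = dA + A ∧ A`. The cyclic sum
of `dF + [A, F]` vanishes because second derivatives commute (`hmat`). The connection terms acting
on the form indices cancel in pairs, as `Γ` is symmetric and `F` antisymmetric (`hpair`). -/
theorem bianchi (M : IsMetric D g) (hx : x ∈ D) (i j k l m : Fin n) :
    covRiemann D g m i j k l x + covRiemann D g k i j l m x + covRiemann D g l i j m k x = 0 := by
  have c := M.christoffel_smooth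
  let A : Fin n → Matrix (Fin n) (Fin n) ℝ := fun k => Matrix.of fun i j => christoffel D g i k j x
  let dA : Fin n → Fin n → Matrix (Fin n) (Fin n) ℝ := fun m k =>
    Matrix.of fun i j => pd D m (christoffel D g i k j) x
  let ddA : Fin n → Fin n → Fin n → Matrix (Fin n) (Fin n) ℝ := fun p m k =>
    Matrix.of fun i j => pd D p (pd D m (christoffel D g i k j)) x
  let F : Fin n → Fin n → Matrix (Fin n) (Fin n) ℝ := fun k l =>
    dA k l - dA l k + (A k * A l - A l * A k)
  have hF : ∀ i j k l, riemann D g i j k l x = F k l i j := by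
    intro i j k l
    simp [F, dA, A, riemann, Matrix.mul_apply, Finset.sum_sub_distrib]
  have hdF : ∀ m i j k l, pd D m (riemann D g i j k l) x
      = (ddA m k l - ddA m l k + ((dA m k * A l + A k * dA m l)
        - (dA m l * A k + A l * dA m k))) i j := by
    intro m i j k l
    have h1 : ∀ p, pd D m (fun y => christoffel D g i k p y * christoffel D g p l j y
        - christoffel D g i l p y * christoffel D g p k j y) x
        = (dA m k i p * A l p j + A k i p * dA m l p j)
          - (dA m l i p * A k p j + A l i p * dA m k p j) := by
      intro p
      rw [pd_sub M.dom ((c _ _ _).mul (c _ _ _)) ((c _ _ _).mul (c _ _ _)) hx,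
        pd_mul M.dom (c _ _ _) (c _ _ _) hx, pd_mul M.dom (c _ _ _) (c _ _ _) hx]
      rfl
    unfold riemann
    rw [pd_add M.dom ((ContDiffOn.pd M.dom (c _ _ _) _).sub (ContDiffOn.pd M.dom (c _ _ _) _))
      (ContDiffOn.sum fun p _ => ((c _ _ _).mul (c _ _ _)).sub ((c _ _ _).mul (c _ _ _))) hx,
      pd_sub M.dom (ContDiffOn.pd M.dom (c _ _ _) _) (ContDiffOn.pd M.dom (c _ _ _) _) hx,
      pd_sum M.dom _ (fun p => ((c _ _ _).mul (c _ _ _)).sub ((c _ _ _).mul (c _ _ _))) hx]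
    simp only [h1]
    simp only [Matrix.add_apply, Matrix.sub_apply, Matrix.mul_apply, Finset.sum_sub_distrib,
      Finset.sum_add_distrib]
    rfl
  have hcov : ∀ m i j k l, covRiemann D g m i j k l x
      = (ddA m k l - ddA m l k + ((dA m k * A l + A k * dA m l)
        - (dA m l * A k + A l * dA m k)) + A m * F k l - F k l * A m) i j
        - ∑ p, christoffel D g p m k x * F p l i j
        - ∑ p, christoffel D g p m l x * F k p i j := by
    intro m i j k l
    rw [covRiemann, hdF]
    simp only [hF]
    rw [Matrix.sub_apply _ (F k l * A m), Matrix.add_apply _ (A m * F k l),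
      Matrix.mul_apply (M := A m), Matrix.mul_apply (N := A m)]
    have : ∑ p, christoffel D g p m j x * F k l i p = ∑ p, F k l i p * A m p j :=
      Finset.sum_congr rfl fun p _ => mul_comm _ _
    rw [this]
    rfl
  have hdd : ∀ p m k, ddA p m k = ddA m p k := by
    intro p m k
    ext i j
    exact pd_comm M.dom (c i k j) hx p m
  have hanti : ∀ k l, F k l = - F l k := by
    intro k l
    simp only [F]
    noncomm_ring
  have hpair : ∀ a b c, ∑ p, christoffel D g p a b x * F p c i j
      + ∑ p, christoffel D g p b a x * F c p i j = 0 := by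
    intro a b c
    rw [← Finset.sum_add_distrib]
    refine Finset.sum_eq_zero fun p _ => ?_
    rw [M.christoffel_symm hx p b a, hanti c p, Matrix.neg_apply]
    ring
  have hmat : (ddA m k l - ddA m l k + ((dA m k * A l + A k * dA m l)
        - (dA m l * A k + A l * dA m k)) + A m * F k l - F k l * A m)
      + (ddA k l m - ddA k m l + ((dA k l * A m + A l * dA k m)
        - (dA k m * A l + A m * dA k l)) + A k * F l m - F l m * A k)
      + (ddA l m k - ddA l k m + ((dA l m * A k + A m * dA l k)
        - (dA l k * A m + A k * dA l m)) + A l * F m k - F m k * A l) = 0 := by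
    rw [hdd k m l, hdd l m k, hdd l k m]
    simp only [F]
    noncomm_ring
  have hij := congrFun (congrFun hmat i) j
  simp only [Matrix.add_apply _ _ i j, Matrix.zero_apply] at hij
  rw [hcov, hcov, hcov]
  linarith [hpair m k l, hpair k l m, hpair l m k]

theorem covRiemann_trace (M : IsMetric D g) (hx : x ∈ D) (j k l : Fin n) :
    ∑ i, covRiemann D g l i j i k x = covDeriv D g (ricci D g) l j k x := by
  have h1 : pd D l (ricci D g j k) x = ∑ i, pd D l (riemann D g i j i k) x :=
    pd_sum M.dom _ (fun i => M.riemann_smooth i j i k) hx l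
  have h2 : ∑ i, ∑ p, christoffel D g i l p x * riemann D g p j i k x
      = ∑ i, ∑ p, christoffel D g p l i x * riemann D g i j p k x := by
    rw [Finset.sum_comm]
  have h3 : ∑ i, ∑ p, christoffel D g p l j x * riemann D g i p i k x
      = ∑ p, christoffel D g p l j x * ricci D g p k x := by
    rw [Finset.sum_comm]
    simp only [ricci, Finset.mul_sum]
  have h4 : ∑ i, ∑ p, christoffel D g p l k x * riemann D g i j i p x
      = ∑ p, christoffel D g p l k x * ricci D g j p x := by
    rw [Finset.sum_comm]
    simp only [ricci, Finset.mul_sum]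
  simp only [covRiemann, covDeriv, Finset.sum_add_distrib, Finset.sum_sub_distrib, h1, h2, h3, h4]
  ring

theorem riemann_antisymm (i j k l : Fin n) : riemann D g i j k l x = - riemann D g i j l k x := by
  simp only [riemann, Finset.sum_sub_distrib]
  ring

/-- The contracted Bianchi identity. -/
theorem bianchi_contracted (M : IsMetric D g) (hx : x ∈ D) (j k l : Fin n) :
    ∑ i, covRiemann D g i i j k l x
      = covDeriv D g (ricci D g) k j l x - covDeriv D g (ricci D g) l j k x := by
  have ha : ∀ i, covRiemann D g k i j l i x = - covRiemann D g k i j i l x := by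
    intro i
    have h1 : pd D k (riemann D g i j l i) x = - pd D k (riemann D g i j i l) x := by
      rw [← pd_neg M.dom hx]
      exact pd_congr (fun y _ => riemann_antisymm i j l i) k hx
    have h2 : ∀ a b c d : Fin n, ∀ f : Fin n → ℝ, f a * riemann D g c d a b x
        = - (f a * riemann D g c d b a x) := fun a b c d f => by rw [riemann_antisymm]; ring
    simp only [covRiemann, h1]
    rw [Finset.sum_congr rfl fun p _ => show _ = -(christoffel D g i k p x
        * riemann D g p j i l x) by rw [riemann_antisymm p j l i]; ring,
      Finset.sum_congr rfl fun p _ => show christoffel D g p k j x * riemann D g i p l i x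
        = -(christoffel D g p k j x * riemann D g i p i l x) by
          rw [riemann_antisymm i p l i]; ring,
      Finset.sum_congr rfl fun p _ => show christoffel D g p k l x * riemann D g i j p i x
        = -(christoffel D g p k l x * riemann D g i j i p x) by
          rw [riemann_antisymm i j p i]; ring,
      Finset.sum_congr rfl fun p _ => show christoffel D g p k i x * riemann D g i j l p x
        = -(christoffel D g p k i x * riemann D g i j p l x) by
          rw [riemann_antisymm i j l p]; ring]
    simp only [Finset.sum_neg_distrib]
    ring
  have h := Finset.sum_congr (rfl : (Finset.univ : Finset (Fin n)) = Finset.univ)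
    fun i _ => M.bianchi hx i j k l i
  simp only [Finset.sum_add_distrib, ha, Finset.sum_neg_distrib, M.covRiemann_trace hx,
    Finset.sum_const_zero] at h
  linarith

theorem covDeriv4_riemannLow (M : IsMetric D g) (hx : x ∈ D) (m i j k l : Fin n) :
    covDeriv4 D g (riemannLow D g) m i j k l x = ∑ q, g x i q * covRiemann D g m q j k l x := by
  have h1 : pd D m (riemannLow D g i j k l) x = ∑ q, ((chrL D g i m q x + chrL D g q m i x)
      * riemann D g q j k l x + g x i q * pd D m (riemann D g q j k l) x) := by
    unfold riemannLow
    rw [pd_sum M.dom _ (fun q => (M.smooth i q).mul (M.riemann_smooth q j k l)) hx]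
    refine Finset.sum_congr rfl fun q _ => ?_
    rw [pd_mul M.dom (M.smooth i q) (M.riemann_smooth q j k l) hx, M.pd_metric hx]
  have h2 : ∑ p, christoffel D g p m i x * riemannLow D g p j k l x
      = ∑ q, chrL D g q m i x * riemann D g q j k l x := by
    simp only [riemannLow, Finset.mul_sum]
    rw [Finset.sum_comm]
    refine Finset.sum_congr rfl fun q _ => ?_
    rw [← M.lower_christoffel hx, Finset.sum_mul]
    exact Finset.sum_congr rfl fun p _ => by rw [M.symm x hx q p]; ring
  have h3 : ∑ q, g x i q * ∑ p, christoffel D g q m p x * riemann D g p j k l x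
      = ∑ q, chrL D g i m q x * riemann D g q j k l x := by
    simp only [Finset.mul_sum]
    rw [Finset.sum_comm]
    refine Finset.sum_congr rfl fun q _ => ?_
    rw [← M.lower_christoffel hx, Finset.sum_mul]
    exact Finset.sum_congr rfl fun p _ => by ring
  have h4 : ∀ (c : Fin n → ℝ) (R : Fin n → Fin n → ℝ), ∑ p, c p * ∑ q, g x i q * R q p
      = ∑ q, g x i q * ∑ p, c p * R q p := by
    intro c R
    simp only [Finset.mul_sum]
    rw [Finset.sum_comm]
    exact Finset.sum_congr rfl fun q _ => Finset.sum_congr rfl fun p _ => by ring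
  have h5 := h4 (fun p => christoffel D g p m j x) (fun q p => riemann D g q p k l x)
  have h6 := h4 (fun p => christoffel D g p m k x) (fun q p => riemann D g q j p l x)
  have h7 := h4 (fun p => christoffel D g p m l x) (fun q p => riemann D g q j k p x)
  simp only [covDeriv4, covRiemann, h1, h2, mul_add, mul_sub, add_mul, Finset.sum_add_distrib,
    Finset.sum_sub_distrib, h3]
  simp only [riemannLow, h5, h6, h7]
  ring

theorem divergence_riemannLow (M : IsMetric D g) (hx : x ∈ D) (j k l : Fin n) :
    ∑ m, ∑ i, (g x)⁻¹ m i * covDeriv4 D g (riemannLow D g) m i j k l x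
      = covDeriv D g (ricci D g) k j l x - covDeriv D g (ricci D g) l j k x := by
  rw [← M.bianchi_contracted hx]
  simp only [M.covDeriv4_riemannLow hx]
  exact Finset.sum_congr rfl fun m _ =>
    M.raise_lower hx (fun q => covRiemann D g m q j k l x) m

theorem covDeriv_metric (M : IsMetric D g) (hx : x ∈ D) (m i j : Fin n) :
    covDeriv D g (fun a b y => g y a b) m i j x = 0 := by
  simp only [covDeriv, Finset.sum_add_distrib]
  have h1 : ∑ p, christoffel D g p m i x * g x p j = chrL D g j m i x := by
    rw [← M.lower_christoffel hx]
    exact Finset.sum_congr rfl fun p _ => by rw [M.symm x hx j p]; ring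
  have h2 : ∑ p, christoffel D g p m j x * g x i p = chrL D g i m j x := by
    rw [← M.lower_christoffel hx]
    exact Finset.sum_congr rfl fun p _ => by ring
  rw [h1, h2, M.pd_metric hx]
  ring

theorem covDeriv4_kn (M : IsMetric D g) (hx : x ∈ D) {P : Fin n → Fin n → (Fin n → ℝ) → ℝ}
    (hP : ∀ i j, ContDiffOn ℝ ∞ (P i j) D) (m i j k l : Fin n) :
    covDeriv4 D g (fun i j k l y => kn (g y) (fun a b => P a b y) i j k l) m i j k l x
      = kn (g x) (fun a b => covDeriv D g P m a b x) i j k l := by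
  have s := M.smooth
  have hg : ∀ i j, pd D m (fun y => g y i j) x = ∑ p, (christoffel D g p m i x * g x p j
      + christoffel D g p m j x * g x i p) := fun i j => by
    have := M.covDeriv_metric hx m i j
    simp only [covDeriv] at this
    linarith
  have hd : pd D m (fun y => kn (g y) (fun a b => P a b y) i j k l) x
      = pd D m (fun y => g y i k) x * P j l x + g x i k * pd D m (P j l) x
        - (pd D m (fun y => g y i l) x * P j k x + g x i l * pd D m (P j k) x)
        + (pd D m (fun y => g y j l) x * P i k x + g x j l * pd D m (P i k) x)
        - (pd D m (fun y => g y j k) x * P i l x + g x j k * pd D m (P i l) x) := by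
    unfold kn
    rw [pd_sub M.dom ((((s _ _).mul (hP _ _)).sub ((s _ _).mul (hP _ _))).add
      ((s _ _).mul (hP _ _))) ((s _ _).mul (hP _ _)) hx,
      pd_add M.dom (((s _ _).mul (hP _ _)).sub ((s _ _).mul (hP _ _))) ((s _ _).mul (hP _ _)) hx,
      pd_sub M.dom ((s _ _).mul (hP _ _)) ((s _ _).mul (hP _ _)) hx,
      pd_mul M.dom (s _ _) (hP _ _) hx, pd_mul M.dom (s _ _) (hP _ _) hx,
      pd_mul M.dom (s _ _) (hP _ _) hx, pd_mul M.dom (s _ _) (hP _ _) hx]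
  simp only [covDeriv4, hd, hg]
  simp only [kn, covDeriv, mul_sub, Finset.mul_sum, Finset.sum_mul]
  rw [← sub_eq_zero]
  -- Here `a, b, c, d` are the four terms `g ∂P`, which occur on both sides. What is left consists
  -- of connection terms and vanishes summand by summand.
  have : ∀ (a b c d s1 s2 s3 s4 s5 t1 t2 t3 t4 : ℝ), s1 - s2 + s3 - s4 - s5 + t1 - t2 + t3 - t4 = 0
      → s1 + a - (s2 + b) + (s3 + c) - (s4 + d) - s5
        - (a - t1 - (b - t2) + (c - t3) - (d - t4)) = 0 := fun _ _ _ _ _ _ _ _ _ _ _ _ _ h => by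
    linarith
  apply this
  simp only [← Finset.sum_add_distrib, ← Finset.sum_sub_distrib]
  refine Finset.sum_eq_zero fun p _ => ?_
  ring

theorem hess_smooth (M : IsMetric D g) {f : (Fin n → ℝ) → ℝ}
    (hf : ContDiffOn ℝ ∞ f D) (j k : Fin n) : ContDiffOn ℝ ∞ (hess D g f j k) D :=
  (ContDiffOn.pd M.dom (ContDiffOn.pd M.dom hf _) _).sub (ContDiffOn.sum fun _ _ =>
    (M.christoffel_smooth _ _ _).mul (ContDiffOn.pd M.dom hf _))

/-- The Ricci identity for a gradient. -/
theorem ricci_identity (M : IsMetric D g) (hx : x ∈ D) {f : (Fin n → ℝ) → ℝ}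
    (hf : ContDiffOn ℝ ∞ f D) (j k l : Fin n) :
    covDeriv D g (hess D g f) k l j x - covDeriv D g (hess D g f) l k j x
      = - ∑ i, riemann D g i j k l x * pd D i f x := by
  have c := M.christoffel_smooth
  have df := fun i => ContDiffOn.pd M.dom hf i
  have hd : ∀ k l, pd D k (hess D g f l j) x = pd D k (pd D l (pd D j f)) x
      - ∑ m, (pd D k (christoffel D g m l j) x * pd D m f x
        + christoffel D g m l j x * pd D k (pd D m f) x) := by
    intro k l
    unfold hess
    rw [pd_sub M.dom (ContDiffOn.pd M.dom (df _) _)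
      (ContDiffOn.sum fun m _ => (c _ _ _).mul (df _)) hx,
      pd_sum M.dom _ (fun m => (c _ _ _).mul (df _)) hx]
    congr 1
    exact Finset.sum_congr rfl fun m _ => pd_mul M.dom (c _ _ _) (df _) hx k
  have e1 : ∑ m, christoffel D g m k l x * hess D g f m j x
      = ∑ m, christoffel D g m l k x * hess D g f m j x :=
    Finset.sum_congr rfl fun m _ => by rw [M.christoffel_symm hx]
  have e2 : ∀ k l, ∑ m, christoffel D g m k j x * hess D g f l m x
      = ∑ m, christoffel D g m k j x * pd D l (pd D m f) x
        - ∑ i, (∑ m, christoffel D g i l m x * christoffel D g m k j x) * pd D i f x := by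
    intro k l
    simp only [hess, mul_sub, Finset.sum_sub_distrib, Finset.mul_sum, Finset.sum_mul]
    congr 1
    rw [Finset.sum_comm]
    exact Finset.sum_congr rfl fun _ _ => Finset.sum_congr rfl fun _ _ => by ring
  simp only [covDeriv, hd, Finset.sum_add_distrib, e1, e2, riemann, add_mul, sub_mul,
    Finset.sum_sub_distrib]
  rw [pd_comm M.dom (df j) hx k l]
  ring

/-! ### Conformal change of the metric -/

theorem inv_conformal (M : IsMetric D g) (hx : x ∈ D) {c : ℝ} (hc : c ≠ 0) :
    (c • g x)⁻¹ = c⁻¹ • (g x)⁻¹ := by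
  have := Matrix.inv_smul' (Units.mk0 c hc) (M.isUnit_det hx) (A := g x)
  simpa [Units.smul_def] using this

theorem conformal (M : IsMetric D g) {f : (Fin n → ℝ) → ℝ} (hf : ContDiffOn ℝ ∞ f D)
    (h0 : ∀ x ∈ D, f x ≠ 0) : IsMetric D (fun x => f x • g x) where
  dom := M.dom
  smooth i j := hf.mul (M.smooth i j)
  symm x hx i j := by simp [M.symm x hx i j]
  det x hx := by
    rw [Matrix.det_smul]
    exact mul_ne_zero (pow_ne_zero _ (h0 x hx)) (M.det x hx)

theorem bil_metric_left (M : IsMetric D g) (hx : x ∈ D) (i : Fin n) (v : Fin n → ℝ) :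
    bil (g x)⁻¹ (fun m => g x m i) v = v i := by
  rw [bil_eq_left]
  have : ∀ j, ∑ k, (g x)⁻¹ k j * g x k i = if i = j then 1 else 0 := by
    intro j
    rw [← M.mul_inv hx i j]
    exact Finset.sum_congr rfl fun k _ => by rw [M.symm x hx k i]; ring
  simp [this]

theorem chrV_conformal (M : IsMetric D g) {f : (Fin n → ℝ) → ℝ} (hf : ContDiffOn ℝ ∞ f D)
    (hx : x ∈ D) (j k : Fin n) :
    chrV D (fun x => f x • g x) j k x = f x • chrV D g j k x
      + ((1 / 2 * pd D j f x) • (fun m => g x m k) + (1 / 2 * pd D k f x) • (fun m => g x m j)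
        - (1 / 2 * g x j k) • fun m => pd D m f x) := by
  ext m
  have h : ∀ a i j, pd D a (fun y => (f y • g y) i j) x
      = pd D a f x * g x i j + f x * pd D a (fun y => g y i j) x := fun a i j =>
    pd_mul M.dom hf (M.smooth i j) hx a
  simp only [chrV, chrL, h, Pi.add_apply, Pi.sub_apply, Pi.smul_apply, smul_eq_mul]
  ring

/-- The curvature of a conformally rescaled metric. -/
theorem riemannLow_conformal (M : IsMetric D g) {f : (Fin n → ℝ) → ℝ} (hf : ContDiffOn ℝ ∞ f D)
    (h0 : ∀ x ∈ D, f x ≠ 0) (hx : x ∈ D) (i j k l : Fin n) :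
    riemannLow D (fun x => f x • g x) i j k l x
      = f x * (riemannLow D g i j k l x - kn (g x) (fun a b => hess D g f a b x / (2 * f x)
        - 3 * pd D a f x * pd D b f x / (4 * f x ^ 2)
        + bil (g x)⁻¹ (fun m => pd D m f x) (fun m => pd D m f x) / (8 * f x ^ 2) * g x a b)
          i j k l) := by
  have hs := M.inv_symm hx
  have h2 : ∀ a b i j, pd D a (pd D b (fun y => (f y • g y) i j)) x
      = pd D a (pd D b f) x * g x i j + pd D b f x * pd D a (fun y => g y i j) x
        + (pd D a f x * pd D b (fun y => g y i j) x + f x * pd D a (pd D b (fun y => g y i j)) x) := by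
    intro a b i j
    have e : Set.EqOn (pd D b (fun y => (f y • g y) i j))
        (fun y => pd D b f y * g y i j + f y * pd D b (fun y => g y i j) y) D := fun y hy =>
      pd_mul M.dom hf (M.smooth i j) hy b
    have s := M.smooth i j
    rw [pd_congr e a hx, pd_add M.dom ((ContDiffOn.pd M.dom hf _).mul s)
      (hf.mul (ContDiffOn.pd M.dom s _)) hx, pd_mul M.dom (ContDiffOn.pd M.dom hf _) s hx,
      pd_mul M.dom hf (ContDiffOn.pd M.dom s _) hx]
  have hV' : ∀ j v, bil (g x)⁻¹ v (fun m => g x m j) = v j := fun j v => by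
    rw [bil_comm hs, M.bil_metric_left hx]
  have hh : ∀ a b, bil (g x)⁻¹ (chrV D g a b x) (fun m => pd D m f x)
      = pd D a (pd D b f) x - hess D g f a b x := fun a b => by
    rw [M.bil_chrV_left hx]; simp [hess]
  have hh' : ∀ a b, bil (g x)⁻¹ (fun m => pd D m f x) (chrV D g a b x)
      = pd D a (pd D b f) x - hess D g f a b x := fun a b => by
    rw [bil_comm hs, hh]
  have hsc : ∀ v w, bil ((f x)⁻¹ • (g x)⁻¹) v w = (f x)⁻¹ * bil (g x)⁻¹ v w := by
    intro v w
    simp only [bil, Matrix.smul_apply, smul_eq_mul, Finset.mul_sum]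
    exact Finset.sum_congr rfl fun _ _ => Finset.sum_congr rfl fun _ _ => by ring
  have hf0 := h0 x hx
  -- Both curvatures are expanded into second derivatives and products of symbols of the first kind.
  -- Products of such a symbol with `df` complete `∂∂f` to the Hessian (`hh`, `hh'`), metricity
  -- removes the first derivatives of `g`, and a rational identity remains.
  rw [(M.conformal hf h0).riemannLow_eq hx, M.riemannLow_eq hx]
  simp only [h2]
  rw [M.inv_conformal hx hf0, hsc, hsc]
  simp only [M.chrV_conformal hf hx, bil_add_left, bil_add_right, bil_sub_left, bil_sub_right,
    bil_smul_left, bil_smul_right, M.bil_metric_left hx, hV', hh, hh', kn, M.pd_metric hx]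
  simp only [chrV, Pi.add_apply, Pi.sub_apply, Pi.smul_apply, smul_eq_mul, M.chrL_symm hx k l j,
    M.chrL_symm hx j l k, M.chrL_symm hx k j i, M.chrL_symm hx l j i, M.chrL_symm hx i l k,
    M.chrL_symm hx l k i, M.chrL_symm hx k l i, M.chrL_symm hx l k j, M.symm x hx j i,
    M.symm x hx k i, M.symm x hx l i, M.symm x hx l k]
  field_simp
  ring

end IsMetric
end AdS

/-! ### Locality of curvature, and the metric `Ω⁻² g` where `Ω ≠ 0`. -/

namespace AdS

section Inter

variable {n : ℕ} {D U : Set (Fin n → ℝ)} {g : (Fin n → ℝ) → Matrix (Fin n) (Fin n) ℝ}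
  {x : Fin n → ℝ}

/-- Curvature is local. This is needed because `Ω⁻² g` is a metric only off the boundary, whereas
all derivatives in the hypotheses are taken within the whole domain. -/
theorem christoffel_inter (hU : IsOpen U) (hx : x ∈ U) (i j k : Fin n) :
    christoffel (D ∩ U) g i j k x = christoffel D g i j k x := by
  simp only [christoffel, pd_inter hU hx]

theorem riemann_inter (hU : IsOpen U) (hx : x ∈ D) (hx' : x ∈ U) (i j k l : Fin n) :
    riemann (D ∩ U) g i j k l x = riemann D g i j k l x := by
  have h : ∀ a i j k, pd (D ∩ U) a (christoffel (D ∩ U) g i j k) x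
      = pd D a (christoffel D g i j k) x := by
    intro a i j k
    rw [← pd_inter (D := D) hU hx' a (f := christoffel D g i j k)]
    exact pd_congr (D := D ∩ U) (f := christoffel (D ∩ U) g i j k) (g := christoffel D g i j k)
      (fun y hy => christoffel_inter hU hy.2 i j k) a ⟨hx, hx'⟩
  simp only [riemann, h, christoffel_inter hU hx']

theorem riemannLow_inter (hU : IsOpen U) (hx : x ∈ D) (hx' : x ∈ U) (i j k l : Fin n) :
    riemannLow (D ∩ U) g i j k l x = riemannLow D g i j k l x := by
  simp only [riemannLow, riemann_inter hU hx hx']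

theorem ricci_inter (hU : IsOpen U) (hx : x ∈ D) (hx' : x ∈ U) (j l : Fin n) :
    ricci (D ∩ U) g j l x = ricci D g j l x := by
  simp only [ricci, riemann_inter hU hx hx']

theorem schouten_inter (hU : IsOpen U) (hx : x ∈ D) (hx' : x ∈ U) (j l : Fin n) :
    schouten (D ∩ U) g j l x = schouten D g j l x := by
  simp only [schouten, scalarCurv, ricci_inter hU hx hx']

theorem weyl_inter (hU : IsOpen U) (hx : x ∈ D) (hx' : x ∈ U) (i j k l : Fin n) :
    weyl (D ∩ U) g i j k l x = weyl D g i j k l x := by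
  simp only [weyl, riemannLow_inter hU hx hx', schouten_inter hU hx hx']

theorem hess_inter (hU : IsOpen U) (hx : x ∈ D) (hx' : x ∈ U) (f : (Fin n → ℝ) → ℝ)
    (j k : Fin n) : hess (D ∩ U) g f j k x = hess D g f j k x := by
  have h : pd (D ∩ U) j (pd (D ∩ U) k f) x = pd D j (pd D k f) x := by
    rw [← pd_inter (D := D) hU hx' j (f := pd D k f)]
    exact pd_congr (D := D ∩ U) (f := pd (D ∩ U) k f) (g := pd D k f)
      (fun y hy => pd_inter hU hy.2 k) j ⟨hx, hx'⟩
  simp only [hess, h, pd_inter hU hx', christoffel_inter hU hx']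

theorem IsMetric.inter (M : IsMetric D g) (hU : IsOpen U) : IsMetric (D ∩ U) g where
  dom := ⟨M.dom.unique.inter hU, fun z hz => by
    have h : U ∩ closure (interior D) ⊆ closure (U ∩ interior D) := hU.inter_closure
    have h2 : U ∩ interior D = interior (D ∩ U) := by
      rw [interior_inter, hU.interior_eq, Set.inter_comm]
    rw [← h2]
    exact h ⟨hz.2, M.dom.dense hz.1⟩⟩
  smooth i j := (M.smooth i j).mono Set.inter_subset_left
  symm x hx := M.symm x hx.1
  det x hx := M.det x hx.1

end Inter

namespace IsMetric

variable {n : ℕ} {D : Set (Fin n → ℝ)} {g : (Fin n → ℝ) → Matrix (Fin n) (Fin n) ℝ}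
  {x : Fin n → ℝ} {om : (Fin n → ℝ) → ℝ}

/-- `|df|²`. -/
noncomputable def gradSq (D : Set (Fin n → ℝ)) (g : (Fin n → ℝ) → Matrix (Fin n) (Fin n) ℝ)
    (f : (Fin n → ℝ) → ℝ) (x : Fin n → ℝ) : ℝ :=
  bil (g x)⁻¹ (fun m => pd D m f x) (fun m => pd D m f x)

theorem riemannLow_rescaled (M : IsMetric D g) (ho : ContDiffOn ℝ ∞ om D)
    (h0 : ∀ x ∈ D, om x ≠ 0) (hx : x ∈ D) (i j k l : Fin n) :
    riemannLow D (fun x => (om x ^ 2)⁻¹ • g x) i j k l x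
      = (om x ^ 2)⁻¹ * (riemannLow D g i j k l x - kn (g x) (fun a b =>
        gradSq D g om x / (2 * om x ^ 2) * g x a b - hess D g om a b x / om x) i j k l) := by
  have hf : ContDiffOn ℝ ∞ (fun x => (om x ^ 2)⁻¹) D :=
    (ho.pow 2).inv fun x hx => pow_ne_zero 2 (h0 x hx)
  have hf0 : ∀ x ∈ D, (om x ^ 2)⁻¹ ≠ 0 := fun x hx => inv_ne_zero (pow_ne_zero 2 (h0 x hx))
  -- The derivatives of `Ω⁻²` are found by differentiating `Ω⁻² Ω² = 1`.
  have h1 : ∀ y ∈ D, ∀ a, pd D a (fun x => (om x ^ 2)⁻¹) y * om y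
      = -2 * ((om y ^ 2)⁻¹ * pd D a om y) := by
    intro y hy a
    have e : Set.EqOn (fun x => (om x ^ 2)⁻¹ * (om x * om x)) (fun _ => (1 : ℝ)) D := fun z hz => by
      have := h0 z hz
      simp only
      field_simp
    have h := pd_congr e a hy
    rw [pd_const, pd_mul M.dom hf (ho.mul ho) hy, pd_mul M.dom ho ho hy] at h
    have := h0 y hy
    have h' : (pd D a (fun x => (om x ^ 2)⁻¹) y * om y + 2 * ((om y ^ 2)⁻¹ * pd D a om y)) * om y
        = 0 := by linarith
    have := (mul_eq_zero.1 h').resolve_right this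
    linarith
  have h2 : ∀ a b, pd D a (pd D b (fun x => (om x ^ 2)⁻¹)) x * om x
      = - pd D b (fun x => (om x ^ 2)⁻¹) x * pd D a om x
        - 2 * (pd D a (fun x => (om x ^ 2)⁻¹) x * pd D b om x
          + (om x ^ 2)⁻¹ * pd D a (pd D b om) x) := by
    intro a b
    have h := pd_congr (fun y hy => h1 y hy b) a hx
    rw [pd_mul M.dom (ContDiffOn.pd M.dom hf b) ho hx,
      pd_const_mul M.dom _ (hf.mul (ContDiffOn.pd M.dom ho b)) hx,
      pd_mul M.dom hf (ContDiffOn.pd M.dom ho b) hx] at h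
    linarith
  have ho0 := h0 x hx
  have h1' : ∀ a, pd D a (fun x => (om x ^ 2)⁻¹) x = (-2 / om x ^ 3) * pd D a om x := by
    intro a
    have := h1 x hx a
    field_simp at this ⊢
    linarith
  have hb : bil (g x)⁻¹ (fun m => pd D m (fun x => (om x ^ 2)⁻¹) x)
      (fun m => pd D m (fun x => (om x ^ 2)⁻¹) x) = (-2 / om x ^ 3) ^ 2 * gradSq D g om x := by
    simp only [h1']
    change bil _ ((-2 / om x ^ 3) • fun m => pd D m om x) ((-2 / om x ^ 3) • fun m => pd D m om x)
      = _
    rw [bil_smul_left, bil_smul_right, gradSq]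
    ring
  have hh : ∀ a b, hess D g (fun x => (om x ^ 2)⁻¹) a b x
      = (-2 / om x ^ 3) * hess D g om a b x + 6 / om x ^ 4 * (pd D a om x * pd D b om x) := by
    intro a b
    have h3 := h2 a b
    simp only [hess, h1'] at h3 ⊢
    have h4 : ∑ m, christoffel D g m a b x * (-2 / om x ^ 3 * pd D m om x)
        = (-2 / om x ^ 3) * ∑ m, christoffel D g m a b x * pd D m om x := by
      rw [Finset.mul_sum]
      exact Finset.sum_congr rfl fun m _ => by ring
    rw [h4]
    have h5 : pd D a (pd D b fun x => (om x ^ 2)⁻¹) x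
        = (-(-2 / om x ^ 3 * pd D b om x) * pd D a om x
        - 2 * (-2 / om x ^ 3 * pd D a om x * pd D b om x
          + (om x ^ 2)⁻¹ * pd D a (pd D b om) x)) / om x := by
      rw [eq_div_iff ho0, h3]
    rw [h5]
    field_simp
    ring
  -- For `f = Ω⁻²` the terms quadratic in `∂_a Ω ∂_b Ω` cancel: the Hessian of `f` contributes `3
  -- Ω⁻²` and the square of `df` contributes `-3 Ω⁻²`. Only the Hessian of `Ω` and a multiple of the
  -- metric survive.
  rw [M.riemannLow_conformal hf hf0 hx]
  congr 2
  congr 1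
  funext a b
  rw [hh, hb, h1', h1']
  field_simp
  ring

/-- The rescaled curvature is visibly a trace-free tensor plus a Kulkarni–Nomizu product, so
`schouten_of_riemannLow` reads off its Schouten tensor. -/
theorem schouten_rescaled (M : IsMetric D g) (h2 : (n : ℝ) - 2 ≠ 0) (h1 : (n : ℝ) - 1 ≠ 0)
    (ho : ContDiffOn ℝ ∞ om D) (h0 : ∀ x ∈ D, om x ≠ 0) (hx : x ∈ D) (j l : Fin n) :
    schouten D (fun x => (om x ^ 2)⁻¹ • g x) j l x = schouten D g j l x
      + hess D g om j l x / om x - gradSq D g om x / (2 * om x ^ 2) * g x j l := by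
  have hf : ContDiffOn ℝ ∞ (fun x => (om x ^ 2)⁻¹) D :=
    (ho.pow 2).inv fun x hx => pow_ne_zero 2 (h0 x hx)
  have hf0 : ∀ x ∈ D, (om x ^ 2)⁻¹ ≠ 0 := fun x hx => inv_ne_zero (pow_ne_zero 2 (h0 x hx))
  refine (M.conformal hf hf0).schouten_of_riemannLow hx h2 h1
    (fun j l => schouten D g j l x + hess D g om j l x / om x
      - gradSq D g om x / (2 * om x ^ 2) * g x j l)
    (fun i j k l => (om x ^ 2)⁻¹ * weyl D g i j k l x) ?_ ?_ j l
  · intro j l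
    rw [M.inv_conformal hx (hf0 x hx)]
    have := M.trace_weyl hx h2 h1 j l
    simp only [Matrix.smul_apply, smul_eq_mul]
    rw [← this]
    refine Finset.sum_congr rfl fun i _ => Finset.sum_congr rfl fun m _ => ?_
    have := h0 x hx
    field_simp
  · intro i j k l
    rw [M.riemannLow_rescaled ho h0 hx, weyl_eq]
    simp only [kn, Matrix.smul_apply, smul_eq_mul]
    ring

theorem weyl_rescaled (M : IsMetric D g) (h2 : (n : ℝ) - 2 ≠ 0) (h1 : (n : ℝ) - 1 ≠ 0)
    (ho : ContDiffOn ℝ ∞ om D) (h0 : ∀ x ∈ D, om x ≠ 0) (hx : x ∈ D) (i j k l : Fin n) :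
    weyl D (fun x => (om x ^ 2)⁻¹ • g x) i j k l x = (om x ^ 2)⁻¹ * weyl D g i j k l x := by
  rw [weyl_eq, weyl_eq, M.riemannLow_rescaled ho h0 hx]
  simp only [M.schouten_rescaled h2 h1 ho h0 hx, kn, Matrix.smul_apply, smul_eq_mul]
  ring

theorem schouten_of_einstein (M : IsMetric D g) (h2 : (n : ℝ) - 2 ≠ 0) (h1 : (n : ℝ) - 1 ≠ 0)
    (hx : x ∈ D) {lam : ℝ} (h : ∀ i j, ricci D g i j x = lam * g x i j) (j l : Fin n) :
    schouten D g j l x = lam / (2 * ((n : ℝ) - 1)) * g x j l := by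
  have hs : scalarCurv D g x = lam * n := by
    rw [← M.trace_metric hx, Finset.mul_sum]
    simp only [scalarCurv, h, Finset.mul_sum]
    refine Finset.sum_congr rfl fun i _ => Finset.sum_congr rfl fun m _ => ?_
    rw [M.symm x hx i m]
    ring
  simp only [schouten, hs, h]
  field_simp
  ring

/-! ### Symmetries of the Weyl tensor -/

theorem weyl_antisymm_right (M : IsMetric D g) (hx : x ∈ D) (i j k l : Fin n) :
    weyl D g i j k l x = - weyl D g i j l k x := by
  rw [weyl_eq, weyl_eq, M.riemannLow_antisymm_right hx]
  simp only [kn]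
  ring

theorem weyl_antisymm_left (M : IsMetric D g) (hx : x ∈ D) (i j k l : Fin n) :
    weyl D g i j k l x = - weyl D g j i k l x := by
  rw [weyl_eq, weyl_eq, M.riemannLow_antisymm_left hx]
  simp only [kn]
  ring

theorem weyl_pair (M : IsMetric D g) (hx : x ∈ D) (i j k l : Fin n) :
    weyl D g i j k l x = weyl D g k l i j x := by
  rw [weyl_eq, weyl_eq, M.riemannLow_pair hx]
  simp only [kn, M.symm x hx k i, M.symm x hx k j, M.symm x hx l i, M.symm x hx l j,
    M.schouten_symm hx k i, M.schouten_symm hx k j, M.schouten_symm hx l i, M.schouten_symm hx l j]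
  ring

theorem weyl_cyclic (M : IsMetric D g) (hx : x ∈ D) (i j k l : Fin n) :
    weyl D g i j k l x + weyl D g i k l j x + weyl D g i l j k x = 0 := by
  have := M.riemannLow_cyclic hx i j k l
  simp only [weyl_eq, kn, M.symm x hx k j, M.symm x hx l j, M.symm x hx l k,
    M.schouten_symm hx k j, M.schouten_symm hx l j, M.schouten_symm hx l k]
  linarith

/-- The gradient vector `g^{mn} ∂_n f`. -/
noncomputable def grad (D : Set (Fin n → ℝ)) (g : (Fin n → ℝ) → Matrix (Fin n) (Fin n) ℝ)
    (f : (Fin n → ℝ) → ℝ) (m : Fin n) (x : Fin n → ℝ) : ℝ := ∑ k, (g x)⁻¹ m k * pd D k f x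

theorem grad_smooth (M : IsMetric D g) (ho : ContDiffOn ℝ ∞ om D) (m : Fin n) :
    ContDiffOn ℝ ∞ (grad D g om m) D :=
  ContDiffOn.sum fun _ _ => (M.inv_smooth _ _).mul (ContDiffOn.pd M.dom ho _)

theorem lower_grad (M : IsMetric D g) (hx : x ∈ D) (i : Fin n) :
    ∑ m, g x i m * grad D g om m x = pd D i om x := M.lower_raise hx _ i

theorem gradSq_eq : gradSq D g om = fun x => ∑ m, grad D g om m x * pd D m om x := by
  funext x
  simp only [gradSq, grad, bil, Finset.sum_mul]
  rw [Finset.sum_comm]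
  conv_rhs => rw [Finset.sum_comm]
  exact Finset.sum_congr rfl fun _ _ => Finset.sum_congr rfl fun _ _ => by ring

theorem gradSq_smooth (M : IsMetric D g) (ho : ContDiffOn ℝ ∞ om D) :
    ContDiffOn ℝ ∞ (gradSq D g om) D := by
  rw [gradSq_eq]
  exact ContDiffOn.sum fun m _ => (M.grad_smooth ho m).mul (ContDiffOn.pd M.dom ho m)

theorem pd_gradSq (M : IsMetric D g) (ho : ContDiffOn ℝ ∞ om D) (hx : x ∈ D) (a : Fin n) :
    pd D a (gradSq D g om) x = 2 * ∑ m, grad D g om m x * hess D g om a m x := by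
  have dg := M.grad_smooth ho
  have dp := fun m => ContDiffOn.pd M.dom ho m
  have h1 : pd D a (gradSq D g om) x
      = ∑ m, pd D a (grad D g om m) x * pd D m om x
        + ∑ m, grad D g om m x * pd D a (pd D m om) x := by
    rw [gradSq_eq, pd_sum M.dom _ (fun m => (dg m).mul (dp m)) hx, ← Finset.sum_add_distrib]
    exact Finset.sum_congr rfl fun m _ => pd_mul M.dom (dg m) (dp m) hx a
  -- Differentiating `∂_m Ω = g_{mk} ∇^k Ω` avoids derivatives of the inverse metric.
  have h2 : ∀ m, pd D a (pd D m om) x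
      = ∑ k, (chrL D g m a k x + chrL D g k a m x) * grad D g om k x
        + ∑ k, g x m k * pd D a (grad D g om k) x := by
    intro m
    have e : Set.EqOn (pd D m om) (fun y => ∑ k, g y m k * grad D g om k y) D := fun y hy =>
      (M.lower_grad hy m).symm
    rw [pd_congr e a hx, pd_sum M.dom _ (fun k => (M.smooth m k).mul (dg k)) hx,
      ← Finset.sum_add_distrib]
    refine Finset.sum_congr rfl fun k _ => ?_
    rw [pd_mul M.dom (M.smooth m k) (dg k) hx, M.pd_metric hx]
  have h3 : ∑ m, grad D g om m x * ∑ k, g x m k * pd D a (grad D g om k) x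
      = ∑ k, pd D a (grad D g om k) x * pd D k om x := by
    simp only [Finset.mul_sum]
    rw [Finset.sum_comm]
    refine Finset.sum_congr rfl fun k _ => ?_
    rw [← M.lower_grad (om := om) hx k, Finset.mul_sum]
    exact Finset.sum_congr rfl fun m _ => by rw [M.symm x hx m k]; ring
  have h4 : ∑ m, grad D g om m x * ∑ k, chrL D g m a k x * grad D g om k x
      = ∑ m, grad D g om m x * ∑ k, chrL D g k a m x * grad D g om k x := by
    simp only [Finset.mul_sum]
    rw [Finset.sum_comm]
    exact Finset.sum_congr rfl fun _ _ => Finset.sum_congr rfl fun _ _ => by ring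
  have h5 : ∀ m, ∑ k, chrL D g k a m x * grad D g om k x
      = ∑ k, christoffel D g k a m x * pd D k om x := by
    intro m
    simp only [← M.lower_christoffel hx, ← M.lower_grad (om := om) hx, Finset.mul_sum,
      Finset.sum_mul]
    rw [Finset.sum_comm]
    exact Finset.sum_congr rfl fun _ _ => Finset.sum_congr rfl fun _ _ => by
      rw [M.symm x hx]; ring
  have h6 : ∑ m, grad D g om m x * pd D a (pd D m om) x
      = 2 * (∑ m, grad D g om m x * ∑ k, christoffel D g k a m x * pd D k om x)
        + ∑ k, pd D a (grad D g om k) x * pd D k om x := by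
    simp only [h2, mul_add, add_mul, Finset.sum_add_distrib, h3, h4, h5]
    ring
  simp only [hess, mul_sub, Finset.sum_sub_distrib]
  rw [h1, h6]
  linarith

end IsMetric
end AdS

/-! ### The conformal field equations, up to and including the boundary. -/

namespace AdS

/-- A conformally extended solution of `Ric[Ω⁻² g] = lam Ω⁻² g` in coordinates on a half-space
domain, with rescaled Weyl tensor `W`. -/
structure IsSolution (lam : ℝ) (D : Set (Fin 4 → ℝ)) (g : (Fin 4 → ℝ) → Matrix (Fin 4) (Fin 4) ℝ)
    (om : (Fin 4 → ℝ) → ℝ) (W : (Fin 4 → ℝ) → Fin 4 → Fin 4 → Fin 4 → Fin 4 → ℝ) : Prop where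
  half : IsHalfDomain D 1
  met : IsMetric D g
  om_smooth : ContDiffOn ℝ ∞ om D
  W_smooth : ∀ i j k l, ContDiffOn ℝ ∞ (fun z => W z i j k l) D
  om_pos : ∀ z ∈ D, z 1 ≠ 0 → 0 < om z
  om_zero : ∀ z ∈ D, z 1 = 0 → om z = 0
  einstein : ∀ z ∈ D, z 1 ≠ 0 → ∀ μ ν,
    ricci D (fun w => (om w ^ 2)⁻¹ • g w) μ ν z = lam * ((om z ^ 2)⁻¹ * g z μ ν)
  weyl : ∀ z ∈ D, ∀ i j k l, om z * W z i j k l = weyl D g i j k l z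

namespace IsSolution

open IsMetric

variable {lam : ℝ} {D : Set (Fin 4 → ℝ)} {g : (Fin 4 → ℝ) → Matrix (Fin 4) (Fin 4) ℝ}
  {om : (Fin 4 → ℝ) → ℝ} {W : (Fin 4 → ℝ) → Fin 4 → Fin 4 → Fin 4 → Fin 4 → ℝ}
  {z : Fin 4 → ℝ}

theorem four_sub_two : ((4 : ℕ) : ℝ) - 2 ≠ 0 := by norm_num

theorem four_sub_one : ((4 : ℕ) : ℝ) - 1 ≠ 0 := by norm_num

/-- Off the boundary `Ω` can be cancelled, and both sides are continuous up to it. Each field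
equation below is first obtained with a factor `Ω`, which is removed here. -/
theorem cancel_om (S : IsSolution lam D g om W) {f h : (Fin 4 → ℝ) → ℝ} (hf : ContDiffOn ℝ ∞ f D)
    (hh : ContDiffOn ℝ ∞ h D) (e : ∀ z ∈ D, z 1 ≠ 0 → om z * f z = om z * h z) (hz : z ∈ D) :
    f z = h z :=
  S.half.eqOn hf.continuousOn hh.continuousOn
    (fun w hw h1 => mul_left_cancel₀ (ne_of_gt (S.om_pos w hw h1)) (e w hw h1)) hz

/-- The interior of the domain. -/
theorem interior (S : IsSolution lam D g om W) :
    IsMetric (D ∩ {z | 0 < z 1}) g ∧ ContDiffOn ℝ ∞ om (D ∩ {z | 0 < z 1}) ∧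
      ∀ x ∈ D ∩ {z | 0 < z 1}, om x ≠ 0 :=
  ⟨S.met.inter (isOpen_pos 1), S.om_smooth.mono Set.inter_subset_left,
    fun x hx => ne_of_gt (S.om_pos x hx.1 (ne_of_gt hx.2))⟩

theorem pos_of_ne (S : IsSolution lam D g om W) (hz : z ∈ D) (h : z 1 ≠ 0) :
    z ∈ D ∩ {z | 0 < z 1} :=
  ⟨hz, lt_of_le_of_ne (S.half.nonneg hz) (Ne.symm h)⟩

/-- The trace-free conformal Einstein equation. -/
theorem hess_om (S : IsSolution lam D g om W) (hz : z ∈ D) (a b : Fin 4) :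
    om z * hess D g om a b z + om z ^ 2 * schouten D g a b z
      = (lam / 6 + gradSq D g om z / 2) * g z a b := by
  have sm := S.om_smooth
  refine S.half.eqOn (f := fun z => om z * hess D g om a b z + om z ^ 2 * schouten D g a b z)
    (g := fun z => (lam / 6 + gradSq D g om z / 2) * g z a b) ?_ ?_ (fun w hw h1 => ?_) hz
  · exact ((sm.mul (S.met.hess_smooth sm a b)).add
      ((sm.pow 2).mul (S.met.schouten_smooth a b))).continuousOn
  · exact ((contDiffOn_const.add ((S.met.gradSq_smooth sm).div_const 2)).mul
      (S.met.smooth a b)).continuousOn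
  · have hp := S.pos_of_ne hw h1
    obtain ⟨M, so, h0⟩ := S.interior
    have hU := isOpen_pos (1 : Fin 4)
    have hf : ContDiffOn ℝ ∞ (fun x => (om x ^ 2)⁻¹) (D ∩ {z | 0 < z 1}) :=
      (so.pow 2).inv fun x hx => pow_ne_zero 2 (h0 x hx)
    have hf0 : ∀ x ∈ D ∩ {z | 0 < z 1}, (om x ^ 2)⁻¹ ≠ 0 := fun x hx =>
      inv_ne_zero (pow_ne_zero 2 (h0 x hx))
    -- In dimension four an Einstein metric has Schouten tensor `λ/6` times the metric. The
    -- transformation law of the Schouten tensor, multiplied by `Ω²`, is the claim.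
    have e := (M.conformal hf hf0).schouten_of_einstein (lam := lam) four_sub_two four_sub_one hp
      (fun i j => by
        rw [ricci_inter hU hp.1 hp.2, S.einstein w hw h1]
        simp) a b
    rw [M.schouten_rescaled four_sub_two four_sub_one so h0 hp, schouten_inter hU hp.1 hp.2,
      hess_inter hU hp.1 hp.2] at e
    have hg : gradSq (D ∩ {z | 0 < z 1}) g om w = gradSq D g om w := by
      simp only [gradSq, pd_inter hU hp.2]
    rw [hg] at e
    have := h0 w hp
    simp only [Matrix.smul_apply, smul_eq_mul, Nat.cast_ofNat] at e
    field_simp at e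
    norm_num at e
    field_simp
    linarith

/-- The Friedrich scalar. -/
noncomputable def fs (D : Set (Fin 4 → ℝ)) (g : (Fin 4 → ℝ) → Matrix (Fin 4) (Fin 4) ℝ)
    (om : (Fin 4 → ℝ) → ℝ) (z : Fin 4 → ℝ) : ℝ :=
  (1 / 4) * ∑ i, ∑ m, (g z)⁻¹ i m * (hess D g om m i z + om z * schouten D g m i z)

theorem fs_smooth (S : IsSolution lam D g om W) : ContDiffOn ℝ ∞ (fs D g om) D :=
  contDiffOn_const.mul (ContDiffOn.sum fun _ _ => ContDiffOn.sum fun _ _ =>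
    (S.met.inv_smooth _ _).mul ((S.met.hess_smooth S.om_smooth _ _).add
      (S.om_smooth.mul (S.met.schouten_smooth _ _))))

/-- The trace of `hess_om`. In the usual form this is the constraint `6 Ω s - 3 |dΩ|² = λ`; at `Ω =
0` it fixes the length of `dΩ`. -/
theorem om_mul_fs (S : IsSolution lam D g om W) (hz : z ∈ D) :
    om z * fs D g om z = lam / 6 + gradSq D g om z / 2 := by
  have h : om z * fs D g om z
      = (1 / 4) * ((lam / 6 + gradSq D g om z / 2) * ∑ i, ∑ m, (g z)⁻¹ i m * g z m i) := by
    simp only [fs, Finset.mul_sum]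
    refine Finset.sum_congr rfl fun i _ => Finset.sum_congr rfl fun m _ => ?_
    have := S.hess_om hz m i
    linear_combination (1 / 4) * (g z)⁻¹ i m * this
  rw [h, S.met.trace_metric hz]
  norm_num
  ring

/-- The conformal field equation for the Hessian of the conformal factor. -/
theorem hess_eq (S : IsSolution lam D g om W) (hz : z ∈ D) (a b : Fin 4) :
    hess D g om a b z = - (om z * schouten D g a b z) + fs D g om z * g z a b := by
  refine S.cancel_om (f := hess D g om a b)
    (h := fun z => - (om z * schouten D g a b z) + fs D g om z * g z a b)
    (S.met.hess_smooth S.om_smooth a b)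
    ((S.om_smooth.mul (S.met.schouten_smooth a b)).neg.add (S.fs_smooth.mul (S.met.smooth a b)))
    (fun w hw _ => ?_) hz
  have := S.hess_om hw a b
  rw [← S.om_mul_fs hw] at this
  linarith

/-- Differentiating the constraint `om_mul_fs` produces the Hessian of `Ω` contracted with `∇Ω`.
Inserting `hess_eq` cancels `s ∂_a Ω`, and every remaining term has a factor `Ω`. -/
theorem pd_fs (S : IsSolution lam D g om W) (hz : z ∈ D) (a : Fin 4) :
    pd D a (fs D g om) z = - ∑ m, schouten D g a m z * grad D g om m z := by
  refine S.cancel_om (f := pd D a (fs D g om))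
    (h := fun z => - ∑ m, schouten D g a m z * grad D g om m z)
    (ContDiffOn.pd S.met.dom S.fs_smooth a)
    (ContDiffOn.sum fun m _ => (S.met.schouten_smooth a m).mul
      (S.met.grad_smooth S.om_smooth m)).neg (fun w hw _ => ?_) hz
  have e : Set.EqOn (fun z => 2 * (om z * fs D g om z)) (fun z => lam / 3 + gradSq D g om z) D :=
    fun y hy => by
      simp only
      rw [S.om_mul_fs hy]
      ring
  have h := pd_congr e a hw
  rw [pd_const_mul S.met.dom _ (S.om_smooth.mul S.fs_smooth) hw,
    pd_mul S.met.dom S.om_smooth S.fs_smooth hw,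
    pd_add S.met.dom contDiffOn_const (S.met.gradSq_smooth S.om_smooth) hw, pd_const,
    S.met.pd_gradSq S.om_smooth hw] at h
  have h2 : ∑ m, grad D g om m w * hess D g om a m w
      = - (om w * ∑ m, schouten D g a m w * grad D g om m w) + fs D g om w * pd D a om w := by
    rw [← S.met.lower_grad hw, Finset.mul_sum, Finset.mul_sum, ← Finset.sum_neg_distrib,
      ← Finset.sum_add_distrib]
    refine Finset.sum_congr rfl fun m _ => ?_
    rw [S.hess_eq hw]
    ring
  rw [h2] at h
  linarith

/-! ### The rescaled Weyl tensor -/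

theorem riemannLow_eq (S : IsSolution lam D g om W) (hz : z ∈ D) (i j k l : Fin 4) :
    riemannLow D g i j k l z
      = om z * W z i j k l + kn (g z) (fun a b => schouten D g a b z) i j k l := by
  rw [S.weyl z hz, weyl_eq]
  ring

theorem W_antisymm_right (S : IsSolution lam D g om W) (hz : z ∈ D) (i j k l : Fin 4) :
    W z i j k l = - W z i j l k :=
  S.cancel_om (f := fun z => W z i j k l) (h := fun z => - W z i j l k) (S.W_smooth _ _ _ _)
    (S.W_smooth _ _ _ _).neg (fun w hw _ => by
      rw [mul_neg, S.weyl w hw, S.weyl w hw, S.met.weyl_antisymm_right hw]) hz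

theorem W_antisymm_left (S : IsSolution lam D g om W) (hz : z ∈ D) (i j k l : Fin 4) :
    W z i j k l = - W z j i k l :=
  S.cancel_om (f := fun z => W z i j k l) (h := fun z => - W z j i k l) (S.W_smooth _ _ _ _)
    (S.W_smooth _ _ _ _).neg (fun w hw _ => by
      rw [mul_neg, S.weyl w hw, S.weyl w hw, S.met.weyl_antisymm_left hw]) hz

theorem W_pair (S : IsSolution lam D g om W) (hz : z ∈ D) (i j k l : Fin 4) :
    W z i j k l = W z k l i j :=
  S.cancel_om (f := fun z => W z i j k l) (h := fun z => W z k l i j) (S.W_smooth _ _ _ _)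
    (S.W_smooth _ _ _ _) (fun w hw _ => by
      rw [S.weyl w hw, S.weyl w hw, S.met.weyl_pair hw]) hz

theorem W_cyclic (S : IsSolution lam D g om W) (hz : z ∈ D) (i j k l : Fin 4) :
    W z i j k l + W z i k l j + W z i l j k = 0 :=
  S.cancel_om (f := fun z => W z i j k l + W z i k l j + W z i l j k) (h := fun _ => 0)
    (((S.W_smooth _ _ _ _).add (S.W_smooth _ _ _ _)).add (S.W_smooth _ _ _ _)) contDiffOn_const
    (fun w hw _ => by
      rw [mul_add, mul_add, S.weyl w hw, S.weyl w hw, S.weyl w hw, S.met.weyl_cyclic hw,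
        mul_zero]) hz

theorem W_trace (S : IsSolution lam D g om W) (hz : z ∈ D) (j l : Fin 4) :
    ∑ i, ∑ m, (g z)⁻¹ i m * W z m j i l = 0 :=
  S.cancel_om (f := fun z => ∑ i, ∑ m, (g z)⁻¹ i m * W z m j i l) (h := fun _ => 0)
    (ContDiffOn.sum fun _ _ => ContDiffOn.sum fun _ _ =>
      (S.met.inv_smooth _ _).mul (S.W_smooth _ _ _ _)) contDiffOn_const
    (fun w hw _ => by
      rw [mul_zero, ← S.met.trace_weyl hw four_sub_two four_sub_one j l, Finset.mul_sum]
      refine Finset.sum_congr rfl fun i _ => ?_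
      rw [Finset.mul_sum]
      refine Finset.sum_congr rfl fun m _ => ?_
      rw [← S.weyl w hw]
      ring) hz

theorem covDeriv_smooth (M : IsMetric D g) {T : Fin 4 → Fin 4 → (Fin 4 → ℝ) → ℝ}
    (hT : ∀ i j, ContDiffOn ℝ ∞ (T i j) D) (c a b : Fin 4) :
    ContDiffOn ℝ ∞ (covDeriv D g T c a b) D :=
  (ContDiffOn.pd M.dom (hT _ _) _).sub (ContDiffOn.sum fun _ _ =>
    ((M.christoffel_smooth _ _ _).mul (hT _ _)).add ((M.christoffel_smooth _ _ _).mul (hT _ _)))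

/-- The Cotton tensor of the conformal metric. -/
theorem cotton_eq (S : IsSolution lam D g om W) (hz : z ∈ D) (j k l : Fin 4) :
    covDeriv D g (schouten D g) k l j z - covDeriv D g (schouten D g) l k j z
      = ∑ i, grad D g om i z * W z i j k l := by
  have sL := S.met.schouten_smooth
  refine S.cancel_om
    (f := fun z => covDeriv D g (schouten D g) k l j z - covDeriv D g (schouten D g) l k j z)
    (h := fun z => ∑ i, grad D g om i z * W z i j k l)
    ((covDeriv_smooth S.met sL k l j).sub (covDeriv_smooth S.met sL l k j))
    (ContDiffOn.sum fun i _ => (S.met.grad_smooth S.om_smooth i).mul (S.W_smooth i j k l))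
    (fun w hw _ => ?_) hz
  have hc : ∀ c a b, covDeriv D g (hess D g om) c a b w
      = - (pd D c om w * schouten D g a b w) - om w * covDeriv D g (schouten D g) c a b w
        + pd D c (fs D g om) w * g w a b := by
    intro c a b
    have e : Set.EqOn (hess D g om a b)
        (fun z => fs D g om z * g z a b - om z * schouten D g a b z) D := fun y hy => by
      simp only
      rw [S.hess_eq hy]
      ring
    have hm := S.met.covDeriv_metric hw c a b
    simp only [covDeriv] at hm ⊢
    rw [pd_congr e c hw, pd_sub S.met.dom (S.fs_smooth.mul (S.met.smooth a b))
      (S.om_smooth.mul (sL a b)) hw, pd_mul S.met.dom S.fs_smooth (S.met.smooth a b) hw,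
      pd_mul S.met.dom S.om_smooth (sL a b) hw]
    have h2 : ∑ m, (christoffel D g m c a w * hess D g om m b w
        + christoffel D g m c b w * hess D g om a m w)
        = fs D g om w * ∑ m, (christoffel D g m c a w * g w m b
          + christoffel D g m c b w * g w a m)
          - om w * ∑ m, (christoffel D g m c a w * schouten D g m b w
            + christoffel D g m c b w * schouten D g a m w) := by
      rw [Finset.mul_sum, Finset.mul_sum, ← Finset.sum_sub_distrib]
      refine Finset.sum_congr rfl fun m _ => ?_
      rw [S.hess_eq hw, S.hess_eq hw]
      ring
    rw [h2]
    linear_combination fs D g om w * hm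
  -- The antisymmetrised derivative of the Hessian is a curvature term. After inserting `hess_eq`,
  -- the Kulkarni–Nomizu part of the curvature cancels the terms with `dΩ ⊗ L` and `ds ⊗ g`, leaving
  -- `Ω` times the Cotton equation.
  have hr := S.met.ricci_identity hw S.om_smooth j k l
  have h3 : ∑ i, riemann D g i j k l w * pd D i om w
      = ∑ i, grad D g om i w * riemannLow D g i j k l w := by
    simp only [← S.met.lower_grad hw, riemannLow, Finset.mul_sum]
    rw [Finset.sum_comm]
    refine Finset.sum_congr rfl fun i _ => Finset.sum_congr rfl fun m _ => ?_
    rw [S.met.symm w hw m i]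
    ring
  have h4 : ∑ i, grad D g om i w * riemannLow D g i j k l w
      = om w * ∑ i, grad D g om i w * W w i j k l
        + (pd D k om w * schouten D g j l w - pd D l om w * schouten D g j k w
          + g w j l * (∑ i, schouten D g k i w * grad D g om i w)
          - g w j k * (∑ i, schouten D g l i w * grad D g om i w)) := by
    rw [← S.met.lower_grad hw k, ← S.met.lower_grad hw l]
    simp only [Finset.mul_sum, Finset.sum_mul, ← Finset.sum_add_distrib, ← Finset.sum_sub_distrib]
    refine Finset.sum_congr rfl fun i _ => ?_
    rw [S.riemannLow_eq hw]
    simp only [kn]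
    rw [S.met.symm w hw i k, S.met.symm w hw i l, S.met.schouten_symm hw i l,
      S.met.schouten_symm hw i k]
    ring
  rw [hc, hc, h3, h4, S.pd_fs hw, S.pd_fs hw, S.met.schouten_symm hw l j,
    S.met.schouten_symm hw k j, S.met.symm w hw l j, S.met.symm w hw k j] at hr
  linarith

theorem covDeriv_schouten_symm (M : IsMetric D g) (hz : z ∈ D) (m i k : Fin 4) :
    covDeriv D g (schouten D g) m k i z = covDeriv D g (schouten D g) m i k z := by
  simp only [covDeriv]
  rw [pd_congr (fun y hy => M.schouten_symm hy k i) m hz]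
  congr 1
  refine Finset.sum_congr rfl fun p _ => ?_
  rw [M.schouten_symm hz p i, M.schouten_symm hz k p]
  ring

/-- The trace of the Cotton tensor vanishes. -/
theorem div_schouten (S : IsSolution lam D g om W) (hz : z ∈ D) (k : Fin 4) :
    ∑ m, ∑ i, (g z)⁻¹ m i * covDeriv D g (schouten D g) m i k z
      = ∑ m, ∑ i, (g z)⁻¹ m i * covDeriv D g (schouten D g) k m i z := by
  have h : ∑ m, ∑ i, (g z)⁻¹ m i * (covDeriv D g (schouten D g) m k i z
      - covDeriv D g (schouten D g) k m i z) = 0 := by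
    simp only [S.cotton_eq hz, Finset.mul_sum]
    have e : ∀ p, ∑ m, ∑ i, (g z)⁻¹ m i * (grad D g om p z * W z p i m k) = 0 := by
      intro p
      have := S.W_trace hz p k
      rw [← mul_zero (- grad D g om p z), ← this]
      simp only [Finset.mul_sum]
      refine Finset.sum_congr rfl fun m _ => Finset.sum_congr rfl fun i _ => ?_
      rw [S.W_antisymm_left hz p i m k]
      ring
    have e2 : ∑ m, ∑ i, ∑ p, (g z)⁻¹ m i * (grad D g om p z * W z p i m k)
        = ∑ p, ∑ m, ∑ i, (g z)⁻¹ m i * (grad D g om p z * W z p i m k) := by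
      rw [Finset.sum_comm]
      conv_rhs => rw [Finset.sum_comm]
      conv_rhs => enter [2, m]; rw [Finset.sum_comm]
      rw [Finset.sum_comm]
    rw [e2]
    simp only [e, Finset.sum_const_zero]
  simp only [fun m i => covDeriv_schouten_symm S.met hz m i k, mul_sub,
    Finset.sum_sub_distrib] at h
  linarith

theorem covDeriv_ricci (S : IsSolution lam D g om W) (hz : z ∈ D) (k j l : Fin 4) :
    covDeriv D g (ricci D g) k j l z = 2 * covDeriv D g (schouten D g) k j l z
      + g z j l * pd D k (fun y => ∑ i, ∑ m, (g y)⁻¹ i m * schouten D g m i y) z := by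
  have M := S.met
  have st : ContDiffOn ℝ ∞ (fun y => ∑ i, ∑ m, (g y)⁻¹ i m * schouten D g m i y) D :=
    ContDiffOn.sum fun _ _ => ContDiffOn.sum fun _ _ =>
      (M.inv_smooth _ _).mul (M.schouten_smooth _ _)
  have e : ∀ j l, Set.EqOn (ricci D g j l) (fun z => 2 * schouten D g j l z
      + g z j l * ∑ i, ∑ m, (g z)⁻¹ i m * schouten D g m i z) D := fun j l y hy => by
    rw [M.ricci_eq_schouten hy four_sub_two four_sub_one]
    norm_num
  have hm := M.covDeriv_metric hz k j l
  simp only [covDeriv] at hm ⊢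
  rw [pd_congr (e j l) k hz, pd_add M.dom (contDiffOn_const.mul (M.schouten_smooth _ _))
    ((M.smooth j l).mul st) hz, pd_const_mul M.dom _ (M.schouten_smooth _ _) hz,
    pd_mul M.dom (M.smooth j l) st hz]
  have h2 : ∑ m, (christoffel D g m k j z * ricci D g m l z
      + christoffel D g m k l z * ricci D g j m z)
      = 2 * ∑ m, (christoffel D g m k j z * schouten D g m l z
        + christoffel D g m k l z * schouten D g j m z)
        + (∑ m, (christoffel D g m k j z * g z m l + christoffel D g m k l z * g z j m))
          * ∑ i, ∑ m, (g z)⁻¹ i m * schouten D g m i z := by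
    rw [Finset.mul_sum, Finset.sum_mul, ← Finset.sum_add_distrib]
    refine Finset.sum_congr rfl fun m _ => ?_
    rw [e m l hz, e j m hz]
    ring
  rw [h2]
  linear_combination (∑ i, ∑ m, (g z)⁻¹ i m * schouten D g m i z) * hm

theorem pd_inv (M : IsMetric D g) (hz : z ∈ D) (k i q : Fin 4) :
    pd D k (fun y => (g y)⁻¹ i q) z = - ∑ p, (christoffel D g i k p z * (g z)⁻¹ p q
      + christoffel D g q k p z * (g z)⁻¹ i p) := by
  have h1 : ∀ n, ∑ m, pd D k (fun y => (g y)⁻¹ i m) z * g z m n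
      = - ∑ m, (g z)⁻¹ i m * (chrL D g m k n z + chrL D g n k m z) := by
    intro n
    have e : Set.EqOn (fun y => ∑ m, (g y)⁻¹ i m * g y m n) (fun _ => if i = n then (1 : ℝ) else 0)
      D := fun y hy => M.inv_mul hy i n
    have h := pd_congr e k hz
    rw [pd_const, pd_sum M.dom _ (fun m => (M.inv_smooth i m).mul (M.smooth m n)) hz] at h
    have h2 : ∀ m, pd D k (fun y => (g y)⁻¹ i m * g y m n) z
        = pd D k (fun y => (g y)⁻¹ i m) z * g z m n
          + (g z)⁻¹ i m * (chrL D g m k n z + chrL D g n k m z) := fun m => by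
      rw [pd_mul M.dom (M.inv_smooth i m) (M.smooth m n) hz, M.pd_metric hz]
    simp only [h2, Finset.sum_add_distrib] at h
    linarith
  have h3 : pd D k (fun y => (g y)⁻¹ i q) z
      = ∑ n, (∑ m, pd D k (fun y => (g y)⁻¹ i m) z * g z m n) * (g z)⁻¹ n q := by
    simp only [Finset.sum_mul]
    rw [Finset.sum_comm]
    have : ∀ m, ∑ n, pd D k (fun y => (g y)⁻¹ i m) z * g z m n * (g z)⁻¹ n q
        = pd D k (fun y => (g y)⁻¹ i m) z * if m = q then 1 else 0 := fun m => by
      rw [← M.mul_inv hz m q, Finset.mul_sum]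
      exact Finset.sum_congr rfl fun _ _ => by ring
    simp [this]
  rw [h3]
  simp only [h1, christoffel_eq, neg_mul, Finset.sum_neg_distrib, Finset.sum_add_distrib, mul_add,
    Finset.sum_mul, add_mul]
  congr 2
  rw [Finset.sum_comm]
  refine Finset.sum_congr rfl fun a _ => Finset.sum_congr rfl fun b _ => ?_
  rw [M.inv_symm hz q b]
  ring

/-- The covariant derivative commutes with traces. -/
theorem pd_trace (M : IsMetric D g) {T : Fin 4 → Fin 4 → (Fin 4 → ℝ) → ℝ}
    (hT : ∀ i j, ContDiffOn ℝ ∞ (T i j) D) (hz : z ∈ D) (k : Fin 4) :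
    pd D k (fun y => ∑ i, ∑ m, (g y)⁻¹ i m * T m i y) z
      = ∑ i, ∑ m, (g z)⁻¹ i m * covDeriv D g T k m i z := by
  have h1 : pd D k (fun y => ∑ i, ∑ m, (g y)⁻¹ i m * T m i y) z
      = ∑ i, ∑ m, (pd D k (fun y => (g y)⁻¹ i m) z * T m i z + (g z)⁻¹ i m * pd D k (T m i) z) := by
    rw [pd_sum M.dom _ (fun i => ContDiffOn.sum fun m _ => (M.inv_smooth i m).mul (hT m i)) hz]
    refine Finset.sum_congr rfl fun i _ => ?_
    rw [pd_sum M.dom _ (fun m => (M.inv_smooth i m).mul (hT m i)) hz]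
    exact Finset.sum_congr rfl fun m _ => pd_mul M.dom (M.inv_smooth i m) (hT m i) hz k
  have h2 : ∑ i, ∑ m, (∑ p, christoffel D g i k p z * (g z)⁻¹ p m) * T m i z
      = ∑ i, ∑ m, (g z)⁻¹ i m * ∑ p, christoffel D g p k i z * T m p z := by
    simp only [Finset.sum_mul, Finset.mul_sum]
    rw [Finset.sum_comm]
    conv_rhs => rw [Finset.sum_comm]
    refine Finset.sum_congr rfl fun m _ => ?_
    rw [Finset.sum_comm]
    exact Finset.sum_congr rfl fun _ _ => Finset.sum_congr rfl fun _ _ => by ring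
  have h3 : ∑ i, ∑ m, (∑ p, christoffel D g m k p z * (g z)⁻¹ i p) * T m i z
      = ∑ i, ∑ m, (g z)⁻¹ i m * ∑ p, christoffel D g p k m z * T p i z := by
    simp only [Finset.sum_mul, Finset.mul_sum]
    refine Finset.sum_congr rfl fun i _ => ?_
    rw [Finset.sum_comm]
    exact Finset.sum_congr rfl fun _ _ => Finset.sum_congr rfl fun _ _ => by ring
  rw [h1]
  simp only [pd_inv M hz, covDeriv, Finset.sum_add_distrib, neg_mul, add_mul, mul_sub, mul_add,
    Finset.sum_sub_distrib, Finset.sum_neg_distrib, h2, h3]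
  ring

/-- The Bianchi equation for the rescaled Weyl tensor, multiplied with the conformal factor. -/
theorem om_mul_div_W (S : IsSolution lam D g om W) (hz : z ∈ D) (j k l : Fin 4) :
    om z * ∑ m, ∑ i, (g z)⁻¹ m i * covDeriv4 D g (fun i j k l z => W z i j k l) m i j k l z
      = 0 := by
  have M := S.met
  have sk : ∀ i j k l, ContDiffOn ℝ ∞ (fun y => kn (g y) (fun a b => schouten D g a b y) i j k l)
      D := by
    intro i j k l
    have := M.smooth
    have := M.schouten_smooth
    simp only [kn]
    exact ((((M.smooth _ _).mul (this _ _)).sub ((M.smooth _ _).mul (this _ _))).add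
      ((M.smooth _ _).mul (this _ _))).sub ((M.smooth _ _).mul (this _ _))
  have h1 : ∀ m i, covDeriv4 D g (riemannLow D g) m i j k l z
      = pd D m om z * W z i j k l
        + om z * covDeriv4 D g (fun i j k l z => W z i j k l) m i j k l z
        + kn (g z) (fun a b => covDeriv D g (schouten D g) m a b z) i j k l := by
    intro m i
    rw [← M.covDeriv4_kn hz M.schouten_smooth]
    have e : pd D m (riemannLow D g i j k l) z = pd D m om z * W z i j k l
        + om z * pd D m (fun z => W z i j k l) z
        + pd D m (fun y => kn (g y) (fun a b => schouten D g a b y) i j k l) z := by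
      rw [pd_congr (fun y hy => S.riemannLow_eq hy i j k l) m hz,
        pd_add M.dom (S.om_smooth.mul (S.W_smooth i j k l)) (sk i j k l) hz,
        pd_mul M.dom S.om_smooth (S.W_smooth i j k l) hz]
    simp only [covDeriv4, e, mul_sub, Finset.mul_sum, S.riemannLow_eq hz]
    have : ∀ a b c s t u : ℝ, s = t + u → a + b + c - s = a + (b - t) + (c - u) :=
      fun _ _ _ _ _ _ h => by rw [h]; ring
    refine this _ _ _ _ _ _ ?_
    rw [← Finset.sum_add_distrib]
    exact Finset.sum_congr rfl fun p _ => by ring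
  have h2 : ∑ m, ∑ i, (g z)⁻¹ m i * (pd D m om z * W z i j k l)
      = ∑ i, grad D g om i z * W z i j k l := by
    simp only [grad, Finset.sum_mul]
    rw [Finset.sum_comm]
    exact Finset.sum_congr rfl fun i _ => Finset.sum_congr rfl fun m _ => by
      rw [M.inv_symm hz]; ring
  have h3 : ∀ f : Fin 4 → Fin 4 → ℝ, ∑ m, ∑ i, (g z)⁻¹ m i * (om z * f m i)
      = om z * ∑ m, ∑ i, (g z)⁻¹ m i * f m i := by
    intro f
    simp only [Finset.mul_sum]
    exact Finset.sum_congr rfl fun _ _ => Finset.sum_congr rfl fun _ _ => by ring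
  have h4 : ∑ m, ∑ i, (g z)⁻¹ m i
      * kn (g z) (fun a b => covDeriv D g (schouten D g) m a b z) i j k l
      = covDeriv D g (schouten D g) k j l z - covDeriv D g (schouten D g) l j k z
        + g z j l * (∑ m, ∑ i, (g z)⁻¹ m i * covDeriv D g (schouten D g) m i k z)
        - g z j k * (∑ m, ∑ i, (g z)⁻¹ m i * covDeriv D g (schouten D g) m i l z) := by
    have c1 := M.contract_left hz k (fun m => covDeriv D g (schouten D g) m j l z)
    have c2 := M.contract_left hz l (fun m => covDeriv D g (schouten D g) m j k z)
    rw [← c1, ← c2]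
    simp only [kn, Finset.mul_sum, ← Finset.sum_add_distrib, ← Finset.sum_sub_distrib]
    exact Finset.sum_congr rfl fun _ _ => Finset.sum_congr rfl fun _ _ => by ring
  have h5 : ∀ k, ∑ m, ∑ i, (g z)⁻¹ m i * covDeriv D g (schouten D g) m i k z
      = pd D k (fun y => ∑ i, ∑ m, (g y)⁻¹ i m * schouten D g m i y) z := by
    intro k
    rw [S.div_schouten hz, pd_trace M M.schouten_smooth hz]
    refine Finset.sum_congr rfl fun m _ => Finset.sum_congr rfl fun i _ => ?_
    rw [covDeriv_schouten_symm M hz]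
  -- The contracted Bianchi identity for the curvature `ΩW + g ∧ L`. The factor `2` in
  -- `covDeriv_ricci` is matched by two copies of the Cotton tensor: one from the term `∇Ω · W`, by
  -- `cotton_eq`, and one from the divergence of the Kulkarni–Nomizu part. Only `Ω div W` is left
  -- over.
  have h := M.divergence_riemannLow hz j k l
  simp only [h1, mul_add, Finset.sum_add_distrib] at h
  rw [h2, h3, h4, h5, h5, S.covDeriv_ricci hz, S.covDeriv_ricci hz, ← S.cotton_eq hz,
    covDeriv_schouten_symm M hz k j l, covDeriv_schouten_symm M hz l j k] at h
  linarith

/-- The Bianchi equation for the rescaled Weyl tensor. -/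
theorem div_W (S : IsSolution lam D g om W) (hz : z ∈ D) (j k l : Fin 4) :
    ∑ m, ∑ i, (g z)⁻¹ m i * covDeriv4 D g (fun i j k l z => W z i j k l) m i j k l z = 0 := by
  have M := S.met
  refine S.cancel_om (f := fun z => ∑ m, ∑ i, (g z)⁻¹ m i
    * covDeriv4 D g (fun i j k l z => W z i j k l) m i j k l z) (h := fun _ => 0)
    (ContDiffOn.sum fun m _ => ContDiffOn.sum fun i _ => (M.inv_smooth m i).mul ?_)
    contDiffOn_const (fun w hw _ => by rw [S.om_mul_div_W hw, mul_zero]) hz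
  have c := M.christoffel_smooth
  have w := S.W_smooth
  exact (ContDiffOn.pd M.dom (w _ _ _ _) _).sub (ContDiffOn.sum fun p _ =>
    ((((c _ _ _).mul (w _ _ _ _)).add ((c _ _ _).mul (w _ _ _ _))).add
      ((c _ _ _).mul (w _ _ _ _))).add ((c _ _ _).mul (w _ _ _ _)))

end IsSolution
end AdS

namespace AdS

/-! ## Hypersurfaces -/

/-- The metric induced on the coordinate hyperplane `x^N = 0`. -/
def indMet {n : ℕ} (N : Fin (n + 1)) (g : (Fin (n + 1) → ℝ) → Matrix (Fin (n + 1)) (Fin (n + 1)) ℝ)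
    (y : Fin n → ℝ) : Matrix (Fin n) (Fin n) ℝ :=
  Matrix.of fun a b => g (hyp N y) (N.succAbove a) (N.succAbove b)

namespace IsMetric

variable {n : ℕ} {N : Fin (n + 1)} {D : Set (Fin (n + 1) → ℝ)}
  {g : (Fin (n + 1) → ℝ) → Matrix (Fin (n + 1)) (Fin (n + 1)) ℝ} {y : Fin n → ℝ}

/-- The inverse of the induced metric is the Schur complement of the entry `g^{NN}` in the inverse
metric. Nondegeneracy of the hypersurface thus reduces to `g^{NN} ≠ 0`. -/
theorem indMet_mul (M : IsMetric D g) (hy : hyp N y ∈ D) (hN : (g (hyp N y))⁻¹ N N ≠ 0) :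
    indMet N g y * (Matrix.of fun a b => (g (hyp N y))⁻¹ (N.succAbove a) (N.succAbove b)
      - (g (hyp N y))⁻¹ (N.succAbove a) N * (g (hyp N y))⁻¹ N (N.succAbove b)
        / (g (hyp N y))⁻¹ N N) = 1 := by
  ext a c
  have h1 := M.mul_inv hy (N.succAbove a) (N.succAbove c)
  have h2 := M.mul_inv hy (N.succAbove a) N
  rw [Fin.sum_univ_succAbove _ N] at h1 h2
  simp only [Fin.succAbove_ne, if_false] at h2
  simp only [Matrix.mul_apply, indMet, Matrix.of_apply, mul_sub, Finset.sum_sub_distrib,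
    Matrix.one_apply]
  have h3 : ∑ b, g (hyp N y) (N.succAbove a) (N.succAbove b) * ((g (hyp N y))⁻¹ (N.succAbove b) N
      * (g (hyp N y))⁻¹ N (N.succAbove c) / (g (hyp N y))⁻¹ N N)
      = (∑ b, g (hyp N y) (N.succAbove a) (N.succAbove b) * (g (hyp N y))⁻¹ (N.succAbove b) N)
        * (g (hyp N y))⁻¹ N (N.succAbove c) / (g (hyp N y))⁻¹ N N := by
    rw [Finset.sum_mul, Finset.sum_div]
    exact Finset.sum_congr rfl fun _ _ => by ring
  rw [h3, eq_neg_of_add_eq_zero_right h2]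
  simp only [Fin.succAbove_right_inj] at h1
  rw [← h1]
  field_simp
  ring

theorem ind (M : IsMetric D g) (hE : IsRegularDomain (hyp N ⁻¹' D))
    (hN : ∀ y ∈ hyp N ⁻¹' D, (g (hyp N y))⁻¹ N N ≠ 0) :
    IsMetric (hyp N ⁻¹' D) (indMet N g) where
  dom := hE
  smooth i j := ContDiffOn.comp_hyp N (M.smooth (N.succAbove i) (N.succAbove j))
  symm y hy i j := M.symm _ hy _ _
  det y hy h0 := by
    have := congrArg Matrix.det (M.indMet_mul hy (hN y hy))
    rw [Matrix.det_mul, h0, zero_mul, Matrix.det_one] at this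
    exact zero_ne_one this

theorem indMet_inv (M : IsMetric D g) (hy : hyp N y ∈ D) (hN : (g (hyp N y))⁻¹ N N ≠ 0)
    (a b : Fin n) : (indMet N g y)⁻¹ a b = (g (hyp N y))⁻¹ (N.succAbove a) (N.succAbove b)
      - (g (hyp N y))⁻¹ (N.succAbove a) N * (g (hyp N y))⁻¹ N (N.succAbove b)
        / (g (hyp N y))⁻¹ N N := by
  rw [Matrix.inv_eq_right_inv (M.indMet_mul hy hN)]
  rfl

/-- Symbols of the first kind with tangential indices contain only tangential derivatives of
tangential components. So the two geometries differ only in how indices are raised, which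
`bil_indMet_inv` describes. -/
theorem chrL_ind (M : IsMetric D g) (hE : IsRegularDomain (hyp N ⁻¹' D)) (hy : hyp N y ∈ D)
    (a b c : Fin n) : chrL (hyp N ⁻¹' D) (indMet N g) a b c y
      = chrL D g (N.succAbove a) (N.succAbove b) (N.succAbove c) (hyp N y) := by
  have h : ∀ k i j, pd (hyp N ⁻¹' D) k (fun y => indMet N g y i j) y
      = pd D (N.succAbove k) (fun z => g z (N.succAbove i) (N.succAbove j)) (hyp N y) :=
    fun k i j => pd_hyp N (M.smooth _ _) hE hy k
  simp only [chrL, h]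

/-- The inverse of the induced metric as the restriction of the inverse metric. -/
theorem bil_indMet_inv (M : IsMetric D g) (hy : hyp N y ∈ D) (hN : (g (hyp N y))⁻¹ N N ≠ 0)
    (v w : Fin (n + 1) → ℝ) :
    bil (indMet N g y)⁻¹ (fun a => v (N.succAbove a)) (fun a => w (N.succAbove a))
      = bil (g (hyp N y))⁻¹ v w - (∑ m, (g (hyp N y))⁻¹ N m * v m)
        * (∑ m, (g (hyp N y))⁻¹ N m * w m) / (g (hyp N y))⁻¹ N N := by
  set H := (g (hyp N y))⁻¹ with hH
  have hs : ∀ i j, H i j = H j i := M.inv_symm hy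
  have h1 : bil (indMet N g y)⁻¹ (fun a => v (N.succAbove a)) (fun a => w (N.succAbove a))
      = ∑ a, ∑ b, H (N.succAbove a) (N.succAbove b) * v (N.succAbove a) * w (N.succAbove b)
        - (∑ a, H N (N.succAbove a) * v (N.succAbove a))
          * (∑ b, H N (N.succAbove b) * w (N.succAbove b)) / H N N := by
    simp only [bil, M.indMet_inv hy hN, ← hH, sub_mul, Finset.sum_sub_distrib]
    congr 1
    rw [Finset.sum_mul_sum, Finset.sum_div]
    refine Finset.sum_congr rfl fun a _ => ?_
    rw [Finset.sum_div]
    refine Finset.sum_congr rfl fun b _ => ?_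
    rw [hs (N.succAbove a) N]
    ring
  rw [h1]
  simp only [bil]
  rw [Fin.sum_univ_succAbove _ N, Fin.sum_univ_succAbove (fun m => H N m * v m) N,
    Fin.sum_univ_succAbove (fun m => H N m * w m) N,
    Fin.sum_univ_succAbove (fun j => H N j * v N * w j) N]
  have h2 : ∑ a, ∑ j, H (N.succAbove a) j * v (N.succAbove a) * w j
      = (∑ a, H N (N.succAbove a) * v (N.succAbove a)) * w N
        + ∑ a, ∑ b, H (N.succAbove a) (N.succAbove b) * v (N.succAbove a) * w (N.succAbove b) := by
    rw [Finset.sum_mul, ← Finset.sum_add_distrib]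
    refine Finset.sum_congr rfl fun a _ => ?_
    rw [Fin.sum_univ_succAbove _ N, hs (N.succAbove a) N]
  have h3 : ∑ b, H N (N.succAbove b) * v N * w (N.succAbove b)
      = v N * ∑ b, H N (N.succAbove b) * w (N.succAbove b) := by
    rw [Finset.mul_sum]
    exact Finset.sum_congr rfl fun _ _ => by ring
  rw [h2, h3]
  have : H N N ≠ 0 := hN
  field_simp
  ring

/-- The Gauss equation.  The second fundamental form with respect to the conormal `dx^N` is
`-Γ^N_{ab}`. -/
theorem gauss (M : IsMetric D g) (hE : IsRegularDomain (hyp N ⁻¹' D))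
    (hN : ∀ y ∈ hyp N ⁻¹' D, (g (hyp N y))⁻¹ N N ≠ 0) (hy : hyp N y ∈ D) (a b c d : Fin n) :
    riemannLow (hyp N ⁻¹' D) (indMet N g) a b c d y
      = riemannLow D g (N.succAbove a) (N.succAbove b) (N.succAbove c) (N.succAbove d) (hyp N y)
        + (christoffel D g N (N.succAbove a) (N.succAbove c) (hyp N y)
            * christoffel D g N (N.succAbove b) (N.succAbove d) (hyp N y)
          - christoffel D g N (N.succAbove a) (N.succAbove d) (hyp N y)
            * christoffel D g N (N.succAbove b) (N.succAbove c) (hyp N y))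
          / (g (hyp N y))⁻¹ N N := by
  have h2 : ∀ k l i j, pd (hyp N ⁻¹' D) k (pd (hyp N ⁻¹' D) l (fun y => indMet N g y i j)) y
      = pd D (N.succAbove k) (pd D (N.succAbove l)
        (fun z => g z (N.succAbove i) (N.succAbove j))) (hyp N y) := by
    intro k l i j
    rw [← pd_hyp N (ContDiffOn.pd M.dom (M.smooth _ _) _) hE hy k]
    exact pd_congr (fun w hw => pd_hyp N (M.smooth _ _) hE hw l) k hy
  have hV : ∀ b c, chrV (hyp N ⁻¹' D) (indMet N g) b c y
      = fun a => chrV D g (N.succAbove b) (N.succAbove c) (hyp N y) (N.succAbove a) := fun b c =>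
    funext fun a => M.chrL_ind hE hy a b c
  have hK : ∀ b c, ∑ m, (g (hyp N y))⁻¹ N m * chrV D g b c (hyp N y) m
      = christoffel D g N b c (hyp N y) := fun b c => by rw [christoffel_eq]; rfl
  -- The second derivatives agree on both sides. The products of symbols are contracted with inverse
  -- metrics that differ by the conormal direction, and this difference is the quadratic term in
  -- `Γ^N`.
  rw [(M.ind hE hN).riemannLow_eq hy, M.riemannLow_eq hy]
  simp only [h2, hV, M.bil_indMet_inv hy (hN y hy), hK]
  ring

/-- The Gauss formula: the covariant derivative of tangential fields splits into the intrinsic one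
and a multiple of the normal vector `g^{N·}`. -/
theorem christoffel_ind (M : IsMetric D g) (hE : IsRegularDomain (hyp N ⁻¹' D))
    (hN : ∀ y ∈ hyp N ⁻¹' D, (g (hyp N y))⁻¹ N N ≠ 0) (hy : hyp N y ∈ D) (a b c : Fin n) :
    christoffel D g (N.succAbove a) (N.succAbove b) (N.succAbove c) (hyp N y)
      = christoffel (hyp N ⁻¹' D) (indMet N g) a b c y
        + (g (hyp N y))⁻¹ N (N.succAbove a)
          * christoffel D g N (N.succAbove b) (N.succAbove c) (hyp N y)
          / (g (hyp N y))⁻¹ N N := by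
  have hs := M.inv_symm hy
  have h0 := hN y hy
  simp only [christoffel_eq, M.chrL_ind hE hy, M.indMet_inv hy h0, sub_mul,
    Finset.sum_sub_distrib]
  rw [Fin.sum_univ_succAbove _ N, Fin.sum_univ_succAbove (fun m => (g (hyp N y))⁻¹ N m
    * chrL D g m (N.succAbove b) (N.succAbove c) (hyp N y)) N]
  have h1 : ∑ x, (g (hyp N y))⁻¹ (N.succAbove a) N * (g (hyp N y))⁻¹ N (N.succAbove x)
      / (g (hyp N y))⁻¹ N N * chrL D g (N.succAbove x) (N.succAbove b) (N.succAbove c) (hyp N y)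
      = (g (hyp N y))⁻¹ N (N.succAbove a) / (g (hyp N y))⁻¹ N N
        * ∑ x, (g (hyp N y))⁻¹ N (N.succAbove x)
          * chrL D g (N.succAbove x) (N.succAbove b) (N.succAbove c) (hyp N y) := by
    rw [Finset.mul_sum]
    exact Finset.sum_congr rfl fun x _ => by rw [hs (N.succAbove a) N]; ring
  rw [h1, hs (N.succAbove a) N]
  field_simp
  ring

/-- The Codazzi equation. -/
theorem codazzi (M : IsMetric D g) (hE : IsRegularDomain (hyp N ⁻¹' D))
    (hN : ∀ y ∈ hyp N ⁻¹' D, (g (hyp N y))⁻¹ N N ≠ 0) (hy : hyp N y ∈ D) (b c d : Fin n) :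
    riemann D g N (N.succAbove b) (N.succAbove c) (N.succAbove d) (hyp N y)
      = covDeriv (hyp N ⁻¹' D) (indMet N g)
          (fun a b y => christoffel D g N (N.succAbove a) (N.succAbove b) (hyp N y)) c d b y
        - covDeriv (hyp N ⁻¹' D) (indMet N g)
          (fun a b y => christoffel D g N (N.succAbove a) (N.succAbove b) (hyp N y)) d c b y
        + christoffel D g N (N.succAbove d) (N.succAbove b) (hyp N y)
          * ((∑ m, (g (hyp N y))⁻¹ N m * christoffel D g N (N.succAbove c) m (hyp N y))
            / (g (hyp N y))⁻¹ N N)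
        - christoffel D g N (N.succAbove c) (N.succAbove b) (hyp N y)
          * ((∑ m, (g (hyp N y))⁻¹ N m * christoffel D g N (N.succAbove d) m (hyp N y))
            / (g (hyp N y))⁻¹ N N) := by
  have h0 := hN y hy
  have hp : ∀ c d b, pd (hyp N ⁻¹' D) c
      (fun y => christoffel D g N (N.succAbove d) (N.succAbove b) (hyp N y)) y
      = pd D (N.succAbove c) (christoffel D g N (N.succAbove d) (N.succAbove b)) (hyp N y) :=
    fun c d b => pd_hyp N (M.christoffel_smooth _ _ _) hE hy c
  -- The sum over `m` is split along the normal vector and the hypersurface. The normal part carries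
  -- the rate of change of the conormal `dx^N` along itself; it is present because `dx^N` is not
  -- normalised.
  have hsum : ∀ c d, ∑ m, christoffel D g N (N.succAbove c) m (hyp N y)
        * christoffel D g m (N.succAbove d) (N.succAbove b) (hyp N y)
      = christoffel D g N (N.succAbove d) (N.succAbove b) (hyp N y)
          * ((∑ m, (g (hyp N y))⁻¹ N m * christoffel D g N (N.succAbove c) m (hyp N y))
            / (g (hyp N y))⁻¹ N N)
        + ∑ e, christoffel (hyp N ⁻¹' D) (indMet N g) e d b y
          * christoffel D g N (N.succAbove c) (N.succAbove e) (hyp N y) := by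
    intro c d
    rw [Fin.sum_univ_succAbove _ N, Fin.sum_univ_succAbove (fun m => (g (hyp N y))⁻¹ N m
      * christoffel D g N (N.succAbove c) m (hyp N y)) N]
    have e : ∑ i, christoffel D g N (N.succAbove c) (N.succAbove i) (hyp N y)
        * christoffel D g (N.succAbove i) (N.succAbove d) (N.succAbove b) (hyp N y)
        = ∑ e, christoffel (hyp N ⁻¹' D) (indMet N g) e d b y
          * christoffel D g N (N.succAbove c) (N.succAbove e) (hyp N y)
        + christoffel D g N (N.succAbove d) (N.succAbove b) (hyp N y) / (g (hyp N y))⁻¹ N N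
          * ∑ i, (g (hyp N y))⁻¹ N (N.succAbove i)
            * christoffel D g N (N.succAbove c) (N.succAbove i) (hyp N y) := by
      rw [Finset.mul_sum, ← Finset.sum_add_distrib]
      refine Finset.sum_congr rfl fun i _ => ?_
      rw [M.christoffel_ind hE hN hy]
      ring
    rw [e]
    field_simp
    ring
  have hsy : ∀ e, christoffel (hyp N ⁻¹' D) (indMet N g) e c d y
      = christoffel (hyp N ⁻¹' D) (indMet N g) e d c y := fun e =>
    (M.ind hE hN).christoffel_symm hy e c d
  simp only [riemann, covDeriv, hp, Finset.sum_sub_distrib, Finset.sum_add_distrib, hsum, hsy]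
  ring

end IsMetric
end AdS

/-! ### The conformal boundary: umbilicity, and the Cotton tensor of the induced metric. -/

namespace AdS

/-- A metric with vanishing Cotton tensor has a Codazzi Schouten tensor. -/
theorem codazzi_of_cotton {D : Set (Fin 3 → ℝ)} {k : (Fin 3 → ℝ) → Matrix (Fin 3) (Fin 3) ℝ}
    (M : IsMetric D k) {y : Fin 3 → ℝ} (hy : y ∈ D) (h : ∀ a b, cotton D k a b y = 0)
    (c d b : Fin 3) : covDeriv D k (schouten D k) c d b y = covDeriv D k (schouten D k) d c b y := by
  set s := Real.sqrt |(k y).det|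
  have hs : s ≠ 0 := ne_of_gt (Real.sqrt_pos.2 (abs_pos.2 (M.det y hy)))
  -- Contracting with the inverse metric strips the lowered first index. The three equations that
  -- remain, `a = 0, 1, 2`, are the independent components of the antisymmetrised derivative.
  have h1 : ∀ a, ∑ c, ∑ d, permSymbol a c d / s * covDeriv D k (schouten D k) c d b y = 0 := by
    intro a
    rw [← M.raise_lower hy (fun a => ∑ c, ∑ d, permSymbol a c d / s
      * covDeriv D k (schouten D k) c d b y) a]
    refine Finset.sum_eq_zero fun m _ => ?_
    have := h m b
    simp only [cotton] at this
    rw [show ∑ l, k y m l * ∑ c, ∑ d, permSymbol l c d / s * covDeriv D k (schouten D k) c d b y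
      = 0 from ?_, mul_zero]
    rw [← this]
    refine Finset.sum_congr rfl fun a' _ => ?_
    rw [Finset.mul_sum]
    refine Finset.sum_congr rfl fun c _ => ?_
    rw [Finset.mul_sum]
    exact Finset.sum_congr rfl fun d _ => by ring
  have h0 := h1 0
  have h1' := h1 1
  have h2 := h1 2
  simp [Fin.sum_univ_three, permSymbol] at h0 h1' h2
  field_simp at h0 h1' h2
  fin_cases c <;> fin_cases d <;> simp <;> linarith

namespace IsSolution

open IsMetric

variable {lam : ℝ} {D : Set (Fin 4 → ℝ)} {g : (Fin 4 → ℝ) → Matrix (Fin 4) (Fin 4) ℝ}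
  {om : (Fin 4 → ℝ) → ℝ} {W : (Fin 4 → ℝ) → Fin 4 → Fin 4 → Fin 4 → Fin 4 → ℝ}
  {y : Fin 3 → ℝ}

/-- On the hyperplane `x¹ = 0` the half-space condition is void, so the boundary domain is open. -/
theorem regular_boundary (S : IsSolution lam D g om W) :
    IsRegularDomain (hyp (1 : Fin 4) ⁻¹' D) := by
  obtain ⟨U, hU, h⟩ := S.half
  have e : hyp (1 : Fin 4) ⁻¹' D = hyp (1 : Fin 4) ⁻¹' U := by
    ext w
    rw [h]
    exact ⟨fun hw => hw.1, fun hw => ⟨hw, le_of_eq (hyp_self 1 w).symm⟩⟩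
  rw [e]
  exact isRegularDomain_of_isOpen (hU.preimage (contDiff_hyp 1).continuous)

theorem pd_om_boundary (S : IsSolution lam D g om W) (hy : hyp 1 y ∈ D) (a : Fin 3) :
    pd D ((1 : Fin 4).succAbove a) om (hyp 1 y) = 0 := by
  rw [← pd_hyp 1 S.om_smooth S.regular_boundary hy a]
  exact pd_zero_of_eqOn (D := hyp (1 : Fin 4) ⁻¹' D) (f := fun w => om (hyp 1 w))
    (fun w hw => S.om_zero _ hw (hyp_self 1 w)) hy a

theorem grad_om_boundary (S : IsSolution lam D g om W) (hy : hyp 1 y ∈ D) (m : Fin 4) :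
    grad D g om m (hyp 1 y) = (g (hyp 1 y))⁻¹ m 1 * pd D 1 om (hyp 1 y) := by
  simp only [grad]
  rw [Fin.sum_univ_succAbove _ 1]
  simp [S.pd_om_boundary hy]

/-- The constraint `om_mul_fs` at `Ω = 0`, where `∂₁Ω` is the only nonzero derivative. For `λ < 0`
it shows at once that the conormal `dx¹` is space-like and that `∂₁Ω ≠ 0`. -/
theorem gradSq_boundary (S : IsSolution lam D g om W) (hy : hyp 1 y ∈ D) :
    (g (hyp 1 y))⁻¹ 1 1 * pd D 1 om (hyp 1 y) ^ 2 = - lam / 3 := by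
  have h := S.om_mul_fs hy
  rw [S.om_zero _ hy (hyp_self 1 y), zero_mul, gradSq_eq] at h
  beta_reduce at h
  rw [Fin.sum_univ_succAbove _ 1, S.grad_om_boundary hy] at h
  simp only [S.pd_om_boundary hy, mul_zero, Finset.sum_const_zero, add_zero] at h
  linarith

theorem inv_boundary_ne (S : IsSolution lam D g om W) (hlam : lam < 0) (hy : hyp 1 y ∈ D) :
    (g (hyp 1 y))⁻¹ 1 1 ≠ 0 ∧ pd D 1 om (hyp 1 y) ≠ 0 := by
  have h := S.gradSq_boundary hy
  constructor <;> intro h0 <;> rw [h0] at h <;> simp at h <;> linarith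

/-- The boundary is umbilic. -/
theorem umbilic (S : IsSolution lam D g om W) (hlam : lam < 0) (hy : hyp 1 y ∈ D) (a b : Fin 3) :
    christoffel D g 1 ((1 : Fin 4).succAbove a) ((1 : Fin 4).succAbove b) (hyp 1 y)
      = - (fs D g om (hyp 1 y) / pd D 1 om (hyp 1 y)) * indMet 1 g y a b := by
  -- At `Ω = 0` the tangential Hessian of `Ω` is `s` times the metric. As `Ω` and its tangential
  -- derivatives vanish along `𝒥`, this Hessian reduces to `-Γ¹_{ab} ∂₁Ω`.
  have h := S.hess_eq hy ((1 : Fin 4).succAbove a) ((1 : Fin 4).succAbove b)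
  have h2 : pd D ((1 : Fin 4).succAbove a) (pd D ((1 : Fin 4).succAbove b) om) (hyp 1 y) = 0 := by
    rw [← pd_hyp 1 (ContDiffOn.pd S.met.dom S.om_smooth _) S.regular_boundary hy a]
    exact pd_zero_of_eqOn (D := hyp (1 : Fin 4) ⁻¹' D)
      (f := fun w => pd D ((1 : Fin 4).succAbove b) om (hyp 1 w))
      (fun w hw => S.pd_om_boundary hw b) hy a
  rw [hess, h2, Fin.sum_univ_succAbove _ 1, S.om_zero _ hy (hyp_self 1 y)] at h
  simp only [S.pd_om_boundary hy, mul_zero, Finset.sum_const_zero, add_zero, zero_mul] at h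
  have h0 := (S.inv_boundary_ne hlam hy).2
  rw [← mul_left_inj' h0]
  simp only [indMet, Matrix.of_apply]
  field_simp
  linarith

/-- On `𝒥` the term `ΩW` drops out of the curvature, and by umbilicity the Gauss correction is a
multiple of the Kulkarni–Nomizu square of `k`. Hence the curvature of `k` is itself a
Kulkarni–Nomizu product with `k`, and its second factor is the Schouten tensor of `k`. -/
theorem schouten_boundary (S : IsSolution lam D g om W) (hlam : lam < 0) (hy : hyp 1 y ∈ D)
    (a b : Fin 3) : schouten (hyp 1 ⁻¹' D) (indMet 1 g) a b y
      = schouten D g ((1 : Fin 4).succAbove a) ((1 : Fin 4).succAbove b) (hyp 1 y)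
        - 3 / (2 * lam) * fs D g om (hyp 1 y) ^ 2 * indMet 1 g y a b := by
  have hN : ∀ y ∈ hyp 1 ⁻¹' D, (g (hyp 1 y))⁻¹ 1 1 ≠ 0 := fun y hy =>
    (S.inv_boundary_ne hlam hy).1
  refine (S.met.ind S.regular_boundary hN).schouten_of_riemannLow hy (by norm_num) (by norm_num)
    (fun a b => schouten D g ((1 : Fin 4).succAbove a) ((1 : Fin 4).succAbove b) (hyp 1 y)
        - 3 / (2 * lam) * fs D g om (hyp 1 y) ^ 2 * indMet 1 g y a b) (fun _ _ _ _ => 0)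
    (by simp) (fun i j k l => ?_) a b
  rw [S.met.gauss S.regular_boundary hN hy, S.riemannLow_eq hy, S.om_zero _ hy (hyp_self 1 y)]
  simp only [S.umbilic hlam hy]
  have h1 := S.gradSq_boundary hy
  obtain ⟨h2, h3⟩ := S.inv_boundary_ne hlam hy
  -- The Gauss correction has the factor `(s/∂₁Ω)²/g¹¹`, which equals `-(3/λ) s²` by
  -- `gradSq_boundary`. The coefficient in the claim is half of it, because the Kulkarni–Nomizu
  -- product of `k` with itself counts every term twice.
  have h4 : ∀ X : ℝ, (fs D g om (hyp 1 y) / pd D 1 om (hyp 1 y)) ^ 2 * X / (g (hyp 1 y))⁻¹ 1 1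
      = - 3 / lam * fs D g om (hyp 1 y) ^ 2 * X := by
    intro X
    have : lam = -3 * ((g (hyp 1 y))⁻¹ 1 1 * pd D 1 om (hyp 1 y) ^ 2) := by linarith
    rw [this]
    field_simp
  have h5 := h4 (indMet 1 g y i k * indMet 1 g y j l - indMet 1 g y i l * indMet 1 g y j k)
  have h6 : ∀ p q r s t u : ℝ, (-t * p * (-t * q) - -t * r * (-t * s)) / u
      = t ^ 2 * (p * q - r * s) / u := fun p q r s t u => by ring
  rw [h6, h5]
  simp only [kn]
  have e : ∀ a b, g (hyp 1 y) ((1 : Fin 4).succAbove a) ((1 : Fin 4).succAbove b)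
    = indMet 1 g y a b := fun _ _ => rfl
  simp only [e]
  ring

/-- The intrinsic covariant derivative of the restriction of a symmetric tensor. -/
theorem covDeriv_restrict (M : IsMetric D g) {N : Fin 4} (hE : IsRegularDomain (hyp N ⁻¹' D))
    (hN : ∀ y ∈ hyp N ⁻¹' D, (g (hyp N y))⁻¹ N N ≠ 0) {T : Fin 4 → Fin 4 → (Fin 4 → ℝ) → ℝ}
    (hT : ∀ i j, ContDiffOn ℝ ∞ (T i j) D) (hy : hyp N y ∈ D) (c a b : Fin 3) :
    covDeriv (hyp N ⁻¹' D) (indMet N g) (fun a b y => T (N.succAbove a) (N.succAbove b) (hyp N y))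
        c a b y
      = covDeriv D g T (N.succAbove c) (N.succAbove a) (N.succAbove b) (hyp N y)
        + christoffel D g N (N.succAbove c) (N.succAbove a) (hyp N y) / (g (hyp N y))⁻¹ N N
          * (∑ m, (g (hyp N y))⁻¹ N m * T m (N.succAbove b) (hyp N y))
        + christoffel D g N (N.succAbove c) (N.succAbove b) (hyp N y) / (g (hyp N y))⁻¹ N N
          * (∑ m, (g (hyp N y))⁻¹ N m * T (N.succAbove a) m (hyp N y)) := by
  have h0 := hN y hy
  have h1 : ∀ (a : Fin 3) (v : Fin 4 → ℝ),
      ∑ m, christoffel D g m (N.succAbove c) (N.succAbove a) (hyp N y) * v m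
      = christoffel D g N (N.succAbove c) (N.succAbove a) (hyp N y) / (g (hyp N y))⁻¹ N N
          * (∑ m, (g (hyp N y))⁻¹ N m * v m)
        + ∑ e, christoffel (hyp N ⁻¹' D) (indMet N g) e c a y * v (N.succAbove e) := by
    intro a v
    rw [Fin.sum_univ_succAbove _ N, Fin.sum_univ_succAbove (fun m => (g (hyp N y))⁻¹ N m * v m) N]
    have : ∑ i, christoffel D g (N.succAbove i) (N.succAbove c) (N.succAbove a) (hyp N y)
        * v (N.succAbove i) = ∑ e, christoffel (hyp N ⁻¹' D) (indMet N g) e c a y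
          * v (N.succAbove e) + christoffel D g N (N.succAbove c) (N.succAbove a) (hyp N y)
          / (g (hyp N y))⁻¹ N N * ∑ e, (g (hyp N y))⁻¹ N (N.succAbove e) * v (N.succAbove e) := by
      rw [Finset.mul_sum, ← Finset.sum_add_distrib]
      refine Finset.sum_congr rfl fun i _ => ?_
      rw [M.christoffel_ind hE hN hy]
      ring
    rw [this]
    field_simp
    ring
  simp only [covDeriv, Finset.sum_add_distrib]
  rw [h1 a (fun m => T m (N.succAbove b) (hyp N y)), h1 b (fun m => T (N.succAbove a) m (hyp N y)),
    pd_hyp N (hT _ _) hE hy c]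
  ring

/-- If the boundary is conformally flat, the magnetic part of `W` on the boundary vanishes. -/
theorem W_boundary (S : IsSolution lam D g om W) (hlam : lam < 0) (hy : hyp 1 y ∈ D)
    (hc : ∀ a b, cotton (hyp 1 ⁻¹' D) (indMet 1 g) a b y = 0) (b c d : Fin 3) :
    ∑ i, (g (hyp 1 y))⁻¹ i 1 * W (hyp 1 y) i ((1 : Fin 4).succAbove b)
      ((1 : Fin 4).succAbove c) ((1 : Fin 4).succAbove d) = 0 := by
  have M := S.met
  have hE := S.regular_boundary
  have hN : ∀ y ∈ hyp 1 ⁻¹' D, (g (hyp 1 y))⁻¹ 1 1 ≠ 0 := fun y hy =>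
    (S.inv_boundary_ne hlam hy).1
  have MI := M.ind hE hN
  obtain ⟨h11, ho⟩ := S.inv_boundary_ne hlam hy
  have sf := ContDiffOn.comp_hyp 1 S.fs_smooth
  have sL := fun a b => ContDiffOn.comp_hyp 1 (M.schouten_smooth ((1 : Fin 4).succAbove a)
    ((1 : Fin 4).succAbove b))
  -- The intrinsic derivative of `schouten_boundary`. As `k` is parallel, only `s²` is
  -- differentiated in the correction term.
  have h1 : ∀ c d b, covDeriv (hyp 1 ⁻¹' D) (indMet 1 g) (schouten (hyp 1 ⁻¹' D) (indMet 1 g))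
      c d b y = covDeriv (hyp 1 ⁻¹' D) (indMet 1 g)
        (fun a b y => schouten D g ((1 : Fin 4).succAbove a) ((1 : Fin 4).succAbove b) (hyp 1 y))
          c d b y
        - 3 / lam * fs D g om (hyp 1 y) * pd D ((1 : Fin 4).succAbove c) (fs D g om) (hyp 1 y)
          * indMet 1 g y d b := by
    intro c d b
    have e : ∀ a b, Set.EqOn (schouten (hyp 1 ⁻¹' D) (indMet 1 g) a b)
        (fun y => schouten D g ((1 : Fin 4).succAbove a) ((1 : Fin 4).succAbove b) (hyp 1 y)
          - 3 / (2 * lam) * ((fs D g om (hyp 1 y) * fs D g om (hyp 1 y)) * indMet 1 g y a b))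
        (hyp 1 ⁻¹' D) := fun a b w hw => by
      rw [S.schouten_boundary hlam hw]
      ring
    have hm := MI.covDeriv_metric hy c d b
    simp only [covDeriv] at hm ⊢
    rw [pd_congr (e d b) c hy, pd_sub hE (sL d b)
      (contDiffOn_const.mul ((sf.mul sf).mul (MI.smooth d b))) hy,
      pd_const_mul hE _ ((sf.mul sf).mul (MI.smooth d b)) hy,
      pd_mul hE (sf.mul sf) (MI.smooth d b) hy, pd_mul hE sf sf hy,
      pd_hyp 1 S.fs_smooth hE hy c]
    have h2 : ∑ m, (christoffel (hyp 1 ⁻¹' D) (indMet 1 g) m c d y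
          * schouten (hyp 1 ⁻¹' D) (indMet 1 g) m b y
        + christoffel (hyp 1 ⁻¹' D) (indMet 1 g) m c b y
          * schouten (hyp 1 ⁻¹' D) (indMet 1 g) d m y)
        = ∑ m, (christoffel (hyp 1 ⁻¹' D) (indMet 1 g) m c d y
          * schouten D g ((1 : Fin 4).succAbove m) ((1 : Fin 4).succAbove b) (hyp 1 y)
        + christoffel (hyp 1 ⁻¹' D) (indMet 1 g) m c b y
          * schouten D g ((1 : Fin 4).succAbove d) ((1 : Fin 4).succAbove m) (hyp 1 y))
        - 3 / (2 * lam) * (fs D g om (hyp 1 y) * fs D g om (hyp 1 y))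
          * ∑ m, (christoffel (hyp 1 ⁻¹' D) (indMet 1 g) m c d y * indMet 1 g y m b
            + christoffel (hyp 1 ⁻¹' D) (indMet 1 g) m c b y * indMet 1 g y d m) := by
      rw [Finset.mul_sum, ← Finset.sum_sub_distrib]
      refine Finset.sum_congr rfl fun m _ => ?_
      rw [e m b hy, e d m hy]
      ring
    rw [h2]
    linear_combination (- (3 / (2 * lam) * (fs D g om (hyp 1 y) * fs D g om (hyp 1 y)))) * hm
  -- On `𝒥` the gradient of `Ω` is normal, so `pd_fs` gives the mixed normal-tangential components
  -- of `L`.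
  have h2 : ∀ d : Fin 3, (∑ m, (g (hyp 1 y))⁻¹ 1 m
        * schouten D g ((1 : Fin 4).succAbove d) m (hyp 1 y)) * pd D 1 om (hyp 1 y)
      = - pd D ((1 : Fin 4).succAbove d) (fs D g om) (hyp 1 y) := by
    intro d
    rw [S.pd_fs hy, neg_neg, Finset.sum_mul]
    refine Finset.sum_congr rfl fun m _ => ?_
    rw [S.grad_om_boundary hy, M.inv_symm hy m 1]
    ring
  -- Passing from intrinsic to ambient derivatives of `L` adds umbilicity times mixed components of
  -- `L`. By `h2` and the constraint these terms cancel the `s ds` terms of `h1`. The ambient Cotton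
  -- tensor with tangential indices therefore vanishes, and `cotton_eq` makes it `∂₁Ω` times the
  -- contraction of `W` in question.
  have h3 := codazzi_of_cotton MI hy hc c d b
  rw [h1, h1, covDeriv_restrict M hE hN M.schouten_smooth hy,
    covDeriv_restrict M hE hN M.schouten_smooth hy] at h3
  simp only [S.umbilic hlam hy] at h3
  have h4 := S.cotton_eq hy ((1 : Fin 4).succAbove b) ((1 : Fin 4).succAbove c)
    ((1 : Fin 4).succAbove d)
  simp only [S.grad_om_boundary hy] at h4
  have h5 : ∑ i, (g (hyp 1 y))⁻¹ i 1 * pd D 1 om (hyp 1 y) * W (hyp 1 y) i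
      ((1 : Fin 4).succAbove b) ((1 : Fin 4).succAbove c) ((1 : Fin 4).succAbove d)
      = pd D 1 om (hyp 1 y) * ∑ i, (g (hyp 1 y))⁻¹ i 1 * W (hyp 1 y) i
      ((1 : Fin 4).succAbove b) ((1 : Fin 4).succAbove c) ((1 : Fin 4).succAbove d) := by
    rw [Finset.mul_sum]
    exact Finset.sum_congr rfl fun _ _ => by ring
  rw [h5] at h4
  refine (mul_eq_zero.1 ?_).resolve_left ho
  rw [← h4]
  have hsy := MI.symm y hy c d
  have h7 : ∀ d : Fin 3, (∑ m, (g (hyp 1 y))⁻¹ 1 m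
        * schouten D g ((1 : Fin 4).succAbove d) m (hyp 1 y))
      = - pd D ((1 : Fin 4).succAbove d) (fs D g om) (hyp 1 y) / pd D 1 om (hyp 1 y) := by
    intro d
    rw [eq_div_iff ho, h2]
  have hlam' : lam = -3 * ((g (hyp 1 y))⁻¹ 1 1 * pd D 1 om (hyp 1 y) ^ 2) := by
    linarith [S.gradSq_boundary hy]
  rw [h7, h7, hsy] at h3
  have h8 : 3 / lam = -1 / ((g (hyp 1 y))⁻¹ 1 1 * pd D 1 om (hyp 1 y) ^ 2) := by
    rw [hlam']
    field_simp
  rw [h8] at h3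
  have h9 : ∀ t k p u o : ℝ, u ≠ 0 → o ≠ 0 → -(t / o) * k / u * (-p / o) = t * k * p / (u * o ^ 2) :=
    fun t k p u o hu ho => by field_simp
  rw [h9 _ _ _ _ _ h11 ho, h9 _ _ _ _ _ h11 ho] at h3
  have h10 : ∀ t p k q : ℝ, -1 / q * t * p * k = - (t * k * p / q) := fun t p k q => by ring
  rw [h10, h10] at h3
  linarith

end IsSolution
end AdS

namespace AdS

/-! ## Algebra of Weyl candidates in null frames -/

/-- The components of a 4-tensor in the frame `E`. -/
def Fr (T : Fin 4 → Fin 4 → Fin 4 → Fin 4 → ℝ) (E : Fin 4 → Fin 4 → ℝ) (p q r s : Fin 4) : ℝ :=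
  ∑ i, ∑ j, ∑ k, ∑ l, T i j k l * E p i * E q j * E r k * E s l

section Contract

variable (T : Fin 4 → Fin 4 → Fin 4 → Fin 4 → ℝ) (u u' v w z : Fin 4 → ℂ) (c : ℂ)

theorem contract_add₁ : contract T (u + u') v w z = contract T u v w z + contract T u' v w z := by
  simp only [contract, ← Finset.sum_add_distrib, Pi.add_apply]
  repeat' refine Finset.sum_congr rfl fun _ _ => ?_
  ring

theorem contract_add₂ : contract T v (u + u') w z = contract T v u w z + contract T v u' w z := by
  simp only [contract, ← Finset.sum_add_distrib, Pi.add_apply]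
  repeat' refine Finset.sum_congr rfl fun _ _ => ?_
  ring

theorem contract_add₃ : contract T v w (u + u') z = contract T v w u z + contract T v w u' z := by
  simp only [contract, ← Finset.sum_add_distrib, Pi.add_apply]
  repeat' refine Finset.sum_congr rfl fun _ _ => ?_
  ring

theorem contract_add₄ : contract T v w z (u + u') = contract T v w z u + contract T v w z u' := by
  simp only [contract, ← Finset.sum_add_distrib, Pi.add_apply]
  repeat' refine Finset.sum_congr rfl fun _ _ => ?_
  ring

theorem contract_smul₁ : contract T (c • u) v w z = c * contract T u v w z := by
  simp only [contract, Finset.mul_sum, Pi.smul_apply, smul_eq_mul]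
  repeat' refine Finset.sum_congr rfl fun _ _ => ?_
  ring

theorem contract_smul₂ : contract T v (c • u) w z = c * contract T v u w z := by
  simp only [contract, Finset.mul_sum, Pi.smul_apply, smul_eq_mul]
  repeat' refine Finset.sum_congr rfl fun _ _ => ?_
  ring

theorem contract_smul₃ : contract T v w (c • u) z = c * contract T v w u z := by
  simp only [contract, Finset.mul_sum, Pi.smul_apply, smul_eq_mul]
  repeat' refine Finset.sum_congr rfl fun _ _ => ?_
  ring

theorem contract_smul₄ : contract T v w z (c • u) = c * contract T v w z u := by
  simp only [contract, Finset.mul_sum, Pi.smul_apply, smul_eq_mul]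
  repeat' refine Finset.sum_congr rfl fun _ _ => ?_
  ring

variable (E : Fin 4 → Fin 4 → ℝ)

theorem contract_frame (p q r s : Fin 4) : contract T (fun i => (E p i : ℂ)) (fun i => (E q i : ℂ))
    (fun i => (E r i : ℂ)) (fun i => (E s i : ℂ)) = (Fr T E p q r s : ℂ) := by
  simp only [contract, Fr]
  push_cast
  rfl

theorem nullL_eq : nullL E = (Real.sqrt 2 : ℂ)⁻¹ • ((fun i => (E 0 i : ℂ)) + fun i => (E 3 i : ℂ)) := by
  ext i
  simp [nullL, div_eq_inv_mul]

theorem nullN_eq : nullN E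
    = (Real.sqrt 2 : ℂ)⁻¹ • ((fun i => (E 0 i : ℂ)) + (-1 : ℂ) • fun i => (E 3 i : ℂ)) := by
  ext i
  simp [nullN, div_eq_inv_mul, sub_eq_add_neg]

theorem nullM_eq : nullM E
    = (Real.sqrt 2 : ℂ)⁻¹ • ((fun i => (E 1 i : ℂ)) + Complex.I • fun i => (E 2 i : ℂ)) := by
  ext i
  simp [nullM, div_eq_inv_mul]

theorem nullMbar_eq : nullMbar E
    = (Real.sqrt 2 : ℂ)⁻¹ • ((fun i => (E 1 i : ℂ)) + (-Complex.I) • fun i => (E 2 i : ℂ)) := by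
  ext i
  simp [nullMbar, div_eq_inv_mul, sub_eq_add_neg]

end Contract

theorem inv_sqrt_two_sq : ((Real.sqrt 2 : ℂ)⁻¹) * ((Real.sqrt 2 : ℂ)⁻¹) = 1 / 2 := by
  rw [← mul_inv, ← Complex.ofReal_mul, Real.mul_self_sqrt (by norm_num)]
  norm_num

/-- The algebraic symmetries of the Weyl tensor, in an orthonormal frame. -/
structure WeylLike (w : Fin 4 → Fin 4 → Fin 4 → Fin 4 → ℝ) : Prop where
  left : ∀ i j k l, w i j k l = - w j i k l
  right : ∀ i j k l, w i j k l = - w i j l k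
  pair : ∀ i j k l, w i j k l = w k l i j
  cyclic : ∀ i j k l, w i j k l + w i k l j + w i l j k = 0
  trace : ∀ j l, - w 0 j 0 l + w 1 j 1 l + w 2 j 2 l + w 3 j 3 l = 0

namespace WeylLike

variable {w : Fin 4 → Fin 4 → Fin 4 → Fin 4 → ℝ}

theorem self_left (h : WeylLike w) (i k l : Fin 4) : w i i k l = 0 := by
  linarith [h.left i i k l]

theorem self_right (h : WeylLike w) (i j k : Fin 4) : w i j k k = 0 := by
  linarith [h.right i j k k]

/-- All components in terms of those with a leading index `0`. -/
theorem basis (h : WeylLike w) :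
    (w 0 2 2 3 = - w 0 1 1 3 ∧ w 0 3 1 3 = - w 0 2 1 2 ∧ w 0 3 2 3 = w 0 1 1 2 ∧
      w 0 3 1 2 = w 0 2 1 3 - w 0 1 2 3 ∧ w 0 3 0 3 = - w 0 1 0 1 - w 0 2 0 2) ∧
    (w 1 2 1 2 = w 0 1 0 1 + w 0 2 0 2 ∧ w 1 3 1 3 = - w 0 2 0 2 ∧ w 2 3 2 3 = - w 0 1 0 1 ∧
      w 1 3 2 3 = w 0 1 0 2 ∧ w 1 2 2 3 = - w 0 1 0 3 ∧ w 1 2 1 3 = w 0 2 0 3) := by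
  have t := h.trace
  have L := h.left
  have R := h.right
  have P := h.pair
  have hl := h.self_left
  have hr := h.self_right
  have t00 := t 0 0
  have t01 := t 0 1
  have t02 := t 0 2
  have t03 := t 0 3
  have t11 := t 1 1
  have t22 := t 2 2
  have t33 := t 3 3
  have t12 := t 1 2
  have t13 := t 1 3
  have t23 := t 2 3
  simp only [hl, hr] at t00 t01 t02 t03 t11 t22 t33 t12 t13 t23
  simp only [L 1 0, L 2 0, L 3 0, L 2 1, L 3 1, L 3 2, R _ _ 1 0, R _ _ 2 0, R _ _ 3 0, R _ _ 2 1,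
    R _ _ 3 1, R _ _ 3 2] at t00 t01 t02 t03 t11 t22 t33 t12 t13 t23
  have c := h.cyclic 0 1 2 3
  rw [R 0 2 3 1] at c
  refine ⟨⟨?_, ?_, ?_, ?_, ?_⟩, ?_, ?_, ?_, ?_, ?_, ?_⟩ <;> linarith

end WeylLike

/-- The components of the rescaled Weyl spinor in terms of the electric and magnetic parts. -/
theorem spinor_eq {T : Fin 4 → Fin 4 → Fin 4 → Fin 4 → ℝ} {E : Fin 4 → Fin 4 → ℝ}
    {w : Fin 4 → Fin 4 → Fin 4 → Fin 4 → ℝ} (hw : Fr T E = w) (h : WeylLike w) :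
    spinor T E 0 = (w 0 1 0 1 - w 0 2 0 2) / 2 - w 0 1 1 3
        + Complex.I * (w 0 1 0 2 - w 0 1 2 3 / 2 - w 0 2 1 3 / 2) ∧
    spinor T E 1 = (- w 0 1 0 3 - w 0 2 1 2) / 2 + Complex.I * ((w 0 1 1 2 - w 0 2 0 3) / 2) ∧
    spinor T E 2 = (- w 0 1 0 1 - w 0 2 0 2) / 2 + Complex.I * ((w 0 1 2 3 - w 0 2 1 3) / 2) ∧
    spinor T E 3 = (w 0 1 0 3 - w 0 2 1 2) / 2 - Complex.I * ((w 0 1 1 2 + w 0 2 0 3) / 2) ∧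
    spinor T E 4 = (w 0 1 0 1 - w 0 2 0 2) / 2 + w 0 1 1 3
        - Complex.I * (w 0 1 0 2 + w 0 1 2 3 / 2 + w 0 2 1 3 / 2) := by
  obtain ⟨⟨h1, h2, h3, h4, h5⟩, h6, h7, h8, h9, h10, h11⟩ := h.basis
  have L := h.left
  have R := h.right
  have P := h.pair
  have r4 : (Real.sqrt 2 : ℂ)⁻¹ ^ 4 = 1 / 4 := by
    linear_combination ((Real.sqrt 2 : ℂ)⁻¹ * (Real.sqrt 2 : ℂ)⁻¹ + 1 / 2) * inv_sqrt_two_sq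
  refine ⟨?_, ?_, ?_, ?_, ?_⟩ <;>
  simp only [spinor, Matrix.cons_val, nullL_eq, nullN_eq, nullM_eq,
    nullMbar_eq, contract_add₁, contract_add₂, contract_add₃, contract_add₄, contract_smul₁,
    contract_smul₂, contract_smul₃, contract_smul₄, contract_frame, hw, h.self_left,
    L 3 0, L 3 1, L 3 2, R _ _ 1 0, R _ _ 2 0,
    R _ _ 3 1, R _ _ 3 2, P 0 2 0 1, P 0 3 0 1, P 1 3 0 1, P 2 3 0 1,
    P 0 3 0 2, P 1 3 0 2, P 2 3 0 2,
    P 2 3 1 3, h1, h2, h3, h7, h8, h9] <;>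
  push_cast <;> ring_nf <;> simp only [Complex.I_sq, r4] <;> ring

end AdS

/-! ### Orthonormal frames, and the algebraic conditions on the boundary. -/

namespace AdS

/-- The diagonal of the Minkowski metric. -/
def eta (p : Fin 4) : ℝ := if p = 0 then -1 else 1

theorem minkowski_eq : (Matrix.of minkowski : Matrix (Fin 4) (Fin 4) ℝ) = Matrix.diagonal eta := by
  ext i j
  by_cases h : i = j
  · subst h
    simp [minkowski, eta]
  · simp [minkowski, h]

theorem eta_mul_eta (p : Fin 4) : eta p * eta p = 1 := by
  unfold eta
  split_ifs <;> norm_num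

section OrthonormalFrame

variable {G : Matrix (Fin 4) (Fin 4) ℝ} {E : Fin 4 → Fin 4 → ℝ}

/-- Orthonormality is `A G Aᵀ = η` with `η² = 1`. It exhibits a right inverse of the square matrix
`A`, which is then also a left inverse; this moves `A` to the other end of the product. -/
theorem frame_mul (h : ∀ i j, ∑ μ, ∑ ν, G μ ν * E i μ * E j ν = minkowski i j) :
    G * ((Matrix.of E).transpose * Matrix.diagonal eta * Matrix.of E) = 1 := by
  set A : Matrix (Fin 4) (Fin 4) ℝ := Matrix.of E
  have h1 : A * G * A.transpose = Matrix.diagonal eta := by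
    rw [← minkowski_eq]
    ext i j
    simp only [Matrix.mul_apply, Matrix.transpose_apply, Matrix.of_apply, A, ← h i j,
      Finset.sum_mul]
    rw [Finset.sum_comm]
    exact Finset.sum_congr rfl fun _ _ => Finset.sum_congr rfl fun _ _ => by ring
  have h2 : A * (G * A.transpose * Matrix.diagonal eta) = 1 := by
    rw [← Matrix.mul_assoc, ← Matrix.mul_assoc, h1, Matrix.diagonal_mul_diagonal]
    simp [eta_mul_eta]
  have h3 := mul_eq_one_comm.1 h2
  rw [← h3]
  simp only [Matrix.mul_assoc]

theorem frame_inv (h : ∀ i j, ∑ μ, ∑ ν, G μ ν * E i μ * E j ν = minkowski i j) (μ ν : Fin 4) :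
    G⁻¹ μ ν = ∑ p, eta p * (E p μ * E p ν) := by
  rw [Matrix.inv_eq_right_inv (frame_mul h), Matrix.mul_apply]
  refine Finset.sum_congr rfl fun p _ => ?_
  rw [Matrix.mul_diagonal]
  simp only [Matrix.transpose_apply, Matrix.of_apply]
  ring

theorem frame_complete (h : ∀ i j, ∑ μ, ∑ ν, G μ ν * E i μ * E j ν = minkowski i j)
    (μ ν : Fin 4) : ∑ p, (eta p * ∑ ρ, G μ ρ * E p ρ) * E p ν = if μ = ν then 1 else 0 := by
  rw [← Matrix.one_apply, ← frame_mul h, Matrix.mul_apply]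
  simp only [Finset.mul_sum, Finset.sum_mul]
  rw [Finset.sum_comm]
  refine Finset.sum_congr rfl fun ρ _ => ?_
  rw [Matrix.mul_apply, Finset.mul_sum]
  refine Finset.sum_congr rfl fun p _ => ?_
  rw [Matrix.mul_diagonal]
  simp only [Matrix.transpose_apply, Matrix.of_apply]
  ring

theorem sum4_swap (f : Fin 4 → Fin 4 → Fin 4 → Fin 4 → ℝ) :
    ∑ i, ∑ j, ∑ k, ∑ l, f i j k l = ∑ k, ∑ l, ∑ i, ∑ j, f i j k l := by
  have h : ∀ F : Fin 4 → Fin 4 → Fin 4 → Fin 4 → ℝ, ∑ i, ∑ j, ∑ k, ∑ l, F i j k l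
      = ∑ p : Fin 4 × Fin 4, ∑ q : Fin 4 × Fin 4, F p.1 p.2 q.1 q.2 := fun F => by
    simp only [Fintype.sum_prod_type]
  rw [h, Finset.sum_comm, h]

theorem sum3_rot (f : Fin 4 → Fin 4 → Fin 4 → ℝ) :
    ∑ j, ∑ k, ∑ l, f j k l = ∑ k, ∑ l, ∑ j, f j k l := by
  rw [Finset.sum_comm]
  exact Finset.sum_congr rfl fun k _ => Finset.sum_comm

theorem fr_weylLike {T : Fin 4 → Fin 4 → Fin 4 → Fin 4 → ℝ}
    (h : ∀ i j, ∑ μ, ∑ ν, G μ ν * E i μ * E j ν = minkowski i j)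
    (left : ∀ i j k l, T i j k l = - T j i k l) (right : ∀ i j k l, T i j k l = - T i j l k)
    (pair : ∀ i j k l, T i j k l = T k l i j)
    (cyclic : ∀ i j k l, T i j k l + T i k l j + T i l j k = 0)
    (trace : ∀ j l, ∑ i, ∑ m, G⁻¹ i m * T m j i l = 0) : WeylLike (Fr T E) where
  left p q r s := by
    simp only [Fr, ← Finset.sum_neg_distrib]
    rw [Finset.sum_comm]
    refine Finset.sum_congr rfl fun i _ => Finset.sum_congr rfl fun j _ =>
      Finset.sum_congr rfl fun k _ => Finset.sum_congr rfl fun l _ => ?_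
    rw [left]
    ring
  right p q r s := by
    simp only [Fr, ← Finset.sum_neg_distrib]
    refine Finset.sum_congr rfl fun i _ => Finset.sum_congr rfl fun j _ => ?_
    rw [Finset.sum_comm]
    refine Finset.sum_congr rfl fun k _ => Finset.sum_congr rfl fun l _ => ?_
    rw [right]
    ring
  pair p q r s := by
    simp only [Fr]
    rw [sum4_swap]
    refine Finset.sum_congr rfl fun i _ => Finset.sum_congr rfl fun j _ =>
      Finset.sum_congr rfl fun k _ => Finset.sum_congr rfl fun l _ => ?_
    rw [pair]
    ring
  cyclic p q r s := by
    simp only [Fr]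
    rw [← Finset.sum_add_distrib, ← Finset.sum_add_distrib]
    refine Finset.sum_eq_zero fun i _ => ?_
    rw [sum3_rot (fun j k l => T i j k l * E p i * E q j * E r k * E s l),
      sum3_rot (fun j k l => T i j k l * E p i * E s j * E q k * E r l),
      sum3_rot (fun k l j => T i j k l * E p i * E s j * E q k * E r l)]
    simp only [← Finset.sum_add_distrib]
    refine Finset.sum_eq_zero fun k _ => Finset.sum_eq_zero fun l _ =>
      Finset.sum_eq_zero fun j _ => ?_
    linear_combination (E p i * E q j * E r k * E s l) * cyclic i j k l
  trace q s := by
    have e : ∑ p, eta p * Fr T E p q p s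
        = ∑ j, ∑ l, (∑ i, ∑ m, G⁻¹ i m * T m j i l) * (E q j * E s l) := by
      simp only [frame_inv h, Fr, Finset.mul_sum, Finset.sum_mul]
      have e1 : ∀ f : Fin 4 → Fin 4 → Fin 4 → Fin 4 → Fin 4 → ℝ,
          ∑ p, ∑ i, ∑ j, ∑ k, ∑ l, f p i j k l = ∑ j, ∑ l, ∑ k, ∑ i, ∑ p, f p i j k l := by
        intro f
        have a1 : ∀ g : Fin 4 → Fin 4 → ℝ, ∑ a, ∑ b, g a b = ∑ b, ∑ a, g a b := fun g =>
          Finset.sum_comm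
        calc ∑ p, ∑ i, ∑ j, ∑ k, ∑ l, f p i j k l
            = ∑ p, ∑ j, ∑ l, ∑ k, ∑ i, f p i j k l := by
              refine Finset.sum_congr rfl fun p _ => ?_
              rw [a1]
              refine Finset.sum_congr rfl fun j _ => ?_
              rw [sum3_rot, a1]
          _ = _ := by
              rw [a1]
              refine Finset.sum_congr rfl fun j _ => ?_
              rw [a1]
              refine Finset.sum_congr rfl fun l _ => ?_
              rw [a1]
              exact Finset.sum_congr rfl fun k _ => a1 _
      rw [e1]
      refine Finset.sum_congr rfl fun j _ => Finset.sum_congr rfl fun l _ =>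
        Finset.sum_congr rfl fun k _ => Finset.sum_congr rfl fun i _ =>
        Finset.sum_congr rfl fun p _ => ?_
      ring
    simp only [trace, zero_mul, Finset.sum_const_zero] at e
    rw [Fin.sum_univ_four] at e
    simp [eta] at e
    linarith

end OrthonormalFrame

namespace IsSolution

variable {lam : ℝ} {D : Set (Fin 4 → ℝ)} {g : (Fin 4 → ℝ) → Matrix (Fin 4) (Fin 4) ℝ}
  {om : (Fin 4 → ℝ) → ℝ} {W : (Fin 4 → ℝ) → Fin 4 → Fin 4 → Fin 4 → Fin 4 → ℝ}
  {z : Fin 4 → ℝ} {E : Fin 4 → Fin 4 → ℝ}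

theorem weylLike (S : IsSolution lam D g om W) (hz : z ∈ D)
    (h : ∀ i j, ∑ μ, ∑ ν, g z μ ν * E i μ * E j ν = minkowski i j) :
    WeylLike (Fr (W z) E) :=
  fr_weylLike h (S.W_antisymm_left hz) (S.W_antisymm_right hz) (S.W_pair hz) (S.W_cyclic hz)
    (S.W_trace hz)

/-- A vector normal to `x¹ = 0` is a multiple of the raised `dx¹`, so being orthogonal to it means
having no `x¹`-component. The first fact converts `W_boundary` into frame components. The second is
used again at `Σ`, to discard transverse derivatives along `e₁` and `e₂`. -/
theorem frame_tangent (M : IsMetric D g) (hz : z ∈ D)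
    (h : ∀ i j, ∑ μ, ∑ ν, g z μ ν * E i μ * E j ν = minkowski i j)
    (hn : ∀ ν, ν ≠ 1 → ∑ μ, g z μ ν * E 3 μ = 0) :
    (∃ α : ℝ, ∀ μ, E 3 μ = α * (g z)⁻¹ μ 1) ∧ ∀ a, a ≠ 3 → E a 1 = 0 := by
  have h1 : ∀ a, ∑ μ, ∑ ν, g z μ ν * E 3 μ * E a ν = (∑ μ, g z μ 1 * E 3 μ) * E a 1 := by
    intro a
    rw [Finset.sum_comm, Finset.sum_eq_single 1]
    · rw [Finset.sum_mul]
    · intro ν _ hν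
      rw [← Finset.sum_mul, hn ν hν, zero_mul]
    · simp
  have h33 := h 3 3
  rw [h1] at h33
  have hα : ∑ μ, g z μ 1 * E 3 μ ≠ 0 := by
    intro h0
    rw [h0, zero_mul] at h33
    simp [minkowski] at h33
  refine ⟨⟨∑ μ, g z μ 1 * E 3 μ, fun μ => ?_⟩, fun a ha => ?_⟩
  · rw [← M.raise_lower hz (E 3) μ, Finset.sum_eq_single 1]
    · rw [mul_comm]
      congr 1
      exact Finset.sum_congr rfl fun l _ => by rw [M.symm z hz 1 l]
    · intro ν _ hν
      rw [show ∑ l, g z ν l * E 3 l = ∑ l, g z l ν * E 3 l from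
        Finset.sum_congr rfl fun l _ => by rw [M.symm z hz ν l], hn ν hν, mul_zero]
    · simp
  · have := h 3 a
    rw [h1] at this
    have h0 : minkowski 3 a = 0 := by simp [minkowski, Ne.symm ha]
    rw [h0] at this
    exact (mul_eq_zero.1 this).resolve_left hα

/-- The reflecting boundary condition in terms of the rescaled Weyl spinor. -/
theorem spinor_reflecting (S : IsSolution lam D g om W) (hlam : lam < 0) {y : Fin 3 → ℝ}
    (hy : hyp 1 y ∈ D) (hc : ∀ a b, cotton (hyp 1 ⁻¹' D) (indMet 1 g) a b y = 0)
    (h : ∀ i j, ∑ μ, ∑ ν, g (hyp 1 y) μ ν * E i μ * E j ν = minkowski i j)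
    (hn : ∀ ν, ν ≠ 1 → ∑ μ, g (hyp 1 y) μ ν * E 3 μ = 0) :
    spinor (W (hyp 1 y)) E 4 = (starRingEnd ℂ) (spinor (W (hyp 1 y)) E 0) ∧
    spinor (W (hyp 1 y)) E 3 = (starRingEnd ℂ) (spinor (W (hyp 1 y)) E 1) ∧
    spinor (W (hyp 1 y)) E 2 = (starRingEnd ℂ) (spinor (W (hyp 1 y)) E 2) := by
  obtain ⟨⟨α, h3⟩, ht⟩ := frame_tangent S.met hy h hn
  have hw := S.weylLike hy h
  -- `e₃` is the raised conormal up to a factor, and the other frame vectors have no `x¹`-component,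
  -- so only the contraction treated in `W_boundary` occurs. The five components `w1` to `w5` below
  -- are those, among the ten independent ones, with a single index `3`. Without them the spinor
  -- components are unchanged by `e₃ ↦ -e₃`.
  have h0 : ∀ a b c, a ≠ 3 → b ≠ 3 → c ≠ 3 → Fr (W (hyp 1 y)) E 3 a b c = 0 := by
    intro a b c ha hb hc'
    have e : Fr (W (hyp 1 y)) E 3 a b c = ∑ j, ∑ k, ∑ l, α * (∑ i, (g (hyp 1 y))⁻¹ i 1
        * W (hyp 1 y) i j k l) * (E a j * E b k * E c l) := by
      simp only [Fr, h3, Finset.mul_sum, Finset.sum_mul]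
      rw [Finset.sum_comm]
      refine Finset.sum_congr rfl fun j _ => ?_
      rw [Finset.sum_comm]
      refine Finset.sum_congr rfl fun k _ => ?_
      rw [Finset.sum_comm]
      exact Finset.sum_congr rfl fun l _ => Finset.sum_congr rfl fun i _ => by ring
    rw [e]
    refine Finset.sum_eq_zero fun j _ => Finset.sum_eq_zero fun k _ =>
      Finset.sum_eq_zero fun l _ => ?_
    refine Fin.succAboveCases 1 ?_ (fun j' => ?_) j
    · rw [ht a ha]; ring
    refine Fin.succAboveCases 1 ?_ (fun k' => ?_) k
    · rw [ht b hb]; ring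
    refine Fin.succAboveCases 1 ?_ (fun l' => ?_) l
    · rw [ht c hc']; ring
    rw [S.W_boundary hlam hy hc]
    ring
  obtain ⟨e0, e1, e2, e3, e4⟩ := spinor_eq rfl hw
  have n0 : (0 : Fin 4) ≠ 3 := by decide
  have n1 : (1 : Fin 4) ≠ 3 := by decide
  have n2 : (2 : Fin 4) ≠ 3 := by decide
  have w1 : Fr (W (hyp 1 y)) E 0 1 1 3 = 0 := by
    rw [hw.pair, hw.left, h0 _ _ _ n1 n0 n1, neg_zero]
  have w2 : Fr (W (hyp 1 y)) E 0 1 2 3 = 0 := by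
    rw [hw.pair, hw.left, h0 _ _ _ n2 n0 n1, neg_zero]
  have w3 : Fr (W (hyp 1 y)) E 0 2 1 3 = 0 := by
    rw [hw.pair, hw.left, h0 _ _ _ n1 n0 n2, neg_zero]
  have w4 : Fr (W (hyp 1 y)) E 0 1 0 3 = 0 := by
    rw [hw.pair, hw.left, h0 _ _ _ n0 n0 n1, neg_zero]
  have w5 : Fr (W (hyp 1 y)) E 0 2 0 3 = 0 := by
    rw [hw.pair, hw.left, h0 _ _ _ n0 n0 n2, neg_zero]
  rw [e0, e1, e2, e3, e4]
  simp only [w1, w2, w3, w4, w5, map_add, map_sub, map_mul, map_div₀, map_neg, Complex.conj_ofReal,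
    Complex.conj_I, map_ofNat, map_zero, Complex.ofReal_zero]
  refine ⟨?_, ?_, ?_⟩ <;> ring

end IsSolution
end AdS

/-! ### From the manifold to coordinates: charts, and nondegeneracy of the component matrix. -/

namespace AdS

theorem slice_eq (x : Fin 3 → ℝ) : slice x = hyp 0 x := by
  simp only [slice, hyp, Fin.insertNth_zero']

section Chart

variable {S : Type*} [TopologicalSpace S] [ChartedSpace (EuclideanHalfSpace 3) S]
  {c : OpenPartialHomeomorph S (EuclideanHalfSpace 3)}

theorem continuous_spat : Continuous spat := by
  unfold spat
  exact (PiLp.continuous_toLp 2 _).comp (continuous_pi fun i => continuous_apply _)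

theorem isHalfDomain_chartDom (t₀ : ℝ) : IsHalfDomain (chartDom c t₀) 1 := by
  refine ⟨{z | z 0 ∈ Set.Ioo (-t₀) t₀ ∧ (𝓡∂ 3).symm (spat z) ∈ c.target}, ?_, ?_⟩
  · exact (isOpen_Ioo.preimage (continuous_apply 0)).inter
      (c.open_target.preimage ((𝓡∂ 3).continuous_symm.comp continuous_spat))
  · ext z
    simp only [chartDom, OpenPartialHomeomorph.extend_target, Set.mem_ofPred_eq, Set.mem_inter_iff,
      Set.mem_preimage, range_modelWithCornersEuclideanHalfSpace]
    exact ⟨fun h => ⟨⟨h.1, h.2.1⟩, h.2.2⟩, fun h => ⟨h.1.1, h.1.2, h.2⟩⟩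

/-- Chart after inverse chart is the identity near `w` within the half-space, so the chain rule
provides a left inverse of the derivative. Uniqueness of derivatives within the half-space makes
this valid at boundary points. -/
theorem injective_mfderivWithin_extend_symm [IsManifold (𝓡∂ 3) ∞ S] (hc : IsChart c)
    {w : EuclideanSpace ℝ (Fin 3)} (hw : w ∈ (c.extend (𝓡∂ 3)).target) :
    Function.Injective (mfderivWithin 𝓘(ℝ, EuclideanSpace ℝ (Fin 3)) (𝓡∂ 3)
      (c.extend (𝓡∂ 3)).symm (Set.range (𝓡∂ 3)) w) := by
  have hp : (c.extend (𝓡∂ 3)).symm w ∈ c.source := by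
    rw [← c.extend_source (I := 𝓡∂ 3)]
    exact (c.extend (𝓡∂ 3)).map_target hw
  have hwe : c.extend (𝓡∂ 3) ((c.extend (𝓡∂ 3)).symm w) = w := (c.extend (𝓡∂ 3)).right_inv hw
  have hn : (c.extend (𝓡∂ 3)).target ∈ 𝓝[Set.range (𝓡∂ 3)] w := by
    have := c.extend_target_mem_nhdsWithin (I := 𝓡∂ 3) hp
    rwa [hwe] at this
  have h1 : MDifferentiableWithinAt 𝓘(ℝ, EuclideanSpace ℝ (Fin 3)) (𝓡∂ 3)
      (c.extend (𝓡∂ 3)).symm (Set.range (𝓡∂ 3)) w := by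
    have h := (contMDiffOn_extend_symm hc).mdifferentiableOn (by simp)
    have he : (𝓡∂ 3) '' c.target = (c.extend (𝓡∂ 3)).target := by
      rw [OpenPartialHomeomorph.extend_target, ModelWithCorners.image_eq]
    rw [he] at h
    exact (h w hw).mono_of_mem_nhdsWithin hn
  have h2 : MDifferentiableAt (𝓡∂ 3) 𝓘(ℝ, EuclideanSpace ℝ (Fin 3)) (c.extend (𝓡∂ 3))
      ((c.extend (𝓡∂ 3)).symm w) := by
    rw [OpenPartialHomeomorph.extend_coe]
    refine MDifferentiableAt.comp (I' := 𝓡∂ 3) _ ?_ ?_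
    · exact (ModelWithCorners.contMDiff (n := 1) (𝓡∂ 3)).mdifferentiable (by simp) _
    · exact ((contMDiffOn_of_mem_maximalAtlas hc).mdifferentiableOn (by simp) _ hp).mdifferentiableAt
        (c.open_source.mem_nhds hp)
  have h3 := HasMFDerivWithinAt.comp w (h2.hasMFDerivAt.hasMFDerivWithinAt (s := Set.univ))
    h1.hasMFDerivWithinAt (fun _ _ => Set.mem_univ _)
  have h4 := (hasMFDerivWithinAt_id (I := 𝓘(ℝ, EuclideanSpace ℝ (Fin 3))) (Set.range (𝓡∂ 3)) w)
  have h5 := h4.congr_of_eventuallyEq (f₁ := (c.extend (𝓡∂ 3)) ∘ (c.extend (𝓡∂ 3)).symm)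
    (by filter_upwards [hn] with v hv using (c.extend (𝓡∂ 3)).right_inv hv) hwe
  have hu : UniqueMDiffWithinAt 𝓘(ℝ, EuclideanSpace ℝ (Fin 3)) (Set.range (𝓡∂ 3)) w := by
    rw [uniqueMDiffWithinAt_iff_uniqueDiffWithinAt]
    exact (𝓡∂ 3).uniqueDiffOn w (by
      rw [OpenPartialHomeomorph.extend_target] at hw
      exact hw.2)
  have h6 := hu.eq h3 h5
  intro u v huv
  have h7 := fun x => DFunLike.congr_fun h6 x
  have hu' := h7 u
  have hv' := h7 v
  rw [ContinuousLinearMap.comp_apply, huv] at hu'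
  rw [ContinuousLinearMap.comp_apply] at hv'
  exact hu'.symm.trans hv'

/-- `chartVec` as a linear map. -/
noncomputable def chartVecₗ (c : OpenPartialHomeomorph S (EuclideanHalfSpace 3)) (z : Fin 4 → ℝ) :
    (Fin 4 → ℝ) →ₗ[ℝ] TangentST (chartPt c z) where
  toFun := chartVec c z
  map_add' u v := by
    have : spat (u + v) = spat u + spat v := rfl
    simp only [chartVec, this]
    exact Prod.ext rfl ((mfderivWithin 𝓘(ℝ, EuclideanSpace ℝ (Fin 3)) (𝓡∂ 3)
      (c.extend (𝓡∂ 3)).symm (Set.range (𝓡∂ 3)) (spat z)).map_add _ _)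
  map_smul' a v := by
    have : spat (a • v) = a • spat v := rfl
    simp only [chartVec, this]
    exact Prod.ext rfl ((mfderivWithin 𝓘(ℝ, EuclideanSpace ℝ (Fin 3)) (𝓡∂ 3)
      (c.extend (𝓡∂ 3)).symm (Set.range (𝓡∂ 3)) (spat z)).map_smul _ _)

theorem chartVecₗ_surjective [IsManifold (𝓡∂ 3) ∞ S] (hc : IsChart c) {z : Fin 4 → ℝ}
    (hz : spat z ∈ (c.extend (𝓡∂ 3)).target) : Function.Bijective (chartVecₗ c z) := by
  have hi : Function.Injective (chartVecₗ c z) := by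
    intro u v h
    have h0 : u 0 = v 0 := congrArg Prod.fst h
    have h1 := injective_mfderivWithin_extend_symm hc hz (congrArg Prod.snd h)
    have h2 : ∀ i : Fin 3, u i.succ = v i.succ := fun i => by
      have := congrArg (fun x : EuclideanSpace ℝ (Fin 3) => x i) h1
      exact this
    funext i
    exact Fin.cases h0 h2 i
  refine ⟨hi, ?_⟩
  have : FiniteDimensional ℝ (TangentSpace (𝓡∂ 3) (chartPt c z)) :=
    inferInstanceAs (FiniteDimensional ℝ (EuclideanSpace ℝ (Fin 3)))
  refine (LinearMap.injective_iff_surjective_of_finrank_eq_finrank ?_).1 hi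
  have : Module.finrank ℝ (TangentSpace (𝓡∂ 3) (chartPt c z)) = 3 :=
    (finrank_euclideanSpace_fin : Module.finrank ℝ (EuclideanSpace ℝ (Fin 3)) = 3)
  rw [Module.finrank_prod, this]
  simp

variable {lam : ℝ} {A : ConformalFields S}

/-- A vector in the kernel of the component matrix is `g`-orthogonal to everything, because the
coordinate vectors span the tangent space. All its coefficients in a `g`-orthonormal basis are then
zero. -/
theorem IsAdSType.det_ne [IsManifold (𝓡∂ 3) ∞ S] (h : IsAdSType lam A) (hc : IsChart c)
    {z : Fin 4 → ℝ} (hz : z ∈ A.dom c) : (A.met c z).det ≠ 0 := by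
  intro h0
  obtain ⟨v, hv, h1⟩ := Matrix.exists_mulVec_eq_zero_iff.2 h0
  apply hv
  obtain ⟨hi, hs⟩ := chartVecₗ_surjective hc hz.2
  obtain ⟨E, hE⟩ := h.lorentz (z 0) hz.1 (chartPt c z)
  have h2 : ∀ μ, A.g (z 0) (chartPt c z) (chartVecₗ c z (Pi.single μ 1)) (chartVecₗ c z v) = 0 := by
    intro μ
    have := congrFun h1 μ
    rw [Pi.zero_apply] at this
    rw [← this]
    have e : v = ∑ ν, v ν • (Pi.single ν (1 : ℝ) : Fin 4 → ℝ) := pi_eq_sum_univ' v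
    conv_lhs => rw [e]
    simp only [map_sum, map_smul, smul_eq_mul, Matrix.mulVec, dotProduct]
    exact Finset.sum_congr rfl fun ν _ => mul_comm _ _
  have h3 : ∀ X, A.g (z 0) (chartPt c z) X (chartVecₗ c z v) = 0 := by
    intro X
    obtain ⟨u, rfl⟩ := hs X
    have e : u = ∑ ν, u ν • (Pi.single ν (1 : ℝ) : Fin 4 → ℝ) := pi_eq_sum_univ' u
    rw [e]
    simp only [map_sum, LinearMap.sum_apply, map_smul, LinearMap.smul_apply, h2, smul_zero,
      Finset.sum_const_zero]
  have h4 : ∀ i, E.repr (chartVecₗ c z v) i = 0 := by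
    intro i
    have := h3 (E i)
    rw [← E.sum_repr (chartVecₗ c z v)] at this
    simp only [map_sum, map_smul, hE] at this
    rw [Finset.sum_eq_single i] at this
    · rcases eq_or_ne i 0 with rfl | hi0
      · simpa [minkowski] using this
      · simpa [minkowski, hi0] using this
    · intro j _ hj
      simp [minkowski, hj.symm]
    · simp
  apply hi
  rw [map_zero]
  exact E.ext_elem fun i => by rw [h4, map_zero, Finsupp.zero_apply]

theorem IsAdSType.isSolution [IsManifold (𝓡∂ 3) ∞ S] (h : IsAdSType lam A) (hc : IsChart c) :
    IsSolution lam (A.dom c) (A.met c) (A.om c) (A.rwe c) where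
  half := isHalfDomain_chartDom _
  met :=
    { dom := (isHalfDomain_chartDom _).regular
      smooth := h.smooth_met c hc
      symm := fun z hz _ _ => h.symm (z 0) hz.1 _ _ _
      det := fun _ hz => h.det_ne hc hz }
  om_smooth := h.smooth_om c hc
  W_smooth := fun i j k l => h.smooth_rwe c hc i j k l
  om_pos := h.om_pos c hc
  om_zero := h.om_zero c hc
  einstein := h.einstein c hc
  weyl := h.rescaled_weyl c hc

theorem eq_hyp_one {z : Fin 4 → ℝ} (h : z 1 = 0) : ∃ y, z = hyp 1 y :=
  ⟨fun i => z (Fin.succAbove 1 i), by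
    funext i
    refine Fin.succAboveCases 1 ?_ (fun j => ?_) i
    · rw [hyp_self, h]
    · rw [hyp_succAbove]⟩

theorem IsAdSType.spinor_reflecting [IsManifold (𝓡∂ 3) ∞ S] (h : IsAdSType lam A) (hlam : lam < 0)
    (hr : A.Reflecting) (hc : IsChart c) {z : Fin 4 → ℝ} (hz : z ∈ A.dom c) (h1 : z 1 = 0)
    {E : Fin 4 → Fin 4 → ℝ} (hE : IsBoundaryFrame A c z E) :
    spinor (A.rwe c z) E 4 = (starRingEnd ℂ) (spinor (A.rwe c z) E 0) ∧
    spinor (A.rwe c z) E 3 = (starRingEnd ℂ) (spinor (A.rwe c z) E 1) ∧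
    spinor (A.rwe c z) E 2 = (starRingEnd ℂ) (spinor (A.rwe c z) E 2) := by
  obtain ⟨y, rfl⟩ := eq_hyp_one h1
  exact (h.isSolution hc).spinor_reflecting hlam hz (hr c hc y hz) hE.orthonormal hE.normal

end Chart
end AdS

/-! ### The initial slice and the gauge conditions in coordinates. -/

namespace AdS

theorem hyp_zero_zero {n : ℕ} (y : Fin n → ℝ) : hyp 0 y 0 = 0 := hyp_self 0 y

theorem hyp_zero_succ {n : ℕ} (y : Fin n → ℝ) (a : Fin n) : hyp 0 y a.succ = y a :=
  hyp_succAbove 0 y a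

theorem IsHalfDomain.slice {D : Set (Fin 4 → ℝ)} (h : IsHalfDomain D 1) :
    IsHalfDomain (hyp 0 ⁻¹' D) 0 := by
  obtain ⟨U, hU, rfl⟩ := h
  refine ⟨hyp 0 ⁻¹' U, hU.preimage (contDiff_hyp 0).continuous, ?_⟩
  ext y
  simp only [Set.mem_preimage, Set.mem_inter_iff, Set.mem_ofPred_eq]
  rw [show (1 : Fin 4) = Fin.succ 0 from rfl, hyp_zero_succ]

theorem covDeriv_inter {n : ℕ} {D U : Set (Fin n → ℝ)}
    {g : (Fin n → ℝ) → Matrix (Fin n) (Fin n) ℝ} {x : Fin n → ℝ} (hU : IsOpen U) (hx : x ∈ U)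
    (T : Fin n → Fin n → (Fin n → ℝ) → ℝ) (c a b : Fin n) :
    covDeriv (D ∩ U) g T c a b x = covDeriv D g T c a b x := by
  simp only [covDeriv, pd_inter hU hx, christoffel_inter hU hx]

namespace IsMetric

variable {n : ℕ} {D : Set (Fin (n + 1) → ℝ)}
  {G : (Fin (n + 1) → ℝ) → Matrix (Fin (n + 1)) (Fin (n + 1)) ℝ} {y : Fin n → ℝ}

/-! ### Hypersurfaces orthogonal to the coordinate vector `∂₀` -/

theorem inv_zero_mul (M : IsMetric D G) (hy : hyp 0 y ∈ D)
    (h : ∀ a : Fin n, G (hyp 0 y) 0 a.succ = 0) (i : Fin (n + 1)) :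
    (G (hyp 0 y))⁻¹ i 0 * G (hyp 0 y) 0 0 = if i = 0 then 1 else 0 := by
  rw [← M.inv_mul hy i 0, Fin.sum_univ_succ]
  have : ∀ a : Fin n, G (hyp 0 y) a.succ 0 = 0 := fun a => by rw [M.symm _ hy, h]
  simp only [this, mul_zero, Finset.sum_const_zero, add_zero]

theorem zero_zero_ne (M : IsMetric D G) (hy : hyp 0 y ∈ D)
    (h : ∀ a : Fin n, G (hyp 0 y) 0 a.succ = 0) : G (hyp 0 y) 0 0 ≠ 0 := by
  intro h0
  have := M.inv_zero_mul hy h 0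
  simp [h0] at this

theorem inv_zero_zero (M : IsMetric D G) (hy : hyp 0 y ∈ D)
    (h : ∀ a : Fin n, G (hyp 0 y) 0 a.succ = 0) :
    (G (hyp 0 y))⁻¹ 0 0 = (G (hyp 0 y) 0 0)⁻¹ := by
  have := M.inv_zero_mul hy h 0
  rw [if_pos rfl] at this
  exact eq_inv_of_mul_eq_one_left this

theorem inv_zero_succ (M : IsMetric D G) (hy : hyp 0 y ∈ D)
    (h : ∀ a : Fin n, G (hyp 0 y) 0 a.succ = 0) (a : Fin n) :
    (G (hyp 0 y))⁻¹ 0 a.succ = 0 := by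
  have := M.inv_zero_mul hy h a.succ
  rw [if_neg (Fin.succ_ne_zero a)] at this
  rw [M.inv_symm hy]
  exact (mul_eq_zero.1 this).resolve_right (M.zero_zero_ne hy h)

theorem christoffel_zero (M : IsMetric D G) (hy : hyp 0 y ∈ D)
    (h : ∀ a : Fin n, G (hyp 0 y) 0 a.succ = 0) (j k : Fin (n + 1)) :
    christoffel D G 0 j k (hyp 0 y) = (G (hyp 0 y) 0 0)⁻¹ * chrL D G 0 j k (hyp 0 y) := by
  simp only [christoffel_eq]
  rw [Fin.sum_univ_succ]
  simp only [M.inv_zero_succ hy h, M.inv_zero_zero hy h, zero_mul, Finset.sum_const_zero, add_zero]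

theorem pd_zero_succ (M : IsMetric D G) (hE : IsRegularDomain (hyp 0 ⁻¹' D))
    (h : ∀ y ∈ hyp 0 ⁻¹' D, ∀ a : Fin n, G (hyp 0 y) 0 a.succ = 0) (hy : hyp 0 y ∈ D)
    (a b : Fin n) : pd D a.succ (fun z => G z 0 b.succ) (hyp 0 y) = 0 := by
  have := pd_hyp 0 (M.smooth 0 b.succ) hE hy a
  rw [Fin.succAbove_zero] at this
  rw [← this]
  exact pd_zero_of_eqOn (fun x hx => h x hx b) hy a

theorem chrL_zero_succ (M : IsMetric D G) (hE : IsRegularDomain (hyp 0 ⁻¹' D))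
    (h : ∀ y ∈ hyp 0 ⁻¹' D, ∀ a : Fin n, G (hyp 0 y) 0 a.succ = 0) (hy : hyp 0 y ∈ D)
    (a b : Fin n) : chrL D G 0 a.succ b.succ (hyp 0 y)
      = - (1 / 2) * pd D 0 (fun z => G z a.succ b.succ) (hyp 0 y) := by
  simp only [chrL, M.pd_zero_succ hE h hy]
  ring

end IsMetric

/-- A solution in an adapted conformal Gauss gauge, in coordinates: the metric `g`, the conformal
factor `om`, the rescaled Weyl tensor `W`, and the 1-form `b`. -/
structure IsGauss (lam : ℝ) (D : Set (Fin 4 → ℝ)) (g : (Fin 4 → ℝ) → Matrix (Fin 4) (Fin 4) ℝ)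
    (om : (Fin 4 → ℝ) → ℝ) (W : (Fin 4 → ℝ) → Fin 4 → Fin 4 → Fin 4 → Fin 4 → ℝ)
    (b : (Fin 4 → ℝ) → Fin 4 → ℝ) : Prop where
  sol : IsSolution lam D g om W
  b_smooth : ∀ μ, ContDiffOn ℝ ∞ (fun z => b z μ) D
  unit : ∀ z ∈ D, g z 0 0 = -1
  orthogonal : ∀ z ∈ D, z 0 = 0 → ∀ μ, μ ≠ 0 → g z 0 μ = 0
  geodesic : ∀ z ∈ D, ∀ μ, christoffel D g μ 0 0 z
    = - 2 * b z 0 * (Pi.single 0 1 : Fin 4 → ℝ) μ - ∑ ν, (g z)⁻¹ μ ν * b z ν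
  one_form : ∀ z ∈ D, ∀ ν, pd D 0 (fun w => b w ν) z - ∑ σ, christoffel D g σ 0 ν z * b z σ
    = b z 0 * b z ν - (1 / 2) * normSq (g z) (b z) * g z 0 ν + schouten D g 0 ν z
  om_slice : ∀ z ∈ D, z 0 = 0 → pd D 0 om z = 0

/-- The second fundamental form of the slice. -/
noncomputable def sff (D : Set (Fin 4 → ℝ)) (g : (Fin 4 → ℝ) → Matrix (Fin 4) (Fin 4) ℝ)
    (α β : Fin 3) (x : Fin 3 → ℝ) : ℝ :=
  ∑ μ, g (hyp 0 x) β.succ μ * christoffel D g μ α.succ 0 (hyp 0 x)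

namespace IsGauss

variable {lam : ℝ} {D : Set (Fin 4 → ℝ)} {g : (Fin 4 → ℝ) → Matrix (Fin 4) (Fin 4) ℝ}
  {om : (Fin 4 → ℝ) → ℝ} {W : (Fin 4 → ℝ) → Fin 4 → Fin 4 → Fin 4 → Fin 4 → ℝ}
  {b : (Fin 4 → ℝ) → Fin 4 → ℝ} {x : Fin 3 → ℝ}

theorem slice_orth (H : IsGauss lam D g om W b) : ∀ x ∈ hyp 0 ⁻¹' D, ∀ a : Fin 3,
    g (hyp 0 x) 0 a.succ = 0 :=
  fun x hx a => H.orthogonal _ hx (hyp_zero_zero x) _ (Fin.succ_ne_zero a)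

theorem sff_eq (H : IsGauss lam D g om W b) (hx : hyp 0 x ∈ D) (α β : Fin 3) :
    sff D g α β x = (1 / 2) * pd D 0 (fun z => g z α.succ β.succ) (hyp 0 x) := by
  rw [sff, H.sol.met.lower_christoffel hx, chrL]
  have h1 := H.sol.met.pd_zero_succ H.sol.half.slice.regular H.slice_orth hx
  have h2 : ∀ a b : Fin 3, pd D a.succ (fun z => g z b.succ 0) (hyp 0 x) = 0 := fun a b => by
    rw [H.sol.met.pd_symm hx, h1]
  have h3 := H.sol.met.pd_symm hx 0 β.succ α.succ
  simp only [h2, h3]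
  ring

end IsGauss
end AdS

/-! ### The Gauss and Codazzi equations of the physical metric on the slice. -/

namespace AdS

/-- The data induced on the slice `τ = 0`, in coordinates. -/
noncomputable def sliceData (D : Set (Fin 4 → ℝ)) (g : (Fin 4 → ℝ) → Matrix (Fin 4) (Fin 4) ℝ)
    (om : (Fin 4 → ℝ) → ℝ) (W : (Fin 4 → ℝ) → Fin 4 → Fin 4 → Fin 4 → Fin 4 → ℝ)
    (b : (Fin 4 → ℝ) → Fin 4 → ℝ) (F : (Fin 4 → ℝ) → Fin 4 → Fin 4 → ℝ) : LocalData where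
  dom := hyp 0 ⁻¹' D
  h := fun x => Matrix.of fun α β => g (hyp 0 x) α.succ β.succ
  chi := sff D g
  om := fun x => om (hyp 0 x)
  W := fun x => W (hyp 0 x)
  b := fun α x => b (hyp 0 x) α.succ
  e := fun a α x => F (hyp 0 x) a.succ α.succ

theorem pd_inv_sq {n : ℕ} {D : Set (Fin n → ℝ)} (hD : IsRegularDomain D) {f : (Fin n → ℝ) → ℝ}
    (hf : ContDiffOn ℝ ∞ f D) (h0 : ∀ x ∈ D, f x ≠ 0) {x : Fin n → ℝ} (hx : x ∈ D) (μ : Fin n) :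
    pd D μ (fun y => (f y ^ 2)⁻¹) x = - 2 * (f x ^ 3)⁻¹ * pd D μ f x := by
  have hs : ContDiffOn ℝ ∞ (fun y => (f y ^ 2)⁻¹) D :=
    (hf.pow 2).inv fun y hy => pow_ne_zero 2 (h0 y hy)
  have h1 : pd D μ (fun y => (f y * f y) * (f y ^ 2)⁻¹) x = 0 := by
    rw [pd_congr (g := fun _ => (1 : ℝ)) (fun y hy => by
      have := h0 y hy
      field_simp) μ hx, pd_const]
  rw [pd_mul hD (hf.mul hf) hs hx, pd_mul hD hf hf hx] at h1
  have := h0 x hx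
  field_simp at h1 ⊢
  linarith

namespace IsGauss

variable {lam : ℝ} {D : Set (Fin 4 → ℝ)} {g : (Fin 4 → ℝ) → Matrix (Fin 4) (Fin 4) ℝ}
  {om : (Fin 4 → ℝ) → ℝ} {W : (Fin 4 → ℝ) → Fin 4 → Fin 4 → Fin 4 → Fin 4 → ℝ}
  {b : (Fin 4 → ℝ) → Fin 4 → ℝ} {x : Fin 3 → ℝ}

theorem physical (H : IsGauss lam D g om W b) :
    IsMetric (D ∩ {z | 0 < z 1}) (fun z => (om z ^ 2)⁻¹ • g z) := by
  obtain ⟨M, ho, h0⟩ := H.sol.interior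
  exact M.conformal ((ho.pow 2).inv fun y hy => pow_ne_zero 2 (h0 y hy))
    fun y hy => inv_ne_zero (pow_ne_zero 2 (h0 y hy))

/-- Conformal covariance gives the Weyl tensor of `ĝ`, lowered with `ĝ`, as `Ω⁻² C[g] = Ω⁻¹ W`. The
Einstein equation turns the rest of the curvature into that of constant curvature `λ/3`. -/
theorem riemannLow_physical (H : IsGauss lam D g om W b) {z : Fin 4 → ℝ}
    (hz : z ∈ D ∩ {z | 0 < z 1}) (i j k l : Fin 4) :
    riemannLow (D ∩ {z | 0 < z 1}) (fun z => (om z ^ 2)⁻¹ • g z) i j k l z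
      = (om z)⁻¹ * W z i j k l + lam / 3 * ((om z ^ 2)⁻¹ * g z i k * ((om z ^ 2)⁻¹ * g z j l)
        - (om z ^ 2)⁻¹ * g z i l * ((om z ^ 2)⁻¹ * g z j k)) := by
  obtain ⟨M, ho, h0⟩ := H.sol.interior
  have e1 := M.weyl_rescaled IsSolution.four_sub_two IsSolution.four_sub_one ho h0 hz i j k l
  rw [weyl_inter (isOpen_pos 1) hz.1 hz.2 (g := g), ← H.sol.weyl z hz.1] at e1
  have e2 := H.physical.schouten_of_einstein IsSolution.four_sub_two IsSolution.four_sub_one hz (lam := lam)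
    (fun i j => by
      rw [ricci_inter (isOpen_pos 1) hz.1 hz.2, H.sol.einstein z hz.1 (ne_of_gt hz.2)]
      rfl)
  simp only [weyl, e2, Matrix.smul_apply, smul_eq_mul] at e1
  have := h0 z hz
  rw [sub_eq_iff_eq_add.1 e1]
  field_simp
  push_cast
  ring

theorem mem_interior (hx : hyp 0 x ∈ D) (h0 : 0 < x 0) : hyp 0 x ∈ D ∩ {z | 0 < z 1} := by
  refine ⟨hx, ?_⟩
  rw [Set.mem_ofPred_eq, show (1 : Fin 4) = Fin.succ 0 from rfl, hyp_zero_succ]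
  exact h0

theorem preimage_interior : hyp 0 ⁻¹' (D ∩ {z | 0 < z 1}) = hyp 0 ⁻¹' D ∩ {x | 0 < x 0} := by
  ext x
  simp only [Set.mem_preimage, Set.mem_inter_iff, Set.mem_ofPred_eq]
  rw [show (1 : Fin 4) = Fin.succ 0 from rfl, hyp_zero_succ]

theorem regular_interior (H : IsGauss lam D g om W b) :
    IsRegularDomain (hyp 0 ⁻¹' (D ∩ {z | 0 < z 1})) := by
  rw [preimage_interior]
  exact isRegularDomain_of_isOpen H.sol.half.slice.isOpen_inter

theorem physical_orth (H : IsGauss lam D g om W b) :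
    ∀ x ∈ hyp 0 ⁻¹' (D ∩ {z | 0 < z 1}), ∀ a : Fin 3,
      ((om (hyp 0 x) ^ 2)⁻¹ • g (hyp 0 x)) 0 a.succ = 0 := fun x hx a => by
  rw [Matrix.smul_apply, H.slice_orth x hx.1 a, smul_zero]

theorem physical_inv_ne (H : IsGauss lam D g om W b) :
    ∀ x ∈ hyp 0 ⁻¹' (D ∩ {z | 0 < z 1}), ((om (hyp 0 x) ^ 2)⁻¹ • g (hyp 0 x))⁻¹ 0 0 ≠ 0 :=
  fun x hx => by
    have := H.physical.inv_zero_zero hx (H.physical_orth x hx)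
    rw [this]
    exact inv_ne_zero (H.physical.zero_zero_ne hx (H.physical_orth x hx))

theorem physical_inv (H : IsGauss lam D g om W b) (hx : hyp 0 x ∈ D ∩ {z | 0 < z 1}) :
    ((om (hyp 0 x) ^ 2)⁻¹ • g (hyp 0 x))⁻¹ 0 0 = - om (hyp 0 x) ^ 2 := by
  have := H.physical.inv_zero_zero hx (H.physical_orth x hx)
  rw [this, Matrix.smul_apply, H.unit _ hx.1, smul_eq_mul, mul_neg_one, inv_neg, inv_inv]

/-- The condition `∂_τ Ω = 0` on `S` enters here: `Ω⁻²` is not differentiated, so `Γ̂⁰_{αβ}` is the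
second fundamental form of `g` without correction. -/
theorem christoffel_physical (H : IsGauss lam D g om W b) (hx : hyp 0 x ∈ D ∩ {z | 0 < z 1})
    (α β : Fin 3) : christoffel (D ∩ {z | 0 < z 1}) (fun z => (om z ^ 2)⁻¹ • g z) 0 α.succ β.succ
      (hyp 0 x) = sff D g α β x := by
  obtain ⟨M, ho, h0⟩ := H.sol.interior
  rw [H.physical.christoffel_zero hx (H.physical_orth x hx),
    H.physical.chrL_zero_succ H.regular_interior H.physical_orth hx, H.sff_eq hx.1]
  have hq : ContDiffOn ℝ ∞ (fun y => (om y ^ 2)⁻¹) (D ∩ {z | 0 < z 1}) :=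
    (ho.pow 2).inv fun y hy => pow_ne_zero 2 (h0 y hy)
  simp only [Matrix.smul_apply, smul_eq_mul]
  rw [pd_mul M.dom hq (M.smooth _ _) hx,
    pd_inv_sq M.dom ho h0 hx, pd_inter (isOpen_pos 1) hx.2, pd_inter (isOpen_pos 1) hx.2,
    H.om_slice _ hx.1 (hyp_zero_zero x), H.unit _ hx.1]
  have := h0 _ hx
  field_simp
  ring

/-- The conormal `dτ` has `ĝ`-square `-Ω²` and is not normalised; this symbol records its change
along `S` and feeds the extra terms of `codazzi`. -/
theorem christoffel_physical_time (H : IsGauss lam D g om W b)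
    (hx : hyp 0 x ∈ D ∩ {z | 0 < z 1}) (α : Fin 3) :
    christoffel (D ∩ {z | 0 < z 1}) (fun z => (om z ^ 2)⁻¹ • g z) 0 α.succ 0 (hyp 0 x)
      = - (om (hyp 0 x))⁻¹ * pd D α.succ om (hyp 0 x) := by
  obtain ⟨M, ho, h0⟩ := H.sol.interior
  have hq : ContDiffOn ℝ ∞ (fun y => (om y ^ 2)⁻¹) (D ∩ {z | 0 < z 1}) :=
    (ho.pow 2).inv fun y hy => pow_ne_zero 2 (h0 y hy)
  have e : pd (D ∩ {z | 0 < z 1}) α.succ (fun z => (om z ^ 2)⁻¹ * g z 0 0) (hyp 0 x)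
      = 2 * (om (hyp 0 x) ^ 3)⁻¹ * pd D α.succ om (hyp 0 x) := by
    rw [pd_congr (g := fun z => - (om z ^ 2)⁻¹) (fun z hz => by
      simp only [H.unit z hz.1, mul_neg_one]) _ hx, pd_neg M.dom hx, pd_inv_sq M.dom ho h0 hx,
      pd_inter (isOpen_pos 1) hx.2]
    ring
  rw [H.physical.christoffel_zero hx (H.physical_orth x hx)]
  rw [chrL, H.physical.pd_symm hx 0 α.succ 0]
  simp only [Matrix.smul_apply, smul_eq_mul, e, H.unit _ hx.1]
  have := h0 _ hx
  field_simp
  ring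

/-- The tangential components come from the Gauss equation of `ĝ`, in which `ĝ⁰⁰ = -Ω²` and `Γ̂⁰ = χ
= Ω χ̂` combine to the products of `χ̂`. The electric part follows by trace-freeness, the magnetic
part from the Codazzi equation. -/
theorem isRescaledWeyl (H : IsGauss lam D g om W b) (F : (Fin 4 → ℝ) → Fin 4 → Fin 4 → ℝ) :
    (sliceData D g om W b F).IsRescaledWeyl lam := by
  have hind : (sliceData D g om W b F).hPhys = indMet 0 (fun z => (om z ^ 2)⁻¹ • g z) := by
    funext x
    ext α β
    simp only [LocalData.hPhys, sliceData, indMet, Matrix.smul_apply, Matrix.of_apply,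
      Fin.succAbove_zero]
  have hpos : ∀ x ∈ hyp 0 ⁻¹' D, x 0 ≠ 0 → 0 < x 0 := fun x hx h =>
    lt_of_le_of_ne (H.sol.half.slice.nonneg hx) (Ne.symm h)
  obtain ⟨-, -, h0⟩ := H.sol.interior
  have htan : ∀ x ∈ hyp 0 ⁻¹' D, x 0 ≠ 0 → ∀ α β γ δ : Fin 3,
      (sliceData D g om W b F).weylPhys lam α β γ δ x
        = (om (hyp 0 x))⁻¹ * W (hyp 0 x) α.succ β.succ γ.succ δ.succ := by
    intro x hx h1 α β γ δ
    have hx' := mem_interior hx (hpos x hx h1)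
    have e := H.physical.gauss H.regular_interior H.physical_inv_ne hx' α β γ δ
    simp only [Fin.succAbove_zero] at e
    rw [preimage_interior, riemannLow_inter (isOpen_pos 0) hx (hpos x hx h1), ← hind,
      H.riemannLow_physical hx', H.physical_inv hx'] at e
    simp only [H.christoffel_physical hx'] at e
    have h2 := h0 _ hx'
    rw [LocalData.weylPhys, show (sliceData D g om W b F).dom = hyp 0 ⁻¹' D from rfl, e]
    simp only [LocalData.hPhys, LocalData.chiPhys, sliceData, Matrix.smul_apply, Matrix.of_apply,
      smul_eq_mul]
    field_simp
    ring
  refine ⟨fun x hx h1 α β γ δ => ?_, fun x hx h1 β δ => ?_, fun x hx h1 β γ δ => ?_⟩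
  · have h2 := h0 _ (mem_interior hx (hpos x hx h1))
    rw [htan x hx h1]
    simp only [sliceData]
    field_simp
  · have hx' := mem_interior hx (hpos x hx h1)
    have h2 := h0 _ hx'
    have hi : ∀ α γ : Fin 3, ((sliceData D g om W b F).hPhys x)⁻¹ α γ
        = om (hyp 0 x) ^ 2 * (g (hyp 0 x))⁻¹ α.succ γ.succ := by
      intro α γ
      rw [hind, H.physical.indMet_inv hx' (H.physical_inv_ne x hx')]
      have e0 := H.physical.inv_zero_succ hx' (H.physical_orth x hx')
      simp only [Fin.succAbove_zero] at e0 ⊢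
      rw [e0, mul_zero, zero_div, sub_zero,
        H.sol.met.inv_conformal hx (inv_ne_zero (pow_ne_zero 2 h2)), inv_inv, Matrix.smul_apply,
        smul_eq_mul]
    -- With `∂_τ` a unit normal of `S`, trace-freeness expresses `W_{0β0δ}` by the spatial trace of
    -- the tangential components. The powers of `Ω` from `ĥ⁻¹`, from `weylPhys` and from the claim
    -- multiply to one.
    have ht := H.sol.W_trace hx β.succ δ.succ
    rw [Fin.sum_univ_succ, Fin.sum_univ_succ] at ht
    simp only [Fin.sum_univ_succ (n := 3), H.sol.met.inv_zero_succ hx (H.slice_orth x hx),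
      H.sol.met.inv_symm hx (Fin.succ _) 0, H.sol.met.inv_zero_zero hx (H.slice_orth x hx),
      H.unit _ hx, zero_mul, Finset.sum_const_zero, zero_add, add_zero] at ht
    have e : ∀ α γ, ((sliceData D g om W b F).hPhys x)⁻¹ α γ
        * (sliceData D g om W b F).weylPhys lam α β γ δ x
        = om (hyp 0 x) * ((g (hyp 0 x))⁻¹ γ.succ α.succ
          * W (hyp 0 x) α.succ β.succ γ.succ δ.succ) := fun α γ => by
      rw [hi, htan x hx h1, H.sol.met.inv_symm hx]
      field_simp
    simp only [e, ← Finset.mul_sum]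
    rw [Finset.sum_comm, show (sliceData D g om W b F).om x = om (hyp 0 x) from rfl,
      inv_mul_cancel_left₀ h2]
    change W (hyp 0 x) 0 β.succ 0 δ.succ = _
    linarith
  · have hx' := mem_interior hx (hpos x hx h1)
    have h2 := h0 _ hx'
    have e := H.physical.codazzi H.regular_interior H.physical_inv_ne hx' β γ δ
    have e0 := H.physical.inv_zero_succ hx' (H.physical_orth x hx')
    have ei := H.physical_inv hx'
    have hom : ContDiffOn ℝ ∞ (fun y => om (hyp 0 y)) (hyp 0 ⁻¹' (D ∩ {z | 0 < z 1})) :=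
      (ContDiffOn.comp_hyp 0 H.sol.om_smooth).mono fun y hy => hy.1
    have hchr : ∀ p q : Fin 3, Set.EqOn (fun y => christoffel (D ∩ {z | 0 < z 1})
        (fun z => (om z ^ 2)⁻¹ • g z) 0 p.succ q.succ (hyp 0 y)) (sff D g p q)
        (hyp 0 ⁻¹' (D ∩ {z | 0 < z 1})) := fun p q y hy => H.christoffel_physical hy p q
    have hsff : ∀ p q, ContDiffOn ℝ ∞ (sff D g p q) (hyp 0 ⁻¹' (D ∩ {z | 0 < z 1})) := fun p q =>
      (ContDiffOn.comp_hyp 0 (H.physical.christoffel_smooth 0 p.succ q.succ)).congr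
        fun y hy => (hchr p q hy).symm
    have hchi : ∀ p q, ContDiffOn ℝ ∞ ((sliceData D g om W b F).chiPhys p q)
        (hyp 0 ⁻¹' (D ∩ {z | 0 < z 1})) := fun p q =>
      (hom.inv fun y hy => h0 _ hy).mul (hsff p q)
    -- Since `χ = Ω χ̂`, its derivative contains an extra `dΩ ⊗ χ̂`. This is what the terms with
    -- `Γ̂⁰_{α0} = -Ω⁻¹ ∂_α Ω` in `codazzi` cancel.
    have hcov : ∀ r p q, covDeriv (hyp 0 ⁻¹' (D ∩ {z | 0 < z 1}))
        (indMet 0 fun z => (om z ^ 2)⁻¹ • g z) (fun p q y => christoffel (D ∩ {z | 0 < z 1})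
        (fun z => (om z ^ 2)⁻¹ • g z) 0 p.succ q.succ (hyp 0 y)) r p q x
        = om (hyp 0 x) * covDeriv (hyp 0 ⁻¹' D) (sliceData D g om W b F).hPhys
            (sliceData D g om W b F).chiPhys r p q x
          + pd D r.succ om (hyp 0 x) * (sliceData D g om W b F).chiPhys p q x := by
      intro r p q
      have hmul : ∀ p q, Set.EqOn (fun y => christoffel (D ∩ {z | 0 < z 1})
          (fun z => (om z ^ 2)⁻¹ • g z) 0 p.succ q.succ (hyp 0 y))
          (fun y => om (hyp 0 y) * (sliceData D g om W b F).chiPhys p q y)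
          (hyp 0 ⁻¹' (D ∩ {z | 0 < z 1})) := fun p q y hy => by
        have := h0 _ hy
        simp only [H.christoffel_physical hy, LocalData.chiPhys, sliceData]
        field_simp
      rw [← covDeriv_inter (D := hyp 0 ⁻¹' D) (isOpen_pos 0) (hpos x hx h1), ← preimage_interior, hind]
      simp only [covDeriv]
      have hpo := pd_hyp 0 H.sol.om_smooth H.sol.half.slice.regular hx r
      rw [Fin.succAbove_zero] at hpo
      have hx1 : x ∈ hyp 0 ⁻¹' (D ∩ {z | 0 < z 1}) := hx'
      have hmx := fun p q => hmul p q hx1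
      simp only at hmx
      rw [pd_congr (hmul p q) r hx1, pd_mul H.regular_interior hom (hchi p q) hx1,
        show pd (hyp 0 ⁻¹' (D ∩ {z | 0 < z 1})) r (fun y => om (hyp 0 y)) x
          = pd D r.succ om (hyp 0 x) by
          rw [preimage_interior, pd_inter (isOpen_pos 0) (hpos x hx h1), hpo]]
      simp only [hmx, Fin.sum_univ_three]
      ring
    rw [H.physical.riemann_eq hx', Fin.sum_univ_succ] at e
    simp only [Fin.succAbove_zero] at e
    rw [hcov, hcov] at e
    simp only [Fin.sum_univ_succ (n := 3)] at e
    have hK0 : ∀ p q, sff D g p q x = om (hyp 0 x) * (sliceData D g om W b F).chiPhys p q x := by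
      intro p q
      simp only [LocalData.chiPhys, sliceData]
      field_simp
    simp only [H.christoffel_physical hx', e0, ei, zero_mul, Finset.sum_const_zero, add_zero,
      H.christoffel_physical_time hx', H.riemannLow_physical hx', H.slice_orth x hx, mul_zero,
      sub_zero, hK0] at e
    change W (hyp 0 x) 0 β.succ γ.succ δ.succ = covDeriv (hyp 0 ⁻¹' D) _ _ δ γ β x
      - covDeriv (hyp 0 ⁻¹' D) _ _ γ δ β x
    apply mul_left_cancel₀ h2
    field_simp at e
    linear_combination -e

end IsGauss
end AdS

namespace AdS

/-! ## Differential polynomials in the data -/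

section MultiDeriv

variable {n : ℕ} {V : Type*} [NormedAddCommGroup V] [NormedSpace ℝ V] {D : Set (Fin n → ℝ)}

theorem contDiffOn_iterate_pd (hD : IsRegularDomain D) {f : (Fin n → ℝ) → V}
    (hf : ContDiffOn ℝ ∞ f D) (μ : Fin n) (k : ℕ) : ContDiffOn ℝ ∞ ((pd D μ)^[k] f) D := by
  induction k with
  | zero => exact hf
  | succ k ih =>
    rw [Function.iterate_succ_apply']
    exact ContDiffOn.pd hD ih μ

theorem iterate_pd_congr {f g : (Fin n → ℝ) → V} (h : Set.EqOn f g D) (μ : Fin n) (k : ℕ) :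
    Set.EqOn ((pd D μ)^[k] f) ((pd D μ)^[k] g) D := by
  induction k with
  | zero => exact h
  | succ k ih =>
    rw [Function.iterate_succ_apply', Function.iterate_succ_apply']
    exact pd_congr ih μ

theorem pd_iterate_comm (hD : IsRegularDomain D) {f : (Fin n → ℝ) → V}
    (hf : ContDiffOn ℝ ∞ f D) (μ ν : Fin n) (k : ℕ) :
    Set.EqOn (pd D μ ((pd D ν)^[k] f)) ((pd D ν)^[k] (pd D μ f)) D := by
  induction k with
  | zero => exact fun _ _ => rfl
  | succ k ih =>
    intro x hx
    rw [Function.iterate_succ_apply', Function.iterate_succ_apply',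
      pd_comm hD (contDiffOn_iterate_pd hD hf ν k) hx]
    exact pd_congr ih ν hx

end MultiDeriv

variable {D : Set (Fin 3 → ℝ)} {f : (Fin 3 → ℝ) → ℂ}

theorem contDiffOn_multiDeriv (hD : IsRegularDomain D) (hf : ContDiffOn ℝ ∞ f D)
    (q : Fin 3 → ℕ) : ContDiffOn ℝ ∞ (multiDeriv D q f) D :=
  contDiffOn_iterate_pd hD (contDiffOn_iterate_pd hD (contDiffOn_iterate_pd hD hf 2 _) 1 _) 0 _

theorem pd_multiDeriv (hD : IsRegularDomain D) (hf : ContDiffOn ℝ ∞ f D) (q : Fin 3 → ℕ)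
    (α : Fin 3) : Set.EqOn (pd D α (multiDeriv D q f)) (multiDeriv D (q + Pi.single α 1) f) D := by
  have h2 := contDiffOn_iterate_pd hD hf 2 (q 2)
  have h1 := contDiffOn_iterate_pd hD h2 1 (q 1)
  fin_cases α
  · intro x hx
    simp [multiDeriv, Function.iterate_succ_apply']
  · intro x hx
    have e := pd_iterate_comm hD h1 1 0 (q 0) hx
    simpa [multiDeriv, Function.iterate_succ_apply'] using e
  · intro x hx
    have e := pd_iterate_comm hD h1 2 0 (q 0) hx
    have e' := iterate_pd_congr (pd_iterate_comm hD h2 2 1 (q 1)) 0 (q 0) hx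
    simpa [multiDeriv, Function.iterate_succ_apply'] using e.trans e'

/-- The variable whose value is the derivative, in the direction `α`, of the given one. -/
def JetVar.shift (α : Fin 3) : JetVar → JetVar
  | .geo f q => .geo f (q + Pi.single α 1)
  | .psi B q => .psi B (q + Pi.single α 1)
  | .psiBar B q => .psiBar B (q + Pi.single α 1)

/-- Derivatives of the geometric data of order at most `k`, and of `ψ` of order less than `k`. -/
def lowJets (k : ℕ) : Set JetVar := fun v => match v with
  | .geo _ q => ∑ i, q i ≤ k
  | .psi _ q => ∑ i, q i < k
  | .psiBar _ q => ∑ i, q i < k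

/-- Derivatives of order at most `k`. -/
def allJets (k : ℕ) : Set JetVar := fun v => match v with
  | .geo _ q => ∑ i, q i ≤ k
  | .psi _ q => ∑ i, q i ≤ k
  | .psiBar _ q => ∑ i, q i ≤ k

/-- Derivatives of order at most `k`, less than `k` of them transverse for `ψ`. -/
def midJets (k : ℕ) : Set JetVar := {v | v.IsLower k}

theorem lowJets_subset_midJets (k : ℕ) : lowJets k ⊆ midJets k := by
  rintro (⟨f, q⟩ | ⟨B, q⟩ | ⟨B, q⟩) h
  · exact h
  all_goals
    have h' : ∑ i, q i < k := h
    have h0 : q 0 ≤ ∑ i, q i := Finset.single_le_sum (f := q) (fun _ _ => Nat.zero_le _)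
      (Finset.mem_univ 0)
    exact ⟨by omega, by omega⟩

theorem midJets_subset_allJets (k : ℕ) : midJets k ⊆ allJets k := by
  rintro (⟨f, q⟩ | ⟨B, q⟩ | ⟨B, q⟩) h
  · exact h
  · exact h.1
  · exact h.1

theorem allJets_subset_lowJets (k : ℕ) : allJets k ⊆ lowJets (k + 1) := by
  rintro (⟨f, q⟩ | ⟨B, q⟩ | ⟨B, q⟩) h
  · exact Nat.le_succ_of_le h
  · exact Nat.lt_succ_of_le h
  · exact Nat.lt_succ_of_le h

theorem lowJets_mono {k l : ℕ} (h : k ≤ l) : lowJets k ⊆ lowJets l := by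
  rintro (⟨f, q⟩ | ⟨B, q⟩ | ⟨B, q⟩) hv
  · exact le_trans (α := ℕ) hv h
  · exact lt_of_lt_of_le (α := ℕ) hv h
  · exact lt_of_lt_of_le (α := ℕ) hv h

theorem allJets_mono {k l : ℕ} (h : k ≤ l) : allJets k ⊆ allJets l := by
  rintro (⟨f, q⟩ | ⟨B, q⟩ | ⟨B, q⟩) hv <;> exact le_trans (α := ℕ) hv h

theorem sum_shift (q : Fin 3 → ℕ) (α : Fin 3) :
    ∑ i, (q + Pi.single α 1 : Fin 3 → ℕ) i = ∑ i, q i + 1 := by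
  simp [Finset.sum_add_distrib]

theorem shift_mem_lowJets {k : ℕ} {v : JetVar} (α : Fin 3) (h : v ∈ lowJets k) :
    v.shift α ∈ lowJets (k + 1) := by
  rcases v with ⟨f, q⟩ | ⟨B, q⟩ | ⟨B, q⟩
  · exact (sum_shift q α).le.trans (Nat.succ_le_succ h)
  · exact (sum_shift q α).le.trans_lt (Nat.succ_lt_succ h)
  · exact (sum_shift q α).le.trans_lt (Nat.succ_lt_succ h)

theorem shift_mem_allJets {k : ℕ} {v : JetVar} (α : Fin 3) (h : v ∈ allJets k) :
    v.shift α ∈ allJets (k + 1) := by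
  rcases v with ⟨f, q⟩ | ⟨B, q⟩ | ⟨B, q⟩ <;> exact (sum_shift q α).le.trans (Nat.succ_le_succ h)

theorem shift_mem_midJets {k : ℕ} {v : JetVar} (α : Fin 3) (h : v ∈ midJets k) :
    v.shift α ∈ midJets (k + 1) := by
  rcases v with ⟨f, q⟩ | ⟨B, q⟩ | ⟨B, q⟩
  · exact (sum_shift q α).le.trans (Nat.succ_le_succ h)
  all_goals
    refine ⟨(sum_shift q α).le.trans (Nat.succ_le_succ h.1), ?_⟩
    have h2 : q 0 < k := h.2
    have h3 : (Pi.single α 1 : Fin 3 → ℕ) 0 ≤ 1 := by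
      rw [Pi.single_apply]
      split_ifs <;> omega
    rw [Pi.add_apply]
    omega

/-- A tangential derivative raises the total order but not the transverse one, so the result is of
lower order in the sense of `JetVar.IsLower`. -/
theorem shift_mem_midJets_of_ne {k : ℕ} {v : JetVar} {α : Fin 3} (hα : α ≠ 0)
    (h : v ∈ allJets k) : v.shift α ∈ midJets (k + 1) := by
  rcases v with ⟨f, q⟩ | ⟨B, q⟩ | ⟨B, q⟩
  · exact (sum_shift q α).le.trans (Nat.succ_le_succ h)
  all_goals
    refine ⟨(sum_shift q α).le.trans (Nat.succ_le_succ h), ?_⟩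
    have h0 : q 0 ≤ ∑ i, q i := Finset.single_le_sum (f := q) (fun _ _ => Nat.zero_le _)
      (Finset.mem_univ 0)
    have h1 : ∑ i, q i ≤ k := h
    have h3 : (Pi.single α 1 : Fin 3 → ℕ) 0 = 0 := by simp [hα.symm]
    rw [Pi.add_apply, h3]
    omega

/-! ## Solutions in the gauge, with a frame field -/

/-- A solution in an adapted conformal Gauss gauge with a propagated orthonormal frame field, in
coordinates. -/
structure GaugeSol (lam : ℝ) where
  D : Set (Fin 4 → ℝ)
  g : (Fin 4 → ℝ) → Matrix (Fin 4) (Fin 4) ℝ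
  om : (Fin 4 → ℝ) → ℝ
  W : (Fin 4 → ℝ) → Fin 4 → Fin 4 → Fin 4 → Fin 4 → ℝ
  b : (Fin 4 → ℝ) → Fin 4 → ℝ
  F : (Fin 4 → ℝ) → Fin 4 → Fin 4 → ℝ
  gauss : IsGauss lam D g om W b
  F_smooth : ∀ i μ, ContDiffOn ℝ ∞ (fun z => F z i μ) D
  F_time : ∀ z ∈ D, F z 0 = Pi.single 0 1
  F_orth : ∀ z ∈ D, ∀ i j, ∑ μ, ∑ ν, g z μ ν * F z i μ * F z j ν = minkowski i j
  F_prop : ∀ z ∈ D, ∀ i μ, pd D 0 (fun w => F w i μ) z + ∑ ν, christoffel D g μ 0 ν z * F z i ν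
    = - (∑ ν, b z ν * F z i ν) * (Pi.single 0 1 : Fin 4 → ℝ) μ - b z 0 * F z i μ
      + (∑ ν, g z 0 ν * F z i ν) * ∑ ν, (g z)⁻¹ μ ν * b z ν

namespace GaugeSol

variable {lam : ℝ} (s : GaugeSol lam) {x : Fin 3 → ℝ}

/-- The Cauchy data of the solution. -/
noncomputable def data : LocalData := sliceData s.D s.g s.om s.W s.b s.F

theorem regular : IsRegularDomain s.D := s.gauss.sol.met.dom

theorem slice_regular : IsRegularDomain (hyp 0 ⁻¹' s.D) := s.gauss.sol.half.slice.regular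

/-- `e₀ = ∂_τ` is the unit normal of `S`, so the other frame vectors are tangent to `S` at `τ = 0`.
Consequently the `τ`-derivatives on the right of the Bianchi equation have coefficients that vanish
on the slice. -/
theorem frame_slice (hx : hyp 0 x ∈ s.D) (a : Fin 3) : s.F (hyp 0 x) a.succ 0 = 0 := by
  have h := s.F_orth _ hx 0 a.succ
  rw [s.F_time _ hx] at h
  have h0 : minkowski 0 a.succ = 0 := by simp [minkowski, (Fin.succ_ne_zero a).symm]
  rw [h0] at h
  simpa [Fin.sum_univ_succ (n := 3), Pi.single_apply, s.gauss.slice_orth x hx,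
    s.gauss.unit _ hx, Fin.succ_ne_zero] using h

theorem data_frame (hx : hyp 0 x ∈ s.D) : s.data.frame x = s.F (hyp 0 x) := by
  funext a
  refine Fin.cases ?_ (fun a => ?_) a
  · exact (s.F_time _ hx).symm
  · funext μ
    refine Fin.cases ?_ (fun α => ?_) μ
    · exact (s.frame_slice hx a).symm
    · rfl

theorem data_psi (hx : hyp 0 x ∈ s.D) (B : Fin 5) :
    s.data.psi B x = spinor (s.W (hyp 0 x)) (s.F (hyp 0 x)) B := by
  rw [LocalData.psi, s.data_frame hx]
  rfl

end GaugeSol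

theorem contDiffOn_ofReal {n : ℕ} {D : Set (Fin n → ℝ)} {f : (Fin n → ℝ) → ℝ}
    (hf : ContDiffOn ℝ ∞ f D) : ContDiffOn ℝ ∞ (fun z => (f z : ℂ)) D :=
  Complex.ofRealCLM.contDiff.comp_contDiffOn hf

theorem contDiffOn_contract {n : ℕ} {D : Set (Fin n → ℝ)}
    {T : (Fin n → ℝ) → Fin 4 → Fin 4 → Fin 4 → Fin 4 → ℝ} {u v w z : (Fin n → ℝ) → Fin 4 → ℂ}
    (hT : ∀ i j k l, ContDiffOn ℝ ∞ (fun y => T y i j k l) D)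
    (hu : ∀ i, ContDiffOn ℝ ∞ (fun y => u y i) D) (hv : ∀ i, ContDiffOn ℝ ∞ (fun y => v y i) D)
    (hw : ∀ i, ContDiffOn ℝ ∞ (fun y => w y i) D) (hz : ∀ i, ContDiffOn ℝ ∞ (fun y => z y i) D) :
    ContDiffOn ℝ ∞ (fun y => contract (T y) (u y) (v y) (w y) (z y)) D :=
  ContDiffOn.sum fun i _ => ContDiffOn.sum fun j _ => ContDiffOn.sum fun k _ =>
    ContDiffOn.sum fun l _ => ((((contDiffOn_ofReal (hT i j k l)).mul (hu i)).mul (hv j)).mul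
      (hw k)).mul (hz l)

theorem contDiffOn_spinor {n : ℕ} {D : Set (Fin n → ℝ)}
    {T : (Fin n → ℝ) → Fin 4 → Fin 4 → Fin 4 → Fin 4 → ℝ} {E : (Fin n → ℝ) → Fin 4 → Fin 4 → ℝ}
    (hT : ∀ i j k l, ContDiffOn ℝ ∞ (fun y => T y i j k l) D)
    (hE : ∀ i μ, ContDiffOn ℝ ∞ (fun y => E y i μ) D) (B : Fin 5) :
    ContDiffOn ℝ ∞ (fun y => spinor (T y) (E y) B) D := by
  have hC := fun i μ => contDiffOn_ofReal (hE i μ)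
  have hl : ∀ μ, ContDiffOn ℝ ∞ (fun y => nullL (E y) μ) D := fun μ =>
    ((hC 0 μ).add (hC 3 μ)).div_const _
  have hn : ∀ μ, ContDiffOn ℝ ∞ (fun y => nullN (E y) μ) D := fun μ =>
    ((hC 0 μ).sub (hC 3 μ)).div_const _
  have hm : ∀ μ, ContDiffOn ℝ ∞ (fun y => nullM (E y) μ) D := fun μ =>
    ((hC 1 μ).add (contDiffOn_const.mul (hC 2 μ))).div_const _
  have hb : ∀ μ, ContDiffOn ℝ ∞ (fun y => nullMbar (E y) μ) D := fun μ =>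
    ((hC 1 μ).sub (contDiffOn_const.mul (hC 2 μ))).div_const _
  fin_cases B
  · exact contDiffOn_contract hT hl hm hl hm
  · exact contDiffOn_contract hT hl hn hl hm
  · exact contDiffOn_contract hT hl hm hb hn
  · exact contDiffOn_contract hT hl hn hb hn
  · exact contDiffOn_contract hT hn hb hn hb

namespace GaugeSol

variable {lam : ℝ} (s : GaugeSol lam) {x : Fin 3 → ℝ}

theorem psi_smooth (B : Fin 5) : ContDiffOn ℝ ∞ (s.data.psi B) s.data.dom := by
  have h := contDiffOn_spinor (D := s.data.dom) (T := fun x => s.W (hyp 0 x))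
    (E := fun x => s.F (hyp 0 x))
    (fun i j k l => ContDiffOn.comp_hyp 0 (s.gauss.sol.W_smooth i j k l))
    (fun i μ => ContDiffOn.comp_hyp 0 (s.F_smooth i μ)) B
  exact h.congr fun x hx => s.data_psi hx B

theorem geo_smooth (f : GeoField) : ContDiffOn ℝ ∞ (s.data.geo f) s.data.dom := by
  rcases f with ⟨α, β⟩ | ⟨α, β⟩ | _ | α | ⟨a, α⟩
  · exact ContDiffOn.comp_hyp 0 (s.gauss.sol.met.smooth α.succ β.succ)
  · change ContDiffOn ℝ ∞ (fun x => ∑ μ : Fin 4, s.g (hyp 0 x) β.succ μ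
      * christoffel s.D s.g μ α.succ 0 (hyp 0 x)) (hyp 0 ⁻¹' s.D)
    exact ContDiffOn.sum fun μ _ => (ContDiffOn.comp_hyp 0 (s.gauss.sol.met.smooth β.succ μ)).mul
      (ContDiffOn.comp_hyp 0 (s.gauss.sol.met.christoffel_smooth μ α.succ 0))
  · exact ContDiffOn.comp_hyp 0 s.gauss.sol.om_smooth
  · exact ContDiffOn.comp_hyp 0 (s.gauss.b_smooth α.succ)
  · exact ContDiffOn.comp_hyp 0 (s.F_smooth a.succ α.succ)

theorem jet_smooth (v : JetVar) : ContDiffOn ℝ ∞ (fun x => s.data.jet x v) s.data.dom := by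
  rcases v with ⟨f, q⟩ | ⟨B, q⟩ | ⟨B, q⟩
  · exact contDiffOn_multiDeriv s.slice_regular (contDiffOn_ofReal (s.geo_smooth f)) q
  · exact contDiffOn_multiDeriv s.slice_regular (s.psi_smooth B) q
  · exact contDiffOn_multiDeriv s.slice_regular
      (Complex.conjCLE.contDiff.comp_contDiffOn (s.psi_smooth B)) q

theorem pd_jet (hx : x ∈ s.data.dom) (v : JetVar) (α : Fin 3) :
    pd s.data.dom α (fun x => s.data.jet x v) x = s.data.jet x (v.shift α) := by
  rcases v with ⟨f, q⟩ | ⟨B, q⟩ | ⟨B, q⟩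
  · exact pd_multiDeriv s.slice_regular (contDiffOn_ofReal (s.geo_smooth f)) q α hx
  · exact pd_multiDeriv s.slice_regular (s.psi_smooth B) q α hx
  · exact pd_multiDeriv s.slice_regular
      (Complex.conjCLE.contDiff.comp_contDiffOn (s.psi_smooth B)) q α hx

end GaugeSol
end AdS

namespace AdS

/-! ## Functions on the slice that are universal differential polynomials in the data -/

/-- Functions on the slice that are assigned to solutions. -/
abbrev SliceFun (lam : ℝ) := GaugeSol lam → (Fin 3 → ℝ) → ℂ

/-- Functions on the space-time that are assigned to solutions. -/
abbrev Quantity (lam : ℝ) := GaugeSol lam → (Fin 4 → ℝ) → ℝ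

variable {lam : ℝ}

/-- The functions on the slice that are universal polynomials in the variables `V`. -/
noncomputable def Pol (lam : ℝ) (V : Set JetVar) : Subalgebra ℂ (SliceFun lam) where
  carrier := {u | ∃ P ∈ MvPolynomial.supported ℂ V,
    ∀ s : GaugeSol lam, ∀ x ∈ s.data.dom, u s x = s.data.eval P x}
  mul_mem' := by
    rintro u v ⟨P, hP, hu⟩ ⟨Q, hQ, hv⟩
    exact ⟨P * Q, mul_mem hP hQ, fun s x hx => by
      simp only [Pi.mul_apply, hu s x hx, hv s x hx, LocalData.eval, map_mul]⟩
  add_mem' := by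
    rintro u v ⟨P, hP, hu⟩ ⟨Q, hQ, hv⟩
    exact ⟨P + Q, add_mem hP hQ, fun s x hx => by
      simp only [Pi.add_apply, hu s x hx, hv s x hx, LocalData.eval, map_add]⟩
  algebraMap_mem' := fun c => ⟨MvPolynomial.C c, Subalgebra.algebraMap_mem _ c, fun s x hx => by
    simp only [LocalData.eval, MvPolynomial.eval_C]
    rfl⟩

theorem Pol.mono {V V' : Set JetVar} (h : V ⊆ V') : Pol lam V ≤ Pol lam V' := by
  rintro u ⟨P, hP, hu⟩
  exact ⟨P, MvPolynomial.supported_mono h hP, hu⟩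

theorem Pol.congr {V : Set JetVar} {u v : SliceFun lam} (hv : v ∈ Pol lam V)
    (h : ∀ s : GaugeSol lam, ∀ x ∈ s.data.dom, u s x = v s x) : u ∈ Pol lam V := by
  obtain ⟨P, hP, hv⟩ := hv
  exact ⟨P, hP, fun s x hx => (h s x hx).trans (hv s x hx)⟩

theorem Pol.jet {V : Set JetVar} {v : JetVar} (hv : v ∈ V) :
    (fun s x => s.data.jet x v : SliceFun lam) ∈ Pol lam V :=
  ⟨MvPolynomial.X v, MvPolynomial.X_mem_supported.2 hv, fun s x _ => by
    simp only [LocalData.eval, MvPolynomial.eval_X]⟩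

theorem Pol.const {V : Set JetVar} (c : ℂ) : (fun _ _ => c : SliceFun lam) ∈ Pol lam V :=
  Subalgebra.algebraMap_mem _ c

/-- The derivative on the slice. -/
noncomputable def dSlice (α : Fin 3) (u : SliceFun lam) : SliceFun lam :=
  fun s => pd s.data.dom α (u s)

/-- The derivative of a variable is its shifted variable, and the Leibniz rule extends this to
polynomials by induction on generators. Smoothness is proved alongside, as the sum and product rules
need it. -/
theorem Pol.contDiffOn_and_dSlice {V V' : Set JetVar} {α : Fin 3}
    (h : ∀ v ∈ V, v ∈ V' ∧ v.shift α ∈ V') {u : SliceFun lam} (hu : u ∈ Pol lam V) :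
    (∀ s : GaugeSol lam, ContDiffOn ℝ ∞ (u s) s.data.dom) ∧ dSlice α u ∈ Pol lam V' := by
  obtain ⟨P, hP, hu⟩ := hu
  suffices key : (∀ s : GaugeSol lam, ContDiffOn ℝ ∞ (s.data.eval P) s.data.dom) ∧
      (dSlice α (fun s => s.data.eval P) : SliceFun lam) ∈ Pol lam V' from
    ⟨fun s => (key.1 s).congr (hu s), Pol.congr key.2 fun s x hx => pd_congr (hu s) α hx⟩
  clear hu
  have hmem : ∀ P ∈ Algebra.adjoin ℂ (MvPolynomial.X '' V : Set (MvPolynomial JetVar ℂ)),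
      (fun s => s.data.eval P : SliceFun lam) ∈ Pol lam V' := fun P hP =>
    ⟨P, MvPolynomial.supported_mono (fun v hv => (h v hv).1) hP, fun _ _ _ => rfl⟩
  induction hP using Algebra.adjoin_induction with
  | mem P hP =>
    obtain ⟨v, hv, rfl⟩ := hP
    have e : ∀ s : GaugeSol lam, s.data.eval (MvPolynomial.X v) = fun x => s.data.jet x v :=
      fun s => funext fun x => by simp only [LocalData.eval, MvPolynomial.eval_X]
    simp only [e]
    exact ⟨fun s => s.jet_smooth v, Pol.congr (Pol.jet (h v hv).2) fun s x hx => s.pd_jet hx v α⟩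
  | algebraMap c =>
    have e : ∀ s : GaugeSol lam, s.data.eval (algebraMap ℂ _ c) = fun _ => c :=
      fun s => funext fun x => by
        simp only [LocalData.eval, MvPolynomial.algebraMap_eq, MvPolynomial.eval_C]
    simp only [e]
    exact ⟨fun s => contDiffOn_const, Pol.congr (Pol.const 0) fun s x _ => pd_const c x α⟩
  | add P Q hP hQ ihP ihQ =>
    have e : ∀ s : GaugeSol lam, s.data.eval (P + Q) = fun x => s.data.eval P x + s.data.eval Q x :=
      fun s => funext fun x => by simp only [LocalData.eval, map_add]
    simp only [e]
    exact ⟨fun s => (ihP.1 s).add (ihQ.1 s), Pol.congr (add_mem ihP.2 ihQ.2) fun s x hx =>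
      pd_add s.slice_regular (ihP.1 s) (ihQ.1 s) hx α⟩
  | mul P Q hP hQ ihP ihQ =>
    have e : ∀ s : GaugeSol lam, s.data.eval (P * Q) = fun x => s.data.eval P x * s.data.eval Q x :=
      fun s => funext fun x => by simp only [LocalData.eval, map_mul]
    simp only [e]
    exact ⟨fun s => (ihP.1 s).mul (ihQ.1 s), Pol.congr (add_mem (mul_mem ihP.2 (hmem Q hQ))
      (mul_mem (hmem P hP) ihQ.2)) fun s x hx =>
      pd_mul s.slice_regular (ihP.1 s) (ihQ.1 s) hx α⟩

theorem Pol.dSlice_low {k : ℕ} {u : SliceFun lam} (hu : u ∈ Pol lam (lowJets k)) (α : Fin 3) :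
    dSlice α u ∈ Pol lam (lowJets (k + 1)) :=
  (Pol.contDiffOn_and_dSlice (fun _ hv => ⟨lowJets_mono k.le_succ hv, shift_mem_lowJets α hv⟩)
    hu).2

theorem allJets_subset_midJets (k : ℕ) : allJets k ⊆ midJets (k + 1) :=
  (allJets_subset_lowJets k).trans (lowJets_subset_midJets _)

theorem Pol.dSlice_tangential {k : ℕ} {u : SliceFun lam} (hu : u ∈ Pol lam (allJets k))
    {α : Fin 3} (hα : α ≠ 0) : dSlice α u ∈ Pol lam (midJets (k + 1)) :=
  (Pol.contDiffOn_and_dSlice (fun _ hv => ⟨allJets_subset_midJets k hv,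
    shift_mem_midJets_of_ne hα hv⟩) hu).2

/-! ## Quantities whose time derivatives on the slice are universal -/

/-- The restriction of a quantity to the slice. -/
noncomputable def res : Quantity lam →ₐ[ℝ] SliceFun lam where
  toFun f s x := (f s (hyp 0 x) : ℂ)
  map_one' := by funext s x; simp
  map_zero' := by funext s x; simp
  map_add' f g := by funext s x; simp
  map_mul' f g := by funext s x; simp
  commutes' r := by funext s x; rfl

theorem res_apply (f : Quantity lam) (s : GaugeSol lam) (x : Fin 3 → ℝ) :
    res f s x = (f s (hyp 0 x) : ℂ) := rfl

/-- The partial derivative of a quantity. -/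
noncomputable def dQ (μ : Fin 4) (f : Quantity lam) : Quantity lam := fun s => pd s.D μ (f s)

/-- Equality of quantities on the domains of the solutions. -/
def EqD (f g : Quantity lam) : Prop := ∀ s : GaugeSol lam, Set.EqOn (f s) (g s) s.D

/-- The smooth quantities. -/
noncomputable def Smooth (lam : ℝ) : Subalgebra ℝ (Quantity lam) where
  carrier := {f | ∀ s : GaugeSol lam, ContDiffOn ℝ ∞ (f s) s.D}
  mul_mem' hf hg s := (hf s).mul (hg s)
  add_mem' hf hg s := (hf s).add (hg s)
  algebraMap_mem' _ _ := contDiffOn_const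

variable {f g : Quantity lam}

theorem EqD.dQ (h : EqD f g) (μ : Fin 4) : EqD (dQ μ f) (dQ μ g) := fun s => pd_congr (h s) μ

theorem Smooth.congr (hg : g ∈ Smooth lam) (h : EqD f g) : f ∈ Smooth lam :=
  fun s => (hg s).congr (h s)

theorem Smooth.dQ (hf : f ∈ Smooth lam) (μ : Fin 4) : dQ μ f ∈ Smooth lam :=
  fun s => ContDiffOn.pd s.regular (hf s) μ

theorem dQ_add (hf : f ∈ Smooth lam) (hg : g ∈ Smooth lam) (μ : Fin 4) :
    EqD (dQ μ (f + g)) (dQ μ f + dQ μ g) := fun s _ hz => pd_add s.regular (hf s) (hg s) hz μ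

theorem dQ_mul (hf : f ∈ Smooth lam) (hg : g ∈ Smooth lam) (μ : Fin 4) :
    EqD (dQ μ (f * g)) (dQ μ f * g + f * dQ μ g) :=
  fun s _ hz => pd_mul s.regular (hf s) (hg s) hz μ

theorem dQ_comm (hf : f ∈ Smooth lam) (μ ν : Fin 4) :
    EqD (dQ μ (dQ ν f)) (dQ ν (dQ μ f)) := fun s _ hz => pd_comm s.regular (hf s) hz μ ν

theorem res_congr {V : Set JetVar} (hg : res g ∈ Pol lam V) (h : EqD f g) : res f ∈ Pol lam V :=
  Pol.congr hg fun s x hx => by rw [res_apply, res_apply, h s hx]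

theorem dSlice_res (hf : f ∈ Smooth lam) (α : Fin 3) (s : GaugeSol lam) {x : Fin 3 → ℝ}
    (hx : x ∈ s.data.dom) : dSlice α (res f) s x = res (dQ α.succ f) s x := by
  have h1 := pd_clm s.slice_regular Complex.ofRealCLM (ContDiffOn.comp_hyp 0 (hf s)) hx α
  have h2 := pd_hyp 0 (hf s) s.slice_regular hx α
  rw [Fin.succAbove_zero] at h2
  rw [h2] at h1
  exact h1

/-- An increasing sequence of sets of variables that is compatible with differentiation. -/
class JetFamily (V : ℕ → Set JetVar) : Prop where
  subset_succ : ∀ k, V k ⊆ V (k + 1)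
  shift_mem : ∀ {k v} (α : Fin 3), v ∈ V k → v.shift α ∈ V (k + 1)

theorem JetFamily.mono {V : ℕ → Set JetVar} [JetFamily V] {k l : ℕ} (h : k ≤ l) : V k ⊆ V l :=
  monotone_nat_of_le_succ JetFamily.subset_succ h

theorem JetFamily.dSlice {V : ℕ → Set JetVar} [JetFamily V] {k : ℕ} {u : SliceFun lam}
    (hu : u ∈ Pol lam (V k)) (α : Fin 3) : dSlice α u ∈ Pol lam (V (k + 1)) :=
  (Pol.contDiffOn_and_dSlice (fun _ hv =>
    ⟨JetFamily.subset_succ k hv, JetFamily.shift_mem α hv⟩) hu).2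

instance : JetFamily lowJets := ⟨fun k => lowJets_mono k.le_succ, shift_mem_lowJets⟩

instance : JetFamily allJets := ⟨fun k => allJets_mono k.le_succ, shift_mem_allJets⟩

instance : JetFamily midJets :=
  ⟨fun k => (midJets_subset_allJets k).trans (allJets_subset_midJets k), shift_mem_midJets⟩

/-- The time derivatives of `f` of order `j < J` are, on the slice, universal polynomials in the
variables in `V (k + j)`. -/
def IsCl (V : ℕ → Set JetVar) : ℕ → ℕ → Quantity lam → Prop
  | 0, _, f => f ∈ Smooth lam
  | J + 1, k, f => f ∈ Smooth lam ∧ res f ∈ Pol lam (V k) ∧ IsCl V J (k + 1) (dQ 0 f)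

namespace IsCl

variable {V : ℕ → Set JetVar} [JetFamily V] {J k l : ℕ}

omit [JetFamily V] in
theorem smooth (h : IsCl V J k f) : f ∈ Smooth lam := by
  cases J with
  | zero => exact h
  | succ J => exact h.1

omit [JetFamily V] in
theorem congr (hg : IsCl V J k g) (h : EqD f g) : IsCl V J k f := by
  induction J generalizing k f g with
  | zero => exact Smooth.congr hg h
  | succ J ih => exact ⟨Smooth.congr hg.1 h, res_congr hg.2.1 h, ih hg.2.2 (h.dQ 0)⟩

theorem mono (h : IsCl V J k f) (hkl : k ≤ l) : IsCl V J l f := by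
  induction J generalizing k l f with
  | zero => exact h
  | succ J ih => exact ⟨h.1, Pol.mono (JetFamily.mono hkl) h.2.1, ih h.2.2 (Nat.succ_le_succ hkl)⟩

omit [JetFamily V] in
theorem pred (h : IsCl V (J + 1) k f) : IsCl V J k f := by
  induction J generalizing k f with
  | zero => exact h.1
  | succ J ih => exact ⟨h.1, h.2.1, ih h.2.2⟩

omit [JetFamily V] in
theorem of_subset {V' : ℕ → Set JetVar} {m : ℕ} (hV : ∀ k, V k ⊆ V' (k + m))
    (h : IsCl V J k f) : IsCl V' J (k + m) f := by
  induction J generalizing k f with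
  | zero => exact h
  | succ J ih => exact ⟨h.1, Pol.mono (hV k) h.2.1, by
      have := ih h.2.2
      rwa [Nat.add_right_comm] at this⟩

theorem zero : IsCl V J k (0 : Quantity lam) := by
  induction J generalizing k with
  | zero => exact zero_mem _
  | succ J ih => exact ⟨zero_mem _, by rw [map_zero]; exact zero_mem _,
      congr ih fun s z _ => pd_const 0 z 0⟩

theorem const (r : ℝ) : IsCl V J k (algebraMap ℝ (Quantity lam) r) := by
  cases J with
  | zero => exact Subalgebra.algebraMap_mem _ r
  | succ J => exact ⟨Subalgebra.algebraMap_mem _ r, Pol.const (r : ℂ),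
      congr zero fun s z _ => pd_const r z 0⟩

theorem add (hf : IsCl V J k f) (hg : IsCl V J k g) : IsCl V J k (f + g) := by
  induction J generalizing k f g with
  | zero => exact add_mem hf hg
  | succ J ih => exact ⟨add_mem hf.1 hg.1, by rw [map_add]; exact add_mem hf.2.1 hg.2.1,
      congr (ih hf.2.2 hg.2.2) (dQ_add hf.1 hg.1 0)⟩

theorem mul (hf : IsCl V J k f) (hg : IsCl V J k g) : IsCl V J k (f * g) := by
  induction J generalizing k f g with
  | zero => exact mul_mem hf hg
  | succ J ih => exact ⟨mul_mem hf.1 hg.1, by rw [map_mul]; exact mul_mem hf.2.1 hg.2.1,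
      congr (add (ih hf.2.2 (hg.pred.mono k.le_succ)) (ih (hf.pred.mono k.le_succ) hg.2.2))
        (dQ_mul hf.1 hg.1 0)⟩

theorem dQ_succ (hf : IsCl V J k f) (α : Fin 3) : IsCl V J (k + 1) (dQ α.succ f) := by
  induction J generalizing k f with
  | zero => exact Smooth.dQ hf _
  | succ J ih => exact ⟨Smooth.dQ hf.1 _, Pol.congr (JetFamily.dSlice hf.2.1 α) fun s x hx =>
      (dSlice_res hf.1 α s hx).symm, congr (ih hf.2.2) (dQ_comm hf.1 _ _)⟩

/-- A factor that vanishes on the slice improves a product by one time derivative. -/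
theorem mul_of_vanish (hf : IsCl V J 0 f) (h0 : ∀ s : GaugeSol lam, ∀ x ∈ s.data.dom,
    f s (hyp 0 x) = 0) (hg : IsCl V (J - 1) k g) : IsCl V J k (f * g) := by
  induction J generalizing k f g with
  | zero => exact mul_mem hf hg.smooth
  | succ J ih =>
    rw [Nat.add_sub_cancel] at hg
    -- In `∂_τ(fg) = (∂_τ f) g + f ∂_τ g` the first term needs one time derivative of `g` fewer than
    -- the total, and the second again has the vanishing factor `f`; the induction closes.
    refine ⟨mul_mem hf.1 hg.smooth, Pol.congr (zero_mem _) fun s x hx => ?_,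
      congr (add (mul (hf.2.2.mono (by omega)) (hg.mono k.le_succ)) ?_) (dQ_mul hf.1 hg.smooth 0)⟩
    · rw [res_apply, Pi.mul_apply, Pi.mul_apply, h0 s x hx, zero_mul, Complex.ofReal_zero]
      rfl
    · cases J with
      | zero => exact mul_mem hf.smooth (Smooth.dQ hg 0)
      | succ J => exact ih hf.pred h0 hg.2.2

end IsCl

/-- The subalgebra of the quantities with `IsCl V J k`. -/
noncomputable def Cl (V : ℕ → Set JetVar) [JetFamily V] (lam : ℝ) (J k : ℕ) : Subalgebra ℝ (Quantity lam) where
  carrier := {f | IsCl V J k f}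
  mul_mem' := IsCl.mul
  add_mem' := IsCl.add
  algebraMap_mem' := IsCl.const

namespace Cl

variable {V : ℕ → Set JetVar} [JetFamily V] {J k l : ℕ}

theorem congr (hg : g ∈ Cl V lam J k) (h : EqD f g) : f ∈ Cl V lam J k := IsCl.congr hg h

theorem mono (hkl : k ≤ l) : Cl V lam J k ≤ Cl V lam J l := fun _ h => IsCl.mono h hkl

theorem of_subset {V' : ℕ → Set JetVar} [JetFamily V'] {m : ℕ} (hV : ∀ k, V k ⊆ V' (k + m)) :
    Cl V lam J k ≤ Cl V' lam J (k + m) := fun _ h => IsCl.of_subset hV h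

theorem pred : Cl V lam (J + 1) k ≤ Cl V lam J k := fun _ h => IsCl.pred h

theorem dQ_succ (hf : f ∈ Cl V lam J k) (α : Fin 3) : dQ α.succ f ∈ Cl V lam J (k + 1) :=
  IsCl.dQ_succ hf α

theorem mul_of_vanish (hf : f ∈ Cl V lam J 0) (h0 : ∀ s : GaugeSol lam, ∀ x ∈ s.data.dom,
    f s (hyp 0 x) = 0) (hg : g ∈ Cl V lam (J - 1) k) : f * g ∈ Cl V lam J k :=
  IsCl.mul_of_vanish hf h0 hg

theorem succ (h1 : f ∈ Smooth lam) (h2 : res f ∈ Pol lam (V k))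
    (h3 : dQ 0 f ∈ Cl V lam J (k + 1)) : f ∈ Cl V lam (J + 1) k := ⟨h1, h2, h3⟩

end Cl

end AdS

namespace AdS

/-! ## The evolution equations -/

/-- The connection terms of the covariant derivative of a covariant 4-tensor. -/
noncomputable def conn4 (D : Set (Fin 4 → ℝ)) (g : (Fin 4 → ℝ) → Matrix (Fin 4) (Fin 4) ℝ)
    (W : (Fin 4 → ℝ) → Fin 4 → Fin 4 → Fin 4 → Fin 4 → ℝ) (m i j k l : Fin 4) (z : Fin 4 → ℝ) : ℝ :=
  ∑ n, (christoffel D g n m i z * W z n j k l + christoffel D g n m j z * W z i n k l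
    + christoffel D g n m k z * W z i j n l + christoffel D g n m l z * W z i j k n)

theorem covDeriv4_eq_conn4 (D : Set (Fin 4 → ℝ)) (g : (Fin 4 → ℝ) → Matrix (Fin 4) (Fin 4) ℝ)
    (W : (Fin 4 → ℝ) → Fin 4 → Fin 4 → Fin 4 → Fin 4 → ℝ) (m i j k l : Fin 4) (z : Fin 4 → ℝ) :
    covDeriv4 D g (fun i j k l z => W z i j k l) m i j k l z
      = pd D m (fun w => W w i j k l) z - conn4 D g W m i j k l z := rfl

theorem sum4_rev (f : Fin 4 → Fin 4 → Fin 4 → Fin 4 → ℝ) :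
    ∑ i, ∑ j, ∑ k, ∑ l, f i j k l = ∑ l, ∑ k, ∑ j, ∑ i, f i j k l := by
  rw [sum4_swap, Finset.sum_comm]
  exact Finset.sum_congr rfl fun _ _ => Finset.sum_congr rfl fun _ _ => Finset.sum_comm

theorem sum3_out (f : Fin 4 → Fin 4 → Fin 4 → Fin 4 → ℝ) :
    ∑ i, ∑ j, ∑ k, ∑ l, f i j k l = ∑ l, ∑ i, ∑ j, ∑ k, f i j k l := by
  calc ∑ i, ∑ j, ∑ k, ∑ l, f i j k l = ∑ i, ∑ j, ∑ l, ∑ k, f i j k l :=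
        Finset.sum_congr rfl fun _ _ => Finset.sum_congr rfl fun _ _ => Finset.sum_comm
    _ = ∑ i, ∑ l, ∑ j, ∑ k, f i j k l := Finset.sum_congr rfl fun _ _ => Finset.sum_comm
    _ = _ := Finset.sum_comm

namespace GaugeSol

variable {lam : ℝ} (s : GaugeSol lam) {z : Fin 4 → ℝ} {x : Fin 3 → ℝ}

theorem met : IsMetric s.D s.g := s.gauss.sol.met

theorem pd_g_zero_zero (hz : z ∈ s.D) (μ : Fin 4) : pd s.D μ (fun w => s.g w 0 0) z = 0 := by
  rw [pd_congr (g := fun _ => (-1 : ℝ)) (fun w hw => s.gauss.unit w hw) μ hz, pd_const]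

/-- As `g(ẋ, ẋ) = -1` is constant, `∇_ẋ ẋ` is orthogonal to `ẋ`. The conformal geodesic equation
equates this product with a nonzero multiple of `⟨b, ẋ⟩`. -/
theorem b_zero (hz : z ∈ s.D) : s.b z 0 = 0 := by
  have h := s.met.lower_christoffel hz 0 0 0
  simp only [chrL, s.pd_g_zero_zero hz, s.gauss.geodesic z hz, mul_sub, Finset.sum_sub_distrib,
    s.met.lower_raise hz] at h
  have h2 : ∑ m, s.g z 0 m * (-2 * s.b z 0 * (Pi.single 0 1 : Fin 4 → ℝ) m)
      = 2 * s.b z 0 := by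
    rw [Finset.sum_eq_single 0]
    · rw [s.gauss.unit z hz, Pi.single_eq_same]; ring
    · intro m _ hm
      rw [Pi.single_eq_of_ne hm]; ring
    · simp
  rw [h2] at h
  linarith

theorem christoffel_time (hz : z ∈ s.D) (i : Fin 4) :
    christoffel s.D s.g i 0 0 z = - ∑ ν, (s.g z)⁻¹ i ν * s.b z ν := by
  rw [s.gauss.geodesic z hz, s.b_zero hz]
  ring

theorem pd_zero_g_zero (hz : z ∈ s.D) (ν : Fin 4) :
    pd s.D 0 (fun w => s.g w ν 0) z = - s.b z ν := by
  have h := s.met.lower_christoffel hz ν 0 0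
  simp only [chrL, s.pd_g_zero_zero hz, s.christoffel_time hz, mul_neg, Finset.sum_neg_distrib,
    s.met.lower_raise hz] at h
  linarith

/-- Because `⟨b, ẋ⟩ = 0`, the `ẋ`-component of the equation for `b` has no derivative left and
determines `L(ẋ, ẋ)` algebraically. This is decisive for the count of derivatives. -/
theorem schouten_time (hz : z ∈ s.D) :
    schouten s.D s.g 0 0 z = (1 / 2) * normSq (s.g z) (s.b z) := by
  have h := s.gauss.one_form z hz 0
  have h1 : pd s.D 0 (fun w => s.b w 0) z = 0 := pd_zero_of_eqOn (fun w hw => s.b_zero hw) hz 0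
  have h2 : ∑ σ, christoffel s.D s.g σ 0 0 z * s.b z σ = - normSq (s.g z) (s.b z) := by
    simp only [s.christoffel_time hz, neg_mul, Finset.sum_neg_distrib, normSq, Finset.sum_mul]
    congr 1
    exact Finset.sum_congr rfl fun _ _ => Finset.sum_congr rfl fun _ _ => by ring
  rw [h1, h2, s.b_zero hz, s.gauss.unit z hz] at h
  linarith

theorem pd_zero_g (hz : z ∈ s.D) (i j : Fin 4) : pd s.D 0 (fun w => s.g w i j) z
    = ∑ m, s.g z i m * christoffel s.D s.g m 0 j z
      + ∑ m, s.g z j m * christoffel s.D s.g m 0 i z := by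
  rw [s.met.pd_metric hz, s.met.lower_christoffel hz, s.met.lower_christoffel hz]

theorem pd_zero_F (hz : z ∈ s.D) (a μ : Fin 4) : pd s.D 0 (fun w => s.F w a μ) z
    = - (∑ ν, s.b z ν * s.F z a ν) * (Pi.single 0 1 : Fin 4 → ℝ) μ
      + (∑ ν, s.g z 0 ν * s.F z a ν) * (∑ ν, (s.g z)⁻¹ μ ν * s.b z ν)
      - ∑ ν, christoffel s.D s.g μ 0 ν z * s.F z a ν := by
  have h := s.F_prop z hz a μ
  rw [s.b_zero hz] at h
  linarith

theorem pd_zero_b (hz : z ∈ s.D) (ν : Fin 4) : pd s.D 0 (fun w => s.b w ν) z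
    = ∑ σ, christoffel s.D s.g σ 0 ν z * s.b z σ
      - (1 / 2) * (∑ μ, ∑ ν, (s.g z)⁻¹ μ ν * s.b z μ * s.b z ν) * s.g z 0 ν
      + schouten s.D s.g 0 ν z := by
  have h := s.gauss.one_form z hz ν
  rw [s.b_zero hz, normSq] at h
  linarith

theorem pd_zero_pd_om (hz : z ∈ s.D) (μ : Fin 4) : pd s.D 0 (pd s.D μ s.om) z
    = ∑ m, christoffel s.D s.g m 0 μ z * pd s.D m s.om z - s.om z * schouten s.D s.g 0 μ z
      + IsSolution.fs s.D s.g s.om z * s.g z 0 μ := by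
  have h := s.gauss.sol.hess_eq hz 0 μ
  rw [hess] at h
  linarith

/-- The definition of the curvature component `R^i_{j0l}`, read as an evolution equation, with the
curvature expressed by `ΩW` and `L`. -/
theorem pd_zero_christoffel (hz : z ∈ s.D) (i j l : Fin 4) :
    pd s.D 0 (christoffel s.D s.g i l j) z = pd s.D l (christoffel s.D s.g i 0 j) z
      - ∑ m, (christoffel s.D s.g i 0 m z * christoffel s.D s.g m l j z
        - christoffel s.D s.g i l m z * christoffel s.D s.g m 0 j z)
      + ∑ m, (s.g z)⁻¹ i m * (s.om z * s.W z m j 0 l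
        + (s.g z m 0 * schouten s.D s.g j l z - s.g z m l * schouten s.D s.g j 0 z
          + s.g z j l * schouten s.D s.g m 0 z - s.g z j 0 * schouten s.D s.g m l z)) := by
  have h := s.met.riemann_eq hz i j 0 l
  simp only [s.gauss.sol.riemannLow_eq hz, kn] at h
  rw [riemann] at h
  linarith

/-- The Cotton equation as an evolution equation. It has content for spatial `ν`, where it trades
the `τ`-derivative of `L_{νr}` for a spatial derivative of `L_{0r}`. -/
theorem pd_zero_schouten (hz : z ∈ s.D) (ν r : Fin 4) :
    pd s.D 0 (schouten s.D s.g ν r) z = pd s.D ν (schouten s.D s.g 0 r) z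
      + ∑ m, (christoffel s.D s.g m 0 ν z * schouten s.D s.g m r z
        + christoffel s.D s.g m 0 r z * schouten s.D s.g ν m z)
      - ∑ m, (christoffel s.D s.g m ν 0 z * schouten s.D s.g m r z
        + christoffel s.D s.g m ν r z * schouten s.D s.g 0 m z)
      + ∑ i, (∑ j, (s.g z)⁻¹ i j * pd s.D j s.om z) * s.W z i r 0 ν := by
  have h := s.gauss.sol.cotton_eq hz r 0 ν
  simp only [covDeriv, IsMetric.grad] at h
  linarith

theorem pd_zero_fs (hz : z ∈ s.D) : pd s.D 0 (IsSolution.fs s.D s.g s.om) z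
    = - ∑ m, schouten s.D s.g 0 m z * ∑ j, (s.g z)⁻¹ m j * pd s.D j s.om z :=
  s.gauss.sol.pd_fs hz 0

theorem inv_eq (hz : z ∈ s.D) (μ ν : Fin 4) :
    (s.g z)⁻¹ μ ν = ∑ p, eta p * (s.F z p μ * s.F z p ν) :=
  frame_inv (s.F_orth z hz) μ ν

theorem weylLike (hz : z ∈ s.D) : WeylLike (Fr (s.W z) (s.F z)) :=
  s.gauss.sol.weylLike hz (s.F_orth z hz)

/-- The coframe dual to the frame. -/
noncomputable def coframe (z : Fin 4 → ℝ) (p μ : Fin 4) : ℝ := eta p * ∑ ρ, s.g z μ ρ * s.F z p ρ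

theorem W_eq (hz : z ∈ s.D) (i j k l : Fin 4) : s.W z i j k l
    = ∑ a, ∑ b, ∑ c, ∑ d, Fr (s.W z) (s.F z) a b c d
      * (s.coframe z a i * s.coframe z b j * s.coframe z c k * s.coframe z d l) := by
  have hc : ∀ μ ν, ∑ p, s.coframe z p μ * s.F z p ν = if μ = ν then 1 else 0 :=
    frame_complete (s.F_orth z hz)
  have h1 : ∀ f : Fin 4 → ℝ, ∀ μ, ∑ p, (∑ ν, f ν * s.F z p ν) * s.coframe z p μ = f μ := by
    intro f μ
    have e : ∀ ν, ∑ p, f ν * s.F z p ν * s.coframe z p μ = f ν * if μ = ν then 1 else 0 := by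
      intro ν
      rw [← hc μ ν, Finset.mul_sum]
      exact Finset.sum_congr rfl fun _ _ => by ring
    simp only [Finset.sum_mul]
    rw [Finset.sum_comm]
    simp only [e, mul_ite, mul_one, mul_zero, Finset.sum_ite_eq, Finset.mem_univ, if_true]
  have e0 : ∀ a b c d, Fr (s.W z) (s.F z) a b c d = ∑ i, (∑ j, (∑ k, (∑ l, s.W z i j k l
      * s.F z d l) * s.F z c k) * s.F z b j) * s.F z a i := by
    intro a b c d
    simp only [Fr, Finset.sum_mul]
    exact Finset.sum_congr rfl fun _ _ => Finset.sum_congr rfl fun _ _ => Finset.sum_congr rfl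
      fun _ _ => Finset.sum_congr rfl fun _ _ => by ring
  rw [sum4_rev]
  have e1 : ∑ d, ∑ c, ∑ b, ∑ a, Fr (s.W z) (s.F z) a b c d
      * (s.coframe z a i * s.coframe z b j * s.coframe z c k * s.coframe z d l)
      = ∑ d, (∑ c, (∑ b, (∑ a, Fr (s.W z) (s.F z) a b c d * s.coframe z a i)
        * s.coframe z b j) * s.coframe z c k) * s.coframe z d l := by
    simp only [Finset.sum_mul]
    exact Finset.sum_congr rfl fun _ _ => Finset.sum_congr rfl fun _ _ => Finset.sum_congr rfl
      fun _ _ => Finset.sum_congr rfl fun _ _ => by ring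
  rw [e1]
  simp only [e0, h1]

/-- The lower order terms of the divergence of the rescaled Weyl tensor in the frame. -/
noncomputable def lower (b c d : Fin 4) (z : Fin 4 → ℝ) : ℝ :=
  ∑ p, eta p * ∑ m, s.F z p m * ∑ i, ∑ j, ∑ k, ∑ l, s.W z i j k l
      * pd s.D m (fun w => s.F w p i * s.F w b j * s.F w c k * s.F w d l) z
    + ∑ j, ∑ k, ∑ l, (∑ m, ∑ i, (s.g z)⁻¹ m i * conn4 s.D s.g s.W m i j k l z)
      * (s.F z b j * s.F z c k * s.F z d l)

theorem Fr_smooth (a b c d : Fin 4) : ContDiffOn ℝ ∞ (fun w => Fr (s.W w) (s.F w) a b c d) s.D :=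
  ContDiffOn.sum fun i _ => ContDiffOn.sum fun j _ => ContDiffOn.sum fun k _ =>
    ContDiffOn.sum fun l _ => ((((s.gauss.sol.W_smooth i j k l).mul (s.F_smooth a i)).mul
      (s.F_smooth b j)).mul (s.F_smooth c k)).mul (s.F_smooth d l)

theorem pd_Fr (hz : z ∈ s.D) (m a b c d : Fin 4) :
    pd s.D m (fun w => Fr (s.W w) (s.F w) a b c d) z
      = ∑ i, ∑ j, ∑ k, ∑ l, (pd s.D m (fun w => s.W w i j k l) z
          * (s.F z a i * s.F z b j * s.F z c k * s.F z d l) + s.W z i j k l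
          * pd s.D m (fun w => s.F w a i * s.F w b j * s.F w c k * s.F w d l) z) := by
  have hF : ∀ i j k l, ContDiffOn ℝ ∞
      (fun w => s.F w a i * s.F w b j * s.F w c k * s.F w d l) s.D := fun i j k l =>
    (((s.F_smooth a i).mul (s.F_smooth b j)).mul (s.F_smooth c k)).mul (s.F_smooth d l)
  have hm : ∀ i j k l, ContDiffOn ℝ ∞ (fun w => s.W w i j k l
      * (s.F w a i * s.F w b j * s.F w c k * s.F w d l)) s.D := fun i j k l =>
    (s.gauss.sol.W_smooth i j k l).mul (hF i j k l)
  have h3 := fun i j k => ContDiffOn.sum (s := Finset.univ) fun l _ => hm i j k l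
  have h2 := fun i j => ContDiffOn.sum (s := Finset.univ) fun k _ => h3 i j k
  have h1 := fun i => ContDiffOn.sum (s := Finset.univ) fun j _ => h2 i j
  have e : (fun w => Fr (s.W w) (s.F w) a b c d) = fun w => ∑ i, ∑ j, ∑ k, ∑ l, s.W w i j k l
      * (s.F w a i * s.F w b j * s.F w c k * s.F w d l) := by
    funext w
    simp only [Fr, mul_assoc]
  rw [e, pd_sum s.regular _ h1 hz]
  refine Finset.sum_congr rfl fun i _ => ?_
  rw [pd_sum s.regular _ (h2 i) hz]
  refine Finset.sum_congr rfl fun j _ => ?_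
  rw [pd_sum s.regular _ (h3 i j) hz]
  refine Finset.sum_congr rfl fun k _ => ?_
  rw [pd_sum s.regular _ (hm i j k) hz]
  refine Finset.sum_congr rfl fun l _ => ?_
  rw [pd_mul s.regular (s.gauss.sol.W_smooth i j k l) (hF i j k l) hz]

/-- Contract `div W = 0` with the frame and write the inverse metric as a sum over frame vectors.
Moving the derivative outside the contractions produces derivatives of the frame, which together
with the connection terms make up `lower`. -/
theorem divergence (hz : z ∈ s.D) (b c d : Fin 4) :
    ∑ p, eta p * ∑ m, s.F z p m * pd s.D m (fun w => Fr (s.W w) (s.F w) p b c d) z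
      = s.lower b c d z := by
  have h := s.gauss.sol.div_W hz
  simp only [covDeriv4_eq_conn4, mul_sub, Finset.sum_sub_distrib, sub_eq_zero] at h
  rw [lower]
  simp only [s.pd_Fr hz, ← h, Finset.sum_add_distrib, mul_add]
  have e : ∑ p, eta p * ∑ m, s.F z p m * ∑ i, ∑ j, ∑ k, ∑ l, pd s.D m (fun w => s.W w i j k l) z
      * (s.F z p i * s.F z b j * s.F z c k * s.F z d l)
      = ∑ j, ∑ k, ∑ l, (∑ m, ∑ i, (s.g z)⁻¹ m i * pd s.D m (fun w => s.W w i j k l) z)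
        * (s.F z b j * s.F z c k * s.F z d l) := by
    simp only [s.inv_eq hz, Finset.mul_sum, Finset.sum_mul]
    rw [sum3_rot, sum3_out]
    refine Finset.sum_congr rfl fun j _ => ?_
    rw [sum3_out]
    refine Finset.sum_congr rfl fun k _ => ?_
    rw [sum3_out]
    refine Finset.sum_congr rfl fun l _ => Finset.sum_congr rfl fun m _ =>
      Finset.sum_congr rfl fun i _ => Finset.sum_congr rfl fun p _ => ?_
    ring
  linarith

/-- The summand `p = 0` of the divergence is `-∂_τ w_{0bcd}`, since `e₀ = ∂_τ`. Components with a
leading index `0` thus have an evolution equation. -/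
theorem pd_zero_Fr (hz : z ∈ s.D) (b c d : Fin 4) :
    pd s.D 0 (fun w => Fr (s.W w) (s.F w) 0 b c d) z
      = ∑ a : Fin 3, ∑ m, s.F z a.succ m * pd s.D m (fun w => Fr (s.W w) (s.F w) a.succ b c d) z
        - s.lower b c d z := by
  rw [← s.divergence hz, Fin.sum_univ_succ (n := 3)]
  have e : ∀ a : Fin 3, eta a.succ = 1 := fun a => by simp [eta]
  simp only [e, one_mul, s.F_time z hz]
  have e0 : ∑ m, (Pi.single 0 1 : Fin 4 → ℝ) m * pd s.D m (fun w => Fr (s.W w) (s.F w) 0 b c d) z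
      = pd s.D 0 (fun w => Fr (s.W w) (s.F w) 0 b c d) z := by
    simp [Pi.single_apply]
  rw [e0, show eta 0 = -1 by simp [eta]]
  ring

end GaugeSol
end AdS

/-! ### Closure rules, and the Weyl components on the slice. -/

namespace AdS

variable {lam : ℝ}

section Mem

variable {A : Subalgebra ℝ (Quantity lam)} {f g : Quantity lam}

theorem mem_mul (hf : (fun s z => f s z) ∈ A) (hg : (fun s z => g s z) ∈ A) :
    (fun s z => f s z * g s z) ∈ A := mul_mem hf hg

theorem mem_add (hf : (fun s z => f s z) ∈ A) (hg : (fun s z => g s z) ∈ A) :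
    (fun s z => f s z + g s z) ∈ A := add_mem hf hg

theorem mem_sub (hf : (fun s z => f s z) ∈ A) (hg : (fun s z => g s z) ∈ A) :
    (fun s z => f s z - g s z) ∈ A := sub_mem hf hg

theorem mem_neg (hf : (fun s z => f s z) ∈ A) : (fun s z => - f s z) ∈ A := neg_mem hf

theorem mem_const (r : ℝ) : (fun _ _ => r : Quantity lam) ∈ A := Subalgebra.algebraMap_mem A r

theorem mem_sum {ι : Type} [Fintype ι] {f : ι → Quantity lam} (hf : ∀ i, (fun s z => f i s z) ∈ A) :
    (fun s z => ∑ i, f i s z) ∈ A := by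
  have h : (fun s z => ∑ i, f i s z) = ∑ i, f i := by
    funext s z
    simp only [Finset.sum_apply]
  rw [h]
  exact sum_mem fun i _ => hf i

end Mem

/-- The quantities that are, on the slice, universal polynomials in the variables `V`. -/
noncomputable def Rs (lam : ℝ) (V : Set JetVar) : Subalgebra ℝ (Quantity lam) :=
  ((Pol lam V).restrictScalars ℝ).comap res

namespace Rs

variable {V V' : Set JetVar} {f g : Quantity lam}

theorem mono (h : V ⊆ V') : Rs lam V ≤ Rs lam V' := fun _ hf => Pol.mono h hf

theorem congr (hg : g ∈ Rs lam V)
    (h : ∀ s : GaugeSol lam, ∀ x, hyp 0 x ∈ s.D → f s (hyp 0 x) = g s (hyp 0 x)) : f ∈ Rs lam V :=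
  Pol.congr hg fun s x hx => congrArg Complex.ofReal (h s x hx)

theorem of_pol {v : SliceFun lam} (hv : v ∈ Pol lam V)
    (h : ∀ s : GaugeSol lam, ∀ x, hyp 0 x ∈ s.D → (f s (hyp 0 x) : ℂ) = v s x) : f ∈ Rs lam V :=
  Pol.congr hv h

theorem of_geo (φ : GeoField) (hφ : JetVar.geo φ 0 ∈ V)
    (h : ∀ s : GaugeSol lam, ∀ x, hyp 0 x ∈ s.D → f s (hyp 0 x) = s.data.geo φ x) :
    f ∈ Rs lam V :=
  Pol.congr (Pol.jet hφ) fun s x hx => congrArg Complex.ofReal (h s x hx)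

theorem dQ_low {k : ℕ} (hs : f ∈ Smooth lam) (hf : f ∈ Rs lam (lowJets k)) (α : Fin 3) :
    dQ α.succ f ∈ Rs lam (lowJets (k + 1)) :=
  Pol.congr (Pol.dSlice_low hf α) fun s _ hx => (dSlice_res hs α s hx).symm

end Rs

theorem geo_mem_lowJets (φ : GeoField) (k : ℕ) : JetVar.geo φ 0 ∈ lowJets k := by
  change ∑ i, (0 : Fin 3 → ℕ) i ≤ k
  simp

/-! ### Membership of all components of a Weyl candidate -/

theorem weyl_components (S : Fin 4 → Fin 4 → Fin 4 → Fin 4 → Prop)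
    (left : ∀ {a b c d}, S a b c d → S b a c d) (right : ∀ {a b c d}, S a b c d → S a b d c)
    (pair : ∀ {a b c d}, S a b c d → S c d a b) (zl : ∀ a c d, S a a c d) (zr : ∀ a b c, S a b c c)
    (h1 : S 0 1 0 1) (h2 : S 0 1 0 2) (h3 : S 0 1 0 3) (h4 : S 0 2 0 2) (h5 : S 0 2 0 3)
    (h6 : S 0 1 1 2) (h7 : S 0 1 1 3) (h8 : S 0 1 2 3) (h9 : S 0 2 1 2) (h10 : S 0 2 1 3)
    (k1 : S 0 2 2 3) (k2 : S 0 3 1 3) (k3 : S 0 3 2 3) (k4 : S 0 3 1 2) (k5 : S 0 3 0 3)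
    (k6 : S 1 2 1 2) (k7 : S 1 3 1 3) (k8 : S 2 3 2 3) (k9 : S 1 3 2 3) (k10 : S 1 2 2 3)
    (k11 : S 1 2 1 3) : ∀ a b c d, S a b c d := by
  have key : ∀ a b : Fin 4, a < b → (a = 0 ∧ b = 1) ∨ (a = 0 ∧ b = 2) ∨ (a = 0 ∧ b = 3) ∨
      (a = 1 ∧ b = 2) ∨ (a = 1 ∧ b = 3) ∨ (a = 2 ∧ b = 3) := by decide
  have h : ∀ a b c d, a < b → c < d → S a b c d := by
    intro a b c d hab hcd
    rcases key a b hab with ⟨rfl, rfl⟩ | ⟨rfl, rfl⟩ | ⟨rfl, rfl⟩ | ⟨rfl, rfl⟩ | ⟨rfl, rfl⟩ |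
      ⟨rfl, rfl⟩ <;>
    rcases key c d hcd with ⟨rfl, rfl⟩ | ⟨rfl, rfl⟩ | ⟨rfl, rfl⟩ | ⟨rfl, rfl⟩ | ⟨rfl, rfl⟩ |
      ⟨rfl, rfl⟩ <;>
    first | assumption | (apply pair; assumption)
  have h' : ∀ a b c d, a < b → S a b c d := by
    intro a b c d hab
    rcases lt_trichotomy c d with hcd | rfl | hcd
    · exact h a b c d hab hcd
    · exact zr a b c
    · exact right (h a b d c hab hcd)
  intro a b c d
  rcases lt_trichotomy a b with hab | rfl | hab
  · exact h' a b c d hab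
  · exact zl a c d
  · exact left (h' b a c d hab)

/-- The frame components of the rescaled Weyl tensor. -/
noncomputable def qFr (lam : ℝ) (a b c d : Fin 4) : Quantity lam :=
  fun s z => Fr (s.W z) (s.F z) a b c d

/-- A subalgebra of quantities that is stable under a relation which is finer than equality on
the slice contains all frame components of the rescaled Weyl tensor if it contains ten of them. -/
theorem qFr_mem {A : Subalgebra ℝ (Quantity lam)} {R : Quantity lam → Quantity lam → Prop}
    (hR : ∀ f g, EqD f g → R f g) (hA : ∀ f g, g ∈ A → R f g → f ∈ A)
    (h1 : qFr lam 0 1 0 1 ∈ A) (h2 : qFr lam 0 1 0 2 ∈ A) (h3 : qFr lam 0 1 0 3 ∈ A)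
    (h4 : qFr lam 0 2 0 2 ∈ A) (h5 : qFr lam 0 2 0 3 ∈ A) (h6 : qFr lam 0 1 1 2 ∈ A)
    (h7 : qFr lam 0 1 1 3 ∈ A) (h8 : qFr lam 0 1 2 3 ∈ A) (h9 : qFr lam 0 2 1 2 ∈ A)
    (h10 : qFr lam 0 2 1 3 ∈ A) (a b c d : Fin 4) : qFr lam a b c d ∈ A := by
  have cg : ∀ {f g : Quantity lam}, g ∈ A → (∀ s : GaugeSol lam, ∀ z ∈ s.D, f s z = g s z) → f ∈ A :=
    fun hg h => hA _ _ hg (hR _ _ fun s z hz => h s z hz)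
  refine weyl_components (fun a b c d => qFr lam a b c d ∈ A)
    (fun h => cg (neg_mem h) fun s z hz => (s.weylLike hz).left _ _ _ _)
    (fun h => cg (neg_mem h) fun s z hz => (s.weylLike hz).right _ _ _ _)
    (fun h => cg h fun s z hz => (s.weylLike hz).pair _ _ _ _)
    (fun a c d => cg (zero_mem A) fun s z hz => (s.weylLike hz).self_left _ _ _)
    (fun a b c => cg (zero_mem A) fun s z hz => (s.weylLike hz).self_right _ _ _)
    h1 h2 h3 h4 h5 h6 h7 h8 h9 h10
    (cg (neg_mem h7) fun s z hz => (s.weylLike hz).basis.1.1)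
    (cg (neg_mem h9) fun s z hz => (s.weylLike hz).basis.1.2.1)
    (cg h6 fun s z hz => (s.weylLike hz).basis.1.2.2.1)
    (cg (sub_mem h10 h8) fun s z hz => (s.weylLike hz).basis.1.2.2.2.1)
    (cg (sub_mem (neg_mem h1) h4) fun s z hz => (s.weylLike hz).basis.1.2.2.2.2)
    (cg (add_mem h1 h4) fun s z hz => (s.weylLike hz).basis.2.1)
    (cg (neg_mem h4) fun s z hz => (s.weylLike hz).basis.2.2.1)
    (cg (neg_mem h1) fun s z hz => (s.weylLike hz).basis.2.2.2.1)
    (cg h2 fun s z hz => (s.weylLike hz).basis.2.2.2.2.1)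
    (cg (neg_mem h3) fun s z hz => (s.weylLike hz).basis.2.2.2.2.2.1)
    (cg h5 fun s z hz => (s.weylLike hz).basis.2.2.2.2.2.2) a b c d

/-! ### The initial values on the slice -/

theorem psi_mem (B : Fin 5) : (fun s x => s.data.psi B x : SliceFun lam) ∈ Pol lam (allJets 0) := by
  refine Pol.congr (Pol.jet (v := .psi B 0) ?_) fun s x _ => rfl
  change ∑ i, (0 : Fin 3 → ℕ) i ≤ 0
  simp

theorem psiBar_mem (B : Fin 5) :
    (fun s x => (starRingEnd ℂ) (s.data.psi B x) : SliceFun lam) ∈ Pol lam (allJets 0) := by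
  refine Pol.congr (Pol.jet (v := .psiBar B 0) ?_) fun s x _ => rfl
  change ∑ i, (0 : Fin 3 → ℕ) i ≤ 0
  simp

namespace Rs

/-- The formulas of `spinor_eq` and their complex conjugates are solved for the ten independent real
components, which become linear in `ψ` and `ψ̄`. -/
theorem Fr (a b c d : Fin 4) : qFr lam a b c d ∈ Rs lam (allJets 0) := by
  have P := psi_mem (lam := lam)
  have Q := psiBar_mem (lam := lam)
  have C := fun r : ℂ => Pol.const (lam := lam) (V := allJets 0) r
  have key : ∀ s : GaugeSol lam, ∀ x, hyp 0 x ∈ s.D → ∀ w,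
      AdS.Fr (s.W (hyp 0 x)) (s.F (hyp 0 x)) = w → ∀ p q : Fin 5 → ℂ,
      (∀ B, s.data.psi B x = p B) → (∀ B, (starRingEnd ℂ) (s.data.psi B x) = q B) →
      (w 0 1 0 1 : ℂ) = 1 / 4 * (p 0 + p 4 + q 0 + q 4) - 1 / 2 * (p 2 + q 2) ∧
      (w 0 1 0 2 : ℂ) = Complex.I / 4 * (p 4 - p 0 + q 0 - q 4) ∧
      (w 0 1 0 3 : ℂ) = 1 / 2 * (p 3 - p 1 + q 3 - q 1) ∧
      (w 0 2 0 2 : ℂ) = - (1 / 4) * (p 0 + p 4 + q 0 + q 4) - 1 / 2 * (p 2 + q 2) ∧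
      (w 0 2 0 3 : ℂ) = Complex.I / 2 * (p 1 + p 3 - q 1 - q 3) ∧
      (w 0 1 1 2 : ℂ) = Complex.I / 2 * (p 3 - p 1 + q 1 - q 3) ∧
      (w 0 1 1 3 : ℂ) = 1 / 4 * (p 4 - p 0 + q 4 - q 0) ∧
      (w 0 1 2 3 : ℂ) = Complex.I / 4 * (p 0 + p 4 - q 0 - q 4) - Complex.I / 2 * (p 2 - q 2) ∧
      (w 0 2 1 2 : ℂ) = - (1 / 2) * (p 1 + p 3 + q 1 + q 3) ∧
      (w 0 2 1 3 : ℂ) = Complex.I / 4 * (p 0 + p 4 - q 0 - q 4) + Complex.I / 2 * (p 2 - q 2) := by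
    intro s x hx w hw p q hp hq
    obtain ⟨e0, e1, e2, e3, e4⟩ := spinor_eq hw (hw ▸ s.weylLike hx)
    simp only [← hp, ← hq]
    simp only [s.data_psi hx, e0, e1, e2, e3, e4, map_add, map_sub, map_mul, map_div₀, map_neg,
      Complex.conj_ofReal, Complex.conj_I, map_ofNat]
    refine ⟨?_, ?_, ?_, ?_, ?_, ?_, ?_, ?_, ?_, ?_⟩ <;> ring_nf <;> simp only [Complex.I_sq] <;> ring
  refine qFr_mem (A := Rs lam (allJets 0)) (R := EqD) (fun _ _ h => h)
    (fun f g hg h => congr hg fun s x hx => h s hx) ?_ ?_ ?_ ?_ ?_ ?_ ?_ ?_ ?_ ?_ a b c d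
  · exact of_pol (sub_mem (mul_mem (C (1 / 4)) (add_mem (add_mem (add_mem (P 0) (P 4)) (Q 0)) (Q 4)))
      (mul_mem (C (1 / 2)) (add_mem (P 2) (Q 2))))
      fun s x hx => (key s x hx _ rfl _ _ (fun _ => rfl) fun _ => rfl).1
  · exact of_pol (mul_mem (C (Complex.I / 4)) (sub_mem (add_mem (sub_mem (P 4) (P 0)) (Q 0)) (Q 4)))
      fun s x hx => (key s x hx _ rfl _ _ (fun _ => rfl) fun _ => rfl).2.1
  · exact of_pol (mul_mem (C (1 / 2)) (sub_mem (add_mem (sub_mem (P 3) (P 1)) (Q 3)) (Q 1)))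
      fun s x hx => (key s x hx _ rfl _ _ (fun _ => rfl) fun _ => rfl).2.2.1
  · exact of_pol (sub_mem (mul_mem (C (- (1 / 4))) (add_mem (add_mem (add_mem (P 0) (P 4)) (Q 0)) (Q 4)))
      (mul_mem (C (1 / 2)) (add_mem (P 2) (Q 2))))
      fun s x hx => (key s x hx _ rfl _ _ (fun _ => rfl) fun _ => rfl).2.2.2.1
  · exact of_pol (mul_mem (C (Complex.I / 2)) (sub_mem (sub_mem (add_mem (P 1) (P 3)) (Q 1)) (Q 3)))
      fun s x hx => (key s x hx _ rfl _ _ (fun _ => rfl) fun _ => rfl).2.2.2.2.1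
  · exact of_pol (mul_mem (C (Complex.I / 2)) (sub_mem (add_mem (sub_mem (P 3) (P 1)) (Q 1)) (Q 3)))
      fun s x hx => (key s x hx _ rfl _ _ (fun _ => rfl) fun _ => rfl).2.2.2.2.2.1
  · exact of_pol (mul_mem (C (1 / 4)) (sub_mem (add_mem (sub_mem (P 4) (P 0)) (Q 4)) (Q 0)))
      fun s x hx => (key s x hx _ rfl _ _ (fun _ => rfl) fun _ => rfl).2.2.2.2.2.2.1
  · exact of_pol (sub_mem (mul_mem (C (Complex.I / 4)) (sub_mem (sub_mem (add_mem (P 0) (P 4)) (Q 0)) (Q 4)))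
      (mul_mem (C (Complex.I / 2)) (sub_mem (P 2) (Q 2))))
      fun s x hx => (key s x hx _ rfl _ _ (fun _ => rfl) fun _ => rfl).2.2.2.2.2.2.2.1
  · exact of_pol (mul_mem (C (- (1 / 2))) (add_mem (add_mem (add_mem (P 1) (P 3)) (Q 1)) (Q 3)))
      fun s x hx => (key s x hx _ rfl _ _ (fun _ => rfl) fun _ => rfl).2.2.2.2.2.2.2.2.1
  · exact of_pol (add_mem (mul_mem (C (Complex.I / 4)) (sub_mem (sub_mem (add_mem (P 0) (P 4)) (Q 0)) (Q 4)))
      (mul_mem (C (Complex.I / 2)) (sub_mem (P 2) (Q 2))))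
      fun s x hx => (key s x hx _ rfl _ _ (fun _ => rfl) fun _ => rfl).2.2.2.2.2.2.2.2.2

end Rs
end AdS

namespace AdS

/-! ### Contractions in dimension three -/

section Contraction

variable {H h : Fin 3 → Fin 3 → ℝ}

theorem contract_three_left
    (hH : ∀ i j, ∑ m, H i m * h m j = if i = j then 1 else 0)
    (a : Fin 3 → ℝ) (c : Fin 3) :
    ∑ i, ∑ j, H i j * (h j c * a i) = a c := by
  have e : ∀ i, ∑ j, H i j * (h j c * a i) = (if i = c then 1 else 0) * a i := fun i => by
    rw [← hH i c, Finset.sum_mul]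
    exact Finset.sum_congr rfl fun _ _ => by ring
  simp only [e, ite_mul, one_mul, zero_mul, Finset.sum_ite_eq', Finset.mem_univ, if_true]

theorem contract_three_right
    (hH : ∀ i j, ∑ m, H i m * h m j = if i = j then 1 else 0) (hs : ∀ i j, H i j = H j i)
    (a : Fin 3 → ℝ) (c : Fin 3) : ∑ i, ∑ j, H i j * (h i c * a j) = a c := by
  rw [Finset.sum_comm, ← contract_three_left hH a c]
  exact Finset.sum_congr rfl fun i _ => Finset.sum_congr rfl fun j _ => by rw [hs j i]

theorem contract_three_trace
    (hH : ∀ i j, ∑ m, H i m * h m j = if i = j then 1 else 0) : ∑ i, ∑ j, H i j * h j i = 3 := by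
  simp only [hH, if_true]
  simp

theorem contract_three_kn
    (hH : ∀ i j, ∑ m, H i m * h m j = if i = j then 1 else 0) (hs : ∀ i j, H i j = H j i)
    (L : Fin 3 → Fin 3 → ℝ) (c d : Fin 3) :
    ∑ i, ∑ j, H i j * (h j i * L c d - h j d * L c i + h c d * L j i - h i c * L j d)
      = L c d + h c d * ∑ i, ∑ j, H i j * L j i := by
  simp only [mul_sub, mul_add, Finset.sum_sub_distrib, Finset.sum_add_distrib]
  rw [contract_three_right hH hs (fun j => L j d) c, contract_three_left hH (fun i => L c i) d]
  simp only [← mul_assoc, ← Finset.sum_mul]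
  rw [contract_three_trace hH]
  simp only [mul_assoc, mul_left_comm _ (h c d), ← Finset.mul_sum]
  ring

/-- The trace of the assumption is `tr X = tr L + 3 tr L`, so `tr L` can be eliminated. This solves
the contracted Gauss equation for the spatial Schouten tensor. -/
theorem eq_of_contract_three
    (hH : ∀ i j, ∑ m, H i m * h m j = if i = j then 1 else 0) {X L : Fin 3 → Fin 3 → ℝ}
    (e : ∀ c d, X c d = L c d + h c d * ∑ i, ∑ j, H i j * L j i) (c d : Fin 3) :
    L c d = X c d - 1 / 4 * h c d * ∑ i, ∑ j, H i j * X j i := by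
  have h1 : ∑ i, ∑ j, H i j * X j i = 4 * ∑ i, ∑ j, H i j * L j i := by
    simp only [e, mul_add, Finset.sum_add_distrib]
    simp only [← mul_assoc, ← Finset.sum_mul]
    rw [contract_three_trace hH]
    ring
  rw [h1, e]
  ring

end Contraction

/-! ### The values of all fields on the slice as polynomials in the data. -/

namespace Rs

variable {lam : ℝ}

theorem smooth_F (a μ : Fin 4) : (fun s z => s.F z a μ : Quantity lam) ∈ Smooth lam :=
  fun s => s.F_smooth a μ

theorem F (a μ : Fin 4) : (fun s z => s.F z a μ) ∈ Rs lam (lowJets 0) := by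
  refine Fin.cases ?_ (fun a => ?_) a
  · exact congr (mem_const ((Pi.single 0 1 : Fin 4 → ℝ) μ)) fun s x hx => by rw [s.F_time _ hx]
  · refine Fin.cases ?_ (fun μ => ?_) μ
    · exact congr (mem_const 0) fun s x hx => s.frame_slice hx a
    · exact of_geo (.e a μ) (geo_mem_lowJets _ _) fun s x hx => rfl

theorem g (μ ν : Fin 4) : (fun s z => s.g z μ ν) ∈ Rs lam (lowJets 0) := by
  refine Fin.cases ?_ (fun μ => ?_) μ <;> refine Fin.cases ?_ (fun ν => ?_) ν
  · exact congr (mem_const (-1)) fun s x hx => s.gauss.unit _ hx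
  · exact congr (mem_const 0) fun s x hx => s.gauss.slice_orth x hx ν
  · exact congr (mem_const 0) fun s x hx => by
      rw [s.met.symm _ hx, s.gauss.slice_orth x hx μ]
  · exact of_geo (.h μ ν) (geo_mem_lowJets _ _) fun s x hx => rfl

theorem b (μ : Fin 4) : (fun s z => s.b z μ) ∈ Rs lam (lowJets 0) := by
  refine Fin.cases ?_ (fun μ => ?_) μ
  · exact congr (mem_const 0) fun s x hx => s.b_zero hx
  · exact of_geo (.b μ) (geo_mem_lowJets _ _) fun s x hx => rfl

theorem om : (fun s z => s.om z) ∈ Rs lam (lowJets 0) :=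
  of_geo .om (geo_mem_lowJets _ _) fun _ _ _ => rfl

/-- In terms of the metric alone the inverse would be rational. The frame makes it quadratic, and so
keeps every expression polynomial. -/
theorem inv (μ ν : Fin 4) : (fun s z => (s.g z)⁻¹ μ ν) ∈ Rs lam (lowJets 0) :=
  congr (mem_sum fun p => mem_mul (mem_const (eta p)) (mem_mul (F p μ) (F p ν)))
    fun s _ hx => s.inv_eq hx μ ν

theorem pd_om (μ : Fin 4) : (fun s z => pd s.D μ s.om z) ∈ Rs lam (lowJets 1) := by
  refine Fin.cases ?_ (fun μ => ?_) μ
  · exact congr (mem_const 0) fun s x hx => s.gauss.om_slice _ hx (hyp_zero_zero x)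
  · exact dQ_low (fun s => s.gauss.sol.om_smooth) om μ

theorem low_mono {k l : ℕ} (h : k ≤ l) : Rs lam (lowJets k) ≤ Rs lam (lowJets l) :=
  mono (lowJets_mono h)

theorem chi (α β : Fin 3) :
    (fun s z => pd s.D 0 (fun w => s.g w α.succ β.succ) z) ∈ Rs lam (lowJets 0) := by
  have h : (fun s z => (1 / 2) * pd s.D 0 (fun w => s.g w α.succ β.succ) z) ∈ Rs lam (lowJets 0) :=
    of_geo (.chi α β) (geo_mem_lowJets _ _) fun s x hx => (s.gauss.sff_eq hx α β).symm
  exact congr (mem_mul (mem_const 2) h) fun s x hx => by ring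

theorem pd_g (μ i j : Fin 4) :
    (fun s z => pd s.D μ (fun w => s.g w i j) z) ∈ Rs lam (lowJets 1) := by
  refine Fin.cases ?_ (fun μ => ?_) μ
  · refine Fin.cases ?_ (fun j => ?_) j
    · exact congr (mem_neg (low_mono zero_le_one (b i))) fun s x hx => s.pd_zero_g_zero hx i
    · refine Fin.cases ?_ (fun i => ?_) i
      · exact congr (mem_neg (low_mono zero_le_one (b j.succ))) fun s x hx => by
          rw [s.met.pd_symm hx, s.pd_zero_g_zero hx]
      · exact low_mono zero_le_one (chi i j)
  · exact dQ_low (fun s => s.met.smooth i j) (g i j) μ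

theorem christoffel (i j k : Fin 4) :
    (fun s z => christoffel s.D s.g i j k z) ∈ Rs lam (lowJets 1) :=
  mem_mul (mem_const _) (mem_sum fun l => mem_mul (low_mono zero_le_one (inv i l))
    (mem_sub (mem_add (pd_g j l k) (pd_g k l j)) (pd_g l j k)))

/-- These symbols are the second fundamental form, which is itself a datum; so no derivative is
needed, in contrast to `christoffel`. -/
theorem christoffel_zero (α β : Fin 3) :
    (fun s z => AdS.christoffel s.D s.g 0 α.succ β.succ z) ∈ Rs lam (lowJets 0) :=
  congr (mem_mul (mem_const (1 / 2)) (chi α β)) fun s x hx => by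
    rw [s.met.christoffel_zero hx (s.gauss.slice_orth x hx),
      s.met.chrL_zero_succ s.slice_regular s.gauss.slice_orth hx, s.gauss.unit _ hx]
    ring

theorem riemann (i j : Fin 4) (γ δ : Fin 3) :
    (fun s z => riemann s.D s.g i j γ.succ δ.succ z) ∈ Rs lam (lowJets 2) := by
  have h1 : ∀ (c : Fin 3) (i j k : Fin 4),
      (fun s z => pd s.D c.succ (AdS.christoffel s.D s.g i j k) z) ∈ Rs lam (lowJets 2) :=
    fun c i j k => dQ_low (fun s => s.met.christoffel_smooth i j k) (christoffel i j k) c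
  have h2 := fun i j k => low_mono (lam := lam) one_le_two (christoffel i j k)
  exact mem_add (mem_sub (h1 _ _ _ _) (h1 _ _ _ _)) (mem_sum fun m =>
    mem_sub (mem_mul (h2 _ _ _) (h2 _ _ _)) (mem_mul (h2 _ _ _) (h2 _ _ _)))

/-- The only derivatives of symbols here are those of the forms `Γ⁰_{αβ}`, hence of `χ`. One
derivative of the data suffices, as in the Codazzi equation. -/
theorem riemann_zero (β γ δ : Fin 3) :
    (fun s z => AdS.riemann s.D s.g 0 β.succ γ.succ δ.succ z) ∈ Rs lam (lowJets 1) := by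
  have h1 : ∀ c α β : Fin 3,
      (fun s z => pd s.D c.succ (AdS.christoffel s.D s.g 0 α.succ β.succ) z) ∈ Rs lam (lowJets 1) :=
    fun c α β => dQ_low (fun s => s.met.christoffel_smooth _ _ _) (christoffel_zero α β) c
  have h2 := christoffel (lam := lam)
  exact mem_add (mem_sub (h1 _ _ _) (h1 _ _ _)) (mem_sum fun m =>
    mem_sub (mem_mul (h2 _ _ _) (h2 _ _ _)) (mem_mul (h2 _ _ _) (h2 _ _ _)))

theorem Fr_low {k : ℕ} (hk : 1 ≤ k) (a b c d : Fin 4) : qFr lam a b c d ∈ Rs lam (lowJets k) :=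
  mono ((allJets_subset_lowJets 0).trans (lowJets_mono hk)) (Fr a b c d)

theorem W {k : ℕ} (hk : 1 ≤ k) (i j k' l : Fin 4) :
    (fun s z => s.W z i j k' l) ∈ Rs lam (lowJets k) := by
  have hF := fun p μ => low_mono (lam := lam) (Nat.zero_le k) (F p μ)
  have hg := fun p μ => low_mono (lam := lam) (Nat.zero_le k) (g p μ)
  have hc : ∀ p μ, (fun s z => s.coframe z p μ) ∈ Rs lam (lowJets k) := fun p μ =>
    mem_mul (mem_const _) (mem_sum fun r => mem_mul (hg _ _) (hF _ _))
  exact congr (mem_sum fun a => mem_sum fun b => mem_sum fun c => mem_sum fun d =>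
    mem_mul (Fr_low hk a b c d) (mem_mul (mem_mul (mem_mul (hc _ _) (hc _ _)) (hc _ _)) (hc _ _)))
    fun s x hx => s.W_eq hx i j k' l

theorem slice_inv_mul (s : GaugeSol lam) {x : Fin 3 → ℝ} (hx : hyp 0 x ∈ s.D) (α β : Fin 3) :
    ∑ γ : Fin 3, (s.g (hyp 0 x))⁻¹ α.succ γ.succ * s.g (hyp 0 x) γ.succ β.succ
      = if α = β then 1 else 0 := by
  have h := s.met.inv_mul hx α.succ β.succ
  rw [Fin.sum_univ_succ, s.gauss.slice_orth x hx β, mul_zero, zero_add] at h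
  rw [h]
  simp [Fin.succ_inj]

/-- `L_{00}` is algebraic in `b`. For `L_{0γ}`, the trace of the Codazzi component of the curvature
gives `L_{0γ} - 3 L_{0γ}`, whence the factor `-1/2`. In this way `L(ẋ, ·)` costs one derivative,
although general components of `L` cost two. -/
theorem schouten_zero (ν : Fin 4) :
    (fun s z => schouten s.D s.g 0 ν z) ∈ Rs lam (lowJets 1) := by
  have hi := fun p μ => low_mono (lam := lam) (Nat.zero_le 1) (inv p μ)
  have hb := fun p => low_mono (lam := lam) (Nat.zero_le 1) (b p)
  have ho := low_mono (lam := lam) (Nat.zero_le 1) om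
  refine Fin.cases ?_ (fun γ => ?_) ν
  · exact congr (mem_mul (mem_const (1 / 2)) (mem_sum fun i => mem_sum fun j =>
      mem_mul (mem_mul (hi i j) (hb i)) (hb j))) fun s x hx => s.schouten_time hx
  · refine congr (g := fun s z => - (1 / 2) * ∑ β : Fin 3, ∑ δ : Fin 3, (s.g z)⁻¹ β.succ δ.succ
      * (AdS.riemann s.D s.g 0 β.succ γ.succ δ.succ z + s.om z * s.W z 0 β.succ γ.succ δ.succ))
      (mem_mul (mem_const _) (mem_sum fun β => mem_sum fun δ => mem_mul (hi _ _)
        (mem_add (riemann_zero β γ δ) (mem_mul ho (W le_rfl _ _ _ _))))) fun s x hx => ?_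
    have e : ∀ β δ : Fin 3, AdS.riemann s.D s.g 0 β.succ γ.succ δ.succ (hyp 0 x)
        + s.om (hyp 0 x) * s.W (hyp 0 x) 0 β.succ γ.succ δ.succ
        = s.g (hyp 0 x) β.succ γ.succ * AdS.schouten s.D s.g 0 δ.succ (hyp 0 x)
          - s.g (hyp 0 x) δ.succ β.succ * AdS.schouten s.D s.g 0 γ.succ (hyp 0 x) := by
      intro β δ
      have h1 := s.gauss.sol.riemannLow_eq hx 0 β.succ γ.succ δ.succ
      rw [riemannLow, Fin.sum_univ_succ] at h1
      simp only [kn, s.gauss.slice_orth x hx, s.gauss.unit _ hx, zero_mul, Finset.sum_const_zero,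
        add_zero] at h1
      rw [s.met.symm _ hx δ.succ β.succ]
      linarith
    simp only [e, mul_sub, Finset.sum_sub_distrib]
    rw [contract_three_right (slice_inv_mul s hx) (fun i j => s.met.inv_symm hx _ _)
      (fun δ => AdS.schouten s.D s.g 0 δ.succ (hyp 0 x)) γ]
    simp only [← mul_assoc, ← Finset.sum_mul]
    rw [contract_three_trace (slice_inv_mul s hx)]
    ring

theorem schouten_trace_part (s : GaugeSol lam) {x : Fin 3 → ℝ} (hx : hyp 0 x ∈ s.D)
    (β δ : Fin 3) :
    ∑ α : Fin 3, ∑ γ : Fin 3, (s.g (hyp 0 x))⁻¹ α.succ γ.succ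
      * (riemannLow s.D s.g γ.succ β.succ α.succ δ.succ (hyp 0 x)
        - s.om (hyp 0 x) * s.W (hyp 0 x) γ.succ β.succ α.succ δ.succ)
      = AdS.schouten s.D s.g β.succ δ.succ (hyp 0 x) + s.g (hyp 0 x) β.succ δ.succ
        * ∑ α : Fin 3, ∑ γ : Fin 3, (s.g (hyp 0 x))⁻¹ α.succ γ.succ
          * AdS.schouten s.D s.g γ.succ α.succ (hyp 0 x) := by
  rw [← contract_three_kn (slice_inv_mul s hx) (fun i j => s.met.inv_symm hx _ _)
    (fun i j => AdS.schouten s.D s.g i.succ j.succ (hyp 0 x)) β δ]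
  refine Finset.sum_congr rfl fun α _ => Finset.sum_congr rfl fun γ _ => ?_
  rw [s.gauss.sol.riemannLow_eq hx γ.succ β.succ α.succ δ.succ, s.met.symm _ hx α.succ β.succ]
  simp only [kn]
  ring

theorem schouten_trace_part_mem (β δ : Fin 3) :
    (fun s z => ∑ α : Fin 3, ∑ γ : Fin 3, (s.g z)⁻¹ α.succ γ.succ
      * (riemannLow s.D s.g γ.succ β.succ α.succ δ.succ z
        - s.om z * s.W z γ.succ β.succ α.succ δ.succ)) ∈ Rs lam (lowJets 2) :=
  mem_sum fun _ => mem_sum fun _ => mem_mul (low_mono (Nat.zero_le 2) (inv _ _))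
    (mem_sub (mem_sum fun m => mem_mul (low_mono (Nat.zero_le 2) (g _ m)) (riemann m _ _ _))
      (mem_mul (low_mono (Nat.zero_le 2) om) (W one_le_two _ _ _ _)))

/-- The combination of slice quantities that equals the spatial Schouten tensor. -/
noncomputable def schoutenTracePart (lam : ℝ) (β δ : Fin 3) : Quantity lam := fun s z =>
  ∑ α : Fin 3, ∑ γ : Fin 3, (s.g z)⁻¹ α.succ γ.succ
    * (riemannLow s.D s.g γ.succ β.succ α.succ δ.succ z
      - s.om z * s.W z γ.succ β.succ α.succ δ.succ)

/-- `schouten_trace_part` equates the spatial trace of `Riem - ΩW` with `L + (tr L) h`, and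
`eq_of_contract_three` inverts this. Unlike the Ricci tensor, it contains no second time
derivatives. -/
theorem schouten_spatial (β δ : Fin 3) :
    (fun s z => AdS.schouten s.D s.g β.succ δ.succ z) ∈ Rs lam (lowJets 2) := by
  have h : ∀ β δ, schoutenTracePart lam β δ ∈ Rs lam (lowJets 2) := schouten_trace_part_mem
  have h2 : (fun s z => schoutenTracePart lam β δ s z - 1 / 4 * s.g z β.succ δ.succ *
      ∑ i : Fin 3, ∑ j : Fin 3, (s.g z)⁻¹ i.succ j.succ * schoutenTracePart lam j i s z)
      ∈ Rs lam (lowJets 2) :=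
    mem_sub (h β δ) (mem_mul (mem_mul (mem_const (1 / 4))
      (low_mono (Nat.zero_le 2) (g β.succ δ.succ)))
      (mem_sum fun i => mem_sum fun j => mem_mul (low_mono (Nat.zero_le 2) (inv i.succ j.succ))
        (h j i)))
  refine congr h2 fun s x hx => ?_
  exact eq_of_contract_three
    (L := fun β δ => AdS.schouten s.D s.g (Fin.succ β) (Fin.succ δ) (hyp 0 x))
    (h := fun β δ => s.g (hyp 0 x) (Fin.succ β) (Fin.succ δ))
    (X := fun β δ => schoutenTracePart lam β δ s (hyp 0 x))
    (slice_inv_mul s hx) (schouten_trace_part s hx) β δ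

theorem schouten (μ ν : Fin 4) :
    (fun s z => AdS.schouten s.D s.g μ ν z) ∈ Rs lam (lowJets 2) := by
  refine Fin.cases ?_ (fun β => ?_) μ
  · exact low_mono one_le_two (schouten_zero ν)
  refine Fin.cases ?_ (fun δ => ?_) ν
  · exact congr (low_mono one_le_two (schouten_zero β.succ)) fun s x hx =>
      s.met.schouten_symm hx β.succ 0
  · exact schouten_spatial β δ

/-- The definition of `s` contains `∂_τ² Ω`. The purely spatial trace of `hess_eq` yields `3 s` and
needs no second time derivative. -/
theorem fs : (fun s z => IsSolution.fs s.D s.g s.om z) ∈ Rs lam (lowJets 2) := by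
  have hi := fun p μ => low_mono (lam := lam) (Nat.zero_le 2) (inv p μ)
  have hG := fun i j k => low_mono (lam := lam) one_le_two (christoffel i j k)
  have hO := fun i => low_mono (lam := lam) one_le_two (pd_om i)
  have ho := low_mono (lam := lam) (Nat.zero_le 2) om
  have h2 : ∀ α β : Fin 3, (fun s z => pd s.D α.succ (pd s.D β.succ s.om) z) ∈ Rs lam (lowJets 2) :=
    fun α β => dQ_low (fun s => ContDiffOn.pd s.regular s.gauss.sol.om_smooth _) (pd_om β.succ) α
  refine congr (mem_mul (mem_const (1 / 3)) (mem_sum fun α : Fin 3 => mem_sum fun β : Fin 3 =>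
    mem_mul (hi α.succ β.succ) (mem_add (mem_sub (h2 β α) (mem_sum fun m => mem_mul
      (hG m β.succ α.succ) (hO m))) (mem_mul ho (schouten β.succ α.succ))))) fun s x hx => ?_
  have e : ∀ α β : Fin 3, pd s.D β.succ (pd s.D α.succ s.om) (hyp 0 x)
      - ∑ m, AdS.christoffel s.D s.g m β.succ α.succ (hyp 0 x) * pd s.D m s.om (hyp 0 x)
      + s.om (hyp 0 x) * AdS.schouten s.D s.g β.succ α.succ (hyp 0 x)
      = s.g (hyp 0 x) β.succ α.succ * IsSolution.fs s.D s.g s.om (hyp 0 x) := by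
    intro α β
    have h := s.gauss.sol.hess_eq hx β.succ α.succ
    rw [hess] at h
    linarith
  simp only [e, ← mul_assoc, ← Finset.sum_mul]
  rw [contract_three_trace (slice_inv_mul s hx)]
  ring

end Rs
end AdS

/-! ### The simultaneous induction over the time derivatives of all fields. -/

namespace AdS

/-- All fields of a solution in the conformal Gauss gauge have time derivatives up to order `J` at
the slice that are polynomials in the data of the expected order. -/
structure FieldsCl (lam : ℝ) (J : ℕ) : Prop where
  F : ∀ a μ, (fun s z => s.F z a μ) ∈ Cl lowJets lam J 0
  g : ∀ μ ν, (fun s z => s.g z μ ν) ∈ Cl lowJets lam J 0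
  b : ∀ μ, (fun s z => s.b z μ) ∈ Cl lowJets lam J 0
  om : (fun s z => s.om z) ∈ Cl lowJets lam J 0
  inv : ∀ μ ν, (fun s z => (s.g z)⁻¹ μ ν) ∈ Cl lowJets lam J 0
  christoffel : ∀ i j k, (fun s z => christoffel s.D s.g i j k z) ∈ Cl lowJets lam J 1
  pd_om : ∀ μ, (fun s z => pd s.D μ s.om z) ∈ Cl lowJets lam J 1
  fr : ∀ a b c d, qFr lam a b c d ∈ Cl lowJets lam J 1
  W : ∀ i j k l, (fun s z => s.W z i j k l) ∈ Cl lowJets lam J 1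
  schouten_zero : ∀ ν, (fun s z => schouten s.D s.g 0 ν z) ∈ Cl lowJets lam J 1
  schouten : ∀ μ ν, (fun s z => schouten s.D s.g μ ν z) ∈ Cl lowJets lam J 2
  fs : (fun s z => IsSolution.fs s.D s.g s.om z) ∈ Cl lowJets lam J 2

namespace FieldsCl

variable {lam : ℝ} {J : ℕ}

theorem base : FieldsCl lam 0 where
  F a μ := fun s => s.F_smooth a μ
  g μ ν := fun s => s.met.smooth μ ν
  b μ := fun s => s.gauss.b_smooth μ
  om := fun s => s.gauss.sol.om_smooth
  inv μ ν := fun s => s.met.inv_smooth μ ν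
  christoffel i j k := fun s => s.met.christoffel_smooth i j k
  pd_om μ := fun s => ContDiffOn.pd s.regular s.gauss.sol.om_smooth μ
  fr a b c d := fun s => s.Fr_smooth a b c d
  W i j k l := fun s => s.gauss.sol.W_smooth i j k l
  schouten_zero ν := fun s => s.met.schouten_smooth 0 ν
  schouten μ ν := fun s => s.met.schouten_smooth μ ν
  fs := fun s => s.gauss.sol.fs_smooth

variable (h : FieldsCl lam J)
include h

/-- The pattern of the induction: the value on the slice comes from `Rs`, and the evolution equation
expresses `∂_τ` of the field by quantities already controlled to order `J`, at a level at most one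
higher. Here `Γ`, of level `1`, drives the frame, of level `0`. Membership of the right-hand side is
then purely formal. -/
theorem F_succ (a μ : Fin 4) : (fun s z => s.F z a μ) ∈ Cl lowJets lam (J + 1) 0 := by
  refine Cl.succ (base.F a μ) (Rs.F a μ) (Cl.congr ?_ fun s z hz => s.pd_zero_F hz a μ)
  have m := Cl.mono (V := lowJets) (lam := lam) (J := J) zero_le_one
  repeat' first
    | exact h.christoffel _ _ _ | exact m (h.F _ _) | exact m (h.g _ _) | exact m (h.b _)
    | exact m (h.inv _ _) | exact mem_const _ | (refine mem_sum fun _ => ?_) | apply mem_mul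
    | apply mem_sub | apply mem_add | apply mem_neg

theorem g_succ (μ ν : Fin 4) : (fun s z => s.g z μ ν) ∈ Cl lowJets lam (J + 1) 0 := by
  refine Cl.succ (base.g μ ν) (Rs.g μ ν) (Cl.congr ?_ fun s z hz => s.pd_zero_g hz μ ν)
  have m := Cl.mono (V := lowJets) (lam := lam) (J := J) zero_le_one
  repeat' first
    | exact h.christoffel _ _ _ | exact m (h.g _ _) | (refine mem_sum fun _ => ?_) | apply mem_mul
    | apply mem_add

theorem b_succ (μ : Fin 4) : (fun s z => s.b z μ) ∈ Cl lowJets lam (J + 1) 0 := by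
  refine Cl.succ (base.b μ) (Rs.b μ) (Cl.congr ?_ fun s z hz => s.pd_zero_b hz μ)
  have m := Cl.mono (V := lowJets) (lam := lam) (J := J) zero_le_one
  repeat' first
    | exact h.christoffel _ _ _ | exact m (h.g _ _) | exact m (h.b _) | exact h.schouten_zero _
    | exact m (h.inv _ _) | exact mem_const _ | (refine mem_sum fun _ => ?_) | apply mem_mul
    | apply mem_sub | apply mem_add

theorem om_succ : (fun s z => s.om z) ∈ Cl lowJets lam (J + 1) 0 :=
  Cl.succ base.om Rs.om (h.pd_om 0)

theorem inv_succ (μ ν : Fin 4) : (fun s z => (s.g z)⁻¹ μ ν) ∈ Cl lowJets lam (J + 1) 0 :=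
  Cl.congr (mem_sum fun p => mem_mul (mem_const (eta p)) (mem_mul (h.F_succ p μ) (h.F_succ p ν)))
    fun s _ hz => s.inv_eq hz μ ν

theorem christoffel_succ_spatial (i j : Fin 4) (l : Fin 3) :
    (fun s z => AdS.christoffel s.D s.g i l.succ j z) ∈ Cl lowJets lam (J + 1) 1 := by
  refine Cl.succ (base.christoffel _ _ _) (Rs.christoffel _ _ _)
    (Cl.congr ?_ fun s z hz => s.pd_zero_christoffel hz i j l.succ)
  have m := Cl.mono (V := lowJets) (lam := lam) (J := J) (Nat.zero_le 2)
  have m1 := Cl.mono (V := lowJets) (lam := lam) (J := J) one_le_two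
  have hd : (fun s z => pd s.D l.succ (AdS.christoffel s.D s.g i 0 j) z) ∈ Cl lowJets lam J 2 :=
    Cl.dQ_succ (h.christoffel i 0 j) l
  refine mem_add (mem_sub hd ?_) ?_
  all_goals repeat' first
    | exact m1 (h.christoffel _ _ _) | exact m (h.g _ _) | exact m h.om | exact m1 (h.W _ _ _ _)
    | exact h.schouten _ _
    | exact m (h.inv _ _) | (refine mem_sum fun _ => ?_) | apply mem_mul
    | apply mem_sub | apply mem_add

/-- The curvature gives no evolution equation when both lower indices are `0`, but these symbols
equal `-b^i` by the geodesic equation. With one lower index `0` the symmetry of `Γ` reduces to the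
spatial case. -/
theorem christoffel_succ (i l j : Fin 4) :
    (fun s z => AdS.christoffel s.D s.g i l j z) ∈ Cl lowJets lam (J + 1) 1 := by
  obtain rfl | ⟨l, rfl⟩ := Fin.eq_zero_or_eq_succ l
  · obtain rfl | ⟨j, rfl⟩ := Fin.eq_zero_or_eq_succ j
    · exact Cl.mono zero_le_one (Cl.congr (mem_neg (mem_sum fun ν =>
        mem_mul (h.inv_succ i ν) (h.b_succ ν))) fun s z hz => s.christoffel_time hz i)
    · exact Cl.congr (h.christoffel_succ_spatial i 0 j) fun s z hz =>
        s.met.christoffel_symm hz _ _ _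
  · exact h.christoffel_succ_spatial i j l

theorem pd_om_succ (μ : Fin 4) : (fun s z => pd s.D μ s.om z) ∈ Cl lowJets lam (J + 1) 1 := by
  refine Cl.succ (base.pd_om μ) (Rs.pd_om μ) (Cl.congr ?_ fun s z hz => s.pd_zero_pd_om hz μ)
  have m := Cl.mono (V := lowJets) (lam := lam) (J := J) (Nat.zero_le 2)
  have m1 := Cl.mono (V := lowJets) (lam := lam) (J := J) one_le_two
  repeat' first
    | exact m1 (h.christoffel _ _ _) | exact m (h.g _ _) | exact m h.om | exact m1 (h.pd_om _)
    | exact h.schouten _ _ | exact h.fs | (refine mem_sum fun _ => ?_) | apply mem_mul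
    | apply mem_sub | apply mem_add

theorem dQ_zero_schouten (ν r : Fin 4) {k : ℕ} (hk : 2 ≤ k)
    (hd : (fun s z => pd s.D ν (AdS.schouten s.D s.g 0 r) z) ∈ Cl lowJets lam J k) :
    dQ 0 (fun s z => AdS.schouten s.D s.g ν r z) ∈ Cl lowJets lam J k := by
  refine Cl.congr ?_ fun s z hz => s.pd_zero_schouten hz ν r
  have m := Cl.mono (V := lowJets) (lam := lam) (J := J) (Nat.zero_le k)
  have m1 := Cl.mono (V := lowJets) (lam := lam) (J := J) (one_le_two.trans hk)
  have m2 := Cl.mono (V := lowJets) (lam := lam) (J := J) hk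
  refine mem_add (mem_sub (mem_add hd ?_) ?_) ?_
  all_goals repeat' first
    | exact m1 (h.christoffel _ _ _) | exact m (h.inv _ _) | exact m1 (h.pd_om _)
    | exact m2 (h.schouten _ _) | exact m1 (h.W _ _ _ _) | (refine mem_sum fun _ => ?_)
    | apply mem_mul | apply mem_sub | apply mem_add

/-- `L_{00}` is quadratic in `b`. The components `L_{0β} = L_{β0}` evolve by the Cotton equation,
whose derivative term `∂_β L_{00}` has level `2`; so level `1` is preserved, and with it level `0`
for `b`. -/
theorem schouten_zero_succ (ν : Fin 4) :
    (fun s z => AdS.schouten s.D s.g 0 ν z) ∈ Cl lowJets lam (J + 1) 1 := by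
  refine Fin.cases ?_ (fun β => ?_) ν
  · exact Cl.mono zero_le_one (Cl.congr (mem_mul (mem_const (1 / 2)) (mem_sum fun i =>
      mem_sum fun j => mem_mul (mem_mul (h.inv_succ i j) (h.b_succ i)) (h.b_succ j)))
      fun s z hz => s.schouten_time hz)
  · refine Cl.congr (g := fun s z => AdS.schouten s.D s.g β.succ 0 z) ?_
      fun s z hz => s.met.schouten_symm hz _ _
    exact Cl.succ (base.schouten _ _)
      (Rs.congr (Rs.schouten_zero β.succ) fun s x hx => s.met.schouten_symm hx _ _)
      (h.dQ_zero_schouten _ _ le_rfl (Cl.dQ_succ (h.schouten_zero 0) β))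

theorem schouten_succ (μ ν : Fin 4) :
    (fun s z => AdS.schouten s.D s.g μ ν z) ∈ Cl lowJets lam (J + 1) 2 := by
  refine Fin.cases ?_ (fun α => ?_) μ
  · exact Cl.mono one_le_two (h.schouten_zero_succ ν)
  · exact Cl.succ (base.schouten _ _) (Rs.schouten _ _) (h.dQ_zero_schouten _ _ (Nat.le_succ 2)
      (Cl.mono (Nat.le_succ 2) (Cl.dQ_succ (h.schouten_zero ν) α)))

theorem fs_succ : (fun s z => IsSolution.fs s.D s.g s.om z) ∈ Cl lowJets lam (J + 1) 2 := by
  refine Cl.succ base.fs Rs.fs (Cl.congr ?_ fun s z hz => s.pd_zero_fs hz)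
  have m := Cl.mono (V := lowJets) (lam := lam) (J := J) (Nat.zero_le 3)
  have m1 := Cl.mono (V := lowJets) (lam := lam) (J := J) (show 1 ≤ 3 by omega)
  repeat' first
    | exact m (h.inv _ _) | exact m1 (h.pd_om _) | exact m1 (h.schouten_zero _)
    | (refine mem_sum fun _ => ?_) | apply mem_mul | apply mem_neg

theorem lower_mem (b c d : Fin 4) : (fun s z => s.lower b c d z) ∈ Cl lowJets lam J 1 := by
  have m := Cl.mono (V := lowJets) (lam := lam) (J := J) zero_le_one
  -- `lower` contains `τ`-derivatives of the frame, so the frame is needed to one order more; that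
  -- step of the induction is independent of `W`.
  have hF : ∀ a μ, (fun s z => s.F z a μ) ∈ Cl lowJets lam (J + 1) 0 := h.F_succ
  have hd : ∀ (p i j k l m : Fin 4), (fun s z => pd s.D m (fun w => s.F w p i * s.F w b j
      * s.F w c k * s.F w d l) z) ∈ Cl lowJets lam J 1 := by
    intro p i j k l m
    have hp : (fun s z => s.F z p i * s.F z b j * s.F z c k * s.F z d l) ∈ Cl lowJets lam (J + 1) 0 :=
      mem_mul (mem_mul (mem_mul (hF _ _) (hF _ _)) (hF _ _)) (hF _ _)
    refine Fin.cases ?_ (fun m => ?_) m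
    · exact hp.2.2
    · exact Cl.dQ_succ (Cl.pred hp) m
  have hc : ∀ i j k l m, (fun s z => conn4 s.D s.g s.W m i j k l z) ∈ Cl lowJets lam J 1 := by
    intro i j k l m
    refine mem_sum fun n => ?_
    repeat' first
      | exact h.christoffel _ _ _ | exact h.W _ _ _ _ | apply mem_mul | apply mem_add
  refine mem_add ?_ ?_
  all_goals repeat' first
    | exact hd _ _ _ _ _ _ | exact hc _ _ _ _ _ | exact m (h.F _ _) | exact h.W _ _ _ _
    | exact m (h.inv _ _) | exact mem_const _ | (refine mem_sum fun _ => ?_) | apply mem_mul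

theorem dQ_zero_fr (b c d : Fin 4) : dQ 0 (qFr lam 0 b c d) ∈ Cl lowJets lam J 2 := by
  refine Cl.congr ?_ fun s z hz => s.pd_zero_Fr hz b c d
  refine mem_sub (mem_sum fun a => mem_sum fun m => ?_) (Cl.mono one_le_two (h.lower_mem b c d))
  refine Fin.cases ?_ (fun m => ?_) m
  -- The frame vectors have a component along `∂_τ` off the slice, so `∂_τ w` appears on both sides
  -- of the Bianchi equation. Its coefficient on the right vanishes at `τ = 0`, and this saves the
  -- one order that would make the argument circular.
  · refine Cl.mul_of_vanish (h.F a.succ 0) (fun s x hx => s.frame_slice hx a) ?_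
      (g := dQ 0 (qFr lam a.succ b c d))
    have h1 := h.fr a.succ b c d
    cases J with
    | zero => exact Smooth.dQ h1 0
    | succ J => exact h1.2.2
  · exact mem_mul (Cl.mono (Nat.zero_le 2) (h.F _ _)) (Cl.dQ_succ (h.fr a.succ b c d) m)

/-- Every component is a linear combination of those with a leading index `0`, and these evolve by
`pd_zero_Fr`. -/
theorem fr_succ (a b c d : Fin 4) : qFr lam a b c d ∈ Cl lowJets lam (J + 1) 1 := by
  have h0 : ∀ b c d, qFr lam 0 b c d ∈ Cl lowJets lam (J + 1) 1 := fun b c d =>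
    Cl.succ (base.fr _ _ _ _) (Rs.Fr_low le_rfl _ _ _ _) (h.dQ_zero_fr b c d)
  exact qFr_mem (R := EqD) (fun _ _ h => h) (fun _ _ => Cl.congr) (h0 _ _ _) (h0 _ _ _) (h0 _ _ _)
    (h0 _ _ _) (h0 _ _ _) (h0 _ _ _) (h0 _ _ _) (h0 _ _ _) (h0 _ _ _) (h0 _ _ _) a b c d

theorem W_succ (i j k l : Fin 4) : (fun s z => s.W z i j k l) ∈ Cl lowJets lam (J + 1) 1 := by
  have m := Cl.mono (V := lowJets) (lam := lam) (J := J + 1) zero_le_one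
  have hc : ∀ p μ, (fun s z => s.coframe z p μ) ∈ Cl lowJets lam (J + 1) 1 := fun p μ =>
    mem_mul (mem_const _) (mem_sum fun r => mem_mul (m (h.g_succ _ _)) (m (h.F_succ _ _)))
  exact Cl.congr (mem_sum fun a => mem_sum fun b => mem_sum fun c => mem_sum fun d =>
    mem_mul (h.fr_succ a b c d) (mem_mul (mem_mul (mem_mul (hc _ _) (hc _ _)) (hc _ _)) (hc _ _)))
    fun s z hz => s.W_eq hz i j k l

omit h in
theorem all : ∀ J, FieldsCl lam J
  | 0 => base
  | J + 1 =>
    have h := all J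
    ⟨h.F_succ, h.g_succ, h.b_succ, h.om_succ, h.inv_succ, h.christoffel_succ, h.pd_om_succ,
      h.fr_succ, h.W_succ, h.schouten_zero_succ, h.schouten_succ, h.fs_succ⟩

end FieldsCl
end AdS

namespace AdS

/-! ### Linearity of iterated derivatives -/

section Iterate

variable {n : ℕ} {V W : Type*} [NormedAddCommGroup V] [NormedSpace ℝ V] [NormedAddCommGroup W]
  [NormedSpace ℝ W] {D : Set (Fin n → ℝ)}

theorem iterate_pd_add (hD : IsRegularDomain D) {f g : (Fin n → ℝ) → V} (hf : ContDiffOn ℝ ∞ f D)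
    (hg : ContDiffOn ℝ ∞ g D) (μ : Fin n) (k : ℕ) :
    Set.EqOn ((pd D μ)^[k] (fun y => f y + g y))
      (fun y => (pd D μ)^[k] f y + (pd D μ)^[k] g y) D := by
  induction k with
  | zero => exact fun _ _ => rfl
  | succ k ih =>
    intro x hx
    simp only [Function.iterate_succ_apply']
    rw [pd_congr ih μ hx, pd_add hD (contDiffOn_iterate_pd hD hf μ k)
      (contDiffOn_iterate_pd hD hg μ k) hx]

theorem iterate_pd_sub (hD : IsRegularDomain D) {f g : (Fin n → ℝ) → V} (hf : ContDiffOn ℝ ∞ f D)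
    (hg : ContDiffOn ℝ ∞ g D) (μ : Fin n) (k : ℕ) :
    Set.EqOn ((pd D μ)^[k] (fun y => f y - g y))
      (fun y => (pd D μ)^[k] f y - (pd D μ)^[k] g y) D := by
  induction k with
  | zero => exact fun _ _ => rfl
  | succ k ih =>
    intro x hx
    simp only [Function.iterate_succ_apply']
    rw [pd_congr ih μ hx, pd_sub hD (contDiffOn_iterate_pd hD hf μ k)
      (contDiffOn_iterate_pd hD hg μ k) hx]

theorem iterate_pd_clm (hD : IsRegularDomain D) (T : V →L[ℝ] W) {f : (Fin n → ℝ) → V}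
    (hf : ContDiffOn ℝ ∞ f D) (μ : Fin n) (k : ℕ) :
    Set.EqOn ((pd D μ)^[k] (fun y => T (f y))) (fun y => T ((pd D μ)^[k] f y)) D := by
  induction k with
  | zero => exact fun _ _ => rfl
  | succ k ih =>
    intro x hx
    simp only [Function.iterate_succ_apply']
    rw [pd_congr ih μ hx, pd_clm hD T (contDiffOn_iterate_pd hD hf μ k) hx]

end Iterate

variable {lam : ℝ} {f g : Quantity lam}

theorem iterate_dQ_apply (μ : Fin 4) (k : ℕ) (f : Quantity lam) (s : GaugeSol lam) :
    (dQ μ)^[k] f s = (pd s.D μ)^[k] (f s) := by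
  induction k generalizing f with
  | zero => rfl
  | succ k ih => rw [Function.iterate_succ_apply, Function.iterate_succ_apply, ih]; rfl

theorem EqD.iterate_dQ (h : EqD f g) (μ : Fin 4) (k : ℕ) : EqD ((AdS.dQ μ)^[k] f) ((AdS.dQ μ)^[k] g) := by
  intro s
  rw [iterate_dQ_apply, iterate_dQ_apply]
  exact iterate_pd_congr (h s) μ k

theorem Smooth.iterate_dQ (hf : f ∈ Smooth lam) (μ : Fin 4) (k : ℕ) :
    (AdS.dQ μ)^[k] f ∈ Smooth lam := by
  intro s
  rw [iterate_dQ_apply]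
  exact contDiffOn_iterate_pd s.regular (hf s) μ k

theorem iterate_dQ_add (hf : f ∈ Smooth lam) (hg : g ∈ Smooth lam) (μ : Fin 4) (k : ℕ) :
    EqD ((dQ μ)^[k] (f + g)) ((dQ μ)^[k] f + (dQ μ)^[k] g) := by
  intro s
  rw [iterate_dQ_apply, Pi.add_apply, Pi.add_apply, iterate_dQ_apply, iterate_dQ_apply]
  exact iterate_pd_add s.regular (hf s) (hg s) μ k

theorem iterate_dQ_const_mul (hf : f ∈ Smooth lam) (r : ℝ) (μ : Fin 4) (k : ℕ) :
    EqD ((dQ μ)^[k] (fun s z => r * f s z)) (fun s z => r * (dQ μ)^[k] f s z) := by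
  intro s
  simp only [iterate_dQ_apply]
  exact iterate_pd_clm s.regular (r • ContinuousLinearMap.id ℝ ℝ) (hf s) μ k

theorem iterate_dQ_sum {ι : Type} [Fintype ι] {f : ι → Quantity lam}
    (hf : ∀ i, f i ∈ Smooth lam) (μ : Fin 4) (k : ℕ) :
    EqD ((dQ μ)^[k] (fun s z => ∑ i, f i s z)) (fun s z => ∑ i, (dQ μ)^[k] (f i) s z) := by
  induction k with
  | zero => exact fun _ _ _ => rfl
  | succ k ih =>
    intro s z hz
    simp only [Function.iterate_succ_apply']
    rw [ih.dQ μ s hz]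
    exact pd_sum s.regular _ (fun i => Smooth.iterate_dQ (hf i) μ k s) hz μ

theorem dQ_iterate_comm (hf : f ∈ Smooth lam) (μ ν : Fin 4) (k : ℕ) :
    EqD ((dQ ν)^[k] (dQ μ f)) (dQ μ ((dQ ν)^[k] f)) := by
  intro s
  have := (pd_iterate_comm s.regular (hf s) μ ν k).symm
  rw [iterate_dQ_apply]
  unfold dQ at *
  rwa [← iterate_dQ_apply] at this

/-! ### Quantities all of whose time derivatives are controlled -/

/-- The quantities whose time derivatives of any order `j` are, on the slice, polynomials in the
variables in `V (k + j)`. -/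
noncomputable def TimeJets (V : ℕ → Set JetVar) [JetFamily V] (lam : ℝ) (k : ℕ) :
    Subalgebra ℝ (Quantity lam) := ⨅ J, Cl V lam J k

namespace TimeJets

variable {V : ℕ → Set JetVar} [JetFamily V] {k l : ℕ}

theorem mem_iff : f ∈ TimeJets V lam k ↔ ∀ J, f ∈ Cl V lam J k := Algebra.mem_iInf

theorem smooth (h : f ∈ TimeJets V lam k) : f ∈ Smooth lam := mem_iff.1 h 0

theorem rs (h : f ∈ TimeJets V lam k) : f ∈ Rs lam (V k) := (mem_iff.1 h 1).2.1

theorem congr (hg : g ∈ TimeJets V lam k) (h : EqD f g) : f ∈ TimeJets V lam k :=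
  mem_iff.2 fun J => Cl.congr (mem_iff.1 hg J) h

theorem mono (hkl : k ≤ l) : TimeJets V lam k ≤ TimeJets V lam l := fun _ h =>
  mem_iff.2 fun J => Cl.mono hkl (mem_iff.1 h J)

theorem of_subset {V' : ℕ → Set JetVar} [JetFamily V'] {m : ℕ} (hV : ∀ k, V k ⊆ V' (k + m)) :
    TimeJets V lam k ≤ TimeJets V' lam (k + m) := fun _ h =>
  mem_iff.2 fun J => Cl.of_subset hV (mem_iff.1 h J)

theorem dQ (h : f ∈ TimeJets V lam k) (μ : Fin 4) : AdS.dQ μ f ∈ TimeJets V lam (k + 1) := by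
  refine mem_iff.2 fun J => ?_
  obtain rfl | ⟨α, rfl⟩ := Fin.eq_zero_or_eq_succ μ
  · exact (mem_iff.1 h (J + 1)).2.2
  · exact Cl.dQ_succ (mem_iff.1 h J) α

theorem iterate_dQ (h : f ∈ TimeJets V lam k) (μ : Fin 4) (i : ℕ) :
    (AdS.dQ μ)^[i] f ∈ TimeJets V lam (k + i) := by
  induction i with
  | zero => exact h
  | succ i ih =>
    rw [Function.iterate_succ_apply']
    exact dQ ih μ

end TimeJets

theorem frame_timeJets (a μ : Fin 4) : (fun s z => s.F z a μ) ∈ TimeJets lowJets lam 0 :=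
  TimeJets.mem_iff.2 fun J => (FieldsCl.all J).F a μ

theorem lower_timeJets (b c d : Fin 4) : (fun s z => s.lower b c d z) ∈ TimeJets lowJets lam 1 :=
  TimeJets.mem_iff.2 fun J => (FieldsCl.all J).lower_mem b c d

theorem lowJets_subset_allJets (k : ℕ) : lowJets k ⊆ allJets k :=
  (lowJets_subset_midJets k).trans (midJets_subset_allJets k)

theorem weyl_timeJets (a b c d : Fin 4) : qFr lam a b c d ∈ TimeJets allJets lam 0 := by
  refine TimeJets.mem_iff.2 fun J => ?_
  induction J generalizing a b c d with
  | zero => exact fun s => s.Fr_smooth a b c d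
  | succ J ih =>
    have hF : ∀ a μ, (fun s z => s.F z a μ) ∈ Cl allJets lam J 0 := fun a μ =>
      TimeJets.mem_iff.1 (TimeJets.of_subset (m := 0) lowJets_subset_allJets
        (frame_timeJets a μ)) J
    have hd : ∀ b c d, dQ 0 (qFr lam 0 b c d) ∈ Cl allJets lam J 1 := by
      intro b c d
      refine Cl.congr (mem_sub (mem_sum fun a => mem_sum fun m => ?_)
        (TimeJets.mem_iff.1 (TimeJets.of_subset (m := 0) lowJets_subset_allJets
          (lower_timeJets b c d)) J)) fun s z hz => s.pd_zero_Fr hz b c d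
      obtain rfl | ⟨m, rfl⟩ := Fin.eq_zero_or_eq_succ m
      · refine Cl.mul_of_vanish (hF a.succ 0) (fun s x hx => s.frame_slice hx a) ?_
          (g := dQ 0 (qFr lam a.succ b c d))
        have h1 := ih a.succ b c d
        cases J with
        | zero => exact Smooth.dQ h1 0
        | succ J => exact h1.2.2
      · exact mem_mul (Cl.mono zero_le_one (hF _ _)) (Cl.dQ_succ (ih a.succ b c d) m)
    have h0 : ∀ b c d, qFr lam 0 b c d ∈ Cl allJets lam (J + 1) 0 := fun b c d =>
      Cl.succ (fun s => s.Fr_smooth 0 b c d) (Rs.Fr 0 b c d) (hd b c d)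
    exact qFr_mem (R := EqD) (fun _ _ h => h) (fun _ _ => Cl.congr) (h0 _ _ _) (h0 _ _ _)
      (h0 _ _ _) (h0 _ _ _) (h0 _ _ _) (h0 _ _ _) (h0 _ _ _) (h0 _ _ _) (h0 _ _ _) (h0 _ _ _)
      a b c d

/-! ### The Leibniz rule up to terms of lower order -/

/-- The error obeys `E_{k+1} = ∂_τ E_k + (∂_τ f) ∂_τ^k g`. The new product involves `ψ` to order at
most `k + 1`, one below the top order `k + 2`, and so lies in `midJets (k + 2)`. -/
theorem leibniz_lower (hf : f ∈ TimeJets lowJets lam 0) (hg : g ∈ TimeJets allJets lam 1) (k : ℕ) :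
    (dQ 0)^[k] (f * g) - f * (dQ 0)^[k] g ∈ TimeJets midJets lam (k + 1) := by
  induction k with
  | zero =>
    rw [Function.iterate_zero, id, id, sub_self]
    exact zero_mem _
  | succ k ih =>
    have hgk := TimeJets.iterate_dQ hg 0 k
    have h1 : dQ 0 f * (dQ 0)^[k] g ∈ TimeJets midJets lam (k + 1 + 1) := by
      refine mul_mem (TimeJets.mono (by omega) (TimeJets.of_subset (m := 0) lowJets_subset_midJets
        (TimeJets.dQ hf 0))) ?_
      have := TimeJets.of_subset (m := 1) allJets_subset_midJets hgk
      rwa [add_comm 1 k] at this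
    refine TimeJets.congr (add_mem (TimeJets.dQ ih 0) h1) ?_
    have e : (dQ 0)^[k] (f * g) = ((dQ 0)^[k] (f * g) - f * (dQ 0)^[k] g) + f * (dQ 0)^[k] g := by
      ring
    rw [Function.iterate_succ_apply', Function.iterate_succ_apply']
    intro s z hz
    have e1 := dQ_add (TimeJets.smooth ih) (mul_mem (TimeJets.smooth hf) (TimeJets.smooth hgk)) 0 s hz
    rw [← e] at e1
    have e2 := dQ_mul (TimeJets.smooth hf) (TimeJets.smooth hgk) 0 s hz
    simp only [Pi.add_apply, Pi.sub_apply, Pi.mul_apply] at e1 e2 ⊢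
    rw [e1, e2]
    ring

theorem Rs.dQ_succ {V : ℕ → Set JetVar} [JetFamily V] {k : ℕ} (hs : f ∈ Smooth lam)
    (hf : f ∈ Rs lam (V k)) (α : Fin 3) : dQ α.succ f ∈ Rs lam (V (k + 1)) :=
  Pol.congr (JetFamily.dSlice hf α) fun s _ hx => (dSlice_res hs α s hx).symm

theorem Rs.dQ_tangential {k : ℕ} (hs : f ∈ Smooth lam) (hf : f ∈ Rs lam (allJets k)) {α : Fin 3}
    (hα : α ≠ 0) : dQ α.succ f ∈ Rs lam (midJets (k + 1)) :=
  Pol.congr (Pol.dSlice_tangential hf hα) fun s _ hx => (dSlice_res hs α s hx).symm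

/-- The derivative of a quantity in the direction of the frame vector `e_a`. -/
noncomputable def frameD (a : Fin 4) (f : Quantity lam) : Quantity lam :=
  fun s z => ∑ m, s.F z a m * pd s.D m (f s) z

theorem frameD_smooth (a : Fin 4) (hf : f ∈ Smooth lam) : frameD a f ∈ Smooth lam :=
  mem_sum fun m => mem_mul (Rs.smooth_F a m) (Smooth.dQ hf m)

/-- On the slice, only the transverse component of a spatial frame vector contributes to the terms
of highest transverse order. -/
theorem iterate_frameD (a : Fin 3) (hf : f ∈ TimeJets allJets lam 0) (k : ℕ) :
    (fun s z => (dQ 0)^[k] (frameD a.succ f) s z - s.F z a.succ 1 * dQ 1 ((dQ 0)^[k] f) s z)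
      ∈ Rs lam (midJets (k + 1)) := by
  have hF := fun m => frame_timeJets (lam := lam) a.succ m
  have h1 : ∀ m, (dQ 0)^[k] (fun s z => s.F z a.succ m * dQ m f s z)
      - (fun s z => s.F z a.succ m * (dQ 0)^[k] (dQ m f) s z) ∈ Rs lam (midJets (k + 1)) :=
    fun m => TimeJets.rs (leibniz_lower (hF m) (TimeJets.dQ hf m) k)
  have hfk := TimeJets.iterate_dQ hf 0 k
  rw [zero_add] at hfk
  have h2 : ∀ α : Fin 3, α ≠ 0 → (fun s z => s.F z a.succ α.succ * dQ α.succ ((dQ 0)^[k] f) s z)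
      ∈ Rs lam (midJets (k + 1)) := fun α hα =>
    mem_mul (Rs.mono ((lowJets_subset_midJets 0).trans (JetFamily.mono (Nat.zero_le _)))
      (Rs.F _ _)) (Rs.dQ_tangential (TimeJets.smooth hfk) (TimeJets.rs hfk) hα)
  refine Rs.congr (mem_add (mem_add (mem_sum h1) (h2 1 (by decide))) (h2 2 (by decide)))
    fun s x hx => ?_
  have e1 := iterate_dQ_sum (f := fun m s z => s.F z a.succ m * dQ m f s z)
    (fun m => mem_mul (Rs.smooth_F _ _) (Smooth.dQ (TimeJets.smooth hf) m)) 0 k s hx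
  have e2 : ∀ m, (dQ 0)^[k] (dQ m f) s (hyp 0 x) = dQ m ((dQ 0)^[k] f) s (hyp 0 x) :=
    fun m => dQ_iterate_comm (TimeJets.smooth hf) m 0 k s hx
  have e0 := s.frame_slice hx a
  simp only [Pi.sub_apply, Finset.sum_sub_distrib, e2]
  refine (congrArg (· - _) e1).trans ?_
  rw [Fin.sum_univ_four (fun m => s.F (hyp 0 x) a.succ m * _), e0]
  simp only [show Fin.succ (1 : Fin 3) = 2 from rfl, show Fin.succ (2 : Fin 3) = 3 from rfl]
  ring

end AdS

/-! ### Transport equations modulo negligible terms. -/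

namespace AdS

variable {lam : ℝ} {f g : Quantity lam} {k : ℕ}

/-- Quantities that are on the slice of lower order, up to multiples of the transverse components of
`e₁` and `e₂`, which vanish at the boundary. -/
def IsNegligible (k : ℕ) (f : Quantity lam) : Prop :=
  ∃ v : Fin 2 → Quantity lam, (∀ a, v a ∈ Smooth lam ∧ v a ∈ Rs lam (allJets k)) ∧
    (fun s z => f s z - ∑ a : Fin 2, s.F z a.castSucc.succ 1 * v a s z) ∈ Rs lam (midJets k)

namespace IsNegligible

theorem of_mem (h : f ∈ Rs lam (midJets k)) : IsNegligible k f :=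
  ⟨fun _ => 0, fun _ => ⟨zero_mem _, zero_mem _⟩, Rs.congr h fun s x _ => by simp⟩

theorem congr (hg : IsNegligible k g)
    (h : ∀ s : GaugeSol lam, ∀ x, hyp 0 x ∈ s.D → f s (hyp 0 x) = g s (hyp 0 x)) :
    IsNegligible k f := by
  obtain ⟨v, hv, hp⟩ := hg
  exact ⟨v, hv, Rs.congr hp fun s x hx => by rw [h s x hx]⟩

theorem add (hf : IsNegligible k f) (hg : IsNegligible k g) : IsNegligible k (f + g) := by
  obtain ⟨v, hv, hp⟩ := hf
  obtain ⟨w, hw, hq⟩ := hg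
  refine ⟨v + w, fun a => ⟨add_mem (hv a).1 (hw a).1, add_mem (hv a).2 (hw a).2⟩,
    Rs.congr (mem_add hp hq) fun s x _ => ?_⟩
  simp only [Pi.add_apply, mul_add, Finset.sum_add_distrib]
  ring

theorem sum {f : Fin 2 → Quantity lam} (hf : ∀ a, IsNegligible k (f a)) :
    IsNegligible k (fun s z => ∑ a, f a s z) :=
  congr (add (hf 0) (hf 1)) fun _ _ _ => Fin.sum_univ_two _

theorem mul (hf : IsNegligible k f) (hs : g ∈ Smooth lam) (hg : g ∈ Rs lam (lowJets 0)) :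
    IsNegligible k (g * f) := by
  obtain ⟨v, hv, hp⟩ := hf
  refine ⟨fun a => g * v a, fun a => ⟨mul_mem hs (hv a).1, mul_mem (Rs.mono
    ((lowJets_subset_allJets 0).trans (allJets_mono (Nat.zero_le k))) hg) (hv a).2⟩,
    Rs.congr (mem_mul (Rs.mono ((lowJets_subset_midJets 0).trans
      (JetFamily.mono (Nat.zero_le k))) hg) hp) fun s x _ => ?_⟩
  simp only [Pi.mul_apply, mul_sub, Finset.mul_sum]
  congr 1
  exact Finset.sum_congr rfl fun a _ => by ring

theorem frame_mul (a : Fin 2) (hs : f ∈ Smooth lam) (hf : f ∈ Rs lam (allJets k)) :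
    IsNegligible k (fun s z => s.F z a.castSucc.succ 1 * f s z) := by
  refine ⟨Pi.single a f, fun b => ?_, Rs.congr (mem_const 0) fun s x _ => ?_⟩
  · obtain rfl | hb := eq_or_ne b a
    · rw [Pi.single_eq_same]
      exact ⟨hs, hf⟩
    · rw [Pi.single_eq_of_ne hb]
      exact ⟨zero_mem _, zero_mem _⟩
  · rw [Finset.sum_eq_single a (fun b _ hb => by rw [Pi.single_eq_of_ne hb]; exact mul_zero _)
      (fun h => absurd (Finset.mem_univ a) h), Pi.single_eq_same, sub_self]

theorem low_one : lowJets 1 ⊆ midJets (k + 1) :=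
  (lowJets_subset_midJets 1).trans (JetFamily.mono (by omega))

theorem dQ_frame (a : Fin 3) : dQ 1 (fun s z => s.F z a.succ 1) ∈ Rs lam (midJets (k + 1)) :=
  Rs.mono low_one (Rs.dQ_low (Rs.smooth_F _ _) (Rs.F a.succ 1) 0)

/-- The coefficients `e₁¹, e₂¹` vanish only on `Σ`, so they have to be carried along while
transverse derivatives are taken. If `∂₁` hits such a coefficient, its cofactor keeps order at most
`k`, and the term is of lower order at level `k + 1`. -/
theorem dQ_one (hs : f ∈ Smooth lam) (hf : IsNegligible k f) : IsNegligible (k + 1) (dQ 1 f) := by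
  obtain ⟨v, hv, hp⟩ := hf
  refine ⟨fun a => dQ 1 (v a), fun a => ⟨Smooth.dQ (hv a).1 1, Rs.dQ_succ (hv a).1 (hv a).2 0⟩, ?_⟩
  have hS : (fun s z => ∑ a : Fin 2, s.F z a.castSucc.succ 1 * v a s z) ∈ Smooth lam :=
    mem_sum fun a => mem_mul (Rs.smooth_F _ _) (hv a).1
  have h1 := Rs.dQ_succ (mem_sub hs hS) hp 0
  have h2 : (fun s z => ∑ a : Fin 2, dQ 1 (fun s z => s.F z a.castSucc.succ 1) s z * v a s z)
      ∈ Rs lam (midJets (k + 1)) := mem_sum fun a => mem_mul (dQ_frame a.castSucc)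
    (Rs.mono (allJets_subset_midJets k) (hv a).2)
  refine Rs.congr (mem_add h1 h2) fun s x hx => ?_
  have e1 := pd_sub s.regular (hs s) (hS s) hx 1
  have e2 := pd_sum s.regular Finset.univ (f := fun (a : Fin 2) z => s.F z a.castSucc.succ 1 * v a s z)
    (fun a => mem_mul (Rs.smooth_F _ _) (hv a).1 s) hx 1
  have e3 := fun a : Fin 2 => dQ_mul (Rs.smooth_F a.castSucc.succ 1) (hv a).1 1 s hx
  have e4 : dQ 1 (fun s z => f s z - ∑ a : Fin 2, s.F z a.castSucc.succ 1 * v a s z) s (hyp 0 x)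
      = dQ 1 f s (hyp 0 x) - ∑ a : Fin 2, (dQ 1 (fun s z => s.F z a.castSucc.succ 1) s (hyp 0 x)
        * v a s (hyp 0 x) + s.F (hyp 0 x) a.castSucc.succ 1 * dQ 1 (v a) s (hyp 0 x)) :=
    e1.trans (congrArg (_ - ·) (e2.trans (Finset.sum_congr rfl fun a _ => e3 a)))
  refine Eq.trans ?_ (congrArg (· + _) e4).symm
  rw [Finset.sum_add_distrib]
  ring

end IsNegligible

theorem Rs.iterate_dQ_one (hf : f ∈ TimeJets allJets lam 0) (k : ℕ) :
    (dQ 1)^[k] f ∈ Rs lam (allJets k) := by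
  have h := TimeJets.rs (TimeJets.iterate_dQ hf 1 k)
  rwa [zero_add] at h

/-- The time derivatives of a quantity that satisfies a transport equation in the direction
`e₀ - ε e₃`, up to derivatives in the directions `e₁`, `e₂` and terms of lower order. -/
theorem transport {q N : Quantity lam} {u : Fin 2 → Quantity lam} {ε : ℝ}
    (hq : q ∈ TimeJets allJets lam 0) (hu : ∀ a, u a ∈ TimeJets allJets lam 0)
    (hN : N ∈ TimeJets lowJets lam 1)
    (h : EqD (dQ 0 q) ((fun s z => ε * frameD 3 q s z)
      + ((fun s z => ∑ a : Fin 2, frameD a.castSucc.succ (u a) s z) + N))) (k : ℕ) :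
    IsNegligible k (fun s z => (dQ 0)^[k] q s z - ε ^ k * s.F z 3 1 ^ k * (dQ 1)^[k] q s z) := by
  induction k with
  | zero => exact .of_mem (Rs.congr (mem_const 0) fun s x _ => by simp)
  | succ k ih =>
    have sq := TimeJets.smooth hq
    have sF := Rs.smooth_F (lam := lam) 3 1
    have sk := Smooth.iterate_dQ sq 1 k
    have sqk := Smooth.iterate_dQ sq 0 k
    -- The index `2` of the spatial frame is `e₃`. Modulo lower order, `∂_τ^k` of the transport
    -- equation leaves `ε e₃¹ ∂₁ ∂_τ^k q` and, for `e₁` and `e₂`, multiples of `e₁¹` and `e₂¹`,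
    -- which are negligible.
    have h3 := iterate_frameD 2 hq k
    have ha := fun a : Fin 2 => iterate_frameD a.castSucc (hu a) k
    have hNk : (dQ 0)^[k] N ∈ Rs lam (midJets (k + 1)) := by
      have := TimeJets.rs (TimeJets.iterate_dQ hN 0 k)
      rw [add_comm] at this
      exact Rs.mono (lowJets_subset_midJets _) this
    have hua : ∀ a, IsNegligible (k + 1) (fun s z => s.F z a.castSucc.succ 1
        * dQ 1 ((dQ 0)^[k] (u a)) s z) := fun a => by
      have hk := TimeJets.iterate_dQ (hu a) 0 k
      rw [zero_add] at hk
      exact .frame_mul a (Smooth.dQ (TimeJets.smooth hk) 1)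
        (Rs.dQ_succ (TimeJets.smooth hk) (TimeJets.rs hk) 0)
    have sP : (fun s z => ε ^ k * s.F z 3 1 ^ k * (dQ 1)^[k] q s z) ∈ Smooth lam :=
      mem_mul (mem_mul (mem_const _) (pow_mem sF k)) sk
    -- `∂₁` of the induction hypothesis replaces `∂₁ ∂_τ^k q`. The derivative of `(e₃¹)^k` that
    -- arises multiplies only `∂₁^k q`, so it is of lower order (`hpow`).
    have hz := ih.dQ_one (mem_sub sqk sP)
    have hpow : (fun s z => ε ^ k * dQ 1 (fun s z => s.F z 3 1 ^ k) s z * (dQ 1)^[k] q s z)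
        ∈ Rs lam (midJets (k + 1)) := by
      exact mem_mul (mem_mul (mem_const _) (Rs.mono IsNegligible.low_one (Rs.dQ_low (pow_mem sF k)
        (pow_mem (Rs.F 3 1) k) 0))) (Rs.mono (allJets_subset_midJets k)
          (Rs.iterate_dQ_one hq k))
    have hall : IsNegligible (k + 1) _ := (((hz.add (.of_mem hpow)).mul
      (g := fun s z => ε * s.F z 3 1) (mem_mul (mem_const ε) sF) (mem_mul (mem_const ε)
      (Rs.F 3 1))).add (.of_mem (mem_mul (mem_const ε) h3))).add
      ((IsNegligible.sum fun a => (hua a).add (.of_mem (ha a))).add (.of_mem hNk))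
    refine hall.congr fun s x hx => ?_
    have s3 : (fun s z => ε * frameD 3 q s z) ∈ Smooth lam :=
      mem_mul (mem_const ε) (frameD_smooth 3 sq)
    have su := fun a : Fin 2 => frameD_smooth a.castSucc.succ (TimeJets.smooth (hu a))
    have sU : (fun s z => ∑ a : Fin 2, frameD a.castSucc.succ (u a) s z) ∈ Smooth lam := mem_sum su
    have e0 := h.iterate_dQ 0 k s hx
    have e1 := iterate_dQ_add s3 (add_mem sU (TimeJets.smooth hN)) 0 k s hx
    have e2 := iterate_dQ_add sU (TimeJets.smooth hN) 0 k s hx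
    have e3 := iterate_dQ_const_mul (frameD_smooth 3 sq) ε 0 k s hx
    have e4 := iterate_dQ_sum su 0 k s hx
    have e5 := pd_sub s.regular (sqk s) (sP s) hx 1
    have e6 := dQ_mul (mem_mul (mem_const (ε ^ k)) (pow_mem sF k)) sk 1 s hx
    have e7 := pd_const_mul s.regular (ε ^ k) (pow_mem sF k s) hx 1
    have e8 : dQ 1 (fun s z => (dQ 0)^[k] q s z - ε ^ k * s.F z 3 1 ^ k * (dQ 1)^[k] q s z) s
        (hyp 0 x) = dQ 1 ((dQ 0)^[k] q) s (hyp 0 x)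
          - (ε ^ k * dQ 1 (fun s z => s.F z 3 1 ^ k) s (hyp 0 x) * (dQ 1)^[k] q s (hyp 0 x)
            + ε ^ k * s.F (hyp 0 x) 3 1 ^ k * dQ 1 ((dQ 1)^[k] q) s (hyp 0 x)) :=
      e5.trans (congrArg (_ - ·) (e6.trans (congrArg (· * _ + _) e7)))
    simp only [Pi.add_apply, Pi.mul_apply] at e1 e2 ⊢
    rw [e8, Function.iterate_succ_apply, e0, e1, e2, e3, e4, Function.iterate_succ_apply' (dQ 1)]
    simp only [Finset.sum_add_distrib, Finset.sum_sub_distrib,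
      show Fin.succ (2 : Fin 3) = 3 from rfl]
    ring

end AdS

/-! ### Transport equations for `ψ₄` and `ψ̄₀`, and the conditions `P_k`. -/

namespace AdS

variable {lam : ℝ}

/-- A linear combination of the frame components `w_{p b c d}` of the rescaled Weyl tensor. -/
noncomputable def weylComb (lam : ℝ) (c : Fin 4 → ℝ) (t : Fin 4 → Fin 4 × Fin 4 × Fin 4)
    (p : Fin 4) : Quantity lam :=
  fun s z => ∑ i, c i * qFr lam p (t i).1 (t i).2.1 (t i).2.2 s z

theorem weylComb_timeJets (c : Fin 4 → ℝ) (t : Fin 4 → Fin 4 × Fin 4 × Fin 4) (p : Fin 4) :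
    weylComb lam c t p ∈ TimeJets allJets lam 0 :=
  mem_sum fun _ => mem_mul (mem_const _) (weyl_timeJets _ _ _ _)

theorem dQ_weylComb (c : Fin 4 → ℝ) (t : Fin 4 → Fin 4 × Fin 4 × Fin 4) (p μ : Fin 4) :
    EqD (dQ μ (weylComb lam c t p))
      (fun s z => ∑ i, c i * dQ μ (qFr lam p (t i).1 (t i).2.1 (t i).2.2) s z) := by
  intro s z hz
  refine (pd_sum s.regular _ (fun i => contDiffOn_const.mul (s.Fr_smooth _ _ _ _)) hz μ).trans ?_
  exact Finset.sum_congr rfl fun i _ => pd_const_mul s.regular _ (s.Fr_smooth _ _ _ _) hz μ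

theorem frameD_congr {f g : Quantity lam} (h : EqD f g) (a : Fin 4) :
    EqD (frameD a f) (frameD a g) := fun s _ hz =>
  Finset.sum_congr rfl fun m _ => congrArg (_ * ·) (pd_congr (h s) m hz)

theorem frameD_weylComb (c : Fin 4 → ℝ) (t : Fin 4 → Fin 4 × Fin 4 × Fin 4) (a p : Fin 4) :
    EqD (frameD a (weylComb lam c t p))
      (fun s z => ∑ i, c i * frameD a (qFr lam p (t i).1 (t i).2.1 (t i).2.2) s z) := by
  intro s z hz
  have h := fun m => dQ_weylComb (lam := lam) c t p m s hz
  simp only [frameD, Finset.mul_sum]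
  rw [Finset.sum_comm]
  refine Finset.sum_congr rfl fun m _ => ?_
  refine (congrArg (_ * ·) (h m)).trans ?_
  rw [Finset.mul_sum]
  exact Finset.sum_congr rfl fun i _ => mul_left_comm _ _ _

theorem frameD_const_mul {f : Quantity lam} (hf : f ∈ Smooth lam) (r : ℝ) (a : Fin 4) :
    EqD (frameD a (fun s z => r * f s z)) (fun s z => r * frameD a f s z) := by
  intro s z hz
  simp only [frameD, Finset.mul_sum]
  refine Finset.sum_congr rfl fun m _ => ?_
  rw [pd_const_mul s.regular r (hf s) hz m]
  ring

/-- The Bianchi equation is a transport equation for a combination of the components `w_{0bcd}` if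
it is an eigenvector for the replacement of the index `0` by `3`. -/
theorem weylComb_transport (c : Fin 4 → ℝ) (t : Fin 4 → Fin 4 × Fin 4 × Fin 4) (ε : ℝ)
    (h : EqD (weylComb lam c t 3) (fun s z => ε * weylComb lam c t 0 s z)) (k : ℕ) :
    IsNegligible k (fun s z => (dQ 0)^[k] (weylComb lam c t 0) s z
      - ε ^ k * s.F z 3 1 ^ k * (dQ 1)^[k] (weylComb lam c t 0) s z) := by
  refine transport (N := fun s z => - ∑ i, c i * s.lower (t i).1 (t i).2.1 (t i).2.2 z)
    (u := fun a => weylComb lam c t a.castSucc.succ) (weylComb_timeJets c t 0)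
    (fun a => weylComb_timeJets c t _)
    (mem_neg (mem_sum fun i => mem_mul (mem_const _) (lower_timeJets _ _ _))) ?_ k
  intro s z hz
  rw [dQ_weylComb c t 0 0 s hz]
  have h3 := (frameD_congr h 3 s hz).symm.trans (frameD_weylComb c t 3 3 s hz)
  rw [frameD_const_mul (TimeJets.smooth (weylComb_timeJets c t 0)) ε 3 s hz] at h3
  beta_reduce at h3
  have ha := fun a : Fin 2 => frameD_weylComb (lam := lam) c t a.castSucc.succ a.castSucc.succ s hz
  beta_reduce at ha
  have h0 := fun i => s.pd_zero_Fr hz (t i).1 (t i).2.1 (t i).2.2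
  simp only [Pi.add_apply]
  rw [Finset.sum_congr rfl fun a _ => ha a, h3, Fin.sum_univ_two, ← Finset.sum_add_distrib,
    ← Finset.sum_neg_distrib, ← Finset.sum_add_distrib, ← Finset.sum_add_distrib]
  refine Finset.sum_congr rfl fun i _ => ?_
  refine (congrArg (c i * ·) (h0 i)).trans ?_
  rw [Fin.sum_univ_three]
  simp only [frameD, show Fin.succ (Fin.castSucc (0 : Fin 2)) = (1 : Fin 4) from rfl,
    show Fin.succ (Fin.castSucc (1 : Fin 2)) = (2 : Fin 4) from rfl,
    show Fin.succ (0 : Fin 3) = (1 : Fin 4) from rfl, show Fin.succ (1 : Fin 3) = (2 : Fin 4) from rfl,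
    show Fin.succ (2 : Fin 3) = (3 : Fin 4) from rfl]
  unfold qFr
  ring

/-- For `σ = 1` the real part of `ψ₄`, for `σ = -1` the real part of `ψ₀`. -/
noncomputable def rePart (lam σ : ℝ) : Quantity lam :=
  weylComb lam ![1 / 2, - (1 / 2), σ / 2, - (σ / 2)] ![(1, 0, 1), (2, 0, 2), (1, 1, 3), (2, 2, 3)] 0

/-- For `σ = 1` the imaginary part of `ψ̄₄`, for `σ = -1` the imaginary part of `ψ₀`. -/
noncomputable def imPart (lam σ : ℝ) : Quantity lam :=
  weylComb lam ![1 / 2, 1 / 2, σ / 2, σ / 2] ![(1, 0, 2), (2, 0, 1), (1, 2, 3), (2, 1, 3)] 0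

/-- Replacing the leading `0` by `3` interchanges the two pairs of terms of the combination, by the
Weyl symmetries and the trace conditions. One pair carries a factor `σ`, so `σ² = 1` makes the
combination an eigenvector with eigenvalue `-σ`. Thus `ψ₄` and `ψ̄₀` are transported in opposite
transverse directions, which is the source of the sign `(-1)^k` in the leading part. -/
theorem rePart_transport {σ : ℝ} (hσ : σ * σ = 1) (k : ℕ) :
    IsNegligible k (fun s z => (dQ 0)^[k] (rePart lam σ) s z
      - (-σ) ^ k * s.F z 3 1 ^ k * (dQ 1)^[k] (rePart lam σ) s z) := by
  refine weylComb_transport _ _ (-σ) (fun s z hz => ?_) k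
  have h := s.weylLike hz
  simp only [weylComb, Fin.sum_univ_four, qFr, Matrix.cons_val]
  generalize Fr (s.W z) (s.F z) = w at h
  have L := h.left
  have R := h.right
  have P := h.pair
  have t1 := h.trace 1 1
  have t2 := h.trace 2 2
  have a1 : w 3 1 0 1 = - w 0 1 1 3 := by rw [P 3 1, R 0 1 3 1]
  have a2 : w 3 2 0 2 = - w 0 2 2 3 := by rw [P 3 2, R 0 2 3 2]
  have a3 : w 3 1 1 3 = - w 3 1 3 1 := R _ _ _ _
  have a4 : w 3 2 2 3 = - w 3 2 3 2 := R _ _ _ _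
  have a5 : w 1 2 1 2 = w 2 1 2 1 := by rw [L 1 2, R 2 1]; ring
  rw [h.self_left] at t1 t2
  rw [a1, a2, a3, a4]
  linear_combination (σ / 2) * (t2 - t1 - a5) + (1 / 2) * (w 0 1 1 3 - w 0 2 2 3) * hσ

theorem imPart_transport {σ : ℝ} (hσ : σ * σ = 1) (k : ℕ) :
    IsNegligible k (fun s z => (dQ 0)^[k] (imPart lam σ) s z
      - (-σ) ^ k * s.F z 3 1 ^ k * (dQ 1)^[k] (imPart lam σ) s z) := by
  refine weylComb_transport _ _ (-σ) (fun s z hz => ?_) k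
  have h := s.weylLike hz
  simp only [weylComb, Fin.sum_univ_four, qFr, Matrix.cons_val]
  generalize Fr (s.W z) (s.F z) = w at h
  have L := h.left
  have R := h.right
  have P := h.pair
  have t1 := h.trace 1 2
  have t2 := h.trace 2 1
  have a1 : w 3 1 0 2 = - w 0 2 1 3 := by rw [P 3 1, R 0 2 3 1]
  have a2 : w 3 2 0 1 = - w 0 1 2 3 := by rw [P 3 2, R 0 1 3 2]
  have a3 : w 3 1 2 3 = - w 3 1 3 2 := R _ _ _ _
  have a4 : w 3 2 1 3 = - w 3 2 3 1 := R _ _ _ _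
  rw [h.self_left, h.self_right] at t1 t2
  rw [a1, a2, a3, a4]
  linear_combination (- σ / 2) * (t1 + t2) + (1 / 2) * (w 0 1 2 3 + w 0 2 1 3) * hσ

theorem psi_four_eq (s : GaugeSol lam) {z : Fin 4 → ℝ} (hz : z ∈ s.D) :
    spinor (s.W z) (s.F z) 4 = (rePart lam 1 s z : ℂ) - Complex.I * (imPart lam 1 s z : ℂ) := by
  have h := s.weylLike hz
  rw [(spinor_eq rfl h).2.2.2.2]
  simp only [rePart, imPart, weylComb, Fin.sum_univ_four, qFr, Matrix.cons_val]
  generalize Fr (s.W z) (s.F z) = w at h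
  have e1 : w 0 2 0 1 = w 0 1 0 2 := h.pair _ _ _ _
  have e2 : w 0 2 2 3 = - w 0 1 1 3 := by
    have t := h.trace 0 3
    rw [h.self_left, h.self_right, h.left 1 0, h.left 2 0] at t
    linarith
  rw [e1, e2]
  push_cast
  ring

theorem conj_psi_zero_eq (s : GaugeSol lam) {z : Fin 4 → ℝ} (hz : z ∈ s.D) :
    (starRingEnd ℂ) (spinor (s.W z) (s.F z) 0)
      = (rePart lam (-1) s z : ℂ) - Complex.I * (imPart lam (-1) s z : ℂ) := by
  have h := s.weylLike hz
  rw [(spinor_eq rfl h).1]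
  simp only [rePart, imPart, weylComb, Fin.sum_univ_four, qFr, Matrix.cons_val]
  generalize Fr (s.W z) (s.F z) = w at h
  have e1 : w 0 2 0 1 = w 0 1 0 2 := h.pair _ _ _ _
  have e2 : w 0 2 2 3 = - w 0 1 1 3 := by
    have t := h.trace 0 3
    rw [h.self_left, h.self_right, h.left 1 0, h.left 2 0] at t
    linarith
  rw [e1, e2]
  simp only [map_add, map_sub, map_mul, map_div₀, Complex.conj_I, Complex.conj_ofReal,
    Complex.conj_ofNat]
  push_cast
  ring

theorem rePart_smooth (σ : ℝ) : rePart lam σ ∈ Smooth lam := TimeJets.smooth (weylComb_timeJets _ _ _)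

theorem imPart_smooth (σ : ℝ) : imPart lam σ ∈ Smooth lam := TimeJets.smooth (weylComb_timeJets _ _ _)

theorem iterate_pd_hyp {n : ℕ} {V : Type*} [NormedAddCommGroup V] [NormedSpace ℝ V]
    {D : Set (Fin (n + 1) → ℝ)} (N : Fin (n + 1)) (hD : IsRegularDomain D)
    (hE : IsRegularDomain (hyp N ⁻¹' D)) {f : (Fin (n + 1) → ℝ) → V} (hf : ContDiffOn ℝ ∞ f D)
    (a : Fin n) (k : ℕ) :
    Set.EqOn ((pd (hyp N ⁻¹' D) a)^[k] (fun w => f (hyp N w)))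
      (fun w => (pd D (N.succAbove a))^[k] f (hyp N w)) (hyp N ⁻¹' D) := by
  induction k with
  | zero => exact fun _ _ => rfl
  | succ k ih =>
    intro y hy
    simp only [Function.iterate_succ_apply']
    rw [pd_congr ih a hy, pd_hyp N (contDiffOn_iterate_pd hD hf _ k) hE hy a]

theorem iterate_pd_re_sub_im {n : ℕ} {D : Set (Fin n → ℝ)} (hD : IsRegularDomain D)
    {r i : (Fin n → ℝ) → ℝ} (hr : ContDiffOn ℝ ∞ r D) (hi : ContDiffOn ℝ ∞ i D) (μ : Fin n) (k : ℕ)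
    {x : Fin n → ℝ} (hx : x ∈ D) :
    (pd D μ)^[k] (fun y => (r y : ℂ) - Complex.I * (i y : ℂ)) x
      = (((pd D μ)^[k] r x : ℝ) : ℂ) - Complex.I * (((pd D μ)^[k] i x : ℝ) : ℂ) := by
  have h1 := iterate_pd_clm hD Complex.ofRealCLM hr μ k hx
  have h2 := iterate_pd_clm hD ((-Complex.I) • Complex.ofRealCLM) hi μ k hx
  have h3 := iterate_pd_add hD (f := fun y => Complex.ofRealCLM (r y))
    (g := fun y => ((-Complex.I) • Complex.ofRealCLM) (i y))
    (Complex.ofRealCLM.contDiff.comp_contDiffOn hr)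
    (((-Complex.I) • Complex.ofRealCLM).contDiff.comp_contDiffOn hi) μ k hx
  beta_reduce at h1 h2 h3
  rw [h1, h2] at h3
  simp only [smul_apply, Complex.ofRealCLM_apply, smul_eq_mul, neg_mul,
    ← sub_eq_add_neg] at h3
  exact h3

/-- Where `e₁` and `e₂` have no transverse component, the multiples of `e₁¹` and `e₂¹` vanish and a
universal polynomial of lower order remains. -/
theorem IsNegligible.exists_poly {f : Quantity lam} {k : ℕ} (h : IsNegligible k f) :
    ∃ Q ∈ MvPolynomial.supported ℂ (midJets k), ∀ s : GaugeSol lam, ∀ x ∈ s.data.dom,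
      (∀ a : Fin 2, s.F (hyp 0 x) a.castSucc.succ 1 = 0) →
      (f s (hyp 0 x) : ℂ) = s.data.eval Q x := by
  obtain ⟨v, -, Q, hQ, h⟩ := h
  refine ⟨Q, hQ, fun s x hx ha => ?_⟩
  refine Eq.trans ?_ (h s x hx)
  refine Eq.trans ?_ (res_apply _ s x).symm
  simp [ha]

theorem eval_principalPart (d : LocalData) (k : ℕ) (x : Fin 3 → ℝ) :
    d.eval (principalPart k) x = (d.e 2 0 x : ℂ) ^ k * ((-1) ^ k * (pd d.dom 0)^[k] (d.psi 4) x
      - (pd d.dom 0)^[k] (fun y => (starRingEnd ℂ) (d.psi 0 y)) x) := by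
  simp [LocalData.eval, principalPart, LocalData.jet, multiDeriv, LocalData.geo]

theorem exists_conditions (lam : ℝ) : ∃ P : ℕ → MvPolynomial JetVar ℂ,
    (∀ k, IsConditionOfOrder k (P k)) ∧ ∀ s : GaugeSol lam, ∀ x ∈ s.data.dom,
      (∀ a : Fin 2, s.F (hyp 0 x) a.castSucc.succ 1 = 0) → ∀ k,
      (pd s.D 0)^[k] (fun z => spinor (s.W z) (s.F z) 4
        - (starRingEnd ℂ) (spinor (s.W z) (s.F z) 0)) (hyp 0 x) = s.data.eval (P k) x := by
  -- The remainders depend on `σ` and `k` only, not on the solution; here universality is secured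
  -- before any solution is given.
  choose Qr hQr er using fun (σ : ℝ) (k : ℕ) (hσ : σ * σ = 1) =>
    (rePart_transport (lam := lam) hσ k).exists_poly
  choose Qi hQi ei using fun (σ : ℝ) (k : ℕ) (hσ : σ * σ = 1) =>
    (imPart_transport (lam := lam) hσ k).exists_poly
  have p1 : (1 : ℝ) * 1 = 1 := one_mul 1
  have m1 : (-1 : ℝ) * (-1) = 1 := by norm_num
  -- `Qr 1 - i Qi 1` is the remainder of `ψ₄` and `Qr (-1) - i Qi (-1)` that of `ψ̄₀`, according to
  -- the decompositions `psi_four_eq` and `conj_psi_zero_eq`.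
  refine ⟨fun k => principalPart k + ((Qr 1 k p1 - MvPolynomial.C Complex.I * Qi 1 k p1)
    - (Qr (-1) k m1 - MvPolynomial.C Complex.I * Qi (-1) k m1)), fun k v hv => ?_,
    fun s x hx ha k => ?_⟩
  · rw [add_sub_cancel_left] at hv
    have hC : (MvPolynomial.C Complex.I : MvPolynomial JetVar ℂ)
      ∈ MvPolynomial.supported ℂ (midJets k) := Subalgebra.algebraMap_mem _ _
    exact MvPolynomial.mem_supported.1 (sub_mem (sub_mem (hQr _ _ _) (mul_mem hC (hQi _ _ _)))
      (sub_mem (hQr _ _ _) (mul_mem hC (hQi _ _ _)))) hv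
  · have hD := s.regular
    have hE := s.slice_regular
    have sm : ∀ σ, ContDiffOn ℝ ∞ (fun z => (rePart lam σ s z : ℂ)
        - Complex.I * (imPart lam σ s z : ℂ)) s.D := fun σ =>
      (Complex.ofRealCLM.contDiff.comp_contDiffOn (rePart_smooth σ s)).sub
        (contDiffOn_const.mul (Complex.ofRealCLM.contDiff.comp_contDiffOn (imPart_smooth σ s)))
    have e0 : Set.EqOn (fun z => spinor (s.W z) (s.F z) 4
        - (starRingEnd ℂ) (spinor (s.W z) (s.F z) 0)) (fun z =>
        ((rePart lam 1 s z : ℂ) - Complex.I * (imPart lam 1 s z : ℂ))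
        - ((rePart lam (-1) s z : ℂ) - Complex.I * (imPart lam (-1) s z : ℂ))) s.D :=
      fun z hz => by simp only [psi_four_eq s hz, conj_psi_zero_eq s hz]
    have e1 : ∀ σ, (pd s.data.dom 0)^[k] (fun y => (rePart lam σ s (hyp 0 y) : ℂ)
        - Complex.I * (imPart lam σ s (hyp 0 y) : ℂ)) x
        = (((dQ 1)^[k] (rePart lam σ) s (hyp 0 x) : ℝ) : ℂ)
          - Complex.I * (((dQ 1)^[k] (imPart lam σ) s (hyp 0 x) : ℝ) : ℂ) := fun σ => by
      have h1 := iterate_pd_hyp 0 hD hE (rePart_smooth σ s) 0 k hx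
      have h2 := iterate_pd_hyp 0 hD hE (imPart_smooth σ s) 0 k hx
      rw [iterate_dQ_apply, iterate_dQ_apply]
      refine (iterate_pd_re_sub_im hE (ContDiffOn.comp_hyp 0 (rePart_smooth σ s))
        (ContDiffOn.comp_hyp 0 (imPart_smooth σ s)) 0 k hx).trans ?_
      exact congrArg₂ (fun a b : ℝ => (a : ℂ) - Complex.I * (b : ℂ)) h1 h2
    have e2 : (pd s.data.dom 0)^[k] (s.data.psi 4) x = _ :=
      (iterate_pd_congr (fun y hy => (s.data_psi hy 4).trans (psi_four_eq s hy)) 0 k hx).trans (e1 1)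
    have e3 : (pd s.data.dom 0)^[k] (fun y => (starRingEnd ℂ) (s.data.psi 0 y)) x = _ :=
      (iterate_pd_congr (fun y hy => (congrArg _ (s.data_psi hy 0)).trans
        (conj_psi_zero_eq s hy)) 0 k hx).trans (e1 (-1))
    have a1 := er 1 k p1 s x hx ha
    have a2 := ei 1 k p1 s x hx ha
    have a3 := er (-1) k m1 s x hx ha
    have a4 := ei (-1) k m1 s x hx ha
    have e4 : s.data.e 2 0 x = s.F (hyp 0 x) 3 1 := rfl
    rw [iterate_pd_congr e0 0 k hx, iterate_pd_sub hD (sm 1) (sm (-1)) 0 k hx]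
    beta_reduce
    rw [iterate_pd_re_sub_im hD (rePart_smooth 1 s) (imPart_smooth 1 s) 0 k hx,
      iterate_pd_re_sub_im hD (rePart_smooth (-1) s) (imPart_smooth (-1) s) 0 k hx]
    have e5 := eval_principalPart s.data k x
    rw [e2, e3, e4] at e5
    simp only [iterate_dQ_apply, LocalData.eval, map_add, map_sub, map_mul, MvPolynomial.eval_C,
      neg_neg, one_pow, one_mul] at a1 a2 a3 a4 e5 ⊢
    rw [e5, ← a1, ← a2, ← a3, ← a4]
    push_cast
    ring

end AdS

/-! ### Assembly of the theorem. -/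

namespace AdS

section Gauge

universe u

variable {S : Type u} [TopologicalSpace S] [ChartedSpace (EuclideanHalfSpace 3) S]
  [IsManifold (𝓡∂ 3) ∞ S] {lam : ℝ} {A : ConformalFields S} {b : OneForm S}
  {c : OpenPartialHomeomorph S (EuclideanHalfSpace 3)} {F : (Fin 4 → ℝ) → Fin 4 → Fin 4 → ℝ}

theorem IsConformalGauss.isGauss (hb : IsConformalGauss A b) (h : IsAdSType lam A)
    (hc : IsChart c) : IsGauss lam (A.dom c) (A.met c) (A.om c) (A.rwe c) (b.comp c) where
  sol := h.isSolution hc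
  b_smooth := hb.smooth c hc
  unit := hb.unit c hc
  orthogonal := hb.orthogonal c hc
  geodesic z hz μ := by
    have h1 := hb.geodesic c hc z hz μ
    have h2 : ∀ f : Fin 4 → ℝ, ∑ ν, f ν * (Pi.single 0 1 : Fin 4 → ℝ) ν = f 0 := fun f => by
      simp [Pi.single_apply]
    rw [pd_const, h2, h2, h2, hb.unit c hc z hz] at h1
    linarith
  one_form z hz ν := hb.one_form c hc z hz ν
  om_slice := hb.om_slice c hc

/-- The local form of a solution in an adapted conformal Gauss gauge. -/
noncomputable def IsGaugeFrame.gaugeSol (hF : IsGaugeFrame A b c F) (hb : IsConformalGauss A b)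
    (h : IsAdSType lam A) (hc : IsChart c) : GaugeSol lam where
  D := A.dom c
  g := A.met c
  om := A.om c
  W := A.rwe c
  b := b.comp c
  F := F
  gauss := hb.isGauss h hc
  F_smooth := hF.smooth
  F_time := hF.time
  F_orth := hF.orthonormal
  F_prop z hz i μ := hF.propagated i z hz μ

omit [IsManifold (𝓡∂ 3) ∞ S] in
theorem data_eq_sliceData : A.data b c F
    = sliceData (A.dom c) (A.met c) (A.om c) (A.rwe c) (b.comp c) F := by
  have hs : slice = hyp 0 := funext slice_eq
  simp only [ConformalFields.data, sliceData, hs]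
  rfl

/-- The gauge frame is adapted along all of `𝒥`, so `ψ₄ - ψ̄₀` vanishes on `𝒥` and not just on `Σ`.
Since `∂_τ` is tangent to `𝒥`, its iterates may be computed from the restriction to `𝒥`, which is
zero. -/
theorem IsGaugeFrame.iterate_pd_eq_zero (hF : IsGaugeFrame A b c F) (h : IsAdSType lam A)
    (hlam : lam < 0) (hr : A.Reflecting) (hc : IsChart c) {z : Fin 4 → ℝ} (hz : z ∈ A.dom c)
    (h1 : z 1 = 0) (k : ℕ) :
    (pd (A.dom c) 0)^[k] (fun z => A.psi c F 4 z - (starRingEnd ℂ) (A.psi c F 0 z)) z = 0 := by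
  have H := h.isSolution hc
  obtain ⟨y, rfl⟩ := eq_hyp_one h1
  have hE : IsRegularDomain (hyp 1 ⁻¹' A.dom c) := H.regular_boundary
  have sm : ContDiffOn ℝ ∞ (fun z => A.psi c F 4 z - (starRingEnd ℂ) (A.psi c F 0 z)) (A.dom c) :=
    (contDiffOn_spinor H.W_smooth hF.smooth 4).sub
      (Complex.conjCLE.contDiff.comp_contDiffOn (contDiffOn_spinor H.W_smooth hF.smooth 0))
  have e := iterate_pd_hyp 1 H.met.dom hE sm 0 k hz
  have e0 : Set.EqOn (fun w => A.psi c F 4 (hyp 1 w) - (starRingEnd ℂ) (A.psi c F 0 (hyp 1 w)))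
      (fun _ => 0) (hyp 1 ⁻¹' A.dom c) := fun w hw =>
    sub_eq_zero.2 (h.spinor_reflecting hlam hr hc hw rfl (hF.adapted _ hw rfl)).1
  have e1 : ∀ k, (pd (hyp 1 ⁻¹' A.dom c) (0 : Fin 3))^[k] (fun _ => (0 : ℂ)) = fun _ => 0 := by
    intro k
    induction k with
    | zero => rfl
    | succ k ih =>
      rw [Function.iterate_succ_apply', ih]
      exact funext fun w => pd_const 0 w 0
  exact e.symm.trans ((iterate_pd_congr e0 0 k hz).trans (congrFun (e1 k) y))

end Gauge

end AdS

theorem proposition1 (lam : ℝ) (hlam : lam < 0) :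
    ∃ P : ℕ → MvPolynomial AdS.JetVar ℂ,
      (∀ k, AdS.IsConditionOfOrder k (P k)) ∧
      ∀ (S : Type*) [TopologicalSpace S] [ChartedSpace (EuclideanHalfSpace 3) S]
        [IsManifold (𝓡∂ 3) ∞ S] (A : AdS.ConformalFields S), AdS.IsAdSType lam A →
        -- the algebraic conditions on `Σ`
        (A.Reflecting →
          ∀ c, AdS.IsChart c → ∀ z ∈ A.dom c, z 0 = 0 → z 1 = 0 →
          ∀ E, AdS.IsBoundaryFrame A c z E →
            AdS.spinor (A.rwe c z) E 4 = (starRingEnd ℂ) (AdS.spinor (A.rwe c z) E 0) ∧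
            AdS.spinor (A.rwe c z) E 3 = (starRingEnd ℂ) (AdS.spinor (A.rwe c z) E 1) ∧
            AdS.spinor (A.rwe c z) E 2 = (starRingEnd ℂ) (AdS.spinor (A.rwe c z) E 2)) ∧
        -- the differential conditions on `Σ`, in the adapted conformal Gauss gauge
        ∀ b : AdS.OneForm S, AdS.IsConformalGauss A b →
          ∀ c, AdS.IsChart c → ∀ F, AdS.IsGaugeFrame A b c F →
            (A.data b c F).IsRescaledWeyl lam ∧
            ∀ x ∈ (A.data b c F).dom, x 0 = 0 → ∀ k : ℕ,
              (AdS.pd (A.dom c) 0)^[k]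
                  (fun z => A.psi c F 4 z - (starRingEnd ℂ) (A.psi c F 0 z)) (AdS.slice x)
                = (A.data b c F).eval (P k) x ∧
              (A.Reflecting →
                (AdS.pd (A.dom c) 0)^[k]
                  (fun z => A.psi c F 4 z - (starRingEnd ℂ) (A.psi c F 0 z)) (AdS.slice x) = 0 ∧
                (A.data b c F).eval (P k) x = 0) := by
  obtain ⟨P, hP, hev⟩ := AdS.exists_conditions lam
  refine ⟨P, hP, fun S _ _ _ A h => ⟨fun hr c hc z hz _ h1 E hE =>
    h.spinor_reflecting hlam hr hc hz h1 hE, fun b hb c hc F hF => ?_⟩⟩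
  let s := hF.gaugeSol hb h hc
  rw [AdS.data_eq_sliceData]
  refine ⟨(hb.isGauss h hc).isRescaledWeyl F, fun x hx h0 k => ?_⟩
  have h1 : AdS.hyp 0 x 1 = 0 := h0
  have hx' : AdS.hyp 0 x ∈ A.dom c := hx
  have hb1 := hF.adapted _ hx' h1
  -- Adaptedness gives `e₁¹ = e₂¹ = 0` on `Σ`, which is what `exists_conditions` asks for. The
  -- formula for `∂_τ^k` thus holds without the reflecting condition, which enters only in its
  -- vanishing.
  have ht := (AdS.IsSolution.frame_tangent (h.isSolution hc).met hx' hb1.orthonormal hb1.normal).2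
  have e := hev s x hx (fun a => ht _ (by revert a; decide)) k
  rw [AdS.slice_eq]
  refine ⟨e, fun hr => ?_⟩
  have z := hF.iterate_pd_eq_zero h hlam hr hc hx' h1 k
  exact ⟨z, e.symm.trans z⟩
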